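/- **Proposition.** PROMISE SPARSE BIPARTITEDNESS is contained in QMA. In detail: *The problem.* Let $s,c:\mathbb N\to\mathbb N$ be polynomially bounded and let $\delta:\mathbb N\to\mathbb R_{>0}$ be inverse-polynomially bounded, i.e. $s(n),c(n)\le Cn^k$ and $\delta(n)\ge C'n^{-k'}$ for all $n\ge 1$, with constants $C,k,C',k'$, $C'>0$. An instance consists of numbers $n$ and $S$ and a classical Boolean circuit (gates NOT, AND, OR), written as a bit string with $n$, $S$ and all wire numbers in unary, such that * $2\le S\le s(n)$ and the circuit has at most $c(n)$ gates; * for some simple undirected graph $G=(V,E)$ with $\emptyset\ne V\subseteq\{1,\dots,2^n-1\}$ and all degrees at most $S$, the circuit implements the marked sparse access of $G$, i.e. it computes a function $\operatorname{adj}:\{0,\dots,2^n-1\}\times\{0,\dots,S-1\}\to\{0,\dots,2^n-1\}$ such that - for $i\in V$, $\operatorname{adj}(i,0),\dots,\operatorname{adj}(i,\deg(i)-1)$ are the neighbors of $i$, each listed once, in some order; - $\operatorname{adj}(i,\ell)=0$ for $i\in V$ and $\deg(i)\le \ell<S$; - $\operatorname{adj}(i,\ell)=\ell$ for $i\notin V$;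 * (promise) the smallest eigenvalue of the signless Laplacian $\mathcal Q^G$ is either $0$ or at least $\delta(n)$. Here $\mathcal Q^G$ is the real $V\times V$ matrix with $\mathcal Q^G_{ii}=\deg(i)$, $\mathcal Q^G_{ij}=1$ if $i\sim j$, and $\mathcal Q^G_{ij}=0$ otherwise. The answer is YES if some connected component of $G$ is bipartite (an isolated vertex counts as bipartite), and NO otherwise. *The class.* A promise problem $(A_{\mathrm{yes}},A_{\mathrm{no}})$ over bit strings is in QMA if there are a polynomial $p$ and a deterministic polynomial-time Turing machine that on every bit string $x$ outputs a description of a quantum circuit $V_x$ over the universal gate set $\{H,T,\mathrm{NOT},\mathrm{CNOT},\mathrm{Toffoli}\}$, acting on $p(|x|)$ witness qubits and on ancilla qubits initialised to $|0\rangle$, one qubit of which is measured at the end (outcome $1$ means acceptance), such that * if $x\in A_{\mathrm{yes}}$, there is a witness state $|w\rangle$ on $p(|x|)$ qubits that $V_x$ accepts with probability at least $2/3$; * if $x\in A_{\mathrm{no}}$, every witness state $|w\rangle$ on $p(|x|)$ qubits is accepted by $V_x$ with probability at most $1/3$. *Claim.* For all such $s$, $c$ and $\delta$, PROMISE SPARSE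 BIPARTITEDNESS with degree bound $s$, circuit size bound $c$ and gap $\delta$ is in QMA. -/

import Mathlib

/-! ## Bit-string encodings -/

/-- Self-delimiting unary code: a list of numbers becomes the concatenation of the blocks `1 ... 1 0`,
the block of `k` having `k` ones. -/
def unaryEncode (l : List ℕ) : List Bool :=
  l.flatMap fun k => List.replicate k true ++ [false]

/-! ## Classical Boolean circuits -/

/-- A gate of a Boolean circuit; its arguments are numbers of wires. -/
inductive BoolGate where
  | not (i : ℕ)
  | and (i j : ℕ)
  | or (i j : ℕ)

namespace BoolGate

/-- The value of a gate when the existing wires carry the values `v`. -/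
def eval (v : List Bool) : BoolGate → Bool
  | not i => !(v.getD i false)
  | and i j => v.getD i false && v.getD j false
  | or i j => v.getD i false || v.getD j false

/-- The gate reads only wires with a number below `k`. -/
def ReadsBelow (k : ℕ) : BoolGate → Prop
  | not i => i < k
  | and i j => i < k ∧ j < k
  | or i j => i < k ∧ j < k

/-- The code of a gate; every code starts with a non-zero number. -/
def tokens : BoolGate → List ℕ
  | not i => [1, i]
  | and i j => [2, i, j]
  | or i j => [3, i, j]

end BoolGate

/-- A Boolean circuit. The wires are numbered: first the input wires, then the output wire of each
gate in turn. `outputs` lists the wires that carry the result. -/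
structure BoolCircuit where
  gates : List BoolGate
  outputs : List ℕ

namespace BoolCircuit

/-- The size of a circuit is its number of gates. -/
def size (C : BoolCircuit) : ℕ := C.gates.length

/-- The values of all wires on the input `v`. -/
def wires (C : BoolCircuit) (v : List Bool) : List Bool :=
  C.gates.foldl (fun u g => u ++ [g.eval u]) v

/-- The output of the circuit on the input `v`. -/
def eval (C : BoolCircuit) (v : List Bool) : List Bool :=
  C.outputs.map fun i => (C.wires v).getD i false

/-- The circuit has `a` input bits and `b` output bits, and reads only wires that already exist. -/
structure WellFormed (C : BoolCircuit) (a b : ℕ) : Prop where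
  gates_read : ∀ (k : ℕ) (g : BoolGate), C.gates[k]? = some g → g.ReadsBelow (a + k)
  outputs_read : ∀ i ∈ C.outputs, i < a + C.gates.length
  outputs_length : C.outputs.length = b

end BoolCircuit

/-- The `k` lowest binary digits of `a`, the least significant one first. -/
def lowBits (k a : ℕ) : List Bool := (List.range k).map fun t => a.testBit t

/-- The number with given binary digits, the least significant one first. -/
def ofLowBits (l : List Bool) : ℕ := Nat.ofDigits 2 (l.map Bool.toNat)

/-! ## Graphs in the marked sparse access model -/

/-- An input of the graph problem: the number `n` of bits of a vertex name, the degree bound `S`, and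
a Boolean circuit that takes a vertex name (`n` bits) and a position in an adjacency list (as many
bits as are needed to write the numbers below `S`) to a vertex name (`n` bits). -/
structure GraphInput where
  n : ℕ
  S : ℕ
  circuit : BoolCircuit

namespace GraphInput

/-- The number of bits needed to write the numbers `0, ..., S - 1`. -/
def posBits (I : GraphInput) : ℕ := Nat.clog 2 I.S

/-- The function `[2^n] × [S] → [2^n]` that the circuit computes. -/
def adj (I : GraphInput) (i l : ℕ) : ℕ :=
  ofLowBits (I.circuit.eval (lowBits I.n i ++ lowBits I.posBits l))

/-- The bit string that presents the input. -/
def encode (I : GraphInput) : List Bool :=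
  unaryEncode ([I.n, I.S] ++ I.circuit.gates.flatMap BoolGate.tokens ++ [0] ++ I.circuit.outputs)

end GraphInput

open Classical in
/-- `adj` is an adjacency function of the graph `G` on `V ⊆ {1, ..., 2^n - 1}`, all of whose degrees
are at most `S`, in the marked sparse access model. The neighbors of a vertex may be listed in any
order. -/
structure IsMarkedSparseAccess (n S : ℕ) (V : Finset ℕ) (G : SimpleGraph V)
    (adj : ℕ → ℕ → ℕ) : Prop where
  two_le : 2 ≤ S
  vertices : ∀ v ∈ V, 0 < v ∧ v < 2 ^ n
  degree_le : ∀ v : V, G.degree v ≤ S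
  neighbors : ∀ v : V, ∃ e : Fin (G.degree v) ≃ G.neighborSet v,
    ∀ l : Fin (G.degree v), adj v l = ((e l : V) : ℕ)
  padding : ∀ v : V, ∀ l, G.degree v ≤ l → l < S → adj v l = 0
  marked : ∀ i, i < 2 ^ n → i ∉ V → ∀ l < S, adj i l = l

/-- The input `I` describes the (non-empty) graph `G` on `V`: its circuit computes a marked sparse
access for `G`. -/
structure GraphInput.Describes (I : GraphInput) (V : Finset ℕ) (G : SimpleGraph V) : Prop where
  nonempty : V.Nonempty
  wellFormed : I.circuit.WellFormed (I.n + I.posBits) I.n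
  access : IsMarkedSparseAccess I.n I.S V G I.adj

/-- Some connected component of the graph is bipartite. -/
def HasBipartiteComponent {V : Type*} (G : SimpleGraph V) : Prop :=
  ∃ C : G.ConnectedComponent, C.toSimpleGraph.IsBipartite

open Classical in
/-- The signless Laplacian of a graph. -/
noncomputable def signlessLaplacian {V : Type*} [Fintype V] (G : SimpleGraph V) : Matrix V V ℝ :=
  Matrix.of fun i j => if i = j then (G.degree i : ℝ) else if G.Adj i j then 1 else 0

open Classical in
/-- `μ` is the smallest eigenvalue of the real square matrix `A`. -/
def IsSmallestEigenvalue {V : Type*} [Fintype V] (A : Matrix V V ℝ) (μ : ℝ) : Prop :=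
  IsLeast {t : ℝ | Module.End.HasEigenvalue (Matrix.toLin' A) t} μ

/-- `f n` is `O(poly n)`. -/
def PolyBounded (f : ℕ → ℕ) : Prop :=
  ∃ C k : ℕ, ∀ n, 1 ≤ n → f n ≤ C * n ^ k

/-- `δ n` is positive and `Ω(1 / poly n)`. -/
def InversePolyBounded (δ : ℕ → ℝ) : Prop :=
  ∃ c : ℝ, 0 < c ∧ ∃ k : ℕ, ∀ n : ℕ, 1 ≤ n → c / (n : ℝ) ^ k ≤ δ n

/-! ## Quantum circuits and QMA -/

/-- Quantum gates on `N` qubits: Hadamard, `T = diag(1, exp(iπ/4))`, NOT, CNOT and Toffoli, which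
together form a universal gate set. Of the qubits of a CNOT or Toffoli gate, the last is the
target. -/
inductive QGate (N : ℕ) where
  | hadamard (q : Fin N)
  | phaseT (q : Fin N)
  | not (q : Fin N)
  | cnot (c t : Fin N) (h : c ≠ t)
  | toffoli (c d t : Fin N) (hcd : c ≠ d) (hct : c ≠ t) (hdt : d ≠ t)

namespace QGate

variable {N : ℕ}

/-- The action of a gate on the amplitudes of an `N`-qubit state in the computational basis. -/
noncomputable def apply (ψ : (Fin N → Bool) → ℂ) : QGate N → ((Fin N → Bool) → ℂ)
  | hadamard q => fun b =>
      (ψ (Function.update b q false) + (if b q then -1 else 1) * ψ (Function.update b q true))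
        / (Real.sqrt 2 : ℂ)
  | phaseT q => fun b => (if b q then Complex.exp (Complex.I * Real.pi / 4) else 1) * ψ b
  | not q => fun b => ψ (Function.update b q (!b q))
  | cnot c t _ => fun b => ψ (Function.update b t (xor (b t) (b c)))
  | toffoli c d t _ _ _ => fun b => ψ (Function.update b t (xor (b t) (b c && b d)))

/-- The code of a gate. -/
def tokens : QGate N → List ℕ
  | hadamard q => [0, q]
  | phaseT q => [1, q]
  | not q => [2, q]
  | cnot c t _ => [3, c, t]
  | toffoli c d t _ _ _ => [4, c, d, t]

end QGate

/-- A quantum circuit that checks a witness: it acts on `witness` qubits that hold the witness,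
followed by `ancilla` qubits that start in the state `|0⟩`, and at the end the qubit `output` is
measured in the computational basis; the result `1` means acceptance. -/
structure QVerifier where
  witness : ℕ
  ancilla : ℕ
  output : Fin (witness + ancilla)
  gates : List (QGate (witness + ancilla))

namespace QVerifier

/-- The initial state `|w⟩|0...0⟩`. -/
def initial (Q : QVerifier) (w : EuclideanSpace ℂ (Fin Q.witness → Bool)) :
    (Fin (Q.witness + Q.ancilla) → Bool) → ℂ := fun b =>
  if ∀ j : Fin Q.ancilla, b (Fin.natAdd Q.witness j) = false then
    w fun i => b (Fin.castAdd Q.ancilla i)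
  else 0

/-- The state after all gates have been applied, the first of the list first. -/
noncomputable def final (Q : QVerifier) (w : EuclideanSpace ℂ (Fin Q.witness → Bool)) :
    (Fin (Q.witness + Q.ancilla) → Bool) → ℂ :=
  Q.gates.foldl QGate.apply (Q.initial w)

/-- The probability of acceptance on the witness state `w`. -/
noncomputable def acceptProb (Q : QVerifier) (w : EuclideanSpace ℂ (Fin Q.witness → Bool)) : ℝ :=
  ∑ b : Fin (Q.witness + Q.ancilla) → Bool, if b Q.output then ‖Q.final w b‖ ^ 2 else 0

/-- The bit string that describes the circuit. -/
def encode (Q : QVerifier) : List Bool :=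
  unaryEncode ([Q.witness, Q.ancilla, (Q.output : ℕ)] ++ Q.gates.flatMap QGate.tokens)

end QVerifier

/-- A promise problem: the bit strings with answer YES and those with answer NO. (The two sets have
to be disjoint for the problem to lie in QMA.) -/
structure PromiseProblem where
  yes : Set (List Bool)
  no : Set (List Bool)

/-- Membership in QMA: a deterministic polynomial-time Turing machine writes down, for each input
`x`, a quantum circuit `V x` that checks witnesses of `p(|x|)` qubits, with completeness `2/3` and
soundness `1/3`. -/
def PromiseProblem.InQMA (A : PromiseProblem) : Prop :=
  ∃ (p : Polynomial ℕ) (V : List Bool → QVerifier),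
    Nonempty (Turing.TM2ComputableInPolyTime (id : List Bool → List Bool) QVerifier.encode V) ∧
    (∀ x, (V x).witness = p.eval x.length) ∧
    (∀ x ∈ A.yes, ∃ w : EuclideanSpace ℂ (Fin (V x).witness → Bool),
      ‖w‖ = 1 ∧ 2 / 3 ≤ (V x).acceptProb w) ∧
    (∀ x ∈ A.no, ∀ w : EuclideanSpace ℂ (Fin (V x).witness → Bool),
      ‖w‖ = 1 → (V x).acceptProb w ≤ 1 / 3)

/-! ## The problem -/

/-- The conditions on an input `I` that describes the graph `G`: the degree bound, the circuit size
and the gap promise, with `s`, `c` and `δ` evaluated at the number `n` of bits of a vertex name. -/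
structure IsPromiseInstance (s c : ℕ → ℕ) (δ : ℕ → ℝ) (I : GraphInput) (V : Finset ℕ)
    (G : SimpleGraph V) : Prop where
  describes : I.Describes V G
  sparse : I.S ≤ s I.n
  size_le : I.circuit.size ≤ c I.n
  gap : ∃ μ, IsSmallestEigenvalue (signlessLaplacian G) μ ∧ (μ = 0 ∨ δ I.n ≤ μ)

/-- PROMISE SPARSE BIPARTITEDNESS with degree bound `s`, circuit size bound `c` and gap `δ`. -/
def promiseSparseBipartitedness (s c : ℕ → ℕ) (δ : ℕ → ℝ) : PromiseProblem where
  yes := {x | ∃ (I : GraphInput) (V : Finset ℕ) (G : SimpleGraph V),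
    x = I.encode ∧ IsPromiseInstance s c δ I V G ∧ HasBipartiteComponent G}
  no := {x | ∃ (I : GraphInput) (V : Finset ℕ) (G : SimpleGraph V),
    x = I.encode ∧ IsPromiseInstance s c δ I V G ∧ ¬ HasBipartiteComponent G}

/-! ## Stack programs -/

namespace StackProg

open Turing Function

/-! The signless Laplacian detects bipartite components because 2·xᵀQx is the sum of (x_i + x_j)²
over ordered adjacent pairs (`two_mul_dotProduct_signlessLaplacian`). If Qx = 0 with x ≠ 0, then x
changes sign along every edge, and the sign of x is a 2-colouring of any component on which x is
non-zero (`hasBipartiteComponent_of_eigenvalue_zero`). Conversely the two colours of a bipartite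
component, read as ±1 and extended by zero, give such an alternating vector
(`HasBipartiteComponent.exists_signs`). In a NO instance the promise therefore forces the smallest
eigenvalue to be at least δ. The honest witness is the normalised alternating vector, written on the
names of the vertices, and a verifier has to measure the quadratic form.

One round does this with a swap test on half-edges. To the name v it adds two uniformly random
positions k, k' and a control bit in the state |+⟩. It computes w = adj(v, k) and adj(w, k'), and
calls the string matched if v and w are vertices, both positions are below S and adj(w, k') = v.
Matched strings come in pairs: (v, k, k', b) and (w, k', k, 1 - b). The two halves of the
computation occupy two blocks of equal layout, so a controlled exchange of the blocks makes the
members of a pair equal up to the control bit (`run_partner`). A Hadamard gate on the control bit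
then puts amplitude proportional to ψ(v) + ψ(w) on the outcome 0 (`interfere_matched`). The round is
bad if v is not a vertex, or if the string is matched and the control bit is 0. An alternating state
is never bad (`good_of_alternating`). Any state is bad with probability at least ε, as soon as
4·4^pb·ε is at most the constant of the quadratic form and ε ≤ 1, where pb is the number of bits of
a position (`le_mass_bad`).

Rounds are chained by flags. A Toffoli gate sets the next flag if the present flag is set and the
round is good, and then the round is run backwards, all gates used being involutions. On an
alternating state the round only flips the next flag (`applyAll_roundAt_eq`), so the acceptance
probability is exactly 1. In a NO instance each round multiplies the probability of a set flag by at
most 1 - ε, for whatever state the earlier rounds have left behind (`mass_round_le`). With M the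
input length plus 16, ε is of order M^-(k+2) and R = C·M^(k+2) rounds push the error below 1/3.

The classical part of a round is specified by equations between bits. Each instruction adds a
Boolean function of lower bits to a fresh higher bit, so the final string is the unique solution of
the equations that agrees with the initial string elsewhere (`Increasing.run_eq`). The symmetry of
matched strings thus reduces to the observation that the equations survive the exchange of the
blocks (`RoundEqs.exchange`). Strings are functions on all of ℕ, with probabilities summed over
`cube N`, so that no dependent types enter the analysis of gates.

The polynomial-time Turing machine is obtained by compiling a structured language of stack programs
(`code_sim`, `computable_of_runs`). The gates of a round are written once, with addresses that are
linear in a few variables and possibly relative to the base of a window. They are stored forwards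
and backwards, and the streams are expanded for each of the R windows (`writeVerifier`). The parser
is total, and all addresses are bounded by the input length (`fits_inputData`), so every bit string,
even a malformed one, yields a legal circuit. -/

/-- Contents of the stacks of a stack program. -/
abbrev Stacks (K : Type) := K → List Bool

/-- Structured programs over finitely many stacks of bits. -/
inductive Prog (K : Type) : Type
  | nop : Prog K
  | push (k : K) (b : Bool) : Prog K
  | pop (k : K) : Prog K
  | seq (p q : Prog K) : Prog K
  | ite (k : K) (c : Option Bool → Bool) (p q : Prog K) : Prog K
  | loop (k : K) (c : Option Bool → Bool) (p : Prog K) : Prog K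

namespace Prog

variable {K : Type}

/-- The control points of a program. -/
def Lab : Prog K → Type
  | nop => Unit
  | push _ _ => Unit
  | pop _ => Unit
  | seq p q => Lab p ⊕ Lab q
  | ite _ _ p q => Option (Lab p ⊕ Lab q)
  | loop _ _ p => Option (Lab p)

/-- The control point at which a program starts. -/
def entry : (p : Prog K) → Lab p
  | nop => ()
  | push _ _ => ()
  | pop _ => ()
  | seq p _ => Sum.inl (entry p)
  | ite _ _ _ _ => none
  | loop _ _ _ => none

instance instFintypeLab : (p : Prog K) → Fintype (Lab p)
  | nop => inferInstanceAs (Fintype Unit)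
  | push _ _ => inferInstanceAs (Fintype Unit)
  | pop _ => inferInstanceAs (Fintype Unit)
  | seq p q =>
    have := instFintypeLab p
    have := instFintypeLab q
    inferInstanceAs (Fintype (Lab p ⊕ Lab q))
  | ite _ _ p q =>
    have := instFintypeLab p
    have := instFintypeLab q
    inferInstanceAs (Fintype (Option (Lab p ⊕ Lab q)))
  | loop _ _ p =>
    have := instFintypeLab p
    inferInstanceAs (Fintype (Option (Lab p)))

/-- A jump that depends on the top of a stack. -/
def test {Λ : Type} (k : K) (c : Option Bool → Bool) (l₁ l₂ : Λ) :
    TM2.Stmt (fun _ : K => Bool) Λ (Option Bool) :=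
  .peek k (fun _ o => o) <| .branch c
    (.load (fun _ => none) (.goto fun _ => l₁)) (.load (fun _ => none) (.goto fun _ => l₂))

/-- The machine code of a program whose control points are embedded into `Λ` and that continues
at `exit`. -/
def code {Λ : Type} : (p : Prog K) → (Lab p → Λ) → Λ → Lab p →
    TM2.Stmt (fun _ : K => Bool) Λ (Option Bool)
  | nop, _, exit, _ => .goto fun _ => exit
  | push k b, _, exit, _ => .push k (fun _ => b) (.goto fun _ => exit)
  | pop k, _, exit, _ => .pop k (fun _ _ => none) (.goto fun _ => exit)
  | seq p q, inj, exit, l =>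
    match l with
    | Sum.inl l => code p (fun l => inj (Sum.inl l)) (inj (Sum.inr (entry q))) l
    | Sum.inr l => code q (fun l => inj (Sum.inr l)) exit l
  | ite k c p q, inj, exit, l =>
    match l with
    | none => test k c (inj (some (Sum.inl (entry p)))) (inj (some (Sum.inr (entry q))))
    | some (Sum.inl l) => code p (fun l => inj (some (Sum.inl l))) exit l
    | some (Sum.inr l) => code q (fun l => inj (some (Sum.inr l))) exit l
  | loop k c p, inj, exit, l =>
    match l with
    | none => test k c (inj (some (entry p))) exit
    | some l => code p (fun l => inj (some l)) (inj none) l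

end Prog

variable {K : Type} [DecidableEq K]

/-- `Runs p s s' t`: started with the stacks `s`, the program `p` stops after `t` steps with the
stacks `s'`. -/
inductive Runs : Prog K → Stacks K → Stacks K → ℕ → Prop
  | nop (s) : Runs .nop s s 1
  | push (k b s) : Runs (.push k b) s (update s k (b :: s k)) 1
  | pop (k s) : Runs (.pop k) s (update s k (s k).tail) 1
  | seq {p q s s' s'' a b} (hp : Runs p s s' a) (hq : Runs q s' s'' b) :
      Runs (.seq p q) s s'' (b + a)
  | ite_true {k c p q s s' a} (h : c (s k).head? = true) (hp : Runs p s s' a) :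
      Runs (.ite k c p q) s s' (a + 1)
  | ite_false {k c p q s s' a} (h : c (s k).head? = false) (hq : Runs q s s' a) :
      Runs (.ite k c p q) s s' (a + 1)
  | loop_done {k c p s} (h : c (s k).head? = false) : Runs (.loop k c p) s s 1
  | loop_step {k c p s s' s'' a b} (h : c (s k).head? = true) (hp : Runs p s s' a)
      (hl : Runs (.loop k c p) s' s'' b) : Runs (.loop k c p) s s'' (b + (a + 1))

namespace Prog

theorem test_step {Λ : Type} {M : Λ → TM2.Stmt (fun _ : K => Bool) Λ (Option Bool)} {l l₁ l₂ : Λ}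
    {k : K} {c : Option Bool → Bool} (hM : M l = test k c l₁ l₂) (s : Stacks K) :
    TM2.step M ⟨some l, none, s⟩
      = some ⟨some (if c (s k).head? then l₁ else l₂), none, s⟩ := by
  simp only [TM2.step, hM, test, TM2.stepAux]
  cases c (s k).head? <;> simp

/-- The embedding of the control points and the exit are left arbitrary so that the induction
applies to a subprogram placed inside a larger machine. The internal register is `none` at every
control point, since each test erases what it has read. -/
theorem code_sim {Λ : Type} (M : Λ → TM2.Stmt (fun _ : K => Bool) Λ (Option Bool)) {p : Prog K}
    {s s' : Stacks K} {t : ℕ} (h : Runs p s s' t) :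
    ∀ (inj : Lab p → Λ) (exit : Λ), (∀ l, M (inj l) = code p inj exit l) →
      (flip bind (TM2.step M))^[t] (some ⟨some (inj (entry p)), none, s⟩)
        = some ⟨some exit, none, s'⟩ := by
  induction h with
  | nop s => intro inj exit hM; simp [flip, TM2.step, hM, code, TM2.stepAux]
  | push k b s => intro inj exit hM; simp [flip, TM2.step, hM, code, TM2.stepAux]
  | pop k s => intro inj exit hM; simp [flip, TM2.step, hM, code, TM2.stepAux]
  | @seq p q s s' s'' a b hp hq ihp ihq =>
    intro inj exit hM
    rw [iterate_add_apply]
    have h1 := ihp (fun l => inj (Sum.inl l)) (inj (Sum.inr (entry q)))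
      (fun l => hM (Sum.inl l))
    have h2 := ihq (fun l => inj (Sum.inr l)) exit (fun l => hM (Sum.inr l))
    simp only [entry]
    rw [h1, h2]
  | @ite_true k c p q s s' a h hp ihp =>
    intro inj exit hM
    rw [iterate_add_apply]
    have h0 := test_step (M := M) (hM none) s
    have h1 := ihp (fun l => inj (some (Sum.inl l))) exit (fun l => hM (some (Sum.inl l)))
    simp only [h, if_true] at h0
    simp only [entry, iterate_one]
    exact (congrArg _ h0).trans h1
  | @ite_false k c p q s s' a h hp ihp =>
    intro inj exit hM
    rw [iterate_add_apply]
    have h0 := test_step (M := M) (hM none) s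
    have h1 := ihp (fun l => inj (some (Sum.inr l))) exit (fun l => hM (some (Sum.inr l)))
    simp only [h] at h0
    simp only [entry, iterate_one]
    exact (congrArg _ h0).trans h1
  | @loop_done k c p s h =>
    intro inj exit hM
    have h0 := test_step (M := M) (hM none) s
    simp only [h] at h0
    exact h0
  | @loop_step k c p s s' s'' a b h hp hl ihp ihl =>
    intro inj exit hM
    rw [iterate_add_apply, iterate_add_apply]
    have h0 := test_step (M := M) (hM none) s
    have h1 := ihp (fun l => inj (some l)) (inj none) (fun l => hM (some l))
    have h2 := ihl inj exit hM
    simp only [h, if_true] at h0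
    simp only [entry, iterate_one]
    exact (congrArg _ ((congrArg _ h0).trans h1)).trans h2

/-- The machine that executes a program and halts. -/
def machine [Fintype K] (p : Prog K) (k₀ k₁ : K) : FinTM2 where
  K := K
  k₀ := k₀
  k₁ := k₁
  Γ _ := Bool
  Λ := Option (Lab p)
  main := some (entry p)
  σ := Option Bool
  initialState := none
  m l := match l with
    | none => .halt
    | some l => code p some none l

end Prog

/-- The initial configuration is defined through a case distinction with a transport between stack
alphabets. As all alphabets are `Bool`, it is an ordinary `update` of the empty stacks. -/
theorem Prog.initList_machine [Fintype K] (p : Prog K) (k₀ k₁ : K) (x : List Bool) :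
    initList (p.machine k₀ k₁) x = (⟨some (some p.entry), none, update (fun _ => []) k₀ x⟩ :
      TM2.Cfg (fun _ : K => Bool) (Option p.Lab) (Option Bool)) := by
  refine congrArg (fun S => (⟨some (some p.entry), none, S⟩ :
      TM2.Cfg (fun _ : K => Bool) (Option p.Lab) (Option Bool))) (funext fun (k : K) => ?_)
  rcases eq_or_ne k k₀ with hk | hk
  · cases hk
    rw [update_self]
    exact dif_pos rfl
  · rw [update_of_ne hk]
    exact dif_neg hk

theorem Prog.haltList_machine [Fintype K] (p : Prog K) (k₀ k₁ : K) (x : List Bool) :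
    haltList (p.machine k₀ k₁) x = (⟨none, none, update (fun _ => []) k₁ x⟩ :
      TM2.Cfg (fun _ : K => Bool) (Option p.Lab) (Option Bool)) := by
  refine congrArg (fun S => (⟨none, none, S⟩ :
      TM2.Cfg (fun _ : K => Bool) (Option p.Lab) (Option Bool))) (funext fun (k : K) => ?_)
  rcases eq_or_ne k k₁ with hk | hk
  · cases hk
    rw [update_self]
    exact dif_pos rfl
  · rw [update_of_ne hk]
    exact dif_neg hk

/-- A program that runs in polynomial time gives a machine that runs in polynomial time. -/
theorem computable_of_runs [Fintype K] {β : Type} (p : Prog K) (k₀ k₁ : K)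
    (enc : β → List Bool) (f : List Bool → β) (q : Polynomial ℕ)
    (h : ∀ x, ∃ t ≤ q.eval x.length,
      Runs p (update (fun _ => []) k₀ x) (update (fun _ => []) k₁ (enc (f x))) t) :
    Nonempty (TM2ComputableInPolyTime (id : List Bool → List Bool) enc f) := by
  choose t ht hr using h
  refine ⟨{ tm := p.machine k₀ k₁
            inputAlphabet := Equiv.refl Bool
            outputAlphabet := Equiv.refl Bool
            time := q + 1
            outputsFun := fun x =>
              -- The extra step executes the halting statement at the control point `none`.
              { steps := 1 + t x
                evals_in_steps := ?_
                steps_le_m := ?_ } }⟩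
  · have e0 : initList (p.machine k₀ k₁) (List.map (Equiv.refl Bool).invFun (id x))
        = (⟨some (some p.entry), none, update (fun _ => []) k₀ x⟩ :
          TM2.Cfg (fun _ : K => Bool) (Option p.Lab) (Option Bool)) :=
      (Prog.initList_machine p k₀ k₁ _).trans (congrArg (fun l => (⟨_, _, update (fun _ => []) _ l⟩ :
          TM2.Cfg (fun _ : K => Bool) (Option p.Lab) (Option Bool))) (List.map_id _))
    have e1 : haltList (p.machine k₀ k₁) (List.map (Equiv.refl Bool).invFun (enc (f x)))
        = (⟨none, none, update (fun _ => []) k₁ (enc (f x))⟩ :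
          TM2.Cfg (fun _ : K => Bool) (Option p.Lab) (Option Bool)) :=
      (Prog.haltList_machine p k₀ k₁ _).trans (congrArg (fun l => (⟨_, _, update (fun _ => []) _ l⟩ :
          TM2.Cfg (fun _ : K => Bool) (Option p.Lab) (Option Bool))) (List.map_id _))
    rw [Option.map_some, e1, iterate_add_apply]
    have h1 := Prog.code_sim (p.machine k₀ k₁).m (hr x) some none (fun l => rfl)
    have h2 : some (initList (p.machine k₀ k₁) (List.map (Equiv.refl Bool).invFun (id x)))
        = some (⟨some (some p.entry), none, update (fun _ => []) k₀ x⟩ :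
          TM2.Cfg (fun _ : K => Bool) (Option p.Lab) (Option Bool)) := congrArg some e0
    refine (congrArg _ (congrArg _ h2)).trans ((congrArg _ h1).trans ?_)
    rfl
  · have := ht x
    simp only [Polynomial.eval_add, Polynomial.eval_one, id]
    omega

end StackProg

namespace StackProg

open Function

/-! ### Polynomial bounds for families -/

/-- The function `f` is bounded by a polynomial in the size `sz`. -/
def PolyIn {ι : Type*} (sz f : ι → ℕ) : Prop := ∃ q : Polynomial ℕ, ∀ i, f i ≤ q.eval (sz i)

namespace PolyIn

variable {ι κ : Type*} {sz f g : ι → ℕ}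

theorem const (sz : ι → ℕ) (c : ℕ) : PolyIn sz fun _ => c := ⟨Polynomial.C c, by simp⟩

theorem self (sz : ι → ℕ) : PolyIn sz sz := ⟨Polynomial.X, by simp⟩

theorem add (hf : PolyIn sz f) (hg : PolyIn sz g) : PolyIn sz fun i => f i + g i := by
  obtain ⟨p, hp⟩ := hf
  obtain ⟨q, hq⟩ := hg
  exact ⟨p + q, fun i => by simpa using add_le_add (hp i) (hq i)⟩

theorem mul (hf : PolyIn sz f) (hg : PolyIn sz g) : PolyIn sz fun i => f i * g i := by
  obtain ⟨p, hp⟩ := hf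
  obtain ⟨q, hq⟩ := hg
  exact ⟨p * q, fun i => by simpa using Nat.mul_le_mul (hp i) (hq i)⟩

theorem pow (hf : PolyIn sz f) (k : ℕ) : PolyIn sz fun i => f i ^ k := by
  induction k with
  | zero => simpa using const sz 1
  | succ k ih => simpa [pow_succ] using ih.mul hf

theorem mono (hg : PolyIn sz g) (h : ∀ i, f i ≤ g i) : PolyIn sz f := by
  obtain ⟨q, hq⟩ := hg
  exact ⟨q, fun i => (h i).trans (hq i)⟩

/-- The body of a loop is a family indexed by pairs of an index i and a round m, but its size is
still that of i. This transfers bounds to such families, so that one polynomial serves all rounds.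
-/
theorem reindex (hf : PolyIn sz f) (e : κ → ι) : PolyIn (fun k => sz (e k)) fun k => f (e k) := by
  obtain ⟨q, hq⟩ := hf
  exact ⟨q, fun i => hq _⟩

end PolyIn

variable {K : Type} [DecidableEq K] {ι κ : Type*} {sz : ι → ℕ}

/-! ### Programs that run in polynomial time on a family of stacks -/

/-- Started with `s i`, the program stops with `s' i` after a number of steps that is polynomial in
the size of `i`. -/
def PolyRuns (sz : ι → ℕ) (p : Prog K) (s s' : ι → Stacks K) : Prop :=
  ∃ q : Polynomial ℕ, ∀ i, ∃ t ≤ q.eval (sz i), Runs p (s i) (s' i) t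

namespace PolyRuns

variable {p q : Prog K} {s s' s'' r r' : ι → Stacks K} {k : K} {c : Option Bool → Bool}

theorem congr (h : PolyRuns sz p s s') (h₁ : ∀ i, s i = r i) (h₂ : ∀ i, s' i = r' i) :
    PolyRuns sz p r r' := by
  obtain rfl : s = r := funext h₁
  obtain rfl : s' = r' := funext h₂
  exact h

theorem trans_eq (h : PolyRuns sz p s s') (h₂ : ∀ i, s' i = r' i) : PolyRuns sz p s r' :=
  h.congr (fun _ => rfl) h₂

theorem nop : PolyRuns sz (.nop : Prog K) s s := ⟨1, fun i => ⟨1, by simp, .nop _⟩⟩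

theorem push (b : Bool) : PolyRuns sz (.push k b) s fun i => update (s i) k (b :: s i k) :=
  ⟨1, fun i => ⟨1, by simp, .push _ _ _⟩⟩

theorem pop : PolyRuns sz (.pop k) s fun i => update (s i) k (s i k).tail :=
  ⟨1, fun i => ⟨1, by simp, .pop _ _⟩⟩

theorem seq (hp : PolyRuns sz p s s') (hq : PolyRuns sz q s' s'') :
    PolyRuns sz (.seq p q) s s'' := by
  obtain ⟨a, ha⟩ := hp
  obtain ⟨b, hb⟩ := hq
  refine ⟨b + a, fun i => ?_⟩
  obtain ⟨t, ht, hr⟩ := ha i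
  obtain ⟨u, hu, hv⟩ := hb i
  exact ⟨u + t, by simpa using add_le_add hu ht, .seq hr hv⟩

/-- A conditional, the branches being treated on the two parts of the index set. -/
theorem ite (b : ι → Prop) (hb : ∀ i, b i → c (s i k).head? = true)
    (hb' : ∀ i, ¬ b i → c (s i k).head? = false)
    (hp : PolyRuns (fun i : {i // b i} => sz i) p (fun i => s i) fun i => s' i)
    (hq : PolyRuns (fun i : {i // ¬ b i} => sz i) q (fun i => s i) fun i => s' i) :
    PolyRuns sz (.ite k c p q) s s' := by
  obtain ⟨a, ha⟩ := hp
  obtain ⟨d, hd⟩ := hq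
  refine ⟨a + d + 1, fun i => ?_⟩
  by_cases hi : b i
  · obtain ⟨t, ht, hr⟩ := ha ⟨i, hi⟩
    exact ⟨t + 1, by simp only [Polynomial.eval_add, Polynomial.eval_one] at ht ⊢; omega,
      .ite_true (hb i hi) hr⟩
  · obtain ⟨t, ht, hr⟩ := hd ⟨i, hi⟩
    exact ⟨t + 1, by simp only [Polynomial.eval_add, Polynomial.eval_one] at ht ⊢; omega,
      .ite_false (hb' i hi) hr⟩

/-- Each round costs its body and one test, and a last test ends the loop. -/
theorem runs_loop {p : Prog K} (c : Option Bool → Bool) (k : K) (cnt B : ℕ) (st : ℕ → Stacks K)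
    (h1 : ∀ m < cnt, c (st m k).head? = true) (h0 : c (st cnt k).head? = false)
    (hb : ∀ m < cnt, ∃ t ≤ B, Runs p (st m) (st (m + 1)) t) :
    ∃ t ≤ cnt * (B + 1) + 1, Runs (.loop k c p) (st 0) (st cnt) t := by
  induction cnt generalizing st with
  | zero => exact ⟨1, by simp, .loop_done h0⟩
  | succ m ih =>
    obtain ⟨t, ht, hr⟩ := ih (fun j => st (j + 1)) (fun j hj => h1 _ (by omega)) h0
      (fun j hj => hb _ (by omega))
    obtain ⟨u, hu, hv⟩ := hb 0 (by omega)
    exact ⟨t + (u + 1), by nlinarith, .loop_step (h1 0 (by omega)) hv hr⟩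

/-- A loop: the stacks after `m` rounds are `st i m`, and there are `cnt i` rounds. -/
theorem loop (cnt : ι → ℕ) (hcnt : PolyIn sz cnt) (st : ι → ℕ → Stacks K)
    (h1 : ∀ i, ∀ m < cnt i, c (st i m k).head? = true)
    (h0 : ∀ i, c (st i (cnt i) k).head? = false)
    (hb : PolyRuns (fun x : {x : ι × ℕ // x.2 < cnt x.1} => sz x.1.1) p
      (fun x => st x.1.1 x.1.2) fun x => st x.1.1 (x.1.2 + 1)) :
    PolyRuns sz (.loop k c p) (fun i => st i 0) fun i => st i (cnt i) := by
  obtain ⟨a, ha⟩ := hcnt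
  obtain ⟨b, hb⟩ := hb
  refine ⟨a * (b + 1) + 1, fun i => ?_⟩
  obtain ⟨t, ht, hr⟩ := runs_loop c k (cnt i) (b.eval (sz i)) (st i) (h1 i) (h0 i)
    (fun m hm => hb ⟨(i, m), hm⟩)
  refine ⟨t, ht.trans ?_, hr⟩
  simp only [Polynomial.eval_add, Polynomial.eval_mul, Polynomial.eval_one]
  gcongr
  exact ha i

end PolyRuns

/-! ### Basic programs -/

/-- The test for a one on top of a stack. -/
def isOne (o : Option Bool) : Bool := o == some true

@[simp] theorem isOne_true : isOne (some true) = true := rfl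
@[simp] theorem isOne_false : isOne (some false) = false := rfl
@[simp] theorem isOne_none : isOne none = false := rfl

namespace Prog

infixr:60 " ;; " => Prog.seq

/-- Remove the ones on top of `k`. -/
def clear (k : K) : Prog K := .loop k isOne (.pop k)

/-- Push all bits of `l` onto `k`, the first one first. -/
def pushList (k : K) : List Bool → Prog K
  | [] => .nop
  | b :: l => .push k b ;; pushList k l

/-- Add the unary number in `r` to the one in `d`, using the empty stack `tmp`. -/
def addTo (r tmp d : K) : Prog K :=
  .loop r isOne (.pop r ;; .push tmp true) ;;
  .loop tmp isOne (.pop tmp ;; .push r true ;; .push d true)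

/-- Move the whole content of `a` to `b`. -/
def moveAll (a b : K) : Prog K :=
  .loop a Option.isSome (.ite a isOne (.pop a ;; .push b true) (.pop a ;; .push b false))

/-- Remove the whole content of `a`. -/
def dropAll (a : K) : Prog K := .loop a Option.isSome (.pop a)

/-- Read a number off the list in `a`, keep its code in `b` and add the number to `r`. -/
def readNum (a b r : K) : Prog K :=
  .loop a isOne (.pop a ;; .push b true ;; .push r true) ;; .pop a ;; .push b false

/-- Read a number off the list in `a` and add the number to `r`. -/
def takeNum (a r : K) : Prog K :=
  .loop a isOne (.pop a ;; .push r true) ;; .pop a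

end Prog

/-- `1 ... 1` -/
abbrev ones (m : ℕ) : List Bool := List.replicate m true

theorem ones_sub_succ {m c : ℕ} (h : m < c) : ones (c - m) = true :: ones (c - (m + 1)) := by
  rw [show c - m = c - (m + 1) + 1 by omega]
  rfl

theorem ones_append_cons (m : ℕ) (l : List Bool) : ones m ++ true :: l = ones (m + 1) ++ l := by
  rw [show true :: l = ones 1 ++ l from rfl, ← List.append_assoc, ← List.replicate_add]

namespace PolyRuns

variable {s : ι → Stacks K} {a b k r tmp d : K}

theorem clear (v : ι → ℕ) (hv : PolyIn sz v) (l : ι → List Bool) (h : ∀ i, s i k = ones (v i) ++ l i)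
    (hl : ∀ i, isOne (l i).head? = false) :
    PolyRuns sz (Prog.clear k) s fun i => update (s i) k (l i) := by
  refine (PolyRuns.loop (sz := sz) v hv
    (fun i m => update (s i) k (ones (v i - m) ++ l i)) ?_ ?_ ?_).congr ?_ ?_
  · intro i m hm; simp [ones_sub_succ hm]
  · intro i; simp [hl]
  · refine PolyRuns.pop.trans_eq fun x => ?_
    simp [ones_sub_succ x.2]
  · intro i; simp [← h]
  · intro i; simp

theorem clear_ones (v : ι → ℕ) (hv : PolyIn sz v) (h : ∀ i, s i k = ones (v i)) :
    PolyRuns sz (Prog.clear k) s fun i => update (s i) k [] :=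
  clear v hv (fun _ => []) (by simpa using h) (by simp)

theorem pushList (l : List Bool) :
    PolyRuns sz (Prog.pushList k l) s fun i => update (s i) k (l.reverse ++ s i k) := by
  induction l generalizing s with
  | nil => exact nop.trans_eq fun i => by simp
  | cons b l ih => exact ((push b).seq ih).trans_eq fun i => by simp

/-- A stack is destroyed by reading. The number is therefore moved to `tmp`, and each bit that is
moved back is also pushed onto `d`. -/
theorem addTo (v : ι → ℕ) (hv : PolyIn sz v) (hr : ∀ i, s i r = ones (v i))
    (ht : ∀ i, s i tmp = []) (h1 : r ≠ tmp) (h2 : r ≠ d) (h3 : tmp ≠ d) :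
    PolyRuns sz (Prog.addTo r tmp d) s fun i => update (s i) d (ones (v i) ++ s i d) := by
  have A := PolyRuns.loop (sz := sz) (k := r) (c := isOne) (p := .pop r ;; .push tmp true) v hv
    (fun i m => update (update (s i) r (ones (v i - m))) tmp (ones m))
    (by intro i m hm; simp [ones_sub_succ hm, h1]) (by intro i; simp [h1])
    (by
      refine (PolyRuns.pop.seq (PolyRuns.push true)).trans_eq fun x => ?_
      funext j
      simp only [update_apply]
      split_ifs <;> simp_all [ones_sub_succ x.2, List.replicate_succ])
  have B := PolyRuns.loop (sz := sz) (k := tmp) (c := isOne)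
    (p := .pop tmp ;; .push r true ;; .push d true) v hv
    (fun i m => update (update (update (s i) r (ones m)) tmp (ones (v i - m))) d
      (ones m ++ s i d))
    (by intro i m hm; simp [ones_sub_succ hm, h3]) (by intro i; simp [h3])
    (by
      refine (PolyRuns.pop.seq ((PolyRuns.push true).seq (PolyRuns.push true))).trans_eq fun x => ?_
      funext j
      simp only [update_apply]
      split_ifs <;> simp_all [ones_sub_succ x.2, List.replicate_succ])
  refine ((A.congr (r := s) (fun i => ?_) fun i => rfl).seq
    (B.congr (fun i => ?_) fun i => rfl)).trans_eq fun i => ?_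
  · funext j
    simp only [update_apply]
    split_ifs <;> simp_all
  · funext j
    simp only [update_apply]
    split_ifs <;> simp_all
  · funext j
    simp only [update_apply]
    split_ifs <;> simp_all

/-- Moving reverses the order. Lists that have been consumed into a primed register, and are
therefore stored there backwards, are restored by one such move. -/
theorem moveAll (hl : PolyIn sz fun i => (s i a).length) (h : a ≠ b) :
    PolyRuns sz (Prog.moveAll a b) s
      fun i => update (update (s i) a []) b ((s i a).reverse ++ s i b) := by
  refine (PolyRuns.loop (sz := sz) _ hl (fun i m => update (update (s i) a ((s i a).drop m)) b
    (((s i a).take m).reverse ++ s i b)) ?_ ?_ ?_).congr ?_ ?_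
  · intro i m hm; simp [h, hm]
  · intro i; simp [h]
  · refine PolyRuns.ite (fun x => (s x.1.1 a)[x.1.2]? = some true) ?_ ?_ ?_ ?_
    · intro x hx; simp [h, hx]
    · intro x hx; simp only [update_of_ne h, update_self, List.head?_drop]
      rcases e : (s x.1.1 a)[x.1.2]? with _ | _ | _ <;> simp_all
    · refine (PolyRuns.pop.seq (PolyRuns.push true)).trans_eq fun x => ?_
      have := x.1.2
      have hx := x.2
      funext j
      simp only [update_apply]
      split_ifs <;> simp_all [List.take_add_one]
    · refine (PolyRuns.pop.seq (PolyRuns.push false)).trans_eq fun x => ?_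
      have := x.1.2
      have hx := x.2
      funext j
      simp only [update_apply]
      split_ifs <;> simp_all [List.take_add_one]
  · intro i; simp
  · intro i; simp

theorem dropAll (hl : PolyIn sz fun i => (s i a).length) :
    PolyRuns sz (Prog.dropAll a) s fun i => update (s i) a [] := by
  refine (PolyRuns.loop (sz := sz) _ hl (fun i m => update (s i) a ((s i a).drop m)) ?_ ?_ ?_).congr
    ?_ ?_
  · intro i m hm; simp [hm]
  · intro i; simp
  · exact PolyRuns.pop.trans_eq fun x => by simp
  · intro i; simp
  · intro i; simp

theorem readNum (v : ι → ℕ) (hv : PolyIn sz v) (l : ι → List Bool)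
    (ha : ∀ i, s i a = ones (v i) ++ false :: l i) (h1 : a ≠ b) (h2 : a ≠ r) (h3 : b ≠ r) :
    PolyRuns sz (Prog.readNum a b r) s fun i => update (update (update (s i) a (l i)) b
      (false :: (ones (v i) ++ s i b))) r (ones (v i) ++ s i r) := by
  have A := PolyRuns.loop (sz := sz) (k := a) (c := isOne)
    (p := .pop a ;; .push b true ;; .push r true) v hv
    (fun i m => update (update (update (s i) a (ones (v i - m) ++ false :: l i)) b
      (ones m ++ s i b)) r (ones m ++ s i r))
    (by intro i m hm; simp [ones_sub_succ hm, h1, h2]) (by intro i; simp [h1, h2])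
    (by
      refine (PolyRuns.pop.seq ((PolyRuns.push true).seq (PolyRuns.push true))).trans_eq fun x => ?_
      funext j
      simp only [update_apply]
      split_ifs <;> simp_all [ones_sub_succ x.2, List.replicate_succ])
  refine ((A.congr (r := s) (fun i => ?_) fun i => rfl).seq
    (PolyRuns.pop.seq (PolyRuns.push false))).trans_eq fun i => ?_
  · funext j
    simp only [update_apply]
    split_ifs <;> simp_all
  · funext j
    simp only [update_apply]
    split_ifs <;> simp_all

/-- The remainder need not start with a separator; it may be empty, in which case the final `pop`
does nothing. This covers inputs that break off in the middle of a number. -/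
theorem takeNum (v : ι → ℕ) (hv : PolyIn sz v) (l : ι → List Bool)
    (ha : ∀ i, s i a = ones (v i) ++ l i) (hl : ∀ i, isOne (l i).head? = false) (h2 : a ≠ r) :
    PolyRuns sz (Prog.takeNum a r) s fun i => update (update (s i) a (l i).tail) r
      (ones (v i) ++ s i r) := by
  have A := PolyRuns.loop (sz := sz) (k := a) (c := isOne)
    (p := .pop a ;; .push r true) v hv
    (fun i m => update (update (s i) a (ones (v i - m) ++ l i)) r (ones m ++ s i r))
    (by intro i m hm; simp [ones_sub_succ hm, h2]) (by intro i; simp [h2, hl])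
    (by
      refine (PolyRuns.pop.seq (PolyRuns.push true)).trans_eq fun x => ?_
      funext j
      simp only [update_apply]
      split_ifs <;> simp_all [ones_sub_succ x.2, List.replicate_succ])
  refine ((A.congr (r := s) (fun i => ?_) fun i => rfl).seq PolyRuns.pop).trans_eq fun i => ?_
  · funext j
    simp only [update_apply]
    split_ifs <;> simp_all
  · funext j
    simp only [update_apply]
    split_ifs <;> simp_all

end PolyRuns

end StackProg

namespace StackProg

open Function

/-! ### Gates with symbolic addresses -/

/-- Reversible gates and the Hadamard gate, over addresses in `α`. -/
inductive RGate (α : Type) : Type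
  | had (t : α) : RGate α
  | not (t : α) : RGate α
  | cnot (c t : α) : RGate α
  | tof (c d t : α) : RGate α

namespace RGate

variable {α β γ : Type}

/-- Rename the addresses of a gate. -/
def map (f : α → β) : RGate α → RGate β
  | had t => had (f t)
  | not t => not (f t)
  | cnot c t => cnot (f c) (f t)
  | tof c d t => tof (f c) (f d) (f t)

/-- The number of the kind of a gate. -/
def kind : RGate α → ℕ
  | had _ => 0
  | not _ => 2
  | cnot _ _ => 3
  | tof _ _ _ => 4

/-- The addresses of a gate. -/
def args : RGate α → List α
  | had t => [t]
  | not t => [t]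
  | cnot c t => [c, t]
  | tof c d t => [c, d, t]

@[simp] theorem kind_map (f : α → β) (x : RGate α) : (x.map f).kind = x.kind := by cases x <;> rfl

@[simp] theorem args_map (f : α → β) (x : RGate α) : (x.map f).args = x.args.map f := by
  cases x <;> rfl

/-- The code of a gate over the natural numbers. -/
def tokens (x : RGate ℕ) : List ℕ := x.kind :: x.args

end RGate

/-- An address: a number and the information whether it is relative to the base of a window. -/
abbrev Addr := Bool × ℕ

/-- The absolute address, for a given base. -/
def Addr.abs (base : ℕ) (a : Addr) : ℕ := if a.1 then base + a.2 else a.2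

/-- The code of an address in a stream of gates: `[false, false]` stands for the base, `[true]` for
a one and `[false, true]` for a zero. -/
def Addr.stream (a : Addr) : List Bool :=
  (if a.1 then [false, false] else []) ++ ones a.2 ++ [false, true]

/-- The code of a gate in a stream of gates. -/
def RGate.stream (x : RGate Addr) : List Bool :=
  ones x.kind ++ [false, true] ++ x.args.flatMap Addr.stream

/-- The variables of symbolic addresses. -/
inductive Var
  | M | n | pb | q | i | j
  deriving DecidableEq

instance : Fintype Var := ⟨{.M, .n, .pb, .q, .i, .j}, fun x => by cases x <;> decide⟩

/-- The stacks of the program that writes down the verifier. -/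
inductive Reg
  | var (v : Var)
  | inp | sav | out | fwd | rev | txt | tmp | cd | ty | top | par | go | base | rounds
  | bits | bits' | recs | recs' | outs | outs'
  deriving DecidableEq, Fintype

/-- A constant plus a sum of variables. -/
structure Lin where
  const : ℕ
  vars : List Var

/-- The value of a linear expression. -/
def Lin.val (e : Var → ℕ) (a : Lin) : ℕ := a.const + (a.vars.map e).sum

/-- A gate with symbolic addresses. -/
abbrev SGate := RGate (Bool × Lin)

/-- The gate for given values of the variables. -/
def SGate.val (e : Var → ℕ) (x : SGate) : RGate Addr := x.map fun a => (a.1, a.2.val e)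

/-- Pieces of a bit string. -/
inductive Item
  | lit (l : List Bool)
  | var (v : Var)

/-- The bits of an item. -/
def Item.val (e : Var → ℕ) : Item → List Bool
  | lit l => l
  | var v => ones (e v)

/-- The item read backwards. -/
def Item.flip : Item → Item
  | lit l => lit l.reverse
  | var v => var v

theorem Item.flip_val (e : Var → ℕ) (x : Item) : x.flip.val e = (x.val e).reverse := by
  cases x <;> simp [Item.flip, Item.val]

/-- The items that make up the code of a gate. -/
def SGate.items (x : SGate) : List Item :=
  .lit (ones x.kind ++ [false, true]) :: x.args.flatMap fun a =>
    .lit ((if a.1 then [false, false] else []) ++ ones a.2.const) :: a.2.vars.map Item.var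
      ++ [.lit [false, true]]

theorem flatMap_ones (e : Var → ℕ) (l : List Var) :
    l.flatMap (fun v => ones (e v)) = ones (l.map e).sum := by
  induction l with
  | nil => rfl
  | cons v l ih => simp [ih]

theorem SGate.items_val (e : Var → ℕ) (x : SGate) :
    x.items.flatMap (Item.val e) = (x.val e).stream := by
  simp only [SGate.items, RGate.stream, SGate.val, RGate.args_map, RGate.kind_map,
    List.flatMap_cons, Item.val, List.flatMap_map, List.flatMap_assoc]
  congr 1
  refine List.flatMap_congr fun a _ => ?_
  simp [Addr.stream, Lin.val, Item.val, List.flatMap_map, flatMap_ones, ← List.append_assoc]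
  rw [List.append_assoc, List.replicate_append_replicate]

namespace Prog

/-- Push the bits of the items onto `d`, the first bit first. -/
def pushItems (d : Reg) : List Item → Prog Reg
  | [] => .nop
  | .lit l :: xs => pushList d l ;; pushItems d xs
  | .var v :: xs => addTo (.var v) .tmp d ;; pushItems d xs

/-- Write a gate to the forward stream and to the backward stream. -/
def emit (x : SGate) : Prog Reg :=
  pushItems .fwd x.items ;; pushItems .rev (x.items.reverse.map Item.flip)

/-- Write a list of gates. -/
def emitList : List SGate → Prog Reg
  | [] => .nop
  | x :: xs => emit x ;; emitList xs

end Prog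

/-- The stacks after a list of gates has been written to both streams. -/
def emitted (s : Stacks Reg) (gs : List (RGate Addr)) : Stacks Reg :=
  update (update s .fwd ((gs.flatMap RGate.stream).reverse ++ s .fwd)) .rev
    (gs.reverse.flatMap RGate.stream ++ s .rev)

@[simp] theorem emitted_nil (s : Stacks Reg) : emitted s [] = s := by simp [emitted]

/-- Gates written later lie higher on the backward stream, and the reverse of a concatenation is the
concatenation of the reverses in the other order. -/
theorem emitted_emitted (s : Stacks Reg) (a b : List (RGate Addr)) :
    emitted (emitted s a) b = emitted s (a ++ b) := by
  funext k
  simp only [emitted, update_apply]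
  split_ifs <;> simp_all

theorem emitted_of_ne (s : Stacks Reg) (gs : List (RGate Addr)) {k : Reg} (h1 : k ≠ .fwd)
    (h2 : k ≠ .rev) : emitted s gs k = s k := by
  simp [emitted, h1, h2]

theorem emitted_update (s : Stacks Reg) (gs : List (RGate Addr)) {k : Reg} (l : List Bool)
    (h1 : k ≠ .fwd) (h2 : k ≠ .rev) : emitted (update s k l) gs = update (emitted s gs) k l := by
  funext m
  simp only [emitted, update_apply]
  split_ifs <;> simp_all

/-- The variables have the values `e`. -/
structure HasVars (s : Stacks Reg) (e : Var → ℕ) : Prop where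
  vars : ∀ v, s (.var v) = ones (e v)
  tmp : s .tmp = []

theorem HasVars.emitted {s : Stacks Reg} {e : Var → ℕ} (h : HasVars s e)
    (gs : List (RGate Addr)) : HasVars (emitted s gs) e :=
  ⟨fun v => by simpa [StackProg.emitted] using h.vars v, by simpa [StackProg.emitted] using h.tmp⟩

variable {ι : Type*} {sz : ι → ℕ} {s : ι → Stacks Reg} {e : ι → Var → ℕ}

namespace PolyRuns

theorem pushItems (d : Reg) (hd : d ≠ .tmp) (hd' : ∀ v, d ≠ .var v) (xs : List Item)
    (h : ∀ i, HasVars (s i) (e i)) (he : ∀ v, PolyIn sz fun i => e i v) :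
    PolyRuns sz (Prog.pushItems d xs) s
      fun i => update (s i) d ((xs.flatMap (Item.val (e i))).reverse ++ s i d) := by
  induction xs generalizing s with
  | nil => exact nop.trans_eq fun i => by simp
  | cons x xs ih =>
    have key : ∀ i l, HasVars (update (s i) d l) (e i) := fun i l =>
      ⟨fun v => by rw [update_of_ne (hd' v).symm]; exact (h i).vars v,
        by rw [update_of_ne hd.symm]; exact (h i).tmp⟩
    cases x with
    | lit l =>
      refine ((pushList l).seq (ih fun i => key i _)).trans_eq fun i => ?_
      simp [Item.val]
    | var v =>
      refine ((addTo _ (he v) (fun i => (h i).vars v) (fun i => (h i).tmp) (by simp)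
        (hd' v).symm hd.symm).seq (ih fun i => key i _)).trans_eq fun i => ?_
      simp [Item.val]

/-- For the backward stream the items are pushed last to first and each one flipped. From the top of
the stack each gate then reads forwards, while the gates themselves appear in reverse order. No
later pass is needed to produce the inverse circuit. -/
theorem emit (x : SGate) (h : ∀ i, HasVars (s i) (e i)) (he : ∀ v, PolyIn sz fun i => e i v) :
    PolyRuns sz (Prog.emit x) s fun i => emitted (s i) [x.val (e i)] := by
  refine ((pushItems .fwd (by simp) (by simp) _ h he).seq
    (pushItems .rev (by simp) (by simp) _ (e := e) ?_ he)).trans_eq fun i => ?_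
  · exact fun i => ⟨fun v => by simpa using (h i).vars v, by simpa using (h i).tmp⟩
  · have : (x.items.reverse.map Item.flip).flatMap (Item.val (e i))
        = (x.val (e i)).stream.reverse := by
      rw [← SGate.items_val, List.reverse_flatMap, List.flatMap_map]
      exact List.flatMap_congr fun a _ => by simp [Item.flip_val]
    rw [this, SGate.items_val]
    simp [emitted]

theorem emitList (xs : List SGate) (h : ∀ i, HasVars (s i) (e i))
    (he : ∀ v, PolyIn sz fun i => e i v) :
    PolyRuns sz (Prog.emitList xs) s fun i => emitted (s i) (xs.map (SGate.val (e i))) := by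
  induction xs generalizing s with
  | nil => exact nop.trans_eq fun i => by simp
  | cons x xs ih =>
    exact ((emit x h he).seq (ih fun i => (h i).emitted _)).trans_eq fun i => by
      simp [emitted_emitted]

end PolyRuns

end StackProg

namespace StackProg

open Function

/-! ### Stages: loops that write gates -/

/-- A loop that writes instructions of type `β`. -/
inductive Stage (β : Type)
  /-- Write the instructions once. -/
  | once (b : List β)
  /-- Write the instructions for `q = 0, 1, ...` below the value of a variable. -/
  | range (v : Var) (b : List β)
  /-- Write instructions for each gate `i`, `j` of the Boolean circuit, with number `q`; the three
  lists are for the three types of gates. -/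
  | recs (b₁ b₂ b₃ : List β)
  /-- Write the instructions for each output `i` of the Boolean circuit, with number `q`. -/
  | outs (b : List β)
  /-- Write instructions for each bit of a bit string, with number `q`; the two lists are for the two
  values of the bit. -/
  | bits (b₀ b₁ : List β)

/-- The data that the stages use. -/
structure StageData where
  e : Var → ℕ
  recs : List (ℕ × ℕ × ℕ)
  outs : List ℕ
  bits : List Bool

/-- The code of the gates of a Boolean circuit, each given by type and arguments. -/
def recsCode (l : List (ℕ × ℕ × ℕ)) : List Bool :=
  l.flatMap fun r => ones r.1 ++ false :: (ones r.2.1 ++ false :: (ones r.2.2 ++ [false]))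

/-- The code of a list of numbers. -/
def numsCode (l : List ℕ) : List Bool := l.flatMap fun k => ones k ++ [false]

/-- Choose according to the type of a Boolean gate. -/
def selectType {α : Type} (ty : ℕ) (b₁ b₂ b₃ : α) : α :=
  if ty ≤ 1 then b₁ else if ty = 2 then b₂ else b₃

/-- The instructions that a stage writes, where `ev` substitutes the values of the variables. -/
def Stage.den {β γ : Type} (ev : (Var → ℕ) → β → γ) (D : StageData) : Stage β → List γ
  | once b => b.map (ev D.e)
  | range v b => (List.range (D.e v)).flatMap fun m => b.map (ev (update D.e .q m))
  | recs b₁ b₂ b₃ => (List.range D.recs.length).flatMap fun m =>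
      (selectType (D.recs.getD m default).1 b₁ b₂ b₃).map
        (ev (update (update (update D.e .q m) .i (D.recs.getD m default).2.1) .j
          (D.recs.getD m default).2.2))
  | outs b => (List.range D.outs.length).flatMap fun m =>
      b.map (ev (update (update D.e .q m) .i (D.outs.getD m 0)))
  | bits b₀ b₁ => (List.range D.bits.length).flatMap fun m =>
      (if D.bits.getD m false then b₁ else b₀).map (ev (update D.e .q m))

open Prog in
/-- The program of a stage. -/
def Stage.prog : Stage SGate → Prog Reg
  | once b => emitList b
  | range v b => addTo (.var v) .tmp .cd ;;
      .loop .cd isOne (.pop .cd ;; emitList b ;; .push (.var .q) true) ;; clear (.var .q)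
  | recs b₁ b₂ b₃ =>
      .loop .recs Option.isSome (readNum .recs .recs' .ty ;; readNum .recs .recs' (.var .i) ;;
        readNum .recs .recs' (.var .j) ;; (.pop .ty ;;
        .ite .ty isOne (.pop .ty ;; .ite .ty isOne (emitList b₃) (emitList b₂)) (emitList b₁) ;;
        clear .ty) ;; clear (.var .i) ;; clear (.var .j) ;; .push (.var .q) true) ;;
      clear (.var .q) ;; moveAll .recs' .recs
  | outs b =>
      .loop .outs Option.isSome (readNum .outs .outs' (.var .i) ;; emitList b ;; clear (.var .i) ;;
        .push (.var .q) true) ;; clear (.var .q) ;; moveAll .outs' .outs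
  | bits b₀ b₁ =>
      .loop .bits Option.isSome (.ite .bits isOne (.pop .bits ;; .push .bits' true ;; emitList b₁)
        (.pop .bits ;; .push .bits' false ;; emitList b₀) ;; .push (.var .q) true) ;;
      clear (.var .q) ;; moveAll .bits' .bits

/-- The data are on the stacks, and the auxiliary stacks are empty. -/
structure Loaded (s : Stacks Reg) (D : StageData) : Prop where
  vars : ∀ v, s (.var v) = ones (D.e v)
  q : D.e .q = 0
  i : D.e .i = 0
  j : D.e .j = 0
  recs : s .recs = recsCode D.recs
  outs : s .outs = numsCode D.outs
  bits : s .bits = D.bits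
  tmp : s .tmp = []
  cd : s .cd = []
  ty : s .ty = []
  recs' : s .recs' = []
  outs' : s .outs' = []
  bits' : s .bits' = []

theorem Loaded.emitted {s : Stacks Reg} {D : StageData} (h : Loaded s D) (gs : List (RGate Addr)) :
    Loaded (emitted s gs) D := by
  constructor <;> simp [emitted_of_ne, h.vars, h.q, h.i, h.j, h.recs, h.outs, h.bits, h.tmp, h.cd,
    h.ty, h.recs', h.outs', h.bits']

/-- Numbers are in unary, so a value is bounded by the length of the code that contains it. This
bounds the variables that are loaded inside the loops. -/
theorem getD_fst_le_recsCode (l : List (ℕ × ℕ × ℕ)) (m : ℕ) :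
    (l.getD m default).1 + (l.getD m default).2.1 + (l.getD m default).2.2
      ≤ (recsCode l).length := by
  induction l generalizing m with
  | nil => simp [default]
  | cons a l ih =>
    cases m with
    | zero => simp [recsCode]; omega
    | succ m =>
      have := ih m
      simp only [recsCode, List.getD_cons_succ, List.flatMap_cons, List.length_append] at this ⊢
      omega

theorem length_le_recsCode (l : List (ℕ × ℕ × ℕ)) : l.length ≤ (recsCode l).length := by
  induction l with
  | nil => simp
  | cons a l ih => simp [recsCode] at ih ⊢; omega

theorem getD_le_numsCode (l : List ℕ) (m : ℕ) : l.getD m 0 ≤ (numsCode l).length := by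
  induction l generalizing m with
  | nil => simp
  | cons a l ih =>
    cases m with
    | zero => simp [numsCode]
    | succ m => exact (ih m).trans (by simp [numsCode]; omega)

theorem length_le_numsCode (l : List ℕ) : l.length ≤ (numsCode l).length := by
  induction l with
  | nil => simp
  | cons a l ih => simp [numsCode] at ih ⊢; omega

theorem drop_eq_getD_cons {α : Type*} (l : List α) (d : α) {m : ℕ} (h : m < l.length) :
    l.drop m = l.getD m d :: l.drop (m + 1) := by
  rw [List.drop_eq_getElem_cons h, List.getD_eq_getElem _ _ h]

theorem take_succ_eq_getD {α : Type*} (l : List α) (d : α) {m : ℕ} (h : m < l.length) :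
    l.take (m + 1) = l.take m ++ [l.getD m d] := by
  rw [List.take_succ_eq_append_getElem h, List.getD_eq_getElem _ _ h]

namespace PolyRuns

variable {ι : Type*} {sz : ι → ℕ} {s : ι → Stacks Reg} {D : ι → StageData}

/-- The loop invariant after m rounds: `cd` counts down from the value of the variable, `q` holds m,
and the gates of the first m rounds have been written. -/
theorem stage_range (v : Var) (b : List SGate) (h : ∀ i, Loaded (s i) (D i))
    (he : ∀ v, PolyIn sz fun i => (D i).e v) :
    PolyRuns sz (Stage.range v b).prog s fun i => emitted (s i) ((Stage.range v b).den SGate.val (D i)) := by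
  set pre : ι → ℕ → List (RGate Addr) := fun i k =>
    (List.range k).flatMap fun m => b.map (SGate.val (update (D i).e .q m)) with hpre
  have A := PolyRuns.loop (sz := sz) (k := .cd) (c := isOne)
    (p := .pop .cd ;; Prog.emitList b ;; .push (.var .q) true) (fun i => (D i).e v) (he v)
    (fun i m => update (update (emitted (s i) (pre i m)) .cd (ones ((D i).e v - m))) (.var .q)
      (ones m))
    (by intro i m hm; simp [ones_sub_succ hm]) (by intro i; simp)
    (by
      refine (PolyRuns.pop.seq ((PolyRuns.emitList b
        (e := fun x => update (D x.1.1).e .q x.1.2) ?_ ?_).seq (PolyRuns.push true))).trans_eq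
          fun x => ?_
      · intro x
        constructor
        · intro w
          by_cases hw : w = .q
          · subst hw; simp
          · simp [hw, emitted_of_ne, (h x.1.1).vars]
        · simp [emitted_of_ne, (h x.1.1).tmp]
      · intro w
        by_cases hw : w = .q
        · subst hw
          simpa using ((he v).reindex _).mono fun x => x.2.le
        · simpa [hw] using (he w).reindex _
      · rw [emitted_update _ _ _ (by simp) (by simp), emitted_update _ _ _ (by simp) (by simp),
          emitted_update _ _ _ (by simp) (by simp), emitted_emitted]
        have : pre x.1.1 (x.1.2 + 1) = pre x.1.1 x.1.2
            ++ b.map (SGate.val (update (D x.1.1).e .q x.1.2)) := by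
          simp [hpre, List.range_succ]
        rw [this]
        funext k
        simp only [update_apply]
        split_ifs <;> simp_all [ones_sub_succ x.2, List.replicate_succ])
  refine ((addTo _ (he v) (fun i => (h i).vars v) (fun i => (h i).tmp) (by simp) (by simp)
    (by simp)).seq ((A.congr (r := _) (fun i => ?_) fun i => rfl).seq
    (clear_ones _ (he v) (fun i => by simp)))).trans_eq fun i => ?_
  · funext k
    simp only [update_apply]
    split_ifs <;> simp_all [(h i).cd, (h i).vars, (h i).q]
  · funext k
    simp only [update_apply]
    split_ifs <;> simp_all [(h i).cd, (h i).vars, (h i).q, Stage.den, emitted_of_ne]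

theorem stage_outs (b : List SGate) (h : ∀ i, Loaded (s i) (D i))
    (he : ∀ v, PolyIn sz fun i => (D i).e v) (ho : PolyIn sz fun i => (s i .outs).length) :
    PolyRuns sz (Stage.outs b).prog s fun i => emitted (s i) ((Stage.outs b).den SGate.val (D i)) := by
  have hlen : PolyIn sz fun i => (D i).outs.length :=
    ho.mono fun i => (length_le_numsCode _).trans_eq (by rw [(h i).outs])
  have hget : PolyIn (fun x : {x : ι × ℕ // x.2 < (D x.1).outs.length} => sz x.1.1)
      fun x => (D x.1.1).outs.getD x.1.2 0 :=
    (ho.reindex _).mono fun x => (getD_le_numsCode _ _).trans_eq (by rw [(h x.1.1).outs])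
  set pre : ι → ℕ → List (RGate Addr) := fun i k =>
    (List.range k).flatMap fun m =>
      b.map (SGate.val (update (update (D i).e .q m) .i ((D i).outs.getD m 0))) with hpre
  have A := PolyRuns.loop (sz := sz) (k := .outs) (c := Option.isSome)
    (p := Prog.readNum .outs .outs' (.var .i) ;; Prog.emitList b ;; Prog.clear (.var .i) ;;
        .push (.var .q) true) (fun i => (D i).outs.length) hlen
    (fun i m => update (update (update (emitted (s i) (pre i m)) .outs
      (numsCode ((D i).outs.drop m))) .outs' (numsCode ((D i).outs.take m)).reverse) (.var .q)
      (ones m))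
    (by
      intro i m hm
      simp only [ne_eq, reduceCtorEq, not_false_eq_true, update_of_ne, update_self,
        drop_eq_getD_cons _ 0 hm, numsCode, List.flatMap_cons]
      -- Even the number zero has a non-empty code, so the stack is non-empty as long as numbers
      -- remain.
      cases (D i).outs.getD m 0 <;> simp [List.replicate_succ])
    (by intro i; simp [numsCode])
    (by
      refine ((readNum (fun x => (D x.1.1).outs.getD x.1.2 0) hget
        (fun x => numsCode ((D x.1.1).outs.drop (x.1.2 + 1))) ?_ (by simp) (by simp)
        (by simp)).seq ((PolyRuns.emitList b
        (e := fun x => update (update (D x.1.1).e .q x.1.2) .i ((D x.1.1).outs.getD x.1.2 0))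
          ?_ ?_).seq ((clear_ones _ hget ?_).seq (PolyRuns.push true)))).trans_eq fun x => ?_
      · intro x
        simp [drop_eq_getD_cons _ 0 x.2, numsCode]
      · intro x
        constructor
        · intro w
          by_cases hw : w = .q
          · subst hw; simp
          by_cases hw' : w = .i
          · subst hw'; simp [emitted_of_ne, (h x.1.1).vars, (h x.1.1).i]
          · simp [hw, hw', emitted_of_ne, (h x.1.1).vars]
        · simp [emitted_of_ne, (h x.1.1).tmp]
      · intro w
        by_cases hw : w = .q
        · subst hw
          simpa using (hlen.reindex _).mono fun x => x.2.le
        by_cases hw' : w = .i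
        · subst hw'
          simpa using hget
        · simpa [hw, hw'] using (he w).reindex _
      · intro x
        simp [emitted_of_ne, (h x.1.1).vars, (h x.1.1).i]
      · have : pre x.1.1 (x.1.2 + 1) = pre x.1.1 x.1.2
            ++ b.map (SGate.val (update (update (D x.1.1).e .q x.1.2) .i
              ((D x.1.1).outs.getD x.1.2 0))) := by
          simp [hpre, List.range_succ]
        rw [this, ← emitted_emitted, take_succ_eq_getD _ 0 x.2]
        simp only [ne_eq, reduceCtorEq, not_false_eq_true, emitted_update]
        have h1 := (h x.1.1).vars .i
        have h2 := (h x.1.1).i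
        funext k
        simp only [update_apply]
        split_ifs <;> simp_all [List.replicate_succ, numsCode, emitted_of_ne])
  -- The loop has left the code backwards on `outs'`; the final move restores `outs` for later
  -- stages.
  refine ((A.congr (r := s) (fun i => ?_) fun i => rfl).seq ((clear_ones _ hlen (fun i => by simp)).seq (moveAll ?_ (by simp)))).trans_eq fun i => ?_
  · have h1 := (h i).vars .q
    have h2 := (h i).q
    have h3 := (h i).outs'
    have h4 := (h i).outs
    funext k
    simp only [update_apply]
    split_ifs <;> simp_all [numsCode]
  · refine ho.mono fun i => ?_
    simp [(h i).outs]
  · have h1 := (h i).vars .q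
    have h2 := (h i).q
    have h3 := (h i).outs'
    have h4 := (h i).outs
    funext k
    simp only [update_apply]
    split_ifs <;> simp_all [numsCode, emitted_of_ne, Stage.den]

theorem stage_bits (b₀ b₁ : List SGate) (h : ∀ i, Loaded (s i) (D i))
    (he : ∀ v, PolyIn sz fun i => (D i).e v) (ho : PolyIn sz fun i => (s i .bits).length) :
    PolyRuns sz (Stage.bits b₀ b₁).prog s
      fun i => emitted (s i) ((Stage.bits b₀ b₁).den SGate.val (D i)) := by
  have hlen : PolyIn sz fun i => (D i).bits.length :=
    ho.mono fun i => by rw [(h i).bits]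
  set pre : ι → ℕ → List (RGate Addr) := fun i k =>
    (List.range k).flatMap fun m =>
      (if (D i).bits.getD m false then b₁ else b₀).map (SGate.val (update (D i).e .q m)) with hpre
  have A := PolyRuns.loop (sz := sz) (k := .bits) (c := Option.isSome)
    (p := .ite .bits isOne (.pop .bits ;; .push .bits' true ;; Prog.emitList b₁)
        (.pop .bits ;; .push .bits' false ;; Prog.emitList b₀) ;; .push (.var .q) true)
    (fun i => (D i).bits.length) hlen
    (fun i m => update (update (update (emitted (s i) (pre i m)) .bits
      ((D i).bits.drop m)) .bits' ((D i).bits.take m).reverse) (.var .q) (ones m))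
    (by intro i m hm; simp [drop_eq_getD_cons _ false hm])
    (by intro i; simp)
    (by
      have hv : ∀ (x : {x : ι × ℕ // x.2 < (D x.1).bits.length}) (b : Bool),
          HasVars (update (update (update (update (update (emitted (s x.1.1) (pre x.1.1 x.1.2)) .bits
            ((D x.1.1).bits.drop x.1.2)) .bits' ((D x.1.1).bits.take x.1.2).reverse) (.var .q)
            (ones x.1.2)) .bits ((D x.1.1).bits.drop x.1.2).tail) .bits'
            (b :: ((D x.1.1).bits.take x.1.2).reverse)) (update (D x.1.1).e .q x.1.2) := by
        intro x b
        constructor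
        · intro w
          by_cases hw : w = .q
          · subst hw; simp
          · simp [hw, emitted_of_ne, (h x.1.1).vars]
        · simp [emitted_of_ne, (h x.1.1).tmp]
      have he' : ∀ w, PolyIn (fun x : {x : ι × ℕ // x.2 < (D x.1).bits.length} => sz x.1.1)
          fun x => update (D x.1.1).e .q x.1.2 w := by
        intro w
        by_cases hw : w = .q
        · subst hw
          simpa using (hlen.reindex _).mono fun x => x.2.le
        · simpa [hw] using (he w).reindex _
      refine (PolyRuns.seq (s' := fun x : {x : ι × ℕ // x.2 < (D x.1).bits.length} =>
        update (update (update (emitted (s x.1.1) (pre x.1.1 (x.1.2 + 1))) .bits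
          ((D x.1.1).bits.drop (x.1.2 + 1))) .bits' ((D x.1.1).bits.take (x.1.2 + 1)).reverse)
          (.var .q) (ones x.1.2))
        (PolyRuns.ite (fun x => (D x.1.1).bits.getD x.1.2 false = true) ?_ ?_ ?_ ?_)
        (PolyRuns.push true)).trans_eq fun x => ?_
      · intro x hx
        simp [drop_eq_getD_cons _ false x.2, -List.getD_eq_getElem?_getD, hx]
      · intro x hx
        simp [drop_eq_getD_cons _ false x.2, -List.getD_eq_getElem?_getD, hx]
      · refine (PolyRuns.pop.seq ((PolyRuns.push true).seq (PolyRuns.emitList b₁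
          (e := fun x => update (D x.1.1.1).e .q x.1.1.2) (fun x => ?_)
          (fun w => (he' w).reindex Subtype.val)))).trans_eq fun x => ?_
        · simpa using hv x.1 true
        · obtain ⟨x, hx⟩ := x
          have : pre x.1.1 (x.1.2 + 1) = pre x.1.1 x.1.2
              ++ b₁.map (SGate.val (update (D x.1.1).e .q x.1.2)) := by
            simp only [hpre, List.range_succ, List.flatMap_append, List.flatMap_singleton, hx,
              if_true]
          simp only [this, ← emitted_emitted, take_succ_eq_getD _ false x.2, hx, ne_eq,
            reduceCtorEq, not_false_eq_true, emitted_update, drop_eq_getD_cons _ false x.2]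
          funext k
          simp only [update_apply]
          split_ifs <;> simp_all
      · refine (PolyRuns.pop.seq ((PolyRuns.push false).seq (PolyRuns.emitList b₀
          (e := fun x => update (D x.1.1.1).e .q x.1.1.2) (fun x => ?_)
          (fun w => (he' w).reindex Subtype.val)))).trans_eq fun x => ?_
        · simpa using hv x.1 false
        · obtain ⟨x, hx⟩ := x
          rw [Bool.not_eq_true] at hx
          have : pre x.1.1 (x.1.2 + 1) = pre x.1.1 x.1.2
              ++ b₀.map (SGate.val (update (D x.1.1).e .q x.1.2)) := by
            simp only [hpre, List.range_succ, List.flatMap_append, List.flatMap_singleton, hx,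
              Bool.false_eq_true, if_false]
          simp only [this, ← emitted_emitted, take_succ_eq_getD _ false x.2, hx, ne_eq,
            reduceCtorEq, not_false_eq_true, emitted_update, drop_eq_getD_cons _ false x.2]
          funext k
          simp only [update_apply]
          split_ifs <;> simp_all
      · simp [List.replicate_succ])
  refine ((A.congr (r := s) (fun i => ?_) fun i => rfl).seq ((clear_ones _ hlen
    (fun i => by simp)).seq (moveAll ?_ (by simp)))).trans_eq fun i => ?_
  · have h1 := (h i).vars .q
    have h2 := (h i).q
    have h3 := (h i).bits'
    have h4 := (h i).bits
    funext k
    simp only [update_apply]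
    split_ifs <;> simp_all
  · refine ho.mono fun i => ?_
    simp [(h i).bits]
  · have h1 := (h i).vars .q
    have h2 := (h i).q
    have h3 := (h i).bits'
    have h4 := (h i).bits
    funext k
    simp only [update_apply]
    split_ifs <;> simp_all [emitted_of_ne, Stage.den]

/-- Write one of three lists of gates, according to the type of a Boolean gate. -/
theorem emit_select (b₁ b₂ b₃ : List SGate) (ty : ι → ℕ) (e : ι → Var → ℕ)
    (h : ∀ i, HasVars (s i) (e i)) (he : ∀ v, PolyIn sz fun i => e i v) (hty : PolyIn sz ty)
    (h0 : ∀ i, s i .ty = ones (ty i)) :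
    PolyRuns sz (.pop .ty ;; .ite .ty isOne (.pop .ty ;; .ite .ty isOne (Prog.emitList b₃)
        (Prog.emitList b₂)) (Prog.emitList b₁) ;; Prog.clear .ty) s
      fun i => update (emitted (s i) ((selectType (ty i) b₁ b₂ b₃).map (SGate.val (e i)))) .ty
        [] := by
  have hv : ∀ i l, HasVars (update (s i) .ty l) (e i) := fun i l =>
    ⟨fun v => by simpa using (h i).vars v, by simpa using (h i).tmp⟩
  -- In truncated subtraction all branches leave the counter at `ty - 2`: for types 0 and 1 both `ty
  -- - 1` and `ty - 2` are zero.
  have A : PolyRuns sz (.ite .ty isOne (.pop .ty ;; .ite .ty isOne (Prog.emitList b₃)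
      (Prog.emitList b₂)) (Prog.emitList b₁)) (fun i => update (s i) .ty (ones (ty i - 1)))
      fun i => update (emitted (s i) ((selectType (ty i) b₁ b₂ b₃).map (SGate.val (e i)))) .ty
        (ones (ty i - 2)) := by
    refine PolyRuns.ite (fun i => 2 ≤ ty i) ?_ ?_ ?_ ?_
    · intro i hi
      obtain ⟨m, hm⟩ := Nat.exists_eq_add_of_le hi
      simp [show ty i - 1 = m + 1 by omega, List.replicate_succ]
    · intro i hi
      simp [show ty i - 1 = 0 by omega]
    · refine PolyRuns.seq
        (s' := fun i : {i // 2 ≤ ty i} => update (s i.1) .ty (ones (ty i.1 - 2)))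
        (PolyRuns.pop.trans_eq fun i => ?_)
        (PolyRuns.ite (fun i : {i // 2 ≤ ty i} => 3 ≤ ty i.1) ?_ ?_ ?_ ?_)
      · have := i.2
        simp [show ty i - 1 = ty i - 2 + 1 by omega, List.replicate_succ]
      · intro i hi
        obtain ⟨m, hm⟩ := Nat.exists_eq_add_of_le hi
        simp [show ty i - 2 = m + 1 by omega, List.replicate_succ]
      · intro i hi
        simp [show ty i - 2 = 0 by omega]
      · refine (PolyRuns.emitList b₃ 
          (e := fun i : {i : {i // 2 ≤ ty i} // 3 ≤ ty i.1} => e i.1.1) (fun i => hv i.1.1 _)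
          (fun v => ((he v).reindex (Subtype.val ∘ Subtype.val)))).trans_eq fun i => ?_
        rw [emitted_update _ _ _ (by simp) (by simp), selectType, if_neg (by have := i.2; omega),
          if_neg (by have := i.2; omega)]
      · refine (PolyRuns.emitList b₂ 
          (e := fun i : {i : {i // 2 ≤ ty i} // ¬ 3 ≤ ty i.1} => e i.1.1) (fun i => hv i.1.1 _)
          (fun v => ((he v).reindex (Subtype.val ∘ Subtype.val)))).trans_eq fun i => ?_
        rw [emitted_update _ _ _ (by simp) (by simp), selectType,
          if_neg (by have := i.1.2; omega), if_pos (by have := i.1.2; have := i.2; omega)]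
    · refine (PolyRuns.emitList b₁ (e := fun i => e i.1) (fun i => hv i.1 _)
          (fun v => ((he v).reindex Subtype.val))).trans_eq fun i => ?_
      have := i.2
      rw [emitted_update _ _ _ (by simp) (by simp), selectType, if_pos (by omega),
        show ty i - 1 = ty i - 2 by omega]
  refine ((PolyRuns.pop.trans_eq fun i => ?_).seq (A.seq (clear_ones (fun i => ty i - 2)
    (hty.mono fun i => by omega) (fun i => by simp)))).trans_eq fun i => ?_
  · rw [h0, ones, List.tail_replicate]
  · simp

theorem stage_recs (b₁ b₂ b₃ : List SGate) (h : ∀ i, Loaded (s i) (D i))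
    (he : ∀ v, PolyIn sz fun i => (D i).e v) (ho : PolyIn sz fun i => (s i .recs).length) :
    PolyRuns sz (Stage.recs b₁ b₂ b₃).prog s
      fun i => emitted (s i) ((Stage.recs b₁ b₂ b₃).den SGate.val (D i)) := by
  have hlen : PolyIn sz fun i => (D i).recs.length :=
    ho.mono fun i => (length_le_recsCode _).trans_eq (by rw [(h i).recs])
  have hget : PolyIn (fun x : {x : ι × ℕ // x.2 < (D x.1).recs.length} => sz x.1.1)
      fun x => ((D x.1.1).recs.getD x.1.2 default).1 + ((D x.1.1).recs.getD x.1.2 default).2.1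
        + ((D x.1.1).recs.getD x.1.2 default).2.2 :=
    (ho.reindex _).mono fun x => (getD_fst_le_recsCode _ _).trans_eq (by rw [(h x.1.1).recs])
  have hg1 := hget.mono (f := fun x => ((D x.1.1).recs.getD x.1.2 default).1) fun x => by omega
  have hg2 := hget.mono (f := fun x => ((D x.1.1).recs.getD x.1.2 default).2.1) fun x => by omega
  have hg3 := hget.mono (f := fun x => ((D x.1.1).recs.getD x.1.2 default).2.2) fun x => by omega
  set ev : ι → ℕ → Var → ℕ := fun i m => update (update (update (D i).e .q m) .i
    ((D i).recs.getD m default).2.1) .j ((D i).recs.getD m default).2.2 with hev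
  set pre : ι → ℕ → List (RGate Addr) := fun i k =>
    (List.range k).flatMap fun m =>
      (selectType ((D i).recs.getD m default).1 b₁ b₂ b₃).map (SGate.val (ev i m)) with hpre
  have A := PolyRuns.loop (sz := sz) (k := .recs) (c := Option.isSome)
    (p := Prog.readNum .recs .recs' .ty ;; Prog.readNum .recs .recs' (.var .i) ;;
        Prog.readNum .recs .recs' (.var .j) ;; (.pop .ty ;;
        .ite .ty isOne (.pop .ty ;; .ite .ty isOne (Prog.emitList b₃) (Prog.emitList b₂))
          (Prog.emitList b₁) ;; Prog.clear .ty) ;;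
        Prog.clear (.var .i) ;; Prog.clear (.var .j) ;; .push (.var .q) true)
    (fun i => (D i).recs.length) hlen
    (fun i m => update (update (update (emitted (s i) (pre i m)) .recs
      (recsCode ((D i).recs.drop m))) .recs' (recsCode ((D i).recs.take m)).reverse) (.var .q)
      (ones m))
    (by
      intro i m hm
      simp only [ne_eq, reduceCtorEq, not_false_eq_true, update_of_ne, update_self,
        drop_eq_getD_cons _ default hm, recsCode, List.flatMap_cons]
      cases ((D i).recs.getD m default).1 <;> simp [List.replicate_succ])
    (by intro i; simp [recsCode])
    (by
      refine ((readNum (fun x => ((D x.1.1).recs.getD x.1.2 default).1) hg1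
        (fun x => ones ((D x.1.1).recs.getD x.1.2 default).2.1 ++ false ::
          (ones ((D x.1.1).recs.getD x.1.2 default).2.2 ++ false ::
          recsCode ((D x.1.1).recs.drop (x.1.2 + 1)))) ?_ (by simp) (by simp) (by simp)).seq
        ((readNum (fun x => ((D x.1.1).recs.getD x.1.2 default).2.1) hg2
        (fun x => ones ((D x.1.1).recs.getD x.1.2 default).2.2 ++ false ::
          recsCode ((D x.1.1).recs.drop (x.1.2 + 1))) ?_ (by simp) (by simp) (by simp)).seq
        ((readNum (fun x => ((D x.1.1).recs.getD x.1.2 default).2.2) hg3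
        (fun x => recsCode ((D x.1.1).recs.drop (x.1.2 + 1))) ?_ (by simp) (by simp) (by simp)).seq
        ((emit_select b₁ b₂ b₃ (fun x => ((D x.1.1).recs.getD x.1.2 default).1)
          (fun x => ev x.1.1 x.1.2) ?_ ?_ hg1 ?_).seq
          ((clear_ones _ hg2 ?_).seq ((clear_ones _ hg3 ?_).seq
            (PolyRuns.push true))))))).trans_eq fun x => ?_
      · intro x
        simp [drop_eq_getD_cons _ default x.2, recsCode]
      · intro x
        simp
      · intro x
        simp
      · intro x
        constructor
        · intro w
          have h1 := (h x.1.1).vars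
          have h2 := (h x.1.1).i
          have h3 := (h x.1.1).j
          cases w <;> simp [hev, emitted_of_ne, h1, h2, h3]
        · simp [emitted_of_ne, (h x.1.1).tmp]
      · intro w
        by_cases hw : w = .q
        · subst hw
          simpa [hev] using (hlen.reindex _).mono fun x => x.2.le
        by_cases hw' : w = .i
        · subst hw'
          simpa [hev] using hg2
        by_cases hw'' : w = .j
        · subst hw''
          simpa [hev] using hg3
        · simpa [hev, hw, hw', hw''] using (he w).reindex _
      · intro x
        simp [emitted_of_ne, (h x.1.1).ty]
      · intro x
        simp [emitted_of_ne, (h x.1.1).vars, (h x.1.1).i]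
      · intro x
        simp [emitted_of_ne, (h x.1.1).vars, (h x.1.1).j]
      · have : pre x.1.1 (x.1.2 + 1) = pre x.1.1 x.1.2
            ++ (selectType ((D x.1.1).recs.getD x.1.2 default).1 b₁ b₂ b₃).map
              (SGate.val (ev x.1.1 x.1.2)) := by
          simp [hpre, List.range_succ]
        rw [this, ← emitted_emitted, take_succ_eq_getD _ default x.2]
        simp only [ne_eq, reduceCtorEq, not_false_eq_true, emitted_update]
        have h1 := (h x.1.1).vars .i
        have h2 := (h x.1.1).i
        have h3 := (h x.1.1).vars .j
        have h4 := (h x.1.1).j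
        have h5 := (h x.1.1).ty
        generalize hS : emitted (s x.1.1) (pre x.1.1 x.1.2) = S
        have h6 : S (.var .i) = [] := by rw [← hS]; simp [emitted_of_ne, h1, h2]
        have h7 : S (.var .j) = [] := by rw [← hS]; simp [emitted_of_ne, h3, h4]
        have h8 : S .ty = [] := by rw [← hS]; simp [emitted_of_ne, h5]
        generalize hT : emitted S _ = T
        have h6' : T (.var .i) = [] := by rw [← hT]; simp [emitted_of_ne, h6]
        have h7' : T (.var .j) = [] := by rw [← hT]; simp [emitted_of_ne, h7]
        have h8' : T .ty = [] := by rw [← hT]; simp [emitted_of_ne, h8]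
        clear hS hT this h1 h2 h3 h4 h5 hget hg1 hg2 hg3 ho he hlen hpre pre hev ev h
        funext k
        simp only [update_apply]
        split_ifs <;> simp_all [List.replicate_succ, recsCode])
  refine ((A.congr (r := s) (fun i => ?_) fun i => rfl).seq ((clear_ones _ hlen
    (fun i => by simp)).seq (moveAll ?_ (by simp)))).trans_eq fun i => ?_
  · have h1 := (h i).vars .q
    have h2 := (h i).q
    have h3 := (h i).recs'
    have h4 := (h i).recs
    funext k
    simp only [update_apply]
    split_ifs <;> simp_all [recsCode]
  · refine ho.mono fun i => ?_
    simp [(h i).recs]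
  · have h1 := (h i).vars .q
    have h2 := (h i).q
    have h3 := (h i).recs'
    have h4 := (h i).recs
    funext k
    simp only [update_apply]
    split_ifs <;> simp_all [recsCode, emitted_of_ne, Stage.den]

theorem stage (st : Stage SGate) (h : ∀ i, Loaded (s i) (D i))
    (he : ∀ v, PolyIn sz fun i => (D i).e v) (hr : PolyIn sz fun i => (s i .recs).length)
    (ho : PolyIn sz fun i => (s i .outs).length) (hb : PolyIn sz fun i => (s i .bits).length) :
    PolyRuns sz st.prog s fun i => emitted (s i) (st.den SGate.val (D i)) := by
  cases st with
  | once b => exact emitList b (fun i => ⟨(h i).vars, (h i).tmp⟩) he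
  | range v b => exact stage_range v b h he
  | recs b₁ b₂ b₃ => exact stage_recs b₁ b₂ b₃ h he hr
  | outs b => exact stage_outs b h he ho
  | bits b₀ b₁ => exact stage_bits b₀ b₁ h he hb

end PolyRuns

/-- The program of a list of stages. -/
def Prog.stages : List (Stage SGate) → Prog Reg
  | [] => .nop
  | st :: l => st.prog ;; Prog.stages l

theorem PolyRuns.stages {ι : Type*} {sz : ι → ℕ} {s : ι → Stacks Reg} {D : ι → StageData}
    (l : List (Stage SGate)) (h : ∀ i, Loaded (s i) (D i))
    (he : ∀ v, PolyIn sz fun i => (D i).e v) (hr : PolyIn sz fun i => (s i .recs).length)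
    (ho : PolyIn sz fun i => (s i .outs).length) (hb : PolyIn sz fun i => (s i .bits).length) :
    PolyRuns sz (Prog.stages l) s
      fun i => emitted (s i) (l.flatMap (Stage.den SGate.val (D i))) := by
  induction l generalizing s with
  | nil => exact nop.trans_eq fun i => by simp
  | cons st l ih =>
    refine ((stage st h he hr ho hb).seq (ih (fun i => (h i).emitted _) ?_ ?_ ?_)).trans_eq
      fun i => by simp [emitted_emitted]
    · simpa [emitted_of_ne] using hr
    · simpa [emitted_of_ne] using ho
    · simpa [emitted_of_ne] using hb

end StackProg

namespace StackProg

open Function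

/-! ### Instructions of the verifier -/

/-- Instructions over addresses in `α`: add the value `c₀ ⊕ c₁ i ⊕ c₂ j ⊕ c₃ i j` to the bit `t`, apply
a Hadamard gate to `t`, swap the bit with absolute address `i` and the bit `t`, and swap the bits `i`
and `t` if the bit `b` is set. -/
inductive Instr (α : Type) : Type
  | bool (c₀ c₁ c₂ c₃ : Bool) (i j t : α) : Instr α
  | had (t : α) : Instr α
  | swap (i t : α) : Instr α
  | cswap (b i t : α) : Instr α

namespace Instr

variable {α β : Type}

/-- Rename the addresses. -/
def map (f : α → β) : Instr α → Instr β
  | bool c₀ c₁ c₂ c₃ i j t => bool c₀ c₁ c₂ c₃ (f i) (f j) (f t)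
  | had t => had (f t)
  | swap i t => swap (f i) (f t)
  | cswap b i t => cswap (f b) (f i) (f t)

/-- Add `i ∧ j` to `t`. -/
abbrev and (i j t : α) : Instr α := bool false false false true i j t
/-- Add `¬ (i ∧ j)` to `t`. -/
abbrev nand (i j t : α) : Instr α := bool true false false true i j t
/-- Add `i ∨ j` to `t`. -/
abbrev or (i j t : α) : Instr α := bool false true true true i j t
/-- Add `i ⊕ j` to `t`. -/
abbrev xor (i j t : α) : Instr α := bool false true true false i j t
/-- Add `i ∧ ¬ j` to `t`. -/
abbrev andn (i j t : α) : Instr α := bool false true false true i j t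
/-- Add `¬ i ∨ j` to `t`. -/
abbrev norr (i j t : α) : Instr α := bool true true false true i j t
/-- Add `¬ i ∧ j` to `t`. -/
abbrev nand' (i j t : α) : Instr α := bool false false true true i j t
/-- Add `i` to `t`. -/
abbrev copy (i t : α) : Instr α := and i i t
/-- Add `1` to `t`. -/
abbrev one (i t : α) : Instr α := bool true false false false i i t

/-- The gates of an instruction; `s₁` and `s₂` are scratch bits. -/
def gates (s₁ s₂ : α) : Instr α → List (RGate (Bool × α))
  | bool c₀ c₁ c₂ c₃ i j t =>
      [.cnot (true, i) (true, s₁), .cnot (true, j) (true, s₂)]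
        ++ (if c₀ then [.not (true, t)] else []) ++ (if c₁ then [.cnot (true, s₁) (true, t)] else [])
        ++ (if c₂ then [.cnot (true, s₂) (true, t)] else [])
        ++ (if c₃ then [.tof (true, s₁) (true, s₂) (true, t)] else [])
        ++ [.cnot (true, j) (true, s₂), .cnot (true, i) (true, s₁)]
  | had t => [.had (true, t)]
  | swap i t => [.cnot (false, i) (true, t), .cnot (true, t) (false, i), .cnot (false, i) (true, t)]
  | cswap b i t => [.tof (true, b) (true, i) (true, t), .tof (true, b) (true, t) (true, i),
      .tof (true, b) (true, i) (true, t)]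

theorem gates_map (f : α → β) (s₁ s₂ : α) (x : Instr α) :
    (x.map f).gates (f s₁) (f s₂) = (x.gates s₁ s₂).map (RGate.map fun a => (a.1, f a.2)) := by
  cases x with
  | bool c₀ c₁ c₂ c₃ i j t =>
    cases c₀ <;> cases c₁ <;> cases c₂ <;> cases c₃ <;> rfl
  | _ => rfl

end Instr

namespace Lin

instance : Add Lin := ⟨fun a b => ⟨a.const + b.const, a.vars ++ b.vars⟩⟩

/-- A constant. -/
def k (c : ℕ) : Lin := ⟨c, []⟩
/-- A variable. -/
def v (x : Var) : Lin := ⟨0, [x]⟩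
/-- A multiple of the segment size `M`. -/
def seg (s : ℕ) : Lin := ⟨0, List.replicate s .M⟩

variable (e : Var → ℕ)

theorem add_def (a b : Lin) : a + b = ⟨a.const + b.const, a.vars ++ b.vars⟩ := rfl

@[simp] theorem val_add (a b : Lin) : (a + b).val e = a.val e + b.val e := by
  simp only [add_def, Lin.val, List.map_append, List.sum_append]
  omega

@[simp] theorem val_k (c : ℕ) : (k c).val e = c := by simp [k, Lin.val]
@[simp] theorem val_v (x : Var) : (v x).val e = e x := by simp [v, Lin.val]
@[simp] theorem val_seg (s : ℕ) : (seg s).val e = s * e .M := by simp [seg, Lin.val]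

end Lin

namespace Stage

variable {β β' γ γ' : Type}

/-- Replace each instruction of a stage by a list of instructions. -/
def bind (f : β → List β') : Stage β → Stage β'
  | once b => once (b.flatMap f)
  | range v b => range v (b.flatMap f)
  | recs b₁ b₂ b₃ => recs (b₁.flatMap f) (b₂.flatMap f) (b₃.flatMap f)
  | outs b => outs (b.flatMap f)
  | bits b₀ b₁ => bits (b₀.flatMap f) (b₁.flatMap f)

/-- Unrolling the loops commutes with expanding instructions into gates. The machine can thus write
gates while the analysis of a round takes place at the level of instructions. -/
theorem den_bind (f : β → List β') (g : γ → List γ') (ev : (Var → ℕ) → β → γ)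
    (ev' : (Var → ℕ) → β' → γ') (h : ∀ e x, (f x).map (ev' e) = g (ev e x)) (D : StageData)
    (st : Stage β) : (st.bind f).den ev' D = (st.den ev D).flatMap g := by
  have key : ∀ e (l : List β), (l.flatMap f).map (ev' e) = (l.map (ev e)).flatMap g := by
    intro e l
    rw [List.map_flatMap, List.flatMap_map]
    exact List.flatMap_congr fun x _ => h e x
  cases st with
  | once b => exact key _ _
  | range v b => simp only [bind, den, key, List.flatMap_assoc]
  | recs b₁ b₂ b₃ =>
    simp only [bind, den, List.flatMap_assoc, ← key]
    refine List.flatMap_congr fun m _ => ?_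
    congr 1
    unfold selectType
    split_ifs <;> rfl
  | outs b => simp only [bind, den, key, List.flatMap_assoc]
  | bits b₀ b₁ =>
    simp only [bind, den, List.flatMap_assoc, ← key]
    refine List.flatMap_congr fun m _ => ?_
    split_ifs <;> rfl

end Stage

/-! ### The checks of one round

A window consists of segments of `M` bits. Segment `0` holds the accept flag of the previous rounds
(address `0`), scratch bits (`1`, `2`) and the control bit of the swap test (`3`). A block of seven
segments, of which there are two, holds the evaluations of the Boolean circuit at a vertex and a
position (segment `0` of the block), at the position zero (segment `1`) and at the position one
(segment `2`), the comparison of the position with the degree bound (segment `3`) and a check that the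
vertex belongs to the graph (segments `4` to `6`). -/

open Instr Stage Lin

/-- Evaluate the Boolean circuit on the inputs at `o`. -/
def evalStage (o : Lin) : Stage (Instr Lin) :=
  recs [nand (o + v .i) (o + v .i) (o + v .n + v .pb + v .q)]
    [and (o + v .i) (o + v .j) (o + v .n + v .pb + v .q)]
    [or (o + v .i) (o + v .j) (o + v .n + v .pb + v .q)]

/-- Copy a vertex name. -/
def copyStage (o o' : Lin) : Stage (Instr Lin) := range .n [copy (o + v .q) (o' + v .q)]

/-- The computations in one block at the address `o`. -/
def blockStages (o : Lin) : List (Stage (Instr Lin)) :=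
  [ evalStage o,
    copyStage o (o + seg 1),
    evalStage (o + seg 1),
    copyStage o (o + seg 2),
    once [one o (o + seg 2 + v .n)],
    evalStage (o + seg 2),
    once [one o (o + seg 3)],
    bits [nand' (o + v .n + v .q) (o + seg 3 + v .q) (o + seg 3 + v .q + k 1)]
      [norr (o + v .n + v .q) (o + seg 3 + v .q) (o + seg 3 + v .q + k 1)],
    once [one o (o + seg 4)],
    outs [andn (o + seg 4 + v .q) (o + seg 1 + v .i) (o + seg 4 + v .q + k 1)],
    outs [xor (o + seg 5 + v .q) (o + seg 2 + v .i) (o + seg 5 + v .q + k 1)],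
    once [nand (o + seg 4 + v .n) (o + seg 5 + v .n) (o + seg 6)] ]

/-- The computations that compare the two blocks: first the name of the second vertex is copied, and
after the computations of the second block the flags are computed. -/
def compareStages : List (Stage (Instr Lin)) :=
  [ outs [xor (seg 8 + v .i) (seg 1 + v .q) (seg 15 + v .q)],
    once [one (seg 8) (seg 16)],
    range .n [andn (seg 16 + v .q) (seg 15 + v .q) (seg 16 + v .q + k 1)],
    once [and (seg 16 + v .n) (seg 7) (seg 17),
      and (seg 17) (seg 14) (seg 17 + k 1),
      and (seg 17 + k 1) (seg 4 + v .pb) (seg 17 + k 2),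
      and (seg 17 + k 2) (seg 11 + v .pb) (seg 17 + k 3),
      copy (seg 7) (seg 17 + k 4)] ]

/-- The part of a round without Hadamard gates. -/
def classicalStages : List (Stage (Instr Lin)) :=
  blockStages (seg 1) ++ outs [copy (seg 1 + v .i) (seg 8 + v .q)] :: blockStages (seg 8)
    ++ compareStages

/-- The checks of one round: prepare two random positions and a control bit, compute both blocks and
the flags, make the swap test, and compute the accept flag of the round. -/
def roundStages : List (Stage (Instr Lin)) :=
  [ range .n [swap (v .q) (seg 1 + v .q)],
    range .pb [had (seg 1 + v .n + v .q), had (seg 8 + v .n + v .q)],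
    once [had (k 3)] ]
  ++ classicalStages ++
  [ range .M ((List.range 7).map fun s => cswap (k 3) (seg (1 + s) + v .q) (seg (8 + s) + v .q)),
    once [had (k 3)],
    once [andn (seg 17 + k 3) (k 3) (seg 17 + k 5), andn (seg 17 + k 4) (seg 17 + k 5) (seg 17 + k 6)]]

/-- The instructions of a list of stages. -/
def instrs (D : StageData) (l : List (Stage (Instr Lin))) : List (Instr ℕ) :=
  l.flatMap (Stage.den (fun e x => x.map (Lin.val e)) D)

/-- The gates of a list of instructions. -/
def gatesOf (l : List (Instr ℕ)) : List (RGate Addr) := l.flatMap (Instr.gates 1 2)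

/-- The stages as programs that write gates. -/
def roundGateStages : List (Stage SGate) := roundStages.map (Stage.bind (Instr.gates (k 1) (k 2)))

theorem roundGateStages_den (D : StageData) :
    roundGateStages.flatMap (Stage.den SGate.val D) = gatesOf (instrs D roundStages) := by
  rw [roundGateStages, List.flatMap_map, gatesOf, instrs, List.flatMap_assoc]
  refine List.flatMap_congr fun st _ => ?_
  refine Stage.den_bind _ _ _ _ (fun e x => ?_) D st
  have := Instr.gates_map (Lin.val e) (k 1) (k 2) x
  simp only [val_k] at this
  exact this.symm

/-- The gate that updates the accept flag. -/
def flagGate : SGate := .tof (true, seg 17 + k 6) (true, k 0) (true, seg 20)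

end StackProg

namespace StackProg

open Function

/-! ### Reading the input -/

/-- Read a number off a bit string. -/
def splitNum : List Bool → ℕ × List Bool
  | [] => (0, [])
  | true :: l => ((splitNum l).1 + 1, (splitNum l).2)
  | false :: l => (0, l)

theorem splitNum_ones (k : ℕ) (l : List Bool) : splitNum (ones k ++ false :: l) = (k, l) := by
  induction k with
  | zero => rfl
  | succ k ih => simp [ones, List.replicate_succ, splitNum] at ih ⊢; simp [ih]

/-- What follows the ones at the beginning. -/
theorem splitNum_spec (l : List Bool) :
    ∃ r, l = ones (splitNum l).1 ++ r ∧ isOne r.head? = false ∧ r.tail = (splitNum l).2 := by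
  induction l with
  | nil => exact ⟨[], rfl, rfl, rfl⟩
  | cons b l ih =>
    cases b with
    | false => exact ⟨false :: l, rfl, rfl, rfl⟩
    | true =>
      obtain ⟨r, h1, h2, h3⟩ := ih
      exact ⟨r, by simpa [splitNum, List.replicate_succ] using h1, h2, h3⟩

theorem splitNum_length (l : List Bool) :
    (splitNum l).1 + (splitNum l).2.length ≤ l.length := by
  obtain ⟨r, h1, -, h3⟩ := splitNum_spec l
  have := congrArg List.length h1
  simp only [List.length_append, List.length_replicate] at this
  rw [← h3, List.length_tail]
  omega

theorem splitNum_length_lt {l : List Bool} (h : l ≠ []) :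
    (splitNum l).2.length < l.length := by
  cases l with
  | nil => exact absurd rfl h
  | cons b l =>
    cases b with
    | false => simp [splitNum]
    | true => have := splitNum_length l; simp [splitNum]; omega

/-- What follows the first number. -/
def skipNum (l : List Bool) : List Bool := (splitNum l).2

/-- Read a gate of a Boolean circuit. -/
def gateRec (l : List Bool) : ℕ × ℕ × ℕ :=
  ((splitNum l).1, (splitNum (skipNum l)).1,
    if 2 ≤ (splitNum l).1 then (splitNum (skipNum (skipNum l))).1 else 0)

/-- What follows the first gate. -/
def gateRest (l : List Bool) : List Bool :=
  if 2 ≤ (splitNum l).1 then skipNum (skipNum (skipNum l)) else skipNum (skipNum l)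

theorem skipNum_length (l : List Bool) : (skipNum l).length ≤ l.length := by
  have := splitNum_length l
  unfold skipNum
  omega

theorem gateRest_length (l : List Bool) : (gateRest l).length ≤ (skipNum l).length := by
  unfold gateRest
  split_ifs
  · exact (skipNum_length _).trans (skipNum_length _)
  · exact skipNum_length _

theorem gateRest_length_lt {l : List Bool} (h : (splitNum l).1 ≠ 0) :
    (gateRest l).length < l.length := by
  have := gateRest_length l
  have h' := splitNum_length l
  unfold skipNum at this
  omega

theorem iterate_gateRest_length (l : List Bool) (m : ℕ) : (gateRest^[m] l).length ≤ l.length := by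
  induction m generalizing l with
  | zero => simp
  | succ m ih =>
    rw [iterate_succ_apply]
    exact (ih _).trans ((gateRest_length l).trans (skipNum_length l))

theorem iterate_skipNum_length (l : List Bool) (m : ℕ) : (skipNum^[m] l).length ≤ l.length := by
  induction m generalizing l with
  | zero => simp
  | succ m ih =>
    rw [iterate_succ_apply]
    exact (ih _).trans (skipNum_length l)

/-- A gate with non-zero type shortens what remains, and the empty string reads as type zero. Hence
parsing ends on every bit string, and the verifier is defined without any assumption on the input.
-/
theorem exists_gates_end (l : List Bool) : ∃ m ≤ l.length, (splitNum (gateRest^[m] l)).1 = 0 := by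
  induction hk : l.length using Nat.strong_induction_on generalizing l with
  | _ k ih =>
    by_cases h : (splitNum l).1 = 0
    · exact ⟨0, by omega, h⟩
    · have h' := gateRest_length_lt h
      obtain ⟨m, hm, hm'⟩ := ih _ (hk ▸ h') _ rfl
      exact ⟨m + 1, by omega, hm'⟩

theorem exists_outs_end (l : List Bool) : ∃ m ≤ l.length, skipNum^[m] l = [] := by
  induction hk : l.length using Nat.strong_induction_on generalizing l with
  | _ k ih =>
    by_cases h : l = []
    · exact ⟨0, by omega, h⟩
    · have h' := splitNum_length_lt h
      obtain ⟨m, hm, hm'⟩ := ih _ (hk ▸ h') (skipNum l) rfl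
      exact ⟨m + 1, by unfold skipNum at hm; omega, hm'⟩

/-- The number of gates. -/
def numGates (l : List Bool) : ℕ :=
  Nat.find (p := fun m => (splitNum (gateRest^[m] l)).1 = 0)
    ((exists_gates_end l).imp fun _ h => h.2)

/-- The number of outputs. -/
def numOuts (l : List Bool) : ℕ :=
  Nat.find (p := fun m => skipNum^[m] l = []) ((exists_outs_end l).imp fun _ h => h.2)

theorem numGates_spec (l : List Bool) : (splitNum (gateRest^[numGates l] l)).1 = 0 :=
  Nat.find_spec (p := fun m => (splitNum (gateRest^[m] l)).1 = 0) _

theorem numGates_min {l : List Bool} {m : ℕ} (h : m < numGates l) :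
    (splitNum (gateRest^[m] l)).1 ≠ 0 :=
  Nat.find_min (p := fun m => (splitNum (gateRest^[m] l)).1 = 0) _ h

theorem numGates_le (l : List Bool) : numGates l ≤ l.length := by
  obtain ⟨m, hm, hm'⟩ := exists_gates_end l
  exact (Nat.find_min' (p := fun m => (splitNum (gateRest^[m] l)).1 = 0) _ hm').trans hm

theorem numOuts_spec (l : List Bool) : skipNum^[numOuts l] l = [] :=
  Nat.find_spec (p := fun m => skipNum^[m] l = []) _

theorem numOuts_min {l : List Bool} {m : ℕ} (h : m < numOuts l) : skipNum^[m] l ≠ [] :=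
  Nat.find_min (p := fun m => skipNum^[m] l = []) _ h

theorem numOuts_le (l : List Bool) : numOuts l ≤ l.length := by
  obtain ⟨m, hm, hm'⟩ := exists_outs_end l
  exact (Nat.find_min' (p := fun m => skipNum^[m] l = []) _ hm').trans hm

/-- The gates at the beginning of a bit string. -/
def readRecs (l : List Bool) : List (ℕ × ℕ × ℕ) :=
  (List.range (numGates l)).map fun m => gateRec (gateRest^[m] l)

/-- The numbers in a bit string. -/
def readNums (l : List Bool) : List ℕ :=
  (List.range (numOuts l)).map fun m => (splitNum (skipNum^[m] l)).1

/-- What follows the gates. -/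
def afterGates (l : List Bool) : List Bool := skipNum (gateRest^[numGates l] l)

theorem afterGates_length (l : List Bool) : (afterGates l).length ≤ l.length :=
  (skipNum_length _).trans (iterate_gateRest_length _ _)

/-- The data for the stages that are extracted from the input. -/
def inputData (x : List Bool) : StageData where
  e := fun
    | .M => x.length + 16
    | .n => (splitNum x).1
    | .pb => (Nat.bits ((splitNum (skipNum x)).1 - 1)).length
    | _ => 0
  recs := readRecs (skipNum (skipNum x))
  outs := readNums (afterGates (skipNum (skipNum x)))
  bits := Nat.bits ((splitNum (skipNum x)).1 - 1)

namespace Prog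

/-- Put the length of the input plus `16` into `M`. -/
def measure : Prog Reg :=
  .loop .inp Option.isSome (.ite .inp isOne (.pop .inp ;; .push .sav true)
    (.pop .inp ;; .push .sav false) ;; .push (.var .M) true) ;;
  moveAll .sav .inp ;; pushList (.var .M) (ones 16)

/-- Read the gates of the Boolean circuit. -/
def parseGates : Prog Reg :=
  takeNum .inp .ty ;;
  .loop .ty isOne (takeNum .inp (.var .i) ;; .pop .ty ;;
    .ite .ty isOne (takeNum .inp (.var .j)) .nop ;; .push .ty true ;;
    addTo .ty .tmp .recs' ;; .push .recs' false ;;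
    addTo (.var .i) .tmp .recs' ;; .push .recs' false ;;
    addTo (.var .j) .tmp .recs' ;; .push .recs' false ;;
    clear .ty ;; clear (.var .i) ;; clear (.var .j) ;; takeNum .inp .ty) ;;
  moveAll .recs' .recs

/-- Read the outputs of the Boolean circuit. -/
def parseOuts : Prog Reg :=
  .loop .inp Option.isSome (takeNum .inp (.var .i) ;; addTo (.var .i) .tmp .outs' ;;
    .push .outs' false ;; clear (.var .i)) ;;
  moveAll .outs' .outs

/-- Compute the binary digits of the number in `top`. -/
def parseBits : Prog Reg :=
  .loop .top isOne (
    .loop .top isOne (.pop .top ;;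
      .ite .top isOne (.pop .top ;; .push .cd true) (.push .par true)) ;;
    .ite .par isOne (.pop .par ;; .push .bits' true) (.push .bits' false) ;;
    .push (.var .pb) true ;; moveAll .cd .top) ;;
  moveAll .bits' .bits

/-- Extract the data for the stages from the input. -/
def parse : Prog Reg :=
  measure ;; takeNum .inp (.var .n) ;; takeNum .inp .top ;; parseGates ;; parseOuts ;;
  .pop .top ;; parseBits

end Prog

namespace PolyRuns

variable {ι : Type*} {sz : ι → ℕ} {s : ι → Stacks Reg}

theorem takeNum' {a r : Reg} (l : ι → List Bool) (ha : ∀ i, s i a = l i) (h2 : a ≠ r)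
    (hl : PolyIn sz fun i => (l i).length) :
    PolyRuns sz (Prog.takeNum a r) s fun i => update (update (s i) a (skipNum (l i))) r
      (ones (splitNum (l i)).1 ++ s i r) := by
  choose t h₁ h₂ h₃ using fun i => splitNum_spec (l i)
  refine (takeNum _ (hl.mono fun i => ?_) t (fun i => (ha i).trans (h₁ i)) h₂ h2).trans_eq
    fun i => ?_
  · have := splitNum_length (l i); omega
  · rw [h₃]; rfl

theorem measure (x : ι → List Bool) (hx : PolyIn sz fun i => (x i).length)
    (h1 : ∀ i, s i .inp = x i) (h2 : ∀ i, s i .sav = []) (h3 : ∀ i, s i (.var .M) = []) :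
    PolyRuns sz Prog.measure s fun i => update (s i) (.var .M) (ones ((x i).length + 16)) := by
  have A := PolyRuns.loop (sz := sz) (k := .inp) (c := Option.isSome)
    (p := .ite .inp isOne (.pop .inp ;; .push .sav true)
      (.pop .inp ;; .push .sav false) ;; .push (.var .M) true) _ hx
    (fun i m => update (update (update (s i) .inp ((x i).drop m)) .sav ((x i).take m).reverse)
      (.var .M) (ones m))
    (by intro i m hm; simp [hm]) (by intro i; simp)
    (by
      refine (PolyRuns.seq (s' := fun x' : {y : ι × ℕ // y.2 < (x y.1).length} =>
        update (update (update (s x'.1.1) .inp ((x x'.1.1).drop (x'.1.2 + 1))) .sav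
          ((x x'.1.1).take (x'.1.2 + 1)).reverse) (.var .M) (ones x'.1.2))
        (PolyRuns.ite (fun x' => (x x'.1.1).getD x'.1.2 false = true) ?_ ?_ ?_ ?_)
        (PolyRuns.push true)).trans_eq fun x' => ?_
      · intro y hy
        simp [drop_eq_getD_cons _ false y.2, -List.getD_eq_getElem?_getD, hy]
      · intro y hy
        simp [drop_eq_getD_cons _ false y.2, -List.getD_eq_getElem?_getD, hy]
      · refine (PolyRuns.pop.seq (PolyRuns.push true)).trans_eq fun y => ?_
        obtain ⟨y, hy⟩ := y
        simp only [take_succ_eq_getD _ false y.2, hy, drop_eq_getD_cons _ false y.2]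
        funext k
        simp only [update_apply]
        split_ifs <;> simp_all
      · refine (PolyRuns.pop.seq (PolyRuns.push false)).trans_eq fun y => ?_
        obtain ⟨y, hy⟩ := y
        rw [Bool.not_eq_true] at hy
        simp only [take_succ_eq_getD _ false y.2, hy, drop_eq_getD_cons _ false y.2]
        funext k
        simp only [update_apply]
        split_ifs <;> simp_all
      · simp [List.replicate_succ])
  refine ((A.congr (r := s) (fun i => ?_) fun i => rfl).seq ((moveAll ?_ (by simp)).seq
    (pushList _))).trans_eq fun i => ?_
  · funext k
    simp only [update_apply]
    split_ifs <;> simp_all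
  · simpa using hx
  · funext k
    simp only [update_apply]
    split_ifs <;> simp_all
    rfl

theorem parseGates (x : ι → List Bool) (hx : PolyIn sz fun i => (x i).length)
    (h1 : ∀ i, s i .inp = x i) (h2 : ∀ i, s i .ty = []) (h3 : ∀ i, s i (.var .i) = [])
    (h4 : ∀ i, s i (.var .j) = []) (h5 : ∀ i, s i .tmp = []) (h6 : ∀ i, s i .recs' = [])
    (h7 : ∀ i, s i .recs = []) :
    PolyRuns sz Prog.parseGates s fun i => update (update (s i) .inp (afterGates (x i))) .recs
      (recsCode (readRecs (x i))) := by
  set rest : ι → ℕ → List Bool := fun i m => gateRest^[m] (x i) with hrest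
  have hrl : PolyIn (fun y : {y : ι × ℕ // y.2 < numGates (x y.1)} => sz y.1.1)
      fun y => (rest y.1.1 y.1.2).length :=
    (hx.reindex _).mono fun y => iterate_gateRest_length _ _
  set pre : ι → ℕ → List Bool := fun i m =>
    (recsCode ((List.range m).map fun m => gateRec (rest i m))).reverse with hpre
  have hpre' : ∀ i m, pre i (m + 1) = false :: (ones (gateRec (rest i m)).2.2 ++ false ::
      (ones (gateRec (rest i m)).2.1 ++ false :: (ones (gateRec (rest i m)).1 ++ pre i m))) := by
    intro i m
    simp [hpre, List.range_succ, recsCode]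
  have hsn : ∀ l : List Bool, (splitNum l).1 ≤ l.length := fun l => by
    have := splitNum_length l; omega
  have A := PolyRuns.loop (sz := sz) (k := .ty) (c := isOne)
    (p := Prog.takeNum .inp (.var .i) ;; .pop .ty ;;
    .ite .ty isOne (Prog.takeNum .inp (.var .j)) .nop ;; .push .ty true ;;
    Prog.addTo .ty .tmp .recs' ;; .push .recs' false ;;
    Prog.addTo (.var .i) .tmp .recs' ;; .push .recs' false ;;
    Prog.addTo (.var .j) .tmp .recs' ;; .push .recs' false ;;
    Prog.clear .ty ;; Prog.clear (.var .i) ;; Prog.clear (.var .j) ;; Prog.takeNum .inp .ty)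
    (fun i => numGates (x i)) (hx.mono fun i => numGates_le _)
    (fun i m => update (update (update (s i) .inp (skipNum (rest i m))) .ty
      (ones (splitNum (rest i m)).1)) .recs' (pre i m))
    (by
      intro i m hm
      obtain ⟨t, ht⟩ := Nat.exists_eq_succ_of_ne_zero (numGates_min hm)
      simp [hrest, ht, List.replicate_succ])
    (by intro i; simp [hrest, numGates_spec])
    (by
      have hg1 : PolyIn (fun y : {y : ι × ℕ // y.2 < numGates (x y.1)} => sz y.1.1)
          fun y => (gateRec (rest y.1.1 y.1.2)).1 := hrl.mono fun y => hsn _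
      have hg2 : PolyIn (fun y : {y : ι × ℕ // y.2 < numGates (x y.1)} => sz y.1.1)
          fun y => (gateRec (rest y.1.1 y.1.2)).2.1 :=
        hrl.mono fun y => (hsn _).trans (skipNum_length _)
      have hg3 : PolyIn (fun y : {y : ι × ℕ // y.2 < numGates (x y.1)} => sz y.1.1)
          fun y => (gateRec (rest y.1.1 y.1.2)).2.2 := hrl.mono fun y => by
        unfold gateRec
        dsimp only
        split_ifs
        · exact (hsn _).trans ((skipNum_length _).trans (skipNum_length _))
        · simp
      have B : PolyRuns (fun y : {y : ι × ℕ // y.2 < numGates (x y.1)} => sz y.1.1)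
          (Prog.takeNum .inp (.var .i) ;; .pop .ty ;;
            .ite .ty isOne (Prog.takeNum .inp (.var .j)) .nop)
          (fun y => update (update (update (s y.1.1) .inp (skipNum (rest y.1.1 y.1.2))) .ty
            (ones (splitNum (rest y.1.1 y.1.2)).1)) .recs' (pre y.1.1 y.1.2))
          (fun y => update (update (update (update (update (s y.1.1) .inp
            (gateRest (rest y.1.1 y.1.2))) .ty (ones ((splitNum (rest y.1.1 y.1.2)).1 - 1)))
            .recs' (pre y.1.1 y.1.2)) (.var .i) (ones (gateRec (rest y.1.1 y.1.2)).2.1)) (.var .j)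
            (ones (gateRec (rest y.1.1 y.1.2)).2.2)) := by
        refine (takeNum' (fun y => skipNum (rest y.1.1 y.1.2)) (by simp) (by simp)
          (hrl.mono fun y => skipNum_length _)).seq (PolyRuns.pop.seq
            (PolyRuns.ite (fun y => 2 ≤ (splitNum (rest y.1.1 y.1.2)).1) ?_ ?_ ?_ ?_))
        · intro y hy
          simp [show (splitNum (rest y.1.1 y.1.2)).1 - 1
            = (splitNum (rest y.1.1 y.1.2)).1 - 2 + 1 by omega, List.replicate_succ]
        · intro y hy
          simp [show (splitNum (rest y.1.1 y.1.2)).1 - 1 = 0 by omega]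
        · refine (takeNum' (fun y => skipNum (skipNum (rest y.1.1.1 y.1.1.2))) (by simp) (by simp)
            ((hrl.reindex Subtype.val).mono fun y =>
              (skipNum_length _).trans (skipNum_length _))).trans_eq fun y => ?_
          have hy := y.2
          have h3' := h3 y.1.1.1
          have h4' := h4 y.1.1.1
          simp only [gateRest, gateRec, hy, if_true]
          funext k
          simp only [update_apply]
          split_ifs <;> simp_all
        · refine PolyRuns.nop.trans_eq fun y => ?_
          have hy := y.2
          have h3' := h3 y.1.1.1
          have h4' := h4 y.1.1.1
          simp only [gateRest, gateRec, hy, if_false]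
          funext k
          simp only [update_apply]
          split_ifs <;> simp_all
      have hb : PolyRuns (fun y : {y : ι × ℕ // y.2 < numGates (x y.1)} => sz y.1.1)
          ((Prog.takeNum .inp (.var .i) ;; .pop .ty ;;
            .ite .ty isOne (Prog.takeNum .inp (.var .j)) .nop) ;; .push .ty true ;;
          Prog.addTo .ty .tmp .recs' ;; .push .recs' false ;;
          Prog.addTo (.var .i) .tmp .recs' ;; .push .recs' false ;;
          Prog.addTo (.var .j) .tmp .recs' ;; .push .recs' false ;;
          Prog.clear .ty ;; Prog.clear (.var .i) ;; Prog.clear (.var .j) ;; Prog.takeNum .inp .ty)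
          (fun y => update (update (update (s y.1.1) .inp (skipNum (rest y.1.1 y.1.2))) .ty
            (ones (splitNum (rest y.1.1 y.1.2)).1)) .recs' (pre y.1.1 y.1.2))
          (fun y => update (update (update (s y.1.1) .inp (skipNum (rest y.1.1 (y.1.2 + 1)))) .ty
            (ones (splitNum (rest y.1.1 (y.1.2 + 1))).1)) .recs' (pre y.1.1 (y.1.2 + 1))) := by
        refine (B.seq ((PolyRuns.push true).seq ((addTo _ hg1 ?_ ?_ (by simp) (by simp)
          (by simp)).seq ((PolyRuns.push false).seq ((addTo _ hg2 ?_ ?_ (by simp) (by simp)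
          (by simp)).seq ((PolyRuns.push false).seq ((addTo _ hg3 ?_ ?_ (by simp) (by simp)
          (by simp)).seq ((PolyRuns.push false).seq ((clear_ones _ hg1 ?_).seq ((clear_ones _ hg2
          ?_).seq ((clear_ones _ hg3 ?_).seq (takeNum' (fun y => rest y.1.1 (y.1.2 + 1)) ?_
          (by simp) ?_)))))))))))).trans_eq fun y => ?_
        · intro y
          -- Inside the loop the type is non-zero, so the one that was removed for the test can be
          -- pushed back.
          obtain ⟨t, ht⟩ := Nat.exists_eq_succ_of_ne_zero (numGates_min y.2)
          simp [gateRec, hrest, ht, List.replicate_succ]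
        · intro y; simp [h5]
        · intro y; simp
        · intro y; simp [h5]
        · intro y; simp
        · intro y; simp [h5]
        · intro y
          obtain ⟨t, ht⟩ := Nat.exists_eq_succ_of_ne_zero (numGates_min y.2)
          simp [gateRec, hrest, ht, List.replicate_succ]
        · intro y; simp
        · intro y; simp
        · intro y; simp [hrest, iterate_succ_apply']
        · exact (hx.reindex _).mono fun y => iterate_gateRest_length _ _
        · rw [hpre']
          have h3' := h3 y.1.1
          have h4' := h4 y.1.1
          have h5' := h5 y.1.1
          clear_value rest pre
          funext k
          rcases k with v | _
          · cases v <;> simp [h3', h4']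
          all_goals simp [h5']
      -- The body was bracketed with its first three commands together, to treat the optional second
      -- argument separately. The run is taken apart and reassembled for the actual bracketing, at
      -- the same cost.
      obtain ⟨q, hq⟩ := hb
      refine ⟨q, fun y => ?_⟩
      obtain ⟨t, ht, hr⟩ := hq y
      cases hr with
      | seq hp hq' =>
        cases hp with
        | seq hp1 hp2 =>
          cases hp2 with
          | seq hp3 hp4 =>
            refine ⟨_, ?_, .seq hp1 (.seq hp3 (.seq hp4 hq'))⟩
            omega)
  refine ((takeNum' x h1 (by simp) hx).seq ((A.congr (fun i => ?_) fun i => rfl).seq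
    (moveAll ?_ (by simp)))).trans_eq fun i => ?_
  · have h2' := h2 i
    have h6' := h6 i
    funext k
    simp only [update_apply]
    split_ifs <;> simp_all [recsCode]
  · have : PolyIn sz fun i => numGates (x i) * (3 * (x i).length + 3) :=
      (hx.mono fun i => numGates_le _).mul (((PolyIn.const _ 3).mul hx).add (.const _ 3))
    refine this.mono fun i => ?_
    simp only [update_self, hpre, List.length_reverse, recsCode, List.length_flatMap, List.map_map]
    refine (List.sum_le_card_nsmul _ (3 * (x i).length + 3) ?_).trans (by simp)
    intro a ha
    simp only [List.mem_map, List.mem_range, comp_apply] at ha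
    obtain ⟨m, -, rfl⟩ := ha
    have b1 := hsn (rest i m)
    have b2 := hsn (skipNum (rest i m))
    have b3 := hsn (skipNum (skipNum (rest i m)))
    have b4 := skipNum_length (rest i m)
    have b5 := skipNum_length (skipNum (rest i m))
    have b6 : (rest i m).length ≤ (x i).length := iterate_gateRest_length _ _
    simp only [gateRec, List.length_append, List.length_cons, List.length_replicate,
      List.length_nil]
    split_ifs <;> omega
  · have h2' := h2 i
    have h6' := h6 i
    have h7' := h7 i
    have e1 : (splitNum (rest i (numGates (x i)))).1 = 0 := numGates_spec _
    funext k
    simp only [update_apply]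
    split_ifs <;> simp_all [readRecs, afterGates]

end PolyRuns

end StackProg

/-! ### Reading the input, continued: outputs of the circuit and binary digits of the degree bound
-/

namespace StackProg

open Function

namespace PolyRuns

variable {ι : Type*} {sz : ι → ℕ} {s : ι → Stacks Reg}

theorem parseOuts (x : ι → List Bool) (hx : PolyIn sz fun i => (x i).length)
    (h1 : ∀ i, s i .inp = x i) (h3 : ∀ i, s i (.var .i) = [])
    (h5 : ∀ i, s i .tmp = []) (h6 : ∀ i, s i .outs' = []) (h7 : ∀ i, s i .outs = []) :
    PolyRuns sz Prog.parseOuts s fun i => update (update (s i) .inp []) .outs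
      (numsCode (readNums (x i))) := by
  set rest : ι → ℕ → List Bool := fun i m => skipNum^[m] (x i) with hrest
  set pre : ι → ℕ → List Bool := fun i m =>
    (numsCode ((List.range m).map fun m => (splitNum (rest i m)).1)).reverse with hpre
  have hpre' : ∀ i m, pre i (m + 1) = false :: (ones (splitNum (rest i m)).1 ++ pre i m) := by
    intro i m
    simp [hpre, List.range_succ, numsCode]
  have hsn : ∀ l : List Bool, (splitNum l).1 ≤ l.length := fun l => by
    have := splitNum_length l; omega
  have A := PolyRuns.loop (sz := sz) (k := .inp) (c := Option.isSome)
    (p := Prog.takeNum .inp (.var .i) ;; Prog.addTo (.var .i) .tmp .outs' ;;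
    .push .outs' false ;; Prog.clear (.var .i))
    (fun i => numOuts (x i)) (hx.mono fun i => numOuts_le _)
    (fun i m => update (update (s i) .inp (rest i m)) .outs' (pre i m))
    (by
      intro i m hm
      obtain ⟨b, t, ht⟩ := List.exists_cons_of_ne_nil (numOuts_min hm)
      simp [hrest, ht])
    (by intro i; simp [hrest, numOuts_spec])
    (by
      have hrl : PolyIn (fun y : {y : ι × ℕ // y.2 < numOuts (x y.1)} => sz y.1.1)
          fun y => (rest y.1.1 y.1.2).length :=
        (hx.reindex _).mono fun y => iterate_skipNum_length _ _
      have hg1 : PolyIn (fun y : {y : ι × ℕ // y.2 < numOuts (x y.1)} => sz y.1.1)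
          fun y => (splitNum (rest y.1.1 y.1.2)).1 := hrl.mono fun y => hsn _
      refine ((takeNum' (fun y => rest y.1.1 y.1.2) (by simp) (by simp) hrl).seq
        ((addTo _ hg1 ?_ ?_ (by simp) (by simp) (by simp)).seq ((PolyRuns.push false).seq
        (clear_ones _ hg1 ?_)))).trans_eq fun y => ?_
      · intro y; simp [h3]
      · intro y; simp [h5]
      · intro y; simp [h3]
      · rw [hpre']
        have h3' := h3 y.1.1
        have h4' : rest y.1.1 (y.1.2 + 1) = skipNum (rest y.1.1 y.1.2) :=
          iterate_succ_apply' _ _ _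
        rw [h4']
        clear_value rest pre
        funext k
        rcases k with v | _
        · cases v <;> simp [h3']
        all_goals simp)
  refine ((A.congr (r := s) (fun i => ?_) fun i => rfl).seq
    (moveAll ?_ (by simp))).trans_eq fun i => ?_
  · have h1' := h1 i
    have h6' := h6 i
    funext k
    simp only [update_apply]
    split_ifs <;> simp_all [numsCode]
  · have : PolyIn sz fun i => numOuts (x i) * ((x i).length + 1) :=
      (hx.mono fun i => numOuts_le _).mul (hx.add (.const _ 1))
    refine this.mono fun i => ?_
    simp only [update_self, hpre, List.length_reverse, numsCode, List.length_flatMap, List.map_map]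
    refine (List.sum_le_card_nsmul _ ((x i).length + 1) ?_).trans (by simp)
    intro a ha
    simp only [List.mem_map, List.mem_range, comp_apply] at ha
    obtain ⟨m, -, rfl⟩ := ha
    have b1 := hsn (rest i m)
    have b6 : (rest i m).length ≤ (x i).length := iterate_skipNum_length _ _
    simp only [List.length_append, List.length_cons, List.length_replicate, List.length_nil]
    omega
  · have h6' := h6 i
    have h7' := h7 i
    have e1 : rest i (numOuts (x i)) = [] := numOuts_spec _
    have e2 : pre i (numOuts (x i)) = (numsCode (readNums (x i))).reverse := rfl
    rw [e1, e2]
    funext k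
    simp only [update_apply]
    split_ifs <;> simp_all

theorem getD_bits (a m : ℕ) : (Nat.bits a).getD m false = decide (a / 2 ^ m % 2 = 1) := by
  rw [← Nat.testBit_eq_decide_div_mod_eq, Nat.testBit_eq_inth, List.getI_eq_getElem?_getD,
    List.getD_eq_getElem?_getD]
  rfl

theorem length_bits_le (a : ℕ) : (Nat.bits a).length ≤ a := by
  rw [Nat.size_eq_bits_len, Nat.size_le]
  exact Nat.lt_two_pow_self

/-- Each round removes two ones from `top` and puts a single one on `cd`. If the number is odd, the
last of the ⌈v/2⌉ rounds finds only a single one and records it in `par`. -/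
theorem halve (v : ι → ℕ) (hv : PolyIn sz v) (h1 : ∀ i, s i .top = ones (v i))
    (h2 : ∀ i, s i .cd = []) (h3 : ∀ i, s i .par = []) :
    PolyRuns sz (.loop .top isOne (.pop .top ;;
      .ite .top isOne (.pop .top ;; .push .cd true) (.push .par true))) s
      fun i => update (update (update (s i) .top []) .cd (ones (v i / 2))) .par
        (if v i % 2 = 1 then [true] else []) := by
  refine (PolyRuns.loop (sz := sz) (fun i => (v i + 1) / 2) (hv.mono fun i => by omega)
    (fun i m => update (update (update (s i) .top (ones (v i - 2 * m))) .cd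
      (ones (min m (v i / 2)))) .par (if v i < 2 * m then [true] else [])) ?_ ?_ ?_).congr ?_ ?_
  · intro i m hm
    obtain ⟨t, ht⟩ : ∃ t, v i - 2 * m = t + 1 := ⟨v i - 2 * m - 1, by omega⟩
    simp [ht, List.replicate_succ]
  · intro i
    simp [show v i - 2 * ((v i + 1) / 2) = 0 by omega]
  · refine (PolyRuns.pop.seq (PolyRuns.ite (fun y => 2 * y.1.2 + 2 ≤ v y.1.1) ?_ ?_
      ((PolyRuns.pop.seq (PolyRuns.push true)).trans_eq ?_) ((PolyRuns.push true).trans_eq ?_)))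
    · rintro ⟨⟨i, m⟩, hm⟩ hy
      dsimp only at hy ⊢
      obtain ⟨t, ht⟩ : ∃ t, v i - 2 * m - 1 = t + 1 := ⟨v i - 2 * m - 2, by omega⟩
      simp [ht, List.replicate_succ]
    · rintro ⟨⟨i, m⟩, hm⟩ hy
      dsimp only at hm hy ⊢
      simp [show v i - 2 * m - 1 = 0 by omega]
    · rintro ⟨⟨⟨i, m⟩, hm⟩, hy⟩
      dsimp only at hm hy ⊢
      have e1 : v i - 2 * m - 1 - 1 = v i - 2 * (m + 1) := by omega
      have e2 : min m (v i / 2) = m := by omega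
      have e3 : min (m + 1) (v i / 2) = m + 1 := by omega
      have e4 : ¬ v i < 2 * m := by omega
      have e5 : ¬ v i < 2 * (m + 1) := by omega
      funext k
      rcases k with w | _
      all_goals simp [e1, e2, e3, e4, e5, List.replicate_succ]
    · rintro ⟨⟨⟨i, m⟩, hm⟩, hy⟩
      dsimp only at hm hy ⊢
      have e1 : v i - 2 * (m + 1) = 0 := by omega
      have e1' : v i - 2 * m - 1 = 0 := by omega
      have e2 : min m (v i / 2) = m := by omega
      have e3 : min (m + 1) (v i / 2) = m := by omega
      have e4 : ¬ v i < 2 * m := by omega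
      have e5 : v i < 2 * (m + 1) := by omega
      funext k
      rcases k with w | _
      all_goals simp [e1, e1', e2, e3, e4, e5]
  · intro i
    have h1' := h1 i
    have h2' := h2 i
    have h3' := h3 i
    funext k
    rcases k with w | _
    all_goals simp [h1', h2', h3']
  · intro i
    have e1 : v i - 2 * ((v i + 1) / 2) = 0 := by omega
    have e2 : min ((v i + 1) / 2) (v i / 2) = v i / 2 := by omega
    have e3 : (v i < 2 * ((v i + 1) / 2)) = (v i % 2 = 1) := by
      apply propext; constructor <;> intro h <;> omega
    simp only [e1, e2, e3, List.replicate_zero]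

/-- Repeated halving yields the digits, least significant first. The loop ends when v / 2^m
vanishes, which happens after exactly as many rounds as v has binary digits. -/
theorem parseBits (v : ι → ℕ) (hv : PolyIn sz v) (h1 : ∀ i, s i .top = ones (v i))
    (h2 : ∀ i, s i .cd = []) (h3 : ∀ i, s i .par = []) (h4 : ∀ i, s i .bits' = [])
    (h5 : ∀ i, s i .bits = []) (h6 : ∀ i, s i (.var .pb) = []) :
    PolyRuns sz Prog.parseBits s fun i => update (update (update (s i) .top []) .bits
      (Nat.bits (v i))) (.var .pb) (ones (Nat.bits (v i)).length) := by
  have hlen : PolyIn sz fun i => (Nat.bits (v i)).length := hv.mono fun i => length_bits_le _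
  have A := PolyRuns.loop (sz := sz) (k := .top) (c := isOne)
    (p := .loop .top isOne (.pop .top ;;
      .ite .top isOne (.pop .top ;; .push .cd true) (.push .par true)) ;;
    .ite .par isOne (.pop .par ;; .push .bits' true) (.push .bits' false) ;;
    .push (.var .pb) true ;; Prog.moveAll .cd .top)
    (fun i => (Nat.bits (v i)).length) hlen
    (fun i m => update (update (update (s i) .top (ones (v i / 2 ^ m))) .bits'
      ((Nat.bits (v i)).take m).reverse) (.var .pb) (ones m))
    (by
      intro i m hm
      rw [Nat.size_eq_bits_len, Nat.lt_size] at hm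
      obtain ⟨t, ht⟩ := Nat.exists_eq_succ_of_ne_zero (Nat.div_pos hm (by positivity)).ne'
      simp [ht, List.replicate_succ])
    (by
      intro i
      have : v i / 2 ^ (Nat.bits (v i)).length = 0 := by
        rw [Nat.size_eq_bits_len]
        exact Nat.div_eq_of_lt (Nat.lt_size_self _)
      simp [this])
    (by
      have hd : PolyIn (fun y : {y : ι × ℕ // y.2 < (Nat.bits (v y.1)).length} => sz y.1.1)
          fun y => v y.1.1 / 2 ^ y.1.2 := (hv.reindex _).mono fun y => Nat.div_le_self _ _
      refine ((halve _ hd (by simp) (by simp [h2]) (by simp [h3])).seq ((PolyRuns.ite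
        (s' := fun y : {y : ι × ℕ // y.2 < (Nat.bits (v y.1)).length} => update (update (update
          (update (s y.1.1) .top []) .cd (ones (v y.1.1 / 2 ^ (y.1.2 + 1)))) .bits'
          ((Nat.bits (v y.1.1)).take (y.1.2 + 1)).reverse) (.var .pb) (ones y.1.2))
        (fun y => v y.1.1 / 2 ^ y.1.2 % 2 = 1) ?_ ?_
        ((PolyRuns.pop.seq (PolyRuns.push true)).trans_eq ?_)
        ((PolyRuns.push false).trans_eq ?_)).seq ((PolyRuns.push true).seq
          (moveAll ?_ (by simp))))).trans_eq ?_
      · rintro ⟨⟨i, m⟩, hm⟩ hy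
        dsimp only at hy ⊢
        simp [hy]
      · rintro ⟨⟨i, m⟩, hm⟩ hy
        dsimp only at hy ⊢
        simp [hy]
      · rintro ⟨⟨⟨i, m⟩, hm⟩, hy⟩
        dsimp only at hm hy ⊢
        have e1 := take_succ_eq_getD (Nat.bits (v i)) false hm
        rw [getD_bits, decide_eq_true hy] at e1
        have e2 : v i / 2 ^ (m + 1) = v i / 2 ^ m / 2 := by rw [pow_succ, Nat.div_div_eq_div_mul]
        have h3' := h3 i
        funext k
        rcases k with w | _
        · cases w <;> simp
        all_goals simp [hy, e1, e2, h3']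
      · rintro ⟨⟨⟨i, m⟩, hm⟩, hy⟩
        dsimp only at hm hy ⊢
        have e1 := take_succ_eq_getD (Nat.bits (v i)) false hm
        rw [getD_bits, decide_eq_false hy] at e1
        have e2 : v i / 2 ^ (m + 1) = v i / 2 ^ m / 2 := by rw [pow_succ, Nat.div_div_eq_div_mul]
        have h3' := h3 i
        funext k
        rcases k with w | _
        · cases w <;> simp
        all_goals simp [hy, e1, e2, h3']
      · refine hd.mono fun y => ?_
        simp only [ne_eq, reduceCtorEq, not_false_eq_true, update_of_ne, update_self,
          List.length_replicate]
        exact Nat.div_le_div_left (Nat.pow_le_pow_right (by norm_num) (by omega)) (by positivity)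
      · rintro ⟨⟨i, m⟩, hm⟩
        have h2' := h2 i
        funext k
        rcases k with w | _
        · cases w <;> simp [List.replicate_succ]
        all_goals simp [h2'])
  refine ((A.congr (r := s) (fun i => ?_) fun i => rfl).seq
    (moveAll ?_ (by simp))).trans_eq fun i => ?_
  · have h1' := h1 i
    have h4' := h4 i
    have h6' := h6 i
    funext k
    rcases k with w | _
    · cases w <;> simp [h6']
    all_goals simp [h1', h4']
  · simpa using hlen
  · have : v i / 2 ^ (Nat.bits (v i)).length = 0 := by
      rw [Nat.size_eq_bits_len]
      exact Nat.div_eq_of_lt (Nat.lt_size_self _)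
    have h4' := h4 i
    have h5' := h5 i
    funext k
    rcases k with w | _
    · cases w <;> simp
    all_goals simp [h4', h5', this]

/-- The registers that are loaded with the data for the stages. -/
def _root_.StackProg.loadedStacks (D : StageData) : Stacks Reg
  | .var .M => ones (D.e .M)
  | .var .n => ones (D.e .n)
  | .var .pb => ones (D.e .pb)
  | .recs => recsCode D.recs
  | .outs => numsCode D.outs
  | .bits => D.bits
  | _ => []

theorem parse : PolyRuns List.length Prog.parse
    (fun x : List Bool => update (fun _ => []) .inp x) fun x => loadedStacks (inputData x) := by
  have hid : PolyIn List.length fun x : List Bool => x.length := PolyIn.self _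
  have hsn : ∀ l : List Bool, (splitNum l).1 ≤ l.length := fun l => by
    have := splitNum_length l; omega
  have hsk : ∀ x : List Bool, (skipNum (skipNum x)).length ≤ x.length := fun l =>
    (skipNum_length _).trans (skipNum_length _)
  refine ((measure (fun x => x) hid ?_ ?_ ?_).seq ((takeNum' (fun x => x) ?_ (by simp) hid).seq
    ((takeNum' skipNum ?_ (by simp) (hid.mono skipNum_length)).seq
    ((parseGates (fun x => skipNum (skipNum x)) (hid.mono hsk) ?_ ?_ ?_ ?_ ?_ ?_ ?_).seq
    ((parseOuts (fun x => afterGates (skipNum (skipNum x)))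
      (hid.mono fun x => (afterGates_length _).trans (hsk _)) ?_ ?_ ?_ ?_ ?_).seq
    (PolyRuns.pop.seq (parseBits (fun x => (splitNum (skipNum x)).1 - 1)
      (hid.mono fun x => ?_) ?_ ?_ ?_ ?_ ?_ ?_))))))).trans_eq ?_
  case refine_18 =>
    have := hsn (skipNum x)
    have := skipNum_length x
    omega
  all_goals try intro x
  case refine_25 =>
    funext k
    rcases k with w | _
    · cases w <;> simp [loadedStacks, inputData]
    all_goals simp [loadedStacks, inputData]
  all_goals simp

end PolyRuns

end StackProg

namespace StackProg

open Function

/-! ### Writing the verifier -/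

/-- A step pushes at most one bit. Lengths of stacks are thus bounded by running times, which avoids
estimating the lengths of the gate streams directly. -/
theorem Runs.length_le {K : Type} [DecidableEq K] {p : Prog K} {s s' : Stacks K} {t : ℕ}
    (h : Runs p s s' t) (k : K) : (s' k).length ≤ (s k).length + t := by
  induction h with
  | nop s => omega
  | push k' b s =>
    by_cases e : k = k'
    · subst e; simp
    · simp [e]
  | pop k' s =>
    by_cases e : k = k'
    · subst e; simp; omega
    · simp [e]
  | seq => omega
  | ite_true => omega
  | ite_false => omega
  | loop_done => omega
  | loop_step => omega

theorem PolyRuns.length {K : Type} [DecidableEq K] {ι : Type*} {sz : ι → ℕ} {p : Prog K}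
    {s s' : ι → Stacks K} (h : PolyRuns sz p s s') (k : K) (hk : PolyIn sz fun i => (s i k).length) :
    PolyIn sz fun i => (s' i k).length := by
  obtain ⟨a, ha⟩ := h
  obtain ⟨b, hb⟩ := hk
  refine ⟨b + a, fun i => ?_⟩
  obtain ⟨t, ht, hr⟩ := ha i
  have := hr.length_le k
  have : (s i k).length ≤ b.eval (sz i) := hb i
  simp only [Polynomial.eval_add]
  omega

/-- The bits that a symbol stands for; `none` stands for the base. -/
def expand (base : ℕ) : Option Bool → List Bool
  | none => ones base
  | some b => [b]

/-- The code of a symbol. -/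
def symCode : Option Bool → List Bool
  | none => [false, false]
  | some true => [true]
  | some false => [false, true]

theorem one_le_length_symCode (a : Option Bool) : 1 ≤ (symCode a).length := by
  rcases a with _ | _ | _ <;> simp [symCode]

/-- The symbols of an address. -/
def Addr.syms (a : Addr) : List (Option Bool) :=
  (if a.1 then [none] else []) ++ List.replicate a.2 (some true) ++ [some false]

/-- The symbols of a gate. -/
def RGate.syms (x : RGate Addr) : List (Option Bool) :=
  List.replicate x.kind (some true) ++ [some false] ++ x.args.flatMap Addr.syms

theorem flatMap_replicate_symCode (m : ℕ) :
    (List.replicate m (some true)).flatMap symCode = ones m := by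
  induction m with
  | zero => rfl
  | succ m ih => simp [List.replicate_succ, ih, symCode]

theorem flatMap_replicate_expand (b m : ℕ) :
    (List.replicate m (some true)).flatMap (expand b) = ones m := by
  induction m with
  | zero => rfl
  | succ m ih => simp [List.replicate_succ, ih, expand]

theorem RGate.syms_code (x : RGate Addr) : x.syms.flatMap symCode = x.stream := by
  simp only [syms, stream, List.flatMap_append, flatMap_replicate_symCode, List.flatMap_assoc]
  congr 1
  refine List.flatMap_congr fun a _ => ?_
  simp only [Addr.syms, Addr.stream, List.flatMap_append, flatMap_replicate_symCode]
  split_ifs <;> simp [symCode]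

theorem unaryEncode_append (l l' : List ℕ) :
    unaryEncode (l ++ l') = unaryEncode l ++ unaryEncode l' := by simp [unaryEncode]

/-- In unary, the base followed by an offset is their sum. Replacing the base symbol by ones
therefore turns a relative address into the code of the absolute one. -/
theorem RGate.syms_expand (b : ℕ) (x : RGate Addr) :
    x.syms.flatMap (expand b) = unaryEncode (x.map (Addr.abs b)).tokens := by
  simp only [syms, tokens, unaryEncode, List.flatMap_append, flatMap_replicate_expand,
    List.flatMap_assoc, List.flatMap_cons, args_map, List.flatMap_map, kind_map]
  congr 1
  refine List.flatMap_congr fun a _ => ?_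
  simp only [Addr.syms, Addr.abs, List.flatMap_append, flatMap_replicate_expand]
  split_ifs <;> simp [expand, List.replicate_append_replicate]

/-- The code of the gates in the window with a given base. -/
def windowText (b : ℕ) (l : List (RGate Addr)) : List Bool :=
  unaryEncode (l.flatMap fun x => (x.map (Addr.abs b)).tokens)

theorem windowText_append (b : ℕ) (l l' : List (RGate Addr)) :
    windowText b (l ++ l') = windowText b l ++ windowText b l' := by
  simp [windowText, unaryEncode_append]

theorem flatMap_syms_expand (b : ℕ) (l : List (RGate Addr)) :
    (l.flatMap RGate.syms).flatMap (expand b) = windowText b l := by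
  simp only [windowText, unaryEncode, List.flatMap_assoc, RGate.syms_expand]

theorem flatMap_syms_code (l : List (RGate Addr)) :
    (l.flatMap RGate.syms).flatMap symCode = l.flatMap RGate.stream := by
  simp only [List.flatMap_assoc, RGate.syms_code]

namespace Prog

/-- Write the gates whose stream is in `r`, for the base in `base`. -/
def streamOut (r : Reg) : Prog Reg :=
  .loop r Option.isSome (.ite r isOne (.pop r ;; .push .fwd true ;; .push .txt true)
    (.pop r ;; .push .fwd false ;; .ite r isOne (.pop r ;; .push .fwd true ;; .push .txt false)
      (.pop r ;; .push .fwd false ;; addTo .base .tmp .txt))) ;;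
  moveAll .fwd r

/-- Multiply the number of rounds by a power of `M`. -/
def mulRounds : ℕ → Prog Reg
  | 0 => .nop
  | d + 1 => (.loop .rounds isOne (.pop .rounds ;; addTo (.var .M) .tmp .cd) ;;
      moveAll .cd .rounds) ;; mulRounds d

/-- Add a multiple of `M`. -/
def addMany (d : Reg) : ℕ → Prog Reg
  | 0 => .nop
  | c + 1 => addTo (.var .M) .tmp d ;; addMany d c

/-- Empty a list of stacks. -/
def dropList : List Reg → Prog Reg
  | [] => .nop
  | r :: l => dropAll r ;; dropList l

/-- Write all gates of the verifier. -/
def writeGates (c₀ d : ℕ) : Prog Reg :=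
  ((stages roundGateStages ;; pushItems .fwd flagGate.items) ;; moveAll .fwd .sav ;;
  pushList .txt (ones 2 ++ [false]) ;; addTo (.var .M) .tmp .txt ;; .push .txt false ;;
  addTo (.var .M) .tmp .base ;; pushList .rounds (ones c₀) ;; mulRounds d) ;;
  .loop .rounds isOne (.pop .rounds ;; streamOut .sav ;; streamOut .rev ;;
    addMany .base 20 ;; addMany .go 20)

/-- Write the verifier. -/
def writeVerifier (c₀ d : ℕ) : Prog Reg :=
  parse ;; writeGates c₀ d ;; moveAll .txt .out ;;
  .push .out false ;; addTo .base .tmp .out ;; .push .out false ;; .push .out true ;;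
  addTo .go .tmp .out ;; .push .out false ;; addTo (.var .M) .tmp .out ;;
  dropList [.var .M, .var .n, .var .pb, .recs, .outs, .bits, .sav, .rev, .base, .go]

end Prog

namespace PolyRuns

variable {ι : Type*} {sz : ι → ℕ} {s : ι → Stacks Reg}

/-- The symbol code is a prefix code that is decided by at most two bits, so symbols are expanded
while they are read. The bits read are kept in `fwd` and moved back, because the stream is needed
again in the next window. -/
theorem streamOut (r : Reg) (hr : r = .sav ∨ r = .rev) (b : ι → ℕ) (hb : PolyIn sz b)
    (l : ι → List (Option Bool)) (hl : PolyIn sz fun i => (s i r).length)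
    (h1 : ∀ i, s i r = (l i).flatMap symCode) (h2 : ∀ i, s i .base = ones (b i))
    (h3 : ∀ i, s i .fwd = []) (h4 : ∀ i, s i .tmp = []) :
    PolyRuns sz (Prog.streamOut r) s
      fun i => update (s i) .txt (((l i).flatMap (expand (b i))).reverse ++ s i .txt) := by
  have n1 : r ≠ .fwd := by rcases hr with rfl | rfl <;> simp
  have n2 : r ≠ .txt := by rcases hr with rfl | rfl <;> simp
  have n3 : r ≠ .tmp := by rcases hr with rfl | rfl <;> simp
  have n4 : r ≠ .base := by rcases hr with rfl | rfl <;> simp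
  have hcnt : PolyIn sz fun i => (l i).length := hl.mono fun i => by
    rw [h1, List.length_flatMap]
    have := List.card_nsmul_le_sum ((l i).map fun a => (symCode a).length) 1
      (by simpa using fun a _ => one_le_length_symCode a)
    simpa using this
  have A := PolyRuns.loop (sz := sz) (k := r) (c := Option.isSome)
    (p := .ite r isOne (.pop r ;; .push .fwd true ;; .push .txt true)
      (.pop r ;; .push .fwd false ;; .ite r isOne (.pop r ;; .push .fwd true ;; .push .txt false)
      (.pop r ;; .push .fwd false ;; Prog.addTo .base .tmp .txt)))
    (fun i => (l i).length) hcnt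
    (fun i m => update (update (update (s i) r (((l i).drop m).flatMap symCode)) .fwd
      (((l i).take m).flatMap symCode).reverse) .txt
      ((((l i).take m).flatMap (expand (b i))).reverse ++ s i .txt))
    (by
      intro i m hm
      have e := drop_eq_getD_cons (l i) none hm
      rcases ha : (l i).getD m none with _ | _ | _ <;> rw [ha] at e <;> simp [n1, n2, e, symCode])
    (by intro i; simp [n1, n2])
    (by
      refine PolyRuns.ite (fun y => (l y.1.1).getD y.1.2 none = some true) ?_ ?_
        ((PolyRuns.pop.seq ((PolyRuns.push true).seq (PolyRuns.push true))).trans_eq ?_)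
        (PolyRuns.pop.seq ((PolyRuns.push false).seq (PolyRuns.ite
          (fun y => (l y.1.1.1).getD y.1.1.2 none = some false) ?_ ?_
          ((PolyRuns.pop.seq ((PolyRuns.push true).seq (PolyRuns.push false))).trans_eq ?_)
          ((PolyRuns.pop.seq ((PolyRuns.push false).seq (addTo _
            (hb.reindex _) ?_ ?_ (by simp) (by simp) (by simp)))).trans_eq ?_))))
      · rintro ⟨⟨i, m⟩, hm⟩ hy
        have e := drop_eq_getD_cons (l i) none hm
        dsimp only at hy e ⊢
        simp [hy, n1, n2, e, symCode, -List.getD_eq_getElem?_getD]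
      · rintro ⟨⟨i, m⟩, hm⟩ hy
        have e := drop_eq_getD_cons (l i) none hm
        dsimp only at hy e ⊢
        rcases ha : (l i).getD m none with _ | _ | _ <;> rw [ha] at e hy <;>
          simp [n1, n2, e, symCode] at hy ⊢
      · rintro ⟨⟨⟨i, m⟩, hm⟩, hy⟩
        have e := drop_eq_getD_cons (l i) none hm
        have e' := take_succ_eq_getD (l i) none hm
        dsimp only at hy e e' ⊢
        rw [hy] at e e'
        rcases hr with rfl | rfl <;> funext k <;> rcases k with w | _ <;>
          simp [e, e', symCode, expand]
      · rintro ⟨⟨⟨i, m⟩, hm⟩, hy'⟩ hy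
        have e := drop_eq_getD_cons (l i) none hm
        dsimp only at hy e ⊢
        simp [hy, n1, n2, e, symCode, -List.getD_eq_getElem?_getD]
      · rintro ⟨⟨⟨i, m⟩, hm⟩, hy'⟩ hy
        have e := drop_eq_getD_cons (l i) none hm
        dsimp only at hy hy' e ⊢
        rcases ha : (l i).getD m none with _ | _ | _ <;> rw [ha] at e hy hy' <;>
          simp [n1, n2, e, symCode] at hy hy' ⊢
      · rintro ⟨⟨⟨⟨i, m⟩, hm⟩, hy'⟩, hy⟩
        have e := drop_eq_getD_cons (l i) none hm
        have e' := take_succ_eq_getD (l i) none hm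
        dsimp only at hy e e' ⊢
        rw [hy] at e e'
        rcases hr with rfl | rfl <;> funext k <;> rcases k with w | _ <;>
          simp [e, e', symCode, expand]
      · intro y; simp [h2, n4.symm]
      · intro y; simp [h4, n3.symm]
      · rintro ⟨⟨⟨⟨i, m⟩, hm⟩, hy'⟩, hy⟩
        have e := drop_eq_getD_cons (l i) none hm
        have e' := take_succ_eq_getD (l i) none hm
        dsimp only at hy hy' e e' ⊢
        have hn : (l i).getD m none = none := by
          rcases ha : (l i).getD m none with _ | _ | _ <;> simp_all
        rw [hn] at e e'
        rcases hr with rfl | rfl <;> funext k <;> rcases k with w | _ <;>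
          simp [e, e', symCode, expand])
  refine ((A.congr (r := s) (fun i => ?_) fun i => rfl).seq
    (moveAll ?_ n1.symm)).trans_eq fun i => ?_
  · have h1' := h1 i
    have h3' := h3 i
    rcases hr with rfl | rfl <;> funext k <;> rcases k with w | _ <;> simp [h1', h3']
  · refine hl.mono fun i => ?_
    simp [h1]
  · have h1' := h1 i
    have h3' := h3 i
    rcases hr with rfl | rfl <;> funext k <;> rcases k with w | _ <;> simp [h1', h3']

theorem mulRounds (d : ℕ) (v m : ι → ℕ) (hv : PolyIn sz v) (hm : PolyIn sz m)
    (h1 : ∀ i, s i .rounds = ones (v i)) (h2 : ∀ i, s i (.var .M) = ones (m i))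
    (h3 : ∀ i, s i .tmp = []) (h4 : ∀ i, s i .cd = []) :
    PolyRuns sz (Prog.mulRounds d) s fun i => update (s i) .rounds (ones (v i * m i ^ d)) := by
  induction d generalizing s v with
  | zero => exact nop.trans_eq fun i => by simp [← h1]
  | succ d ih =>
    have A := PolyRuns.loop (sz := sz) (k := .rounds) (c := isOne)
      (p := .pop .rounds ;; Prog.addTo (.var .M) .tmp .cd) v hv
      (fun i k => update (update (s i) .rounds (ones (v i - k))) .cd (ones (k * m i)))
      (by intro i k hk; simp [ones_sub_succ hk]) (by intro i; simp)
      (by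
        refine (PolyRuns.pop.seq (addTo _ (hm.reindex _) (by simp [h2])
          (by simp [h3]) (by simp) (by simp) (by simp))).trans_eq fun y => ?_
        funext k
        rcases k with w | _
        all_goals simp [ones_sub_succ y.2, add_mul, List.replicate_append_replicate, add_comm])
    refine ((((A.congr (r := s) (fun i => ?_) fun i => rfl).seq (moveAll ?_ (by simp))).trans_eq
      (r' := fun i => update (s i) .rounds (ones (v i * m i))) fun i => ?_).seq
      (ih (fun i => v i * m i) (hv.mul hm) ?_ ?_ ?_ ?_)).trans_eq fun i => ?_
    · have h1' := h1 i
      have h4' := h4 i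
      funext k
      rcases k with w | _
      all_goals simp [h1', h4']
    · simpa using hv.mul hm
    · have h4' := h4 i
      funext k
      rcases k with w | _
      all_goals simp [h4']
    · simp
    · simpa using h2
    · simpa using h3
    · simpa using h4
    · simp [pow_succ', mul_assoc]

theorem addMany (d : Reg) (hd : d = .base ∨ d = .go) (c : ℕ) (m : ι → ℕ) (hm : PolyIn sz m)
    (h2 : ∀ i, s i (.var .M) = ones (m i)) (h3 : ∀ i, s i .tmp = []) :
    PolyRuns sz (Prog.addMany d c) s fun i => update (s i) d (ones (c * m i) ++ s i d) := by
  have n1 : d ≠ .tmp := by rcases hd with rfl | rfl <;> simp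
  have n2 : d ≠ .var .M := by rcases hd with rfl | rfl <;> simp
  induction c generalizing s with
  | zero => exact nop.trans_eq fun i => by simp
  | succ c ih =>
    refine ((addTo _ hm h2 h3 (by simp) n2.symm n1.symm).seq (ih ?_ ?_)).trans_eq fun i => ?_
    · intro i; rw [update_of_ne n2.symm]; exact h2 i
    · intro i; rw [update_of_ne n1.symm]; exact h3 i
    · simp only [update_idem, update_self, ← List.append_assoc, List.replicate_append_replicate]
      rw [add_mul, one_mul]

theorem dropList (l : List Reg) (hl : ∀ r ∈ l, PolyIn sz fun i => (s i r).length) :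
    PolyRuns sz (Prog.dropList l) s fun i k => if k ∈ l then [] else s i k := by
  induction l generalizing s with
  | nil => exact nop.trans_eq fun i => by simp
  | cons r l ih =>
    refine ((dropAll (hl r (by simp))).seq (ih fun r' hr' => ?_)).trans_eq fun i => ?_
    · refine (hl r' (by simp [hr'])).mono fun i => ?_
      rw [update_apply]
      split_ifs <;> simp_all
    · funext k
      by_cases h : k = r <;> simp [h]

end PolyRuns

end StackProg

/-! ### The text of the verifier, and the program that writes it in polynomial time -/

namespace StackProg

open Function

/-- The gates of one round. -/
def roundGates (D : StageData) : List (RGate Addr) :=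
  (gatesOf (instrs D roundStages) ++ [flagGate.val D.e]) ++ (gatesOf (instrs D roundStages)).reverse

/-- The code of the gates of `r` rounds. -/
def roundsText (D : StageData) (r : ℕ) : List Bool :=
  unaryEncode [2, D.e .M] ++ (List.range r).flatMap fun k =>
    windowText (D.e .M + k * (20 * D.e .M)) (roundGates D)

theorem roundsText_succ (D : StageData) (r : ℕ) : roundsText D (r + 1) = roundsText D r ++
    windowText (D.e .M + r * (20 * D.e .M)) (roundGates D) := by
  simp [roundsText, List.range_succ]

/-- The stacks after all gates have been written. -/
def writtenStacks (D : StageData) (R : ℕ) : Stacks Reg :=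
  update (update (update (update (update (loadedStacks D)
    .sav ((gatesOf (instrs D roundStages) ++ [flagGate.val D.e]).flatMap RGate.stream))
    .rev ((gatesOf (instrs D roundStages)).reverse.flatMap RGate.stream))
    .txt (roundsText D R).reverse)
    .base (ones (D.e .M + R * (20 * D.e .M)))) .go (ones (R * (20 * D.e .M)))

/-- The code of the verifier with `R` rounds. -/
def verifierText (D : StageData) (R : ℕ) : List Bool :=
  unaryEncode [D.e .M, R * (20 * D.e .M) + 1, D.e .M + R * (20 * D.e .M)] ++ roundsText D R

theorem loaded_loadedStacks {D : StageData} (h1 : D.e .q = 0) (h2 : D.e .i = 0) (h3 : D.e .j = 0) :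
    Loaded (loadedStacks D) D := by
  constructor <;> first | assumption | rfl | skip
  intro v
  cases v <;> simp [loadedStacks, h1, h2, h3]

namespace PolyRuns

variable {ι : Type*} {sz : ι → ℕ} {D : ι → StageData}

/-- The invariant of the outer loop: after m rounds the stacks are those of a verifier with m
rounds, apart from the counter `rounds`. The flag gate goes to the forward stream only, since it
must not be undone. -/
theorem writeGates (c₀ d : ℕ) (hD : ∀ i, (D i).e .q = 0 ∧ (D i).e .i = 0 ∧ (D i).e .j = 0)
    (he : ∀ v, PolyIn sz fun i => (D i).e v)
    (hr : PolyIn sz fun i => (recsCode (D i).recs).length)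
    (ho : PolyIn sz fun i => (numsCode (D i).outs).length)
    (hb : PolyIn sz fun i => (D i).bits.length) :
    PolyRuns sz (Prog.writeGates c₀ d) (fun i => loadedStacks (D i))
      fun i => writtenStacks (D i) (c₀ * (D i).e .M ^ d) := by
  have hload : ∀ i, Loaded (loadedStacks (D i)) (D i) := fun i =>
    loaded_loadedStacks (hD i).1 (hD i).2.1 (hD i).2.2
  set W : ι → List (RGate Addr) := fun i => gatesOf (instrs (D i) roundStages) with hW
  have hM := he .M
  have hR : PolyIn sz fun i => c₀ * (D i).e .M ^ d := (PolyIn.const _ c₀).mul (hM.pow d)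
  have S1 := (PolyRuns.stages (sz := sz) roundGateStages hload he hr ho hb).trans_eq
    (r' := fun i => emitted (loadedStacks (D i)) (W i)) fun i => by rw [roundGateStages_den]
  have S2 : PolyRuns sz (Prog.stages roundGateStages ;; Prog.pushItems .fwd flagGate.items)
      (fun i => loadedStacks (D i)) fun i => update (update (loadedStacks (D i))
        .fwd ((W i ++ [flagGate.val (D i).e]).flatMap RGate.stream).reverse)
        .rev ((W i).reverse.flatMap RGate.stream) := by
    refine (S1.seq (pushItems .fwd (by simp) (by simp) _ (e := fun i => (D i).e) ?_ he)).trans_eq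
      fun i => ?_
    · intro i
      exact HasVars.emitted ⟨(hload i).vars, (hload i).tmp⟩ _
    · rw [SGate.items_val]
      funext k
      rcases k with w | _
      all_goals simp [emitted, loadedStacks]
  have hfwd := S2.length .fwd (by simpa [loadedStacks] using PolyIn.const sz 0)
  have hrev := S2.length .rev (by simpa [loadedStacks] using PolyIn.const sz 0)
  have S4 : PolyRuns sz ((Prog.stages roundGateStages ;; Prog.pushItems .fwd flagGate.items) ;;
      Prog.moveAll .fwd .sav ;; Prog.pushList .txt (ones 2 ++ [false]) ;;
      Prog.addTo (.var .M) .tmp .txt ;; .push .txt false ;;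
      Prog.addTo (.var .M) .tmp .base ;; Prog.pushList .rounds (ones c₀) ;; Prog.mulRounds d)
      (fun i => loadedStacks (D i)) fun i => update (writtenStacks (D i) 0) .rounds
        (ones (c₀ * (D i).e .M ^ d)) := by
    refine (S2.seq ((moveAll hfwd (by simp)).seq ((pushList _).seq ((addTo _ hM ?_ ?_ (by simp)
      (by simp) (by simp)).seq ((PolyRuns.push false).seq ((addTo _ hM ?_ ?_ (by simp)
      (by simp) (by simp)).seq ((pushList _).seq (mulRounds d (fun _ => c₀) (fun i => (D i).e .M)
      (.const _ _) hM ?_ ?_ ?_ ?_)))))))).trans_eq fun i => ?_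
    case refine_9 =>
      funext k
      rcases k with w | _
      · cases w <;> simp [writtenStacks, loadedStacks]
      all_goals simp [writtenStacks, loadedStacks, roundsText, unaryEncode, hW]
    all_goals intro i
    all_goals simp [loadedStacks]
  have A := PolyRuns.loop (sz := sz) (k := .rounds) (c := isOne)
    (p := .pop .rounds ;; Prog.streamOut .sav ;; Prog.streamOut .rev ;;
    Prog.addMany .base 20 ;; Prog.addMany .go 20)
    (fun i => c₀ * (D i).e .M ^ d) hR
    (fun i m => update (writtenStacks (D i) m) .rounds (ones (c₀ * (D i).e .M ^ d - m)))
    (by intro i k hk; simp [ones_sub_succ hk]) (by intro i; simp)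
    (by
      have hM' := hM.reindex fun y : {y : ι × ℕ // y.2 < c₀ * (D y.1).e .M ^ d} => y.1.1
      have hbase : PolyIn (fun y : {y : ι × ℕ // y.2 < c₀ * (D y.1).e .M ^ d} => sz y.1.1)
          fun y => (D y.1.1).e .M + y.1.2 * (20 * (D y.1.1).e .M) :=
        hM'.add (PolyIn.mul ((hR.reindex _).mono fun y => y.2.le) ((PolyIn.const _ 20).mul hM'))
      refine (PolyRuns.pop.seq ((streamOut .sav (.inl rfl)
        (fun y => (D y.1.1).e .M + y.1.2 * (20 * (D y.1.1).e .M)) hbase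
        (fun y => (W y.1.1 ++ [flagGate.val (D y.1.1).e]).flatMap RGate.syms) ?_ ?_ ?_ ?_ ?_).seq
        ((streamOut .rev (.inr rfl)
        (fun y => (D y.1.1).e .M + y.1.2 * (20 * (D y.1.1).e .M)) hbase
        (fun y => (W y.1.1).reverse.flatMap RGate.syms) ?_ ?_ ?_ ?_ ?_).seq
        ((addMany .base (.inl rfl) 20 _ hM' ?_ ?_).seq
          (addMany .go (.inr rfl) 20 _ hM' ?_ ?_))))).trans_eq ?_
      · refine (hfwd.reindex _).mono fun y => ?_
        simp [writtenStacks, hW, add_comm]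
      · intro y
        simp only [flatMap_syms_code]
        simp [writtenStacks, hW]
      · intro y; simp [writtenStacks]
      · intro y; simp [writtenStacks, loadedStacks]
      · intro y; simp [writtenStacks, loadedStacks]
      · refine (hrev.reindex _).mono fun y => ?_
        simp [writtenStacks, hW]
      · intro y
        simp only [flatMap_syms_code]
        simp [writtenStacks, hW]
      · intro y; simp [writtenStacks]
      · intro y; simp [writtenStacks, loadedStacks]
      · intro y; simp [writtenStacks, loadedStacks]
      · intro y; simp [writtenStacks, loadedStacks]
      · intro y; simp [writtenStacks, loadedStacks]
      · intro y; simp [writtenStacks, loadedStacks]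
      · intro y; simp [writtenStacks, loadedStacks]
      · rintro ⟨⟨i, m⟩, hm⟩
        simp only [flatMap_syms_expand]
        have e1 : (m + 1) * (20 * (D i).e .M) = 20 * (D i).e .M + m * (20 * (D i).e .M) := by ring
        have e2 : (D i).e .M + (m + 1) * (20 * (D i).e .M)
          = 20 * (D i).e .M + ((D i).e .M + m * (20 * (D i).e .M)) := by ring
        funext k
        rcases k with w | _
        · simp [writtenStacks, loadedStacks]
        case txt =>
          simp only [writtenStacks, roundsText_succ, roundGates, windowText_append]
          simp [hW]
        case base => simp [writtenStacks, e2, List.replicate_append_replicate]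
        case go => simp [writtenStacks, e1, List.replicate_append_replicate]
        case rounds => simp [ones_sub_succ hm]
        all_goals simp [writtenStacks])
  exact S4.seq ((A.congr (fun i => rfl) fun i => rfl).trans_eq fun i => by
    funext k
    rcases k with w | _
    all_goals simp [writtenStacks, loadedStacks])

theorem writeVerifier (c₀ d : ℕ) :
    PolyRuns List.length (Prog.writeVerifier c₀ d)
      (fun x : List Bool => update (fun _ => []) .inp x) fun x => update (fun _ => []) .out
        (verifierText (inputData x) (c₀ * (inputData x).e .M ^ d)) := by
  have h0 : ∀ r, PolyIn List.length fun x : List Bool =>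
      ((update (fun _ => []) Reg.inp x : Stacks Reg) r).length := fun r =>
    (PolyIn.self _).mono fun x => by
      rw [update_apply]; split_ifs <;> simp
  have h1 := fun r => parse.length r (h0 r)
  have hM : PolyIn List.length fun x : List Bool => (inputData x).e .M := by
    simpa [loadedStacks] using h1 (.var .M)
  have G := writeGates (sz := List.length) (D := inputData) c₀ d (fun i => ⟨rfl, rfl, rfl⟩)
    (fun v => by
      cases v
      · exact hM
      · simpa [loadedStacks] using h1 (.var .n)
      · simpa [loadedStacks] using h1 (.var .pb)
      all_goals exact PolyIn.const _ 0)
    (by simpa [loadedStacks] using h1 .recs) (by simpa [loadedStacks] using h1 .outs)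
    (by simpa [loadedStacks] using h1 .bits)
  have h2 := fun r => G.length r (h1 r)
  -- The header is pushed on top of the finished text, hence last number first: the measured qubit,
  -- the number of ancillas (one more than the windows occupy, for the last flag), the number of
  -- witness qubits. Within each number the separator comes first.
  refine (parse.seq (G.seq ((moveAll (h2 .txt) (by simp)).seq ((PolyRuns.push false).seq
    ((addTo (fun x => (inputData x).e .M + c₀ * (inputData x).e .M ^ d * (20 * (inputData x).e .M))
      ?_ ?_ ?_ (by simp) (by simp) (by simp)).seq ((PolyRuns.push false).seq
    ((PolyRuns.push true).seq
    ((addTo (fun x => c₀ * (inputData x).e .M ^ d * (20 * (inputData x).e .M))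
      ?_ ?_ ?_ (by simp) (by simp) (by simp)).seq ((PolyRuns.push false).seq
    ((addTo (fun x => (inputData x).e .M)
      hM ?_ ?_ (by simp) (by simp) (by simp)).seq (dropList _ ?_))))))))))).trans_eq fun x => ?_
  · exact hM.add (((PolyIn.const _ c₀).mul (hM.pow d)).mul ((PolyIn.const _ 20).mul hM))
  · intro x; simp [writtenStacks]
  · intro x; simp [writtenStacks, loadedStacks]
  · exact ((PolyIn.const _ c₀).mul (hM.pow d)).mul ((PolyIn.const _ 20).mul hM)
  · intro x; simp [writtenStacks]
  · intro x; simp [writtenStacks, loadedStacks]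
  · intro x; simp [writtenStacks, loadedStacks]
  · intro x; simp [writtenStacks, loadedStacks]
  · intro r hr
    refine (h2 r).mono fun x => ?_
    have n1 : r ≠ .txt := by rintro rfl; simp at hr
    have n2 : r ≠ .out := by rintro rfl; simp at hr
    simp [n1, n2]
  · funext k
    rcases k with w | _
    · cases w <;> simp [writtenStacks, loadedStacks, inputData]
    all_goals simp [writtenStacks, loadedStacks, verifierText, unaryEncode, List.replicate_succ,
      ones_append_cons]

end PolyRuns

theorem nonempty_computable (c₀ d : ℕ) {β : Type} (enc : β → List Bool) (f : List Bool → β)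
    (h : ∀ x, enc (f x) = verifierText (inputData x) (c₀ * (inputData x).e .M ^ d)) :
    Nonempty (Turing.TM2ComputableInPolyTime (id : List Bool → List Bool) enc f) := by
  obtain ⟨q, hq⟩ := PolyRuns.writeVerifier c₀ d
  exact computable_of_runs (Prog.writeVerifier c₀ d) Reg.inp Reg.out enc f q fun x => by rw [h]; exact hq x

end StackProg

namespace StackProg

open Function

/-! ### Reversible gates and Hadamard gates on strings of bits -/

/-- Assignments of bits to addresses. -/
abbrev Str := ℕ → Bool

namespace RGate

/-- The action of a reversible gate on bit strings. -/
def act : RGate ℕ → Str → Str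
  | had _, γ => γ
  | not t, γ => update γ t (!γ t)
  | cnot c t, γ => update γ t (xor (γ t) (γ c))
  | tof c d t, γ => update γ t (xor (γ t) (γ c && γ d))

/-- The action of a gate on amplitudes. -/
noncomputable def apply : RGate ℕ → (Str → ℂ) → Str → ℂ
  | had q, ψ => fun γ => (ψ (update γ q false) + (if γ q then -1 else 1) * ψ (update γ q true))
      / (Real.sqrt 2 : ℂ)
  | not t, ψ => fun γ => ψ ((not t).act γ)
  | cnot c t, ψ => fun γ => ψ ((cnot c t).act γ)
  | tof c d t, ψ => fun γ => ψ ((tof c d t).act γ)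

/-- The gate is not a Hadamard gate. -/
def Reversible {α : Type} : RGate α → Prop
  | had _ => False
  | _ => True

/-- The addresses of the gate are distinct. -/
def Distinct (g : RGate ℕ) : Prop := g.args.Nodup

/-- The bit that the gate changes. -/
def target {α : Type} : RGate α → α
  | had t => t
  | not t => t
  | cnot _ t => t
  | tof _ _ t => t

theorem target_mem_args (g : RGate ℕ) : g.target ∈ g.args := by cases g <;> simp [target, args]

theorem apply_eq {g : RGate ℕ} (h : g.Reversible) (ψ : Str → ℂ) (γ : Str) :
    g.apply ψ γ = ψ (g.act γ) := by
  cases g <;> first | rfl | exact h.elim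

theorem act_act {g : RGate ℕ} (h : g.Distinct) (γ : Str) : g.act (g.act γ) = γ := by
  cases g with
  | had => rfl
  | not t => simp [act]
  | cnot c t =>
    have : c ≠ t := by simpa [Distinct, args] using h
    simp [act, this]
  | tof c d t =>
    have : (c ≠ d ∧ c ≠ t) ∧ d ≠ t := by simpa [Distinct, args] using h
    simp [act, this]

end RGate

/-- The action of a list of reversible gates. -/
def run (l : List (RGate ℕ)) (γ : Str) : Str := l.foldl (fun γ g => g.act γ) γ

/-- The action of a list of gates on amplitudes. -/
noncomputable def applyAll (l : List (RGate ℕ)) (ψ : Str → ℂ) : Str → ℂ :=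
  l.foldl (fun ψ g => g.apply ψ) ψ

@[simp] theorem run_nil (γ : Str) : run [] γ = γ := rfl
@[simp] theorem run_cons (g : RGate ℕ) (l : List (RGate ℕ)) (γ : Str) :
    run (g :: l) γ = run l (g.act γ) := rfl
theorem run_append (l l' : List (RGate ℕ)) (γ : Str) : run (l ++ l') γ = run l' (run l γ) := by
  simp [run, List.foldl_append]

@[simp] theorem applyAll_nil (ψ : Str → ℂ) : applyAll [] ψ = ψ := rfl
@[simp] theorem applyAll_cons (g : RGate ℕ) (l : List (RGate ℕ)) (ψ : Str → ℂ) :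
    applyAll (g :: l) ψ = applyAll l (g.apply ψ) := rfl
theorem applyAll_append (l l' : List (RGate ℕ)) (ψ : Str → ℂ) :
    applyAll (l ++ l') ψ = applyAll l' (applyAll l ψ) := by
  simp [applyAll, List.foldl_append]

/-- A gate pulls amplitudes back along its action on strings, so the gate applied last acts first on
the argument. -/
theorem applyAll_eq_run {l : List (RGate ℕ)} (h : ∀ g ∈ l, g.Reversible) (ψ : Str → ℂ) (γ : Str) :
    applyAll l ψ γ = ψ (run l.reverse γ) := by
  induction l generalizing ψ with
  | nil => rfl
  | cons g l ih =>
    rw [applyAll_cons, ih fun x hx => h x (by simp [hx]), RGate.apply_eq (h g (by simp)),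
      List.reverse_cons, run_append]
    rfl

theorem run_reverse_run {l : List (RGate ℕ)} (h : ∀ g ∈ l, g.Distinct) (γ : Str) :
    run l.reverse (run l γ) = γ := by
  induction l generalizing γ with
  | nil => rfl
  | cons g l ih =>
    rw [List.reverse_cons, run_append]
    change g.act (run l.reverse (run l (g.act γ))) = γ
    rw [ih fun x hx => h x (by simp [hx])]
    exact RGate.act_act (h g (by simp)) γ

theorem run_run_reverse {l : List (RGate ℕ)} (h : ∀ g ∈ l, g.Distinct) (γ : Str) :
    run l (run l.reverse γ) = γ := by
  simpa using run_reverse_run (l := l.reverse) (by simpa using h) γ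

theorem sqrt_two_mul_self : (Real.sqrt 2 : ℂ) * (Real.sqrt 2 : ℂ) = 2 := by
  rw [← Complex.ofReal_mul, Real.mul_self_sqrt (by norm_num)]
  norm_num

theorem sqrt_two_ne_zero : (Real.sqrt 2 : ℂ) ≠ 0 := by
  intro h
  have := sqrt_two_mul_self
  rw [h] at this
  norm_num at this

theorem RGate.apply_apply {g : RGate ℕ} (h : g.Distinct) (ψ : Str → ℂ) :
    g.apply (g.apply ψ) = ψ := by
  funext γ
  cases g with
  | had q =>
    have h2 := sqrt_two_ne_zero
    have h3 : (Real.sqrt 2 : ℂ) ^ 2 = 2 := by rw [sq]; exact sqrt_two_mul_self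
    simp only [apply, update_self, update_idem]
    cases hq : γ q
    · have : update γ q false = γ := by rw [← hq, update_eq_self]
      simp only [this]
      simp
      field_simp
      rw [h3]
      ring
    · have : update γ q true = γ := by rw [← hq, update_eq_self]
      simp only [this]
      simp
      field_simp
      rw [h3]
      ring
  | not t => simp only [apply, act_act h]
  | cnot c t => simp only [apply, act_act h]
  | tof c d t => simp only [apply, act_act h]

/-- All gates in use, including the Hadamard gate, are involutions, so reversing the list inverts
the circuit. -/
theorem applyAll_reverse_applyAll {l : List (RGate ℕ)} (h : ∀ g ∈ l, g.Distinct) (ψ : Str → ℂ) :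
    applyAll l.reverse (applyAll l ψ) = ψ := by
  induction l generalizing ψ with
  | nil => rfl
  | cons g l ih =>
    rw [List.reverse_cons, applyAll_append]
    change g.apply (applyAll l.reverse (applyAll l (g.apply ψ))) = ψ
    rw [ih fun x hx => h x (by simp [hx])]
    exact RGate.apply_apply (h g (by simp)) ψ

/-! ### Masses of sets of strings -/

/-- Extend a string of `N` bits by zeros. -/
def extend (N : ℕ) (b : Fin N → Bool) : Str := fun a => if h : a < N then b ⟨a, h⟩ else false

theorem extend_injective (N : ℕ) : Injective (extend N) := by
  intro b b' h
  funext i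
  have := congrFun h i
  simpa [extend] using this

/-- The strings that vanish from `N` on. -/
def cube (N : ℕ) : Finset Str := Finset.univ.map ⟨extend N, extend_injective N⟩

theorem mem_cube {N : ℕ} {γ : Str} : γ ∈ cube N ↔ ∀ a, N ≤ a → γ a = false := by
  simp only [cube, Finset.mem_map, Finset.mem_univ, true_and, Embedding.coeFn_mk]
  constructor
  · rintro ⟨b, rfl⟩ a ha
    simp [extend, Nat.not_lt.2 ha]
  · intro h
    refine ⟨fun i => γ i, funext fun a => ?_⟩
    unfold extend
    split_ifs with ha
    · rfl
    · exact (h a (not_lt.1 ha)).symm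

theorem update_mem_cube {N q : ℕ} {γ : Str} (hγ : γ ∈ cube N) (hq : q < N) (b : Bool) :
    update γ q b ∈ cube N := by
  rw [mem_cube] at hγ ⊢
  intro a ha
  rw [update_of_ne (by omega)]
  exact hγ a ha

theorem act_mem_cube {N : ℕ} {g : RGate ℕ} (hg : g.target < N) {γ : Str} (hγ : γ ∈ cube N) :
    g.act γ ∈ cube N := by
  cases g <;> first | exact hγ | exact update_mem_cube hγ hg _

open Classical in
/-- The probability that a measurement gives a string with the property `P`. -/
noncomputable def mass (N : ℕ) (P : Str → Prop) (ψ : Str → ℂ) : ℝ :=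
  ∑ γ ∈ cube N, if P γ then ‖ψ γ‖ ^ 2 else 0

variable {N : ℕ} {P P' : Str → Prop} {ψ : Str → ℂ}

theorem mass_congr (h : ∀ γ ∈ cube N, ψ γ ≠ 0 → (P γ ↔ P' γ)) : mass N P ψ = mass N P' ψ := by
  classical
  refine Finset.sum_congr rfl fun γ hγ => ?_
  by_cases h0 : ψ γ = 0
  · simp [h0]
  · simp [h γ hγ h0]

theorem mass_nonneg : 0 ≤ mass N P ψ :=
  Finset.sum_nonneg fun γ _ => by split_ifs <;> positivity

theorem mass_mono (h : ∀ γ, P γ → P' γ) : mass N P ψ ≤ mass N P' ψ := by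
  refine Finset.sum_le_sum fun γ _ => ?_
  by_cases hP : P γ
  · simp [hP, h γ hP]
  · rw [if_neg hP]
    split_ifs <;> positivity

theorem mass_and_add (P P' : Str → Prop) :
    mass N (fun γ => P γ ∧ P' γ) ψ + mass N (fun γ => P γ ∧ ¬ P' γ) ψ = mass N P ψ := by
  classical
  rw [mass, mass, mass, ← Finset.sum_add_distrib]
  refine Finset.sum_congr rfl fun γ _ => ?_
  by_cases h : P γ <;> by_cases h' : P' γ <;> simp [h, h']

theorem mass_act {g : RGate ℕ} (hr : g.Reversible) (hd : g.Distinct) (ht : g.target < N) :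
    mass N P (g.apply ψ) = mass N (fun γ => P (g.act γ)) ψ := by
  classical
  refine Finset.sum_nbij' g.act g.act (fun γ h => act_mem_cube ht h)
    (fun γ h => act_mem_cube ht h) (fun γ _ => RGate.act_act hd γ) (fun γ _ => RGate.act_act hd γ)
    fun γ _ => ?_
  simp only [RGate.apply_eq hr, RGate.act_act hd]

theorem sum_cube_flip {q : ℕ} (hq : q < N) (f : Str → ℝ) :
    ∑ γ ∈ cube N, f (update γ q (!γ q)) = ∑ γ ∈ cube N, f γ :=
  Finset.sum_nbij' (fun γ => update γ q (!γ q)) (fun γ => update γ q (!γ q))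
    (fun γ h => update_mem_cube h hq _) (fun γ h => update_mem_cube h hq _)
    (fun γ _ => by simp) (fun γ _ => by simp) fun γ _ => rfl

theorem norm_add_sq_add_norm_sub_sq (a b : ℂ) :
    ‖(a + b) / (Real.sqrt 2 : ℂ)‖ ^ 2 + ‖(a - b) / (Real.sqrt 2 : ℂ)‖ ^ 2
      = ‖a‖ ^ 2 + ‖b‖ ^ 2 := by
  have h : ‖(Real.sqrt 2 : ℂ)‖ ^ 2 = 2 := by
    rw [Complex.norm_real, Real.norm_eq_abs, sq_abs, Real.sq_sqrt (by norm_num)]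
  rw [norm_div, norm_div, div_pow, div_pow, h]
  have := parallelogram_law_with_norm ℝ a b
  linarith

/-- The strings split into pairs that differ in the bit q. The property is constant on a pair, and
the parallelogram law gives equal mass on each pair before and after. -/
theorem mass_had {q : ℕ} (hq : q < N) (hP : ∀ γ b, P (update γ q b) ↔ P γ) :
    mass N P ((RGate.had q).apply ψ) = mass N P ψ := by
  classical
  -- Doubling the sum lets each string be summed together with its flip, so that no representatives
  -- of the pairs have to be chosen.
  have key : ∀ φ : Str → ℂ, 2 * mass N P φ
      = ∑ γ ∈ cube N, open Classical in
        if P γ then ‖φ γ‖ ^ 2 + ‖φ (update γ q (!γ q))‖ ^ 2 else 0 := by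
    intro φ
    rw [two_mul]
    nth_rw 2 [mass]
    rw [← sum_cube_flip hq, mass, ← Finset.sum_add_distrib]
    refine Finset.sum_congr rfl fun γ _ => ?_
    simp only [hP]
    split_ifs <;> simp
  have h2 : 2 * mass N P ((RGate.had q).apply ψ) = 2 * mass N P ψ := by
    rw [key, key]
    refine Finset.sum_congr rfl fun γ _ => ?_
    split_ifs with h
    · have := norm_add_sq_add_norm_sub_sq (ψ (update γ q false)) (ψ (update γ q true))
      simp only [RGate.apply, update_self, update_idem]
      cases hq : γ q
      · have e : update γ q false = γ := by rw [← hq, update_eq_self]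
        simp only [e] at this ⊢
        simpa [← sub_eq_add_neg] using this
      · have e : update γ q true = γ := by rw [← hq, update_eq_self]
        simp only [e] at this ⊢
        simp [← sub_eq_add_neg] at this ⊢
        linarith
    · rfl
  linarith

/-- If a property does not look at the bits that are changed, each gate acts unitarily on the
strings that have the property. This holds with Hadamard gates present. -/
theorem mass_applyAll {l : List (RGate ℕ)} (hd : ∀ g ∈ l, g.Distinct) (ht : ∀ g ∈ l, g.target < N)
    (hP : ∀ g ∈ l, ∀ γ b, P (update γ g.target b) ↔ P γ) :
    mass N P (applyAll l ψ) = mass N P ψ := by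
  induction l generalizing ψ with
  | nil => rfl
  | cons g l ih =>
    rw [applyAll_cons, ih (fun x hx => hd x (by simp [hx])) (fun x hx => ht x (by simp [hx]))
      (fun x hx => hP x (by simp [hx]))]
    have hg := hP g (by simp)
    have hact : ∀ γ, P (g.act γ) ↔ P γ := by
      intro γ
      cases g <;> first | exact Iff.rfl | exact hg _ _
    have hd' := hd g (by simp)
    have ht' := ht g (by simp)
    by_cases hr : g.Reversible
    · rw [mass_act hr hd' ht']
      exact mass_congr fun γ _ _ => hact γ
    · cases g with
      | had q => exact mass_had ht' hg
      | _ => exact absurd trivial hr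

/-- Reversible gates permute the strings, so measuring afterwards amounts to measuring the
pulled-back property before. -/
theorem mass_applyAll_reversible {l : List (RGate ℕ)} (hr : ∀ g ∈ l, g.Reversible)
    (hd : ∀ g ∈ l, g.Distinct) (ht : ∀ g ∈ l, g.target < N) :
    mass N P (applyAll l ψ) = mass N (fun γ => P (run l γ)) ψ := by
  induction l generalizing ψ P with
  | nil => rfl
  | cons g l ih =>
    rw [applyAll_cons, ih (fun x hx => hr x (by simp [hx])) (fun x hx => hd x (by simp [hx]))
      (fun x hx => ht x (by simp [hx])),
      mass_act (hr _ (by simp)) (hd _ (by simp)) (ht _ (by simp))]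
    rfl

open Classical in
/-- The part of a state on the strings with the property `P`. -/
noncomputable def restrict (P : Str → Prop) (ψ : Str → ℂ) : Str → ℂ :=
  fun γ => if P γ then ψ γ else 0

theorem mass_restrict : mass N P' (restrict P ψ) = mass N (fun γ => P γ ∧ P' γ) ψ := by
  classical
  refine Finset.sum_congr rfl fun γ _ => ?_
  by_cases h : P γ <;> by_cases h' : P' γ <;> simp [h, h', restrict]

/-- A property that ignores all changed bits is a conserved quantity. This permits conditioning on
the accept flag before a round, and gives invariants of the support. -/
theorem applyAll_restrict {l : List (RGate ℕ)}
    (hP : ∀ g ∈ l, ∀ γ b, P (update γ g.target b) ↔ P γ) :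
    applyAll l (restrict P ψ) = restrict P (applyAll l ψ) := by
  classical
  induction l generalizing ψ with
  | nil => rfl
  | cons g l ih =>
    rw [applyAll_cons, applyAll_cons, ← ih fun x hx => hP x (by simp [hx])]
    congr 1
    have hg := hP g (by simp)
    funext γ
    cases g <;> simp only [RGate.apply, RGate.act, restrict, RGate.target] at hg ⊢ <;>
      by_cases h : P γ <;> simp [hg, h]

/-- Properties of the strings with non-zero amplitude that do not depend on the targets persist. -/
theorem applyAll_support {l : List (RGate ℕ)}
    (hP : ∀ g ∈ l, ∀ γ b, P (update γ g.target b) ↔ P γ) (h : ∀ γ, ψ γ ≠ 0 → P γ) :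
    ∀ γ, applyAll l ψ γ ≠ 0 → P γ := by
  intro γ hγ
  have : restrict P ψ = ψ := by
    funext γ
    unfold restrict
    split_ifs with h'
    · rfl
    · by_contra h0
      exact h' (h γ (Ne.symm h0))
  rw [← this, applyAll_restrict hP] at hγ
  by_contra h'
  exact hγ (by simp [restrict, h'])

/-- Hadamard gates on bits that are zero. -/
theorem applyAll_had (l : List ℕ) (hl : l.Nodup) (h : ∀ γ, ψ γ ≠ 0 → ∀ q ∈ l, γ q = false)
    (γ : Str) : applyAll (l.map RGate.had) ψ γ
      = ψ (fun a => if a ∈ l then false else γ a) / (Real.sqrt 2 : ℂ) ^ l.length := by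
  induction l generalizing ψ with
  | nil => simp
  | cons q l ih =>
    rw [List.nodup_cons] at hl
    have hz : ∀ γ, ψ (update γ q true) = 0 := by
      intro γ
      by_contra h0
      simpa using h _ h0 q (by simp)
    have e : (RGate.had q).apply ψ = fun γ => ψ (update γ q false) / (Real.sqrt 2 : ℂ) := by
      funext γ
      simp [RGate.apply, hz]
    rw [List.map_cons, applyAll_cons, ih hl.2]
    · rw [e, List.length_cons, pow_succ', div_div]
      congr 2
      funext a
      by_cases ha : a = q
      · subst ha; simp
      · simp [ha]
    · intro γ hγ q' hq'
      rw [e] at hγ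
      have := h (update γ q false) (fun h0 => hγ (by simp [h0])) q' (by simp [hq'])
      rwa [update_of_ne (by rintro rfl; exact hl.1 hq')] at this

end StackProg

namespace StackProg

open Function Instr

/-! ### The instructions of a round, explicitly -/

/-- Evaluate the Boolean circuit on the inputs at `o`. -/
def evalList (D : StageData) (o : ℕ) : List (Instr ℕ) :=
  (List.range D.recs.length).map fun m =>
    selectType (D.recs.getD m default).1
      (nand (o + (D.recs.getD m default).2.1) (o + (D.recs.getD m default).2.1)
        (o + D.e .n + D.e .pb + m))
      (and (o + (D.recs.getD m default).2.1) (o + (D.recs.getD m default).2.2)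
        (o + D.e .n + D.e .pb + m))
      (or (o + (D.recs.getD m default).2.1) (o + (D.recs.getD m default).2.2)
        (o + D.e .n + D.e .pb + m))

/-- Copy a vertex name. -/
def copyList (D : StageData) (o o' : ℕ) : List (Instr ℕ) :=
  (List.range (D.e .n)).map fun q => copy (o + q) (o' + q)

/-- The instructions of a block. -/
def blockList (D : StageData) (o : ℕ) : List (Instr ℕ) :=
  evalList D o ++ (copyList D o (o + 1 * D.e .M) ++ (evalList D (o + 1 * D.e .M) ++
  (copyList D o (o + 2 * D.e .M) ++ ([one o (o + 2 * D.e .M + D.e .n)] ++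
  (evalList D (o + 2 * D.e .M) ++ ([one o (o + 3 * D.e .M)] ++
  ((List.range D.bits.length).map (fun q => if D.bits.getD q false then
    norr (o + D.e .n + q) (o + 3 * D.e .M + q) (o + 3 * D.e .M + q + 1) else
    nand' (o + D.e .n + q) (o + 3 * D.e .M + q) (o + 3 * D.e .M + q + 1)) ++
  ([one o (o + 4 * D.e .M)] ++
  ((List.range D.outs.length).map (fun q =>
    andn (o + 4 * D.e .M + q) (o + 1 * D.e .M + D.outs.getD q 0) (o + 4 * D.e .M + q + 1)) ++
  ((List.range D.outs.length).map (fun q =>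
    xor (o + 5 * D.e .M + q) (o + 2 * D.e .M + D.outs.getD q 0) (o + 5 * D.e .M + q + 1)) ++
  [nand (o + 4 * D.e .M + D.e .n) (o + 5 * D.e .M + D.e .n) (o + 6 * D.e .M)]))))))))))

/-- The instructions that copy the name of the second vertex. -/
def linkList (D : StageData) : List (Instr ℕ) :=
  (List.range D.outs.length).map fun q => copy (1 * D.e .M + D.outs.getD q 0) (8 * D.e .M + q)

/-- The instructions that compare the blocks. -/
def compareList (D : StageData) : List (Instr ℕ) :=
  (List.range D.outs.length).map (fun q =>
    xor (8 * D.e .M + D.outs.getD q 0) (1 * D.e .M + q) (15 * D.e .M + q)) ++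
  ([one (8 * D.e .M) (16 * D.e .M)] ++
  ((List.range (D.e .n)).map (fun q =>
    andn (16 * D.e .M + q) (15 * D.e .M + q) (16 * D.e .M + q + 1)) ++
  [and (16 * D.e .M + D.e .n) (7 * D.e .M) (17 * D.e .M),
    and (17 * D.e .M) (14 * D.e .M) (17 * D.e .M + 1),
    and (17 * D.e .M + 1) (4 * D.e .M + D.e .pb) (17 * D.e .M + 2),
    and (17 * D.e .M + 2) (11 * D.e .M + D.e .pb) (17 * D.e .M + 3),
    copy (7 * D.e .M) (17 * D.e .M + 4)]))

/-- The instructions of a round between the two groups of Hadamard gates. -/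
def classicalList (D : StageData) : List (Instr ℕ) :=
  blockList D (1 * D.e .M) ++ (linkList D ++ (blockList D (8 * D.e .M) ++ compareList D))

/-- The instructions that load a vertex name from the witness. -/
def loadList (D : StageData) : List (Instr ℕ) :=
  (List.range (D.e .n)).map fun q => swap q (1 * D.e .M + q)

/-- The bits to which Hadamard gates are applied at the beginning. -/
def coinList (D : StageData) : List ℕ :=
  (List.range (D.e .pb)).flatMap (fun q => [1 * D.e .M + D.e .n + q, 8 * D.e .M + D.e .n + q])
    ++ [3]

/-- The controlled swap of the blocks. -/
def swapList (D : StageData) : List (Instr ℕ) :=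
  (List.range (D.e .M)).flatMap fun q => (List.range 7).map fun s =>
    cswap 3 ((1 + s) * D.e .M + q) ((8 + s) * D.e .M + q)

/-- The instructions that compute the accept flag. -/
def flagList (D : StageData) : List (Instr ℕ) :=
  [andn (17 * D.e .M + 3) 3 (17 * D.e .M + 5),
    andn (17 * D.e .M + 4) (17 * D.e .M + 5) (17 * D.e .M + 6)]

/-- All instructions of a round. -/
def roundList (D : StageData) : List (Instr ℕ) :=
  loadList D ++ ((coinList D).map Instr.had ++ (classicalList D ++ (swapList D ++
    ([Instr.had 3] ++ flagList D))))

section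

variable (D : StageData)

theorem instrs_append (l l' : List (Stage (Instr Lin))) :
    instrs D (l ++ l') = instrs D l ++ instrs D l' := by simp [instrs]

theorem instrs_cons (a : Stage (Instr Lin)) (l : List (Stage (Instr Lin))) :
    instrs D (a :: l) = a.den (fun e x => x.map (Lin.val e)) D ++ instrs D l := by simp [instrs]

theorem instrs_nil : instrs D [] = [] := rfl

theorem den_evalStage (o : Lin) (k : ℕ) (ho : ∀ e : Var → ℕ, e .M = D.e .M → o.val e = k) :
    (evalStage o).den (fun e x => x.map (Lin.val e)) D = evalList D k := by
  simp only [evalStage, Stage.den, evalList, List.map_eq_flatMap]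
  refine List.flatMap_congr fun m _ => ?_
  unfold selectType
  split_ifs <;> simp [Instr.map, ho]

theorem den_copyStage (o o' : Lin) (k k' : ℕ) (ho : ∀ e : Var → ℕ, e .M = D.e .M → o.val e = k)
    (ho' : ∀ e : Var → ℕ, e .M = D.e .M → o'.val e = k') :
    (copyStage o o').den (fun e x => x.map (Lin.val e)) D = copyList D k k' := by
  simp only [copyStage, Stage.den, copyList, List.map_eq_flatMap]
  refine List.flatMap_congr fun m _ => ?_
  simp [Instr.map, ho, ho']

theorem instrs_blockStages (c : ℕ) :
    instrs D (blockStages (Lin.seg c)) = blockList D (c * D.e .M) := by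
  have h0 : ∀ e : Var → ℕ, e .M = D.e .M → (Lin.seg c).val e = c * D.e .M := by
    intro e he; simp [he]
  have h : ∀ k, ∀ e : Var → ℕ, e .M = D.e .M →
      (Lin.seg c + Lin.seg k).val e = c * D.e .M + k * D.e .M := by
    intro k e he; simp [he]
  simp only [blockStages, instrs_cons, instrs_nil, den_evalStage D _ _ h0,
    den_evalStage D _ _ (h _), den_copyStage D _ _ _ _ h0 (h _), List.append_nil, blockList]
  congr 5
  · simp [Stage.den, Instr.map]
  congr 1
  congr 1
  · simp [Stage.den, Instr.map]
  congr 1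
  · simp only [Stage.den, List.map_eq_flatMap]
    refine List.flatMap_congr fun m _ => ?_
    split_ifs <;> simp [Instr.map]
  congr 1
  · simp [Stage.den, Instr.map]
  congr 1
  · simp [Stage.den, Instr.map, List.map_eq_flatMap]
  congr 1
  · simp [Stage.den, Instr.map, List.map_eq_flatMap]
  · simp [Stage.den, Instr.map]

theorem instrs_compareStages : instrs D compareStages = compareList D := by
  simp [compareStages, instrs_cons, instrs_nil, Stage.den, Instr.map, List.map_eq_flatMap,
    compareList]

theorem instrs_roundStages : instrs D roundStages = roundList D := by
  simp only [roundStages, classicalStages, instrs_append, instrs_cons, instrs_nil,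
    instrs_blockStages, List.append_nil, roundList, classicalList, List.append_assoc, coinList,
    List.map_append]
  congr 1
  · simp [Stage.den, Instr.map, List.map_eq_flatMap, loadList]
  congr 1
  · simp [Stage.den, Instr.map, List.map_eq_flatMap, List.flatMap_assoc]
  congr 1
  congr 1
  congr 1
  · simp [Stage.den, Instr.map, List.map_eq_flatMap, linkList]
  rw [instrs_compareStages]
  refine congrArg₂ (· ++ ·) rfl (congrArg₂ (· ++ ·) rfl (congrArg₂ (· ++ ·) ?_ ?_))
  · simp [Stage.den, Instr.map, List.map_eq_flatMap, swapList, List.flatMap_assoc]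
  · simp [Stage.den, Instr.map, flagList]

end

/-- The data fit into the layout of a window. -/
structure Fits (D : StageData) : Prop where
  e_le : D.e .n + D.e .pb + D.recs.length + 16 ≤ D.e .M
  bits : D.bits.length = D.e .pb
  recs : ∀ r ∈ D.recs, r.2.1 < D.e .M ∧ r.2.2 < D.e .M
  outs : ∀ k ∈ D.outs, k < D.e .M
  outs_length : D.outs.length + 16 ≤ D.e .M

theorem Fits.getD_recs {D : StageData} (h : Fits D) {m : ℕ} (hm : m < D.recs.length) :
    (D.recs.getD m default).2.1 < D.e .M ∧ (D.recs.getD m default).2.2 < D.e .M := by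
  rw [List.getD_eq_getElem _ _ hm]
  exact h.recs _ (List.getElem_mem _)

theorem Fits.getD_outs {D : StageData} (h : Fits D) {m : ℕ} (hm : m < D.outs.length) :
    D.outs.getD m 0 < D.e .M := by
  rw [List.getD_eq_getElem _ _ hm]
  exact h.outs _ (List.getElem_mem _)

/-- Unary numbers occupy disjoint parts of the input, so even the sum of the name length, the number
of digits of the degree bound and the number of gates is at most the input length. The addition of
16 leaves room for the constants and the flags. Well-formedness of the input plays no role. -/
theorem fits_inputData (x : List Bool) : Fits (inputData x) := by
  have h1 := splitNum_length x
  have h2 := splitNum_length (skipNum x)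
  have h3 := PolyRuns.length_bits_le ((splitNum (skipNum x)).1 - 1)
  have h4 := numGates_le (skipNum (skipNum x))
  have h5 := afterGates_length (skipNum (skipNum x))
  have h6 := numOuts_le (afterGates (skipNum (skipNum x)))
  have h7 := skipNum_length x
  have h8 := skipNum_length (skipNum x)
  have e1 : (splitNum x).2 = skipNum x := rfl
  have e2 : (splitNum (skipNum x)).2 = skipNum (skipNum x) := rfl
  rw [e1] at h1
  rw [e2] at h2
  have hsn : ∀ l : List Bool, (splitNum l).1 ≤ l.length := fun l => by
    have := splitNum_length l; omega
  constructor
  · simp only [inputData, readRecs, List.length_map, List.length_range]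
    omega
  · rfl
  · intro r hr
    simp only [inputData, readRecs, List.mem_map, List.mem_range] at hr
    obtain ⟨m, -, rfl⟩ := hr
    have b0 := iterate_gateRest_length (skipNum (skipNum x)) m
    generalize gateRest^[m] (skipNum (skipNum x)) = l at b0
    have b2 := hsn (skipNum l)
    have b3 := hsn (skipNum (skipNum l))
    have b4 := skipNum_length l
    have b5 := skipNum_length (skipNum l)
    simp only [inputData, gateRec]
    split_ifs <;> omega
  · intro k hk
    simp only [inputData, readNums, List.mem_map, List.mem_range] at hk
    obtain ⟨m, -, rfl⟩ := hk
    have b0 := iterate_skipNum_length (afterGates (skipNum (skipNum x))) m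
    have b1 := hsn (skipNum^[m] (afterGates (skipNum (skipNum x))))
    simp only [inputData]
    omega
  · simp only [inputData, readNums, List.length_map, List.length_range]
    omega

/-- The addresses of an instruction are in the expected ranges. -/
def Instr.Ok (M : ℕ) : Instr ℕ → Prop
  | .bool _ _ _ _ i j t => (3 ≤ i ∧ i < 20 * M) ∧ (3 ≤ j ∧ j < 20 * M) ∧ 3 ≤ t ∧ t < 20 * M
  | .had t => 3 ≤ t ∧ t < 20 * M
  | .swap i t => i < M ∧ 3 ≤ t ∧ t < 20 * M
  | .cswap b i t => (b ≠ i ∧ b ≠ t ∧ i ≠ t) ∧ (3 ≤ b ∧ b < 20 * M) ∧ (3 ≤ i ∧ i < 20 * M) ∧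
      3 ≤ t ∧ t < 20 * M

section

variable {D : StageData}

theorem ok_evalList (h : Fits D) {o : ℕ} (ho : D.e .M ≤ o) (ho' : o ≤ 16 * D.e .M) :
    ∀ x ∈ evalList D o, x.Ok (D.e .M) := by
  intro x hx
  simp only [evalList, List.mem_map, List.mem_range] at hx
  obtain ⟨m, hm, rfl⟩ := hx
  have h1 := h.getD_recs hm
  have h2 := h.e_le
  unfold selectType
  split_ifs <;> simp only [Instr.Ok] <;> omega

theorem ok_blockList (h : Fits D) {o : ℕ} (ho : D.e .M ≤ o) (ho' : o ≤ 8 * D.e .M) :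
    ∀ x ∈ blockList D o, x.Ok (D.e .M) := by
  have h2 := h.e_le
  have h3 := h.outs_length
  have h4 := h.bits
  simp only [blockList, copyList, List.forall_mem_append, List.forall_mem_map, List.mem_range,
    List.mem_singleton, forall_eq]
  refine ⟨ok_evalList h ho (by omega), fun q hq => ?_, ok_evalList h (by omega) (by omega),
    fun q hq => ?_, ?_, ok_evalList h (by omega) (by omega), ?_, fun q hq => ?_, ?_,
    fun q hq => ?_, fun q hq => ?_, ?_⟩
  case refine_5 => split_ifs <;> simp only [Instr.Ok] <;> omega
  case refine_7 =>
    have := h.getD_outs hq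
    simp only [Instr.Ok]; omega
  case refine_8 =>
    have := h.getD_outs hq
    simp only [Instr.Ok]; omega
  all_goals simp only [Instr.Ok]; omega

theorem ok_classicalList (h : Fits D) : ∀ x ∈ classicalList D, x.Ok (D.e .M) := by
  have h2 := h.e_le
  have h3 := h.outs_length
  simp only [classicalList, linkList, compareList, List.forall_mem_append, List.forall_mem_map,
    List.mem_range, List.mem_singleton, forall_eq, List.forall_mem_cons]
  refine ⟨ok_blockList h (by omega) (by omega), fun q hq => ?_,
    ok_blockList h (by omega) (by omega), fun q hq => ?_, ?_, fun q hq => ?_, ?_⟩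
  · have := h.getD_outs hq
    simp only [Instr.Ok]; omega
  · have := h.getD_outs hq
    simp only [Instr.Ok]; omega
  · simp only [Instr.Ok]; omega
  · simp only [Instr.Ok]; omega
  · simp only [Instr.Ok]; omega

theorem ok_roundList (h : Fits D) : ∀ x ∈ roundList D, x.Ok (D.e .M) := by
  have h2 := h.e_le
  simp only [roundList, loadList, coinList, swapList, flagList, List.forall_mem_append,
    List.forall_mem_map, List.mem_range, List.mem_singleton, forall_eq, List.forall_mem_cons,
    List.map_append, List.map_flatMap, List.forall_mem_flatMap, List.map_cons, List.map_nil]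
  refine ⟨fun q hq => ?_, ⟨fun q hq => ?_, ?_⟩, ok_classicalList h, fun q hq s hs => ?_, ?_, ?_⟩
  case refine_4 => interval_cases s <;> simp only [Instr.Ok] <;> omega
  all_goals simp only [Instr.Ok]; omega

end

end StackProg

namespace StackProg

open Function

/-! ### The verifier -/

/-- The gate is a gate on `N` qubits. -/
def RGate.Valid (N : ℕ) (g : RGate ℕ) : Prop := g.Distinct ∧ ∀ a ∈ g.args, a < N

theorem RGate.Valid.target_lt {N : ℕ} {g : RGate ℕ} (h : g.Valid N) : g.target < N :=
  h.2 _ g.target_mem_args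

/-- The gate as a gate on `N` qubits. -/
def RGate.toQ {N : ℕ} : (g : RGate ℕ) → g.Valid N → QGate N
  | had t, h => .hadamard ⟨t, h.2 t (by simp [args])⟩
  | not t, h => .not ⟨t, h.2 t (by simp [args])⟩
  | cnot c t, h => .cnot ⟨c, h.2 c (by simp [args])⟩ ⟨t, h.2 t (by simp [args])⟩ fun e => by
      have h' := h.1
      simp only [Fin.mk.injEq] at e
      simp [Distinct, args, e] at h'
  | tof c d t, h => .toffoli ⟨c, h.2 c (by simp [args])⟩ ⟨d, h.2 d (by simp [args])⟩
      ⟨t, h.2 t (by simp [args])⟩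
      (fun e => by
        have h' := h.1
        simp only [Fin.mk.injEq] at e
        simp [Distinct, args, e] at h')
      (fun e => by
        have h' := h.1
        simp only [Fin.mk.injEq] at e
        simp [Distinct, args, e] at h')
      (fun e => by
        have h' := h.1
        simp only [Fin.mk.injEq] at e
        simp [Distinct, args, e] at h')

theorem RGate.toQ_tokens {N : ℕ} (g : RGate ℕ) (h : g.Valid N) : (g.toQ h).tokens = g.tokens := by
  cases g <;> rfl

theorem extend_update {N q : ℕ} (hq : q < N) (b : Fin N → Bool) (v : Bool) :
    extend N (update b ⟨q, hq⟩ v) = update (extend N b) q v := by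
  funext a
  by_cases h : a = q
  · subst h; simp [extend, hq]
  · rw [update_of_ne h]
    unfold extend
    split_ifs with ha
    · rw [update_of_ne (by simpa using h)]
    · rfl

theorem extend_apply {N q : ℕ} (hq : q < N) (b : Fin N → Bool) : extend N b q = b ⟨q, hq⟩ := by
  simp [extend, hq]

/-- Amplitudes on N qubits are amplitudes on infinite strings restricted along `extend N`, and a
gate on addresses below N respects this restriction. -/
theorem RGate.toQ_apply {N : ℕ} (g : RGate ℕ) (h : g.Valid N) (ψ : Str → ℂ) :
    QGate.apply (fun b => ψ (extend N b)) (g.toQ h) = fun b => g.apply ψ (extend N b) := by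
  have ha := h.2
  funext b
  cases g <;> simp [args] at ha <;> simp [toQ, QGate.apply, apply, act, extend_update, extend_apply, ha]

/-- A list of gates as a list of gates on `N` qubits. -/
def toQList {N : ℕ} (l : List (RGate ℕ)) (h : ∀ g ∈ l, g.Valid N) : List (QGate N) :=
  l.pmap RGate.toQ h

theorem toQList_tokens {N : ℕ} (l : List (RGate ℕ)) (h : ∀ g ∈ l, g.Valid N) :
    (toQList l h).flatMap QGate.tokens = l.flatMap RGate.tokens := by
  induction l with
  | nil => rfl
  | cons g l ih =>
    have := ih fun x hx => h x (by simp [hx])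
    simp only [toQList, List.pmap_cons, List.flatMap_cons, RGate.toQ_tokens] at this ⊢
    rw [this]

theorem toQList_apply {N : ℕ} (l : List (RGate ℕ)) (h : ∀ g ∈ l, g.Valid N) (ψ : Str → ℂ) :
    (toQList l h).foldl QGate.apply (fun b => ψ (extend N b))
      = fun b => applyAll l ψ (extend N b) := by
  induction l generalizing ψ with
  | nil => rfl
  | cons g l ih =>
    have := ih (fun x hx => h x (by simp [hx])) (g.apply ψ)
    simp only [toQList, List.pmap_cons, List.foldl_cons, RGate.toQ_apply] at this ⊢
    rw [this]
    rfl

/-- The gates of instructions in the window with the base `B`. -/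
def gatesAt (B : ℕ) (l : List (Instr ℕ)) : List (RGate ℕ) :=
  (gatesOf l).map (RGate.map (Addr.abs B))

theorem gatesAt_append (B : ℕ) (l l' : List (Instr ℕ)) :
    gatesAt B (l ++ l') = gatesAt B l ++ gatesAt B l' := by simp [gatesAt, gatesOf]

theorem gatesAt_cons (B : ℕ) (x : Instr ℕ) (l : List (Instr ℕ)) :
    gatesAt B (x :: l) = gatesAt B [x] ++ gatesAt B l := by simp [gatesAt, gatesOf]

@[simp] theorem gatesAt_nil (B : ℕ) : gatesAt B [] = [] := rfl

/-- The gate that updates the accept flag in the window with the base `B`. -/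
def flagGateAt (D : StageData) (B : ℕ) : RGate ℕ :=
  .tof (B + (17 * D.e .M + 6)) B (B + 20 * D.e .M)

/-- The gates of the round in the window with the base `B`. -/
def roundAt (D : StageData) (B : ℕ) : List (RGate ℕ) :=
  gatesAt B (roundList D) ++ [flagGateAt D B] ++ (gatesAt B (roundList D)).reverse

/-- The gates of `R` rounds. -/
def roundsAt (D : StageData) (R : ℕ) : List (RGate ℕ) :=
  .not (D.e .M) :: (List.range R).flatMap fun k => roundAt D (D.e .M + k * (20 * D.e .M))

/-- The gate is applied to witness bits and to inner bits of the window. -/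
def RGate.Inside (M B : ℕ) (g : RGate ℕ) : Prop :=
  g.Distinct ∧ ∀ a ∈ g.args, a < M ∨ B < a ∧ a < B + 20 * M

/-- Boolean instructions first copy their operands to the scratch bits 1 and 2, which lie below all
operands and targets. The qubits of each gate are thus distinct even if two operands coincide or,
for a malformed circuit, an operand coincides with the target. -/
theorem inside_gatesAt {M B : ℕ} (hM : 16 ≤ M) (hB : M ≤ B) {l : List (Instr ℕ)}
    (hl : ∀ x ∈ l, x.Ok M) : ∀ g ∈ gatesAt B l, g.Inside M B := by
  intro g hg
  simp only [gatesAt, gatesOf, List.mem_map, List.mem_flatMap] at hg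
  obtain ⟨a, ⟨x, hx, ha⟩, rfl⟩ := hg
  have hx := hl x hx
  cases x with
  | bool c₀ c₁ c₂ c₃ i j t =>
    simp only [Instr.Ok] at hx
    simp only [Instr.gates, List.mem_append, List.mem_cons, List.not_mem_nil, or_false,
      List.mem_ite_nil_right] at ha
    rcases ha with ((((((rfl | rfl) | ⟨-, rfl⟩) | ⟨-, rfl⟩) | ⟨-, rfl⟩) | ⟨-, rfl⟩) | rfl | rfl) <;>
      simp [RGate.Inside, RGate.Distinct, RGate.args, RGate.map, Addr.abs] <;> omega
  | had t =>
    simp only [Instr.Ok] at hx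
    simp only [Instr.gates, List.mem_singleton] at ha
    subst ha
    simp [RGate.Inside, RGate.Distinct, RGate.args, RGate.map, Addr.abs]; omega
  | swap i t =>
    simp only [Instr.Ok] at hx
    simp only [Instr.gates, List.mem_cons, List.not_mem_nil, or_false] at ha
    rcases ha with rfl | rfl | rfl <;>
      simp [RGate.Inside, RGate.Distinct, RGate.args, RGate.map, Addr.abs] <;> omega
  | cswap b i t =>
    simp only [Instr.Ok] at hx
    simp only [Instr.gates, List.mem_cons, List.not_mem_nil, or_false] at ha
    rcases ha with rfl | rfl | rfl <;>
      simp [RGate.Inside, RGate.Distinct, RGate.args, RGate.map, Addr.abs] <;> omega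

theorem RGate.Inside.valid {M B N : ℕ} {g : RGate ℕ} (h : g.Inside M B)
    (hB : B + 20 * M ≤ N) : g.Valid N :=
  ⟨h.1, fun a ha => by rcases h.2 a ha with h | h <;> omega⟩

/-- The number of qubits. -/
def numQubits (M R : ℕ) : ℕ := M + (R * (20 * M) + 1)

theorem window_le {M R k : ℕ} (hk : k < R) : M + k * (20 * M) + 20 * M < numQubits M R := by
  have : (k + 1) * (20 * M) ≤ R * (20 * M) := Nat.mul_le_mul_right _ hk
  rw [add_mul, one_mul] at this
  unfold numQubits
  omega

theorem valid_roundAt {D : StageData} (hD : Fits D) {B N : ℕ} (hB : D.e .M ≤ B)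
    (hN : B + 20 * D.e .M < N) : ∀ g ∈ roundAt D B, g.Valid N := by
  have h16 : 16 ≤ D.e .M := by have := hD.e_le; omega
  have key : ∀ g ∈ gatesAt B (roundList D), g.Valid N := fun g hg =>
    (inside_gatesAt h16 hB (ok_roundList hD) g hg).valid (by omega)
  intro g hg
  simp only [roundAt, List.mem_append, List.mem_reverse, List.mem_singleton] at hg
  rcases hg with (hg | rfl) | hg
  · exact key g hg
  · constructor
    · simp [flagGateAt, RGate.Distinct, RGate.args]; omega
    · simp [flagGateAt, RGate.args]; omega
  · exact key g hg

theorem valid_roundsAt {D : StageData} (hD : Fits D) (R : ℕ) :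
    ∀ g ∈ roundsAt D R, g.Valid (numQubits (D.e .M) R) := by
  intro g hg
  simp only [roundsAt, List.mem_cons, List.mem_flatMap, List.mem_range] at hg
  rcases hg with rfl | ⟨k, hk, hg⟩
  · simp [RGate.Valid, RGate.Distinct, RGate.args, numQubits]
  · exact valid_roundAt hD (by omega) (window_le hk) g hg

/-- The verifier with `R` rounds. -/
def verifier (D : StageData) (hD : Fits D) (R : ℕ) : QVerifier where
  witness := D.e .M
  ancilla := R * (20 * D.e .M) + 1
  output := ⟨D.e .M + R * (20 * D.e .M), by omega⟩
  gates := toQList (roundsAt D R) (valid_roundsAt hD R)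

theorem windowText_roundGates (D : StageData) (B : ℕ) :
    windowText B (roundGates D) = unaryEncode ((roundAt D B).flatMap RGate.tokens) := by
  rw [windowText, roundGates, instrs_roundStages]
  congr 1
  have : RGate.map (Addr.abs B) (flagGate.val D.e) = flagGateAt D B := by
    simp [flagGate, SGate.val, RGate.map, flagGateAt, Addr.abs]
  simp [roundAt, gatesAt, List.flatMap_append, List.flatMap_map, this, ← List.map_reverse]

theorem encode_verifier (D : StageData) (hD : Fits D) (R : ℕ) :
    (verifier D hD R).encode = verifierText D R := by
  have e : (verifier D hD R).gates.flatMap QGate.tokens = (roundsAt D R).flatMap RGate.tokens :=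
    toQList_tokens _ _
  rw [QVerifier.encode, e, roundsAt]
  simp only [verifier, verifierText, roundsText, windowText_roundGates, unaryEncode_append]
  simp only [List.flatMap_cons, unaryEncode, List.flatMap_append, List.flatMap_assoc]
  rfl

end StackProg

namespace StackProg

open Function

/-! ### Instructions that add a Boolean function to a bit -/

namespace Instr

variable {α : Type}

/-- The instruction adds a Boolean function of two bits to a third bit. -/
def IsBool : Instr α → Prop
  | bool _ _ _ _ _ _ _ => True
  | _ => False

/-- The first bit that is read. -/
def src₁ : Instr α → α
  | bool _ _ _ _ i _ _ => i
  | had t => t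
  | swap i _ => i
  | cswap _ i _ => i

/-- The second bit that is read. -/
def src₂ : Instr α → α
  | bool _ _ _ _ _ j _ => j
  | had t => t
  | swap i _ => i
  | cswap _ i _ => i

/-- The bit that is changed. -/
def tgt : Instr α → α
  | bool _ _ _ _ _ _ t => t
  | had t => t
  | swap _ t => t
  | cswap _ _ t => t

/-- The Boolean function. -/
def result (T : α → Bool) : Instr α → Bool
  | bool c₀ c₁ c₂ c₃ i j _ =>
      Bool.xor (Bool.xor (Bool.xor c₀ (c₁ && T i)) (c₂ && T j)) (c₃ && (T i && T j))
  | _ => false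

theorem result_congr {T T' : α → Bool} (x : Instr α) (h₁ : T x.src₁ = T' x.src₁)
    (h₂ : T x.src₂ = T' x.src₂) : x.result T = x.result T' := by
  cases x <;> simp_all [result, src₁, src₂]

end Instr

/-- The operands are copied to two zero bits, the four terms of the polynomial over 𝔽₂ are added to
the target, and the copies are undone. The last part works because the target is not an operand, so
the operands are unchanged. -/
theorem run_scratch (c₀ c₁ c₂ c₃ : Bool) {i j t p q : ℕ} (γ : Str) (hp : γ p = false)
    (hq : γ q = false) (h1 : p ≠ q) (h2 : i ≠ p ∧ i ≠ q ∧ i ≠ t) (h3 : j ≠ p ∧ j ≠ q ∧ j ≠ t)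
    (h4 : t ≠ p ∧ t ≠ q) :
    run ([.cnot i p, .cnot j q] ++ (if c₀ then [.not t] else []) ++ (if c₁ then [.cnot p t] else [])
        ++ (if c₂ then [.cnot q t] else []) ++ (if c₃ then [.tof p q t] else [])
        ++ [.cnot j q, .cnot i p]) γ
      = update γ t (Bool.xor (γ t) (Bool.xor (Bool.xor (Bool.xor c₀ (c₁ && γ i)) (c₂ && γ j))
        (c₃ && (γ i && γ j)))) := by
  obtain ⟨a1, a2, a3⟩ := h2
  obtain ⟨b1, b2, b3⟩ := h3
  obtain ⟨d1, d2⟩ := h4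
  set γ' := update (update γ p (γ i)) q (γ j) with hγ'
  have e1 : ∀ v, run [.cnot j q, .cnot i p] (update γ' t v) = update γ t v := by
    intro v
    funext a
    simp only [run_cons, run_nil, RGate.act, hγ']
    by_cases ht : a = t
    · subst ht; simp [d1, d2]
    · by_cases hap : a = p
      · subst hap; simp [*, Ne.symm]
      · by_cases haq : a = q
        · subst haq; simp [*, Ne.symm]
        · simp [*]
  have e0 : run [.cnot i p, .cnot j q] γ = γ' := by
    simp [RGate.act, hp, hq, h1.symm, hγ', b1]
  have m0 : γ' t = γ t := by simp [hγ', d1, d2]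
  have mp : γ' p = γ i := by simp [hγ', h1]
  have mq : γ' q = γ j := by simp [hγ']
  have key : run ((if c₀ then [.not t] else []) ++ (if c₁ then [.cnot p t] else [])
        ++ (if c₂ then [.cnot q t] else []) ++ (if c₃ then [.tof p q t] else [])) γ'
      = update γ' t (Bool.xor (γ t) (Bool.xor (Bool.xor (Bool.xor c₀ (c₁ && γ i)) (c₂ && γ j))
        (c₃ && (γ i && γ j)))) := by
    cases c₀ <;> cases c₁ <;> cases c₂ <;> cases c₃ <;>
      simp [RGate.act, m0, mp, mq, d1.symm, d2.symm]
    all_goals first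
      | rw [← m0, update_eq_self]
      | (congr 1; generalize γ t = x; generalize γ i = y; generalize γ j = z; revert x y z; decide)
  simp only [List.append_assoc] at key ⊢
  rw [run_append, e0]
  simp only [← List.append_assoc] at key ⊢
  rw [run_append, key, e1]

theorem run_gatesAt_bool (B : ℕ) {x : Instr ℕ} (hx : x.IsBool) (h1 : 3 ≤ x.src₁) (h2 : 3 ≤ x.src₂)
    (h3 : 3 ≤ x.tgt) (h4 : x.src₁ ≠ x.tgt) (h5 : x.src₂ ≠ x.tgt) (γ : Str)
    (hs₁ : γ (B + 1) = false) (hs₂ : γ (B + 2) = false) :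
    run (gatesAt B [x]) γ
      = update γ (B + x.tgt) (Bool.xor (γ (B + x.tgt)) (x.result fun a => γ (B + a))) := by
  cases x with
  | bool c₀ c₁ c₂ c₃ i j t =>
    simp only [Instr.src₁, Instr.src₂, Instr.tgt] at h1 h2 h3 h4 h5
    have := run_scratch c₀ c₁ c₂ c₃ (i := B + i) (j := B + j) (t := B + t) γ hs₁ hs₂ (by omega)
      (by omega) (by omega) (by omega)
    rw [Instr.tgt, Instr.result, ← this]
    congr 1
    cases c₀ <;> cases c₁ <;> cases c₂ <;> cases c₃ <;> rfl
  | _ => exact hx.elim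

/-- The instructions add Boolean functions to increasing bits between `lo` and `hi`, and each reads
only lower bits. -/
structure Increasing (lo hi : ℕ) (l : List (Instr ℕ)) : Prop where
  bound : ∀ x ∈ l, x.IsBool ∧ (3 ≤ x.src₁ ∧ x.src₁ < x.tgt) ∧ (3 ≤ x.src₂ ∧ x.src₂ < x.tgt) ∧
    lo ≤ x.tgt ∧ x.tgt < hi
  pairwise : l.Pairwise fun x y => x.tgt < y.tgt

theorem Increasing.append {a b c d : ℕ} {l l' : List (Instr ℕ)} (h : Increasing a b l)
    (h' : Increasing c d l') (hab : a ≤ b) (hbc : b ≤ c) (hcd : c ≤ d) :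
    Increasing a d (l ++ l') := by
  refine ⟨fun x hx => ?_, List.pairwise_append.2 ⟨h.pairwise, h'.pairwise, fun x hx y hy => ?_⟩⟩
  · rcases List.mem_append.1 hx with hx | hx
    · have := h.bound x hx
      exact ⟨this.1, this.2.1, this.2.2.1, by omega, by omega⟩
    · have := h'.bound x hx
      exact ⟨this.1, this.2.1, this.2.2.1, by omega, by omega⟩
  · have h1 := h.bound x hx
    have h2 := h'.bound y hy
    omega

theorem Increasing.map_range {c k : ℕ} {f : ℕ → Instr ℕ}
    (h : ∀ m < k, (f m).IsBool ∧ (3 ≤ (f m).src₁ ∧ (f m).src₁ < c + m) ∧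
      (3 ≤ (f m).src₂ ∧ (f m).src₂ < c + m) ∧ (f m).tgt = c + m) :
    Increasing c (c + k) ((List.range k).map f) := by
  constructor
  · simp only [List.mem_map, List.mem_range, forall_exists_index, and_imp,
      forall_apply_eq_imp_iff₂]
    intro m hm
    obtain ⟨h1, h2, h3, h4⟩ := h m hm
    rw [h4]
    exact ⟨h1, h2, h3, by omega, by omega⟩
  · rw [List.pairwise_map]
    refine List.pairwise_lt_range.imp_of_mem ?_
    intro a b ha hb hab
    rw [(h a (List.mem_range.1 ha)).2.2.2, (h b (List.mem_range.1 hb)).2.2.2]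
    omega

theorem Increasing.singleton {c : ℕ} {x : Instr ℕ} (h : x.IsBool ∧ (3 ≤ x.src₁ ∧ x.src₁ < c) ∧
    (3 ≤ x.src₂ ∧ x.src₂ < c) ∧ x.tgt = c) : Increasing c (c + 1) [x] := by
  obtain ⟨h1, h2, h3, rfl⟩ := h
  exact ⟨by simp [h1, h2, h3], by simp⟩

theorem Increasing.mono {a b c d : ℕ} {l : List (Instr ℕ)} (h : Increasing a b l) (hca : c ≤ a)
    (hbd : b ≤ d) : Increasing c d l :=
  ⟨fun x hx => by
    have := h.bound x hx
    exact ⟨this.1, this.2.1, this.2.2.1, by omega, by omega⟩, h.pairwise⟩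

theorem Increasing.tail {a b : ℕ} {x : Instr ℕ} {l : List (Instr ℕ)}
    (h : Increasing a b (x :: l)) : Increasing a b l :=
  ⟨fun y hy => h.bound y (by simp [hy]), h.pairwise.of_cons⟩

/-- The equations that hold after a list of instructions has been executed on bits that are zero. -/
def Solves (B : ℕ) (l : List (Instr ℕ)) (T : Str) : Prop :=
  ∀ x ∈ l, T (B + x.tgt) = x.result fun a => T (B + a)

section

variable {B lo hi : ℕ} {l : List (Instr ℕ)} {γ T : Str}

theorem Increasing.run_cons {x : Instr ℕ} (h : Increasing lo hi (x :: l))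
    (hs₁ : γ (B + 1) = false) (hs₂ : γ (B + 2) = false)
    (hz : ∀ y ∈ x :: l, γ (B + y.tgt) = false) :
    run (gatesAt B (x :: l)) γ
        = run (gatesAt B l) (update γ (B + x.tgt) (x.result fun a => γ (B + a))) ∧
      update γ (B + x.tgt) (x.result fun a => γ (B + a)) (B + 1) = false ∧
      update γ (B + x.tgt) (x.result fun a => γ (B + a)) (B + 2) = false ∧
      ∀ y ∈ l, update γ (B + x.tgt) (x.result fun a => γ (B + a)) (B + y.tgt) = false := by
  have hx := h.bound x (by simp)
  refine ⟨?_, ?_, ?_, fun y hy => ?_⟩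
  · rw [gatesAt_cons, run_append, run_gatesAt_bool B hx.1 hx.2.1.1 hx.2.2.1.1 (by omega) (by omega)
      (by omega) γ hs₁ hs₂, hz x (by simp), Bool.false_xor]
  · rw [update_of_ne (by omega)]; exact hs₁
  · rw [update_of_ne (by omega)]; exact hs₂
  · have := List.rel_of_pairwise_cons h.pairwise hy
    rw [update_of_ne (by omega)]
    exact hz y (by simp [hy])

/-- The result of the instructions on a string is determined by the equations. -/
theorem Increasing.run_eq (h : Increasing lo hi l) (hs₁ : γ (B + 1) = false)
    (hs₂ : γ (B + 2) = false) (hz : ∀ x ∈ l, γ (B + x.tgt) = false) (hT : Solves B l T)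
    (hag : ∀ a, (∀ x ∈ l, a ≠ B + x.tgt) → T a = γ a) : run (gatesAt B l) γ = T := by
  induction l generalizing γ with
  | nil =>
    funext a
    simp [hag a]
  | cons x l ih =>
    obtain ⟨h1, h2, h3, h4⟩ := h.run_cons hs₁ hs₂ hz
    have hx := h.bound x (by simp)
    have hr : (x.result fun a => γ (B + a)) = T (B + x.tgt) := by
      rw [hT x (by simp)]
      refine x.result_congr ?_ ?_
      · refine (hag _ fun y hy => ?_).symm
        rcases List.mem_cons.1 hy with rfl | hy
        · omega
        · have := List.rel_of_pairwise_cons h.pairwise hy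
          omega
      · refine (hag _ fun y hy => ?_).symm
        rcases List.mem_cons.1 hy with rfl | hy
        · omega
        · have := List.rel_of_pairwise_cons h.pairwise hy
          omega
    rw [h1]
    refine ih h.tail h2 h3 h4 (fun y hy => hT y (by simp [hy])) fun a ha => ?_
    by_cases hax : a = B + x.tgt
    · subst hax; rw [update_self, hr]
    · rw [update_of_ne hax]
      exact hag a fun y hy => by
        rcases List.mem_cons.1 hy with rfl | hy
        · exact hax
        · exact ha y hy

theorem Increasing.run_of_forall_ne (h : Increasing lo hi l) (hs₁ : γ (B + 1) = false)
    (hs₂ : γ (B + 2) = false) (hz : ∀ x ∈ l, γ (B + x.tgt) = false) {a : ℕ}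
    (ha : ∀ x ∈ l, a ≠ B + x.tgt) : run (gatesAt B l) γ a = γ a := by
  induction l generalizing γ with
  | nil => rfl
  | cons x l ih =>
    obtain ⟨h1, h2, h3, h4⟩ := h.run_cons hs₁ hs₂ hz
    rw [h1, ih h.tail h2 h3 h4 fun y hy => ha y (by simp [hy]), update_of_ne (ha x (by simp))]

/-- An equation involves only its target and lower bits, and the later instructions change only
higher bits, so an equation that holds once remains true. -/
theorem Increasing.solves_run (h : Increasing lo hi l) (hs₁ : γ (B + 1) = false)
    (hs₂ : γ (B + 2) = false) (hz : ∀ x ∈ l, γ (B + x.tgt) = false) :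
    Solves B l (run (gatesAt B l) γ) := by
  induction l generalizing γ with
  | nil => simp [Solves]
  | cons x l ih =>
    obtain ⟨h1, h2, h3, h4⟩ := h.run_cons hs₁ hs₂ hz
    have hx := h.bound x (by simp)
    have hlt : ∀ y ∈ l, x.tgt < y.tgt := fun y hy => List.rel_of_pairwise_cons h.pairwise hy
    rw [h1]
    intro y hy
    rcases List.mem_cons.1 hy with rfl | hy
    · rw [h.tail.run_of_forall_ne h2 h3 h4 fun z hz => by have := hlt z hz; omega, update_self]
      refine y.result_congr ?_ ?_
      · rw [h.tail.run_of_forall_ne h2 h3 h4 fun z hz => by have := hlt z hz; omega,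
          update_of_ne (by omega)]
      · rw [h.tail.run_of_forall_ne h2 h3 h4 fun z hz => by have := hlt z hz; omega,
          update_of_ne (by omega)]
    · exact ih h.tail h2 h3 h4 y hy

end

section

variable {D : StageData}

theorem increasing_evalList (h : Fits D) {o : ℕ} (ho : D.e .M ≤ o)
    (hr : ∀ m < D.recs.length, (D.recs.getD m default).2.1 < D.e .n + D.e .pb + m ∧
      (D.recs.getD m default).2.2 < D.e .n + D.e .pb + m) :
    Increasing (o + D.e .n + D.e .pb) (o + D.e .M) (evalList D o) := by
  have h2 := h.e_le
  refine Increasing.mono (a := o + D.e .n + D.e .pb) (b := o + D.e .n + D.e .pb + D.recs.length)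
    (Increasing.map_range fun m hm => ?_) le_rfl (by omega)
  have := hr m hm
  unfold selectType
  split_ifs <;> simp only [Instr.IsBool, Instr.src₁, Instr.src₂, Instr.tgt, true_and, and_true] <;> omega

theorem increasing_blockList (h : Fits D) (hp : 1 ≤ D.e .pb) {o : ℕ}
    (ho : D.e .M ≤ o)
    (hr : ∀ m < D.recs.length, (D.recs.getD m default).2.1 < D.e .n + D.e .pb + m ∧
      (D.recs.getD m default).2.2 < D.e .n + D.e .pb + m) :
    Increasing (o + D.e .n + D.e .pb) (o + 7 * D.e .M) (blockList D o) := by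
  have h2 := h.e_le
  have h3 := h.outs_length
  have h4 := h.bits
  refine (increasing_evalList h ho hr).append (Increasing.append (b := o + 1 * D.e .M + D.e .n)
    (Increasing.map_range fun q hq => ?_) ((increasing_evalList h (by omega) hr).append
    (Increasing.append (b := o + 2 * D.e .M + D.e .n) (Increasing.map_range fun q hq => ?_)
    ((Increasing.singleton (c := o + 2 * D.e .M + D.e .n) ?_).append
    ((increasing_evalList h (by omega) hr).append
    ((Increasing.singleton (c := o + 3 * D.e .M) ?_).append (Increasing.append (c := o + 4 * D.e .M)
    (Increasing.map_range (c := o + 3 * D.e .M + 1) fun q hq => ?_)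
    ((Increasing.singleton (c := o + 4 * D.e .M) ?_).append (Increasing.append (c := o + 5 * D.e .M + 1)
    (Increasing.map_range (c := o + 4 * D.e .M + 1) fun q hq => ?_)
    (Increasing.append (c := o + 6 * D.e .M)
    (Increasing.map_range (c := o + 5 * D.e .M + 1) fun q hq => ?_)
    ((Increasing.singleton (c := o + 6 * D.e .M) ?_).mono (d := o + 7 * D.e .M) le_rfl (by omega))
    ?_ ?_ ?_) ?_ ?_ ?_) ?_ ?_ ?_) ?_ ?_ ?_) ?_ ?_ ?_) ?_ ?_ ?_) ?_ ?_ ?_) ?_ ?_ ?_) ?_ ?_ ?_)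
    ?_ ?_ ?_) ?_ ?_ ?_
  case refine_5 =>
    split_ifs <;> simp only [Instr.IsBool, Instr.src₁, Instr.src₂, Instr.tgt, true_and] <;> omega
  case refine_7 =>
    have := h.getD_outs hq
    simp only [Instr.IsBool, Instr.src₁, Instr.src₂, Instr.tgt, true_and]; omega
  case refine_8 =>
    have := h.getD_outs hq
    simp only [Instr.IsBool, Instr.src₁, Instr.src₂, Instr.tgt, true_and]; omega
  all_goals try simp only [Instr.IsBool, Instr.src₁, Instr.src₂, Instr.tgt, true_and, and_true]
  all_goals omega

theorem increasing_classicalList (h : Fits D) (hp : 1 ≤ D.e .pb)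
    (hn : D.outs.length = D.e .n)
    (hr : ∀ m < D.recs.length, (D.recs.getD m default).2.1 < D.e .n + D.e .pb + m ∧
      (D.recs.getD m default).2.2 < D.e .n + D.e .pb + m) :
    Increasing (1 * D.e .M + D.e .n + D.e .pb) (17 * D.e .M + 5) (classicalList D) := by
  have h2 := h.e_le
  have h3 := h.outs_length
  refine (increasing_blockList h hp (by omega) hr).append (Increasing.append (c := 8 * D.e .M + D.e .n
    + D.e .pb) (Increasing.map_range (c := 8 * D.e .M) fun q hq => ?_)
    ((increasing_blockList h hp (by omega) hr).append (Increasing.append (c := 16 * D.e .M)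
    (Increasing.map_range (c := 15 * D.e .M) fun q hq => ?_) 
    ((Increasing.singleton (c := 16 * D.e .M) ?_).append
    (Increasing.append (c := 17 * D.e .M)
    (Increasing.map_range (c := 16 * D.e .M + 1) fun q hq => ?_) ⟨?_, ?_⟩
    ?_ ?_ ?_) ?_ ?_ ?_) ?_ ?_ ?_) ?_ ?_ ?_) ?_ ?_ ?_) ?_ ?_ ?_
  case refine_1 =>
    have := h.getD_outs hq
    simp only [Instr.IsBool, Instr.src₁, Instr.src₂, Instr.tgt, true_and, and_true]; omega
  case refine_2 =>
    have := h.getD_outs hq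
    simp only [Instr.IsBool, Instr.src₁, Instr.src₂, Instr.tgt, true_and, and_true]; omega
  case refine_5 =>
    simp only [List.forall_mem_cons, Instr.IsBool, Instr.src₁, Instr.src₂, Instr.tgt, true_and]
    refine ⟨?_, ?_, ?_, ?_, ?_, by simp⟩ <;> omega
  case refine_6 => simp [Instr.tgt]
  all_goals try simp only [Instr.IsBool, Instr.src₁, Instr.src₂, Instr.tgt, true_and, and_true]
  all_goals omega

end

end StackProg

namespace StackProg

open Function

/-! ### The equations of a block -/

/-- The equations of the evaluation of the Boolean circuit. -/
def EvalEqs (D : StageData) (s : Str) : Prop :=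
  ∀ m < D.recs.length, s (D.e .n + D.e .pb + m) = selectType (D.recs.getD m default).1
    (!s (D.recs.getD m default).2.1)
    (s (D.recs.getD m default).2.1 && s (D.recs.getD m default).2.2)
    (s (D.recs.getD m default).2.1 || s (D.recs.getD m default).2.2)

/-- The equations of a block, with addresses relative to the block. -/
structure BlockEqs (D : StageData) (s : Str) : Prop where
  eval : EvalEqs D s
  copy₁ : ∀ q < D.e .n, s (1 * D.e .M + q) = s q
  eval₁ : EvalEqs D fun a => s (1 * D.e .M + a)
  copy₂ : ∀ q < D.e .n, s (2 * D.e .M + q) = s q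
  one₂ : s (2 * D.e .M + D.e .n) = true
  eval₂ : EvalEqs D fun a => s (2 * D.e .M + a)
  le_zero : s (3 * D.e .M) = true
  le_succ : ∀ q < D.bits.length, s (3 * D.e .M + (q + 1)) = if D.bits.getD q false then
    (!s (D.e .n + q) || s (3 * D.e .M + q)) else (!s (D.e .n + q) && s (3 * D.e .M + q))
  null_zero : s (4 * D.e .M) = true
  null_succ : ∀ q < D.outs.length, s (4 * D.e .M + (q + 1))
    = (s (4 * D.e .M + q) && !s (1 * D.e .M + D.outs.getD q 0))
  parity_succ : ∀ q < D.outs.length, s (5 * D.e .M + (q + 1))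
    = Bool.xor (s (5 * D.e .M + q)) (s (2 * D.e .M + D.outs.getD q 0))
  mark : s (6 * D.e .M) = !(s (4 * D.e .M + D.e .n) && s (5 * D.e .M + D.e .n))

/-- The equations of a round. -/
structure RoundEqs (D : StageData) (t : Str) : Prop where
  fst : BlockEqs D fun a => t (1 * D.e .M + a)
  link : ∀ q < D.outs.length, t (8 * D.e .M + q) = t (1 * D.e .M + D.outs.getD q 0)
  snd : BlockEqs D fun a => t (8 * D.e .M + a)
  diff : ∀ q < D.outs.length, t (15 * D.e .M + q)
    = Bool.xor (t (8 * D.e .M + D.outs.getD q 0)) (t (1 * D.e .M + q))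
  eq_zero : t (16 * D.e .M) = true
  eq_succ : ∀ q < D.e .n, t (16 * D.e .M + (q + 1)) = (t (16 * D.e .M + q) && !t (15 * D.e .M + q))
  flag₀ : t (17 * D.e .M) = (t (16 * D.e .M + D.e .n) && t (7 * D.e .M))
  flag₁ : t (17 * D.e .M + 1) = (t (17 * D.e .M) && t (14 * D.e .M))
  flag₂ : t (17 * D.e .M + 2) = (t (17 * D.e .M + 1) && t (4 * D.e .M + D.e .pb))
  flag₃ : t (17 * D.e .M + 3) = (t (17 * D.e .M + 2) && t (11 * D.e .M + D.e .pb))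
  flag₄ : t (17 * D.e .M + 4) = t (7 * D.e .M)

section

variable {D : StageData} {B o : ℕ} {T : Str}

theorem solves_append {l l' : List (Instr ℕ)} :
    Solves B (l ++ l') T ↔ Solves B l T ∧ Solves B l' T := by
  simp only [Solves, List.forall_mem_append]

theorem solves_map_range {k : ℕ} {f : ℕ → Instr ℕ} :
    Solves B ((List.range k).map f) T ↔
      ∀ m < k, T (B + (f m).tgt) = (f m).result fun a => T (B + a) := by
  simp [Solves]

theorem solves_singleton {x : Instr ℕ} :
    Solves B [x] T ↔ T (B + x.tgt) = x.result fun a => T (B + a) := by simp [Solves]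

theorem solves_evalList : Solves B (evalList D o) T ↔ EvalEqs D fun a => T (B + (o + a)) := by
  rw [evalList, solves_map_range]
  refine forall₂_congr fun m _ => ?_
  unfold selectType
  split_ifs <;> simp only [Instr.tgt, Instr.result, add_assoc]
  · generalize T (B + (o + (D.e .n + (D.e .pb + m)))) = x
    generalize T (B + (o + (D.recs.getD m default).2.1)) = y
    revert x y; decide
  · generalize T (B + (o + (D.e .n + (D.e .pb + m)))) = x
    generalize T (B + (o + (D.recs.getD m default).2.1)) = y
    generalize T (B + (o + (D.recs.getD m default).2.2)) = z
    revert x y z; decide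
  · generalize T (B + (o + (D.e .n + (D.e .pb + m)))) = x
    generalize T (B + (o + (D.recs.getD m default).2.1)) = y
    generalize T (B + (o + (D.recs.getD m default).2.2)) = z
    revert x y z; decide

theorem Instr.result_copy (t : Str) (i j : ℕ) : (Instr.copy i j).result t = t i := by
  simp [Instr.result]
theorem Instr.result_one (t : Str) (i j : ℕ) : (Instr.one i j).result t = true := by
  simp [Instr.result]
theorem Instr.result_and (t : Str) (i j k : ℕ) : (Instr.and i j k).result t = (t i && t j) := by
  simp [Instr.result]
theorem Instr.result_andn (t : Str) (i j k : ℕ) : (Instr.andn i j k).result t = (t i && !t j) := by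
  simp only [Instr.result]; generalize t i = x; generalize t j = y; revert x y; decide
theorem Instr.result_nand (t : Str) (i j k : ℕ) :
    (Instr.nand i j k).result t = !(t i && t j) := by
  simp only [Instr.result]; generalize t i = x; generalize t j = y; revert x y; decide
theorem Instr.result_xor (t : Str) (i j k : ℕ) :
    (Instr.xor i j k).result t = Bool.xor (t i) (t j) := by
  simp only [Instr.result]; generalize t i = x; generalize t j = y; revert x y; decide
theorem Instr.result_norr (t : Str) (i j k : ℕ) : (Instr.norr i j k).result t = (!t i || t j) := by
  simp only [Instr.result]; generalize t i = x; generalize t j = y; revert x y; decide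
theorem Instr.result_nand' (t : Str) (i j k : ℕ) :
    (Instr.nand' i j k).result t = (!t i && t j) := by
  simp only [Instr.result]; generalize t i = x; generalize t j = y; revert x y; decide

theorem solves_blockList :
    Solves B (blockList D o) T ↔ BlockEqs D fun a => T (B + (o + a)) := by
  simp only [blockList, copyList, solves_append, solves_map_range, solves_singleton,
    solves_evalList, Instr.result_copy, Instr.result_one, Instr.result_andn, Instr.result_nand,
    Instr.result_xor, add_assoc]
  have h : ∀ q, T (B + (if D.bits.getD q false = true then
      Instr.norr (o + (D.e .n + q)) (o + (3 * D.e .M + q)) (o + (3 * D.e .M + (q + 1))) else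
      Instr.nand' (o + (D.e .n + q)) (o + (3 * D.e .M + q)) (o + (3 * D.e .M + (q + 1)))).tgt)
      = (if D.bits.getD q false = true then
      Instr.norr (o + (D.e .n + q)) (o + (3 * D.e .M + q)) (o + (3 * D.e .M + (q + 1))) else
      Instr.nand' (o + (D.e .n + q)) (o + (3 * D.e .M + q)) (o + (3 * D.e .M + (q + 1)))).result
        (fun a => T (B + a)) ↔
      T (B + (o + (3 * D.e .M + (q + 1)))) = if D.bits.getD q false then
    (!T (B + (o + (D.e .n + q))) || T (B + (o + (3 * D.e .M + q)))) else
    (!T (B + (o + (D.e .n + q))) && T (B + (o + (3 * D.e .M + q)))) := by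
    intro q
    split_ifs <;> simp only [Instr.result_norr, Instr.result_nand', Instr.tgt]
  simp only [h]
  simp only [Instr.tgt]
  constructor
  · rintro ⟨h1, h2, h3, h4, h5, h6, h7, h8, h9, h10, h11, h12⟩
    exact ⟨h1, h2, h3, h4, h5, h6, h7, h8, h9, h10, h11, h12⟩
  · rintro ⟨h1, h2, h3, h4, h5, h6, h7, h8, h9, h10, h11, h12⟩
    exact ⟨h1, h2, h3, h4, h5, h6, h7, h8, h9, h10, h11, h12⟩

theorem solves_classicalList :
    Solves B (classicalList D) T ↔ RoundEqs D fun a => T (B + a) := by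
  have hl : ∀ (x y z u v : Instr ℕ), Solves B [x, y, z, u, v] T ↔
      Solves B [x] T ∧ Solves B [y] T ∧ Solves B [z] T ∧ Solves B [u] T ∧ Solves B [v] T := by
    intro x y z u v
    simp [Solves]
  simp only [classicalList, linkList, compareList, solves_append, solves_map_range,
    solves_blockList, hl, solves_singleton, Instr.result_copy, Instr.result_one,
    Instr.result_andn, Instr.result_and, Instr.result_xor, add_assoc, Instr.tgt]
  constructor
  · rintro ⟨h1, h2, h3, h4, h5, h6, h7, h8, h9, h10, h11⟩
    exact ⟨h1, h2, h3, h4, h5, h6, h7, h8, h9, h10, h11⟩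
  · rintro ⟨h1, h2, h3, h4, h5, h6, h7, h8, h9, h10, h11⟩
    exact ⟨h1, h2, h3, h4, h5, h6, h7, h8, h9, h10, h11⟩

end

theorem EvalEqs.congr {D : StageData} (h : Fits D) {s s' : Str} (hs : EvalEqs D s)
    (e : ∀ x < D.e .M, s' x = s x) : EvalEqs D s' := by
  intro m hm
  have h1 := h.e_le
  have h2 := h.getD_recs hm
  rw [e _ (by omega), e _ h2.1, e _ h2.2]
  exact hs m hm

theorem BlockEqs.congr {D : StageData} (h : Fits D) {s s' : Str} (hs : BlockEqs D s)
    (e : ∀ x < 7 * D.e .M, s' x = s x) : BlockEqs D s' := by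
  have h1 := h.e_le
  have h2 := h.bits
  have h3 := h.outs_length
  constructor
  · exact hs.eval.congr h fun x hx => e x (by omega)
  · intro q hq
    rw [e _ (by omega), e _ (by omega)]
    exact hs.copy₁ q hq
  · exact hs.eval₁.congr h fun x hx => e _ (by omega)
  · intro q hq
    rw [e _ (by omega), e _ (by omega)]
    exact hs.copy₂ q hq
  · rw [e _ (by omega)]
    exact hs.one₂
  · exact hs.eval₂.congr h fun x hx => e _ (by omega)
  · rw [e _ (by omega)]
    exact hs.le_zero
  · intro q hq
    rw [e _ (by omega), e _ (by omega), e _ (by omega)]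
    exact hs.le_succ q hq
  · rw [e _ (by omega)]
    exact hs.null_zero
  · intro q hq
    have := h.getD_outs hq
    rw [e _ (by omega), e _ (by omega), e _ (by omega)]
    exact hs.null_succ q hq
  · intro q hq
    have := h.getD_outs hq
    rw [e _ (by omega), e _ (by omega), e _ (by omega)]
    exact hs.parity_succ q hq
  · rw [e _ (by omega), e _ (by omega), e _ (by omega)]
    exact hs.mark

/-- Exchange the two blocks and flip the control bit. -/
def exchange (M : ℕ) (t : Str) : Str := fun a =>
  if a = 3 then !t 3 else if M ≤ a ∧ a < 8 * M then t (a + 7 * M)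
    else if 8 * M ≤ a ∧ a < 15 * M then t (a - 7 * M) else t a

theorem exchange_fst {M a : ℕ} (hM : 16 ≤ M) (t : Str) (ha : a < 7 * M) :
    exchange M t (1 * M + a) = t (8 * M + a) := by
  unfold exchange
  rw [if_neg (by omega), if_pos (by omega)]
  congr 1
  omega

theorem exchange_snd {M a : ℕ} (t : Str) (ha : a < 7 * M) :
    exchange M t (8 * M + a) = t (1 * M + a) := by
  unfold exchange
  rw [if_neg (by omega), if_neg (by omega), if_pos (by omega)]
  congr 1
  omega

theorem exchange_of_le {M a : ℕ} (hM : 16 ≤ M) (t : Str) (ha : 15 * M ≤ a) :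
    exchange M t a = t a := by
  unfold exchange
  rw [if_neg (by omega), if_neg (by omega), if_neg (by omega)]

/-- All conditions are met. -/
structure AllSet (D : StageData) (t : Str) : Prop where
  eq : ∀ q ≤ D.e .n, t (16 * D.e .M + q) = true
  diff : ∀ q < D.e .n, t (15 * D.e .M + q) = false
  mark₁ : t (7 * D.e .M) = true
  mark₂ : t (14 * D.e .M) = true
  le₁ : t (4 * D.e .M + D.e .pb) = true
  le₂ : t (11 * D.e .M + D.e .pb) = true
  flag : ∀ k < 5, t (17 * D.e .M + k) = true

/-- The flags form a chain of conjunctions, as do the bits of the equality test, so the last flag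
forces all of them. -/
theorem RoundEqs.allSet {D : StageData} {t : Str} (h : RoundEqs D t)
    (h3 : t (17 * D.e .M + 3) = true) : AllSet D t := by
  have a3 := h.flag₃.symm.trans h3
  rw [Bool.and_eq_true] at a3
  have a2 := h.flag₂.symm.trans a3.1
  rw [Bool.and_eq_true] at a2
  have a1 := h.flag₁.symm.trans a2.1
  rw [Bool.and_eq_true] at a1
  have a0 := h.flag₀.symm.trans a1.1
  rw [Bool.and_eq_true] at a0
  -- The equality bits are followed downwards from the last one.
  have key : ∀ k ≤ D.e .n, t (16 * D.e .M + (D.e .n - k)) = true := by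
    intro k
    induction k with
    | zero => intro _; exact a0.1
    | succ k ih =>
      intro hk
      have := ih (by omega)
      rw [show D.e .n - k = D.e .n - (k + 1) + 1 by omega, h.eq_succ _ (by omega),
        Bool.and_eq_true] at this
      exact this.1
  have heq : ∀ q ≤ D.e .n, t (16 * D.e .M + q) = true := by
    intro q hq
    have := key (D.e .n - q) (by omega)
    rwa [show D.e .n - (D.e .n - q) = q by omega] at this
  refine ⟨heq, fun q hq => ?_, a0.2, a1.2, a2.2, a3.2, fun k hk => ?_⟩
  · have := heq (q + 1) (by omega)
    rw [h.eq_succ q hq, Bool.and_eq_true] at this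
    simpa using this.2
  · interval_cases k
    · exact a1.1
    · exact a2.1
    · exact a3.1
    · exact h3
    · exact h.flag₄.trans a0.2

/-- The only equations that are not visibly symmetric are the link from the first block to the
second name and the comparison of the second output with the first name. On a matched string both
hold as equalities, and the exchange trades one for the other. The comparison bits and the flags are
then constants, so they need not move. -/
theorem RoundEqs.exchange {D : StageData} (hD : Fits D) (hn : D.outs.length = D.e .n) {t : Str}
    (h : RoundEqs D t) (h3 : t (17 * D.e .M + 3) = true) :
    RoundEqs D (exchange (D.e .M) t) := by
  have hs := h.allSet h3
  have h1 := hD.e_le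
  have hM : 16 ≤ D.e .M := by omega
  have e1 := fun a (ha : a < 7 * D.e .M) => exchange_fst hM t ha
  have e2 := fun a (ha : a < 7 * D.e .M) => exchange_snd t ha
  have e3 := fun a (ha : 15 * D.e .M ≤ a) => exchange_of_le hM t ha
  have m1 : StackProg.exchange (D.e .M) t (7 * D.e .M) = t (14 * D.e .M) := by
    have := e1 (6 * D.e .M) (by omega)
    rwa [show 1 * D.e .M + 6 * D.e .M = 7 * D.e .M by ring,
      show 8 * D.e .M + 6 * D.e .M = 14 * D.e .M by ring] at this
  have m2 : StackProg.exchange (D.e .M) t (14 * D.e .M) = t (7 * D.e .M) := by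
    have := e2 (6 * D.e .M) (by omega)
    rwa [show 1 * D.e .M + 6 * D.e .M = 7 * D.e .M by ring,
      show 8 * D.e .M + 6 * D.e .M = 14 * D.e .M by ring] at this
  have l1 : StackProg.exchange (D.e .M) t (4 * D.e .M + D.e .pb) = t (11 * D.e .M + D.e .pb) := by
    have := e1 (3 * D.e .M + D.e .pb) (by omega)
    rwa [show 1 * D.e .M + (3 * D.e .M + D.e .pb) = 4 * D.e .M + D.e .pb by ring,
      show 8 * D.e .M + (3 * D.e .M + D.e .pb) = 11 * D.e .M + D.e .pb by ring] at this
  have l2 : StackProg.exchange (D.e .M) t (11 * D.e .M + D.e .pb) = t (4 * D.e .M + D.e .pb) := by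
    have := e2 (3 * D.e .M + D.e .pb) (by omega)
    rwa [show 1 * D.e .M + (3 * D.e .M + D.e .pb) = 4 * D.e .M + D.e .pb by ring,
      show 8 * D.e .M + (3 * D.e .M + D.e .pb) = 11 * D.e .M + D.e .pb by ring] at this
  constructor
  · exact h.snd.congr hD e1
  -- The new link equation is the old statement that the comparison found no difference.
  · intro q hq
    have := hD.getD_outs hq
    have hd := hs.diff q (by omega)
    rw [h.diff q hq] at hd
    rw [e1 _ (by omega), e2 _ (by omega)]
    exact (by simpa using hd : t (8 * D.e .M + D.outs.getD q 0) = t (1 * D.e .M + q)).symm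
  · exact h.fst.congr hD e2
  -- The new comparison finds no difference, by the old link equation.
  · intro q hq
    have := hD.getD_outs hq
    rw [e1 _ (by omega), e2 _ (by omega), e3 _ (by omega), hs.diff q (by omega), h.link q hq]
    simp
  · rw [e3 _ (by omega)]; exact h.eq_zero
  · intro q hq
    rw [e3 _ (by omega), e3 _ (by omega), e3 _ (by omega)]
    exact h.eq_succ q hq
  · rw [e3 _ (by omega), e3 _ (by omega), m1, hs.mark₂, hs.eq _ le_rfl]
    exact hs.flag 0 (by norm_num)
  · rw [e3 _ (by omega), e3 _ (by omega), m2, hs.mark₁, hs.flag 1 (by norm_num)]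
    have := hs.flag 0 (by norm_num)
    simpa using this.symm
  · rw [e3 _ (by omega), e3 _ (by omega), l1, hs.le₂, hs.flag 1 (by norm_num),
      hs.flag 2 (by norm_num)]
    rfl
  · rw [e3 _ (by omega), e3 _ (by omega), l2, hs.le₁, hs.flag 2 (by norm_num),
      hs.flag 3 (by norm_num)]
    rfl
  · rw [e3 _ (by omega), m1, hs.mark₂, hs.flag 4 (by norm_num)]

end StackProg

/-! ### Binary digits -/

theorem testBit_ofLowBits (l : List Bool) (t : ℕ) : (ofLowBits l).testBit t = l.getD t false := by
  induction l generalizing t with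
  | nil => simp [ofLowBits]
  | cons b l ih =>
    have h : ofLowBits (b :: l) = Nat.bit b (ofLowBits l) := by
      rw [Nat.bit_val]
      simp [ofLowBits, Nat.ofDigits_cons, add_comm]
    rw [h]
    cases t with
    | zero => simp
    | succ t => rw [Nat.testBit_bit_succ, ih]; simp

theorem ofLowBits_lt (l : List Bool) : ofLowBits l < 2 ^ l.length := by
  have := Nat.ofDigits_lt_base_pow_length (b := 2) (l := l.map Bool.toNat) (by norm_num) (by
    intro x hx
    obtain ⟨b, -, rfl⟩ := List.mem_map.1 hx
    cases b <;> simp)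
  simpa [ofLowBits] using this

/-- The number whose binary digits are the first `k` bits of a string. -/
def bitsValue (k : ℕ) (s : ℕ → Bool) : ℕ := ofLowBits ((List.range k).map s)

theorem getD_map_range (k : ℕ) (s : ℕ → Bool) (t : ℕ) :
    ((List.range k).map s).getD t false = if t < k then s t else false := by
  by_cases h : t < k <;> simp [List.getD_eq_getElem?_getD, h]

theorem testBit_bitsValue (k : ℕ) (s : ℕ → Bool) (t : ℕ) :
    (bitsValue k s).testBit t = if t < k then s t else false := by
  rw [bitsValue, testBit_ofLowBits, getD_map_range]

theorem bitsValue_lt (k : ℕ) (s : ℕ → Bool) : bitsValue k s < 2 ^ k := by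
  simpa [bitsValue] using ofLowBits_lt ((List.range k).map s)

theorem lowBits_bitsValue (k : ℕ) (s : ℕ → Bool) :
    lowBits k (bitsValue k s) = (List.range k).map s := by
  refine List.map_congr_left fun t ht => ?_
  rw [testBit_bitsValue, if_pos (List.mem_range.1 ht)]

theorem bitsValue_congr {k : ℕ} {s s' : ℕ → Bool} (h : ∀ t < k, s t = s' t) :
    bitsValue k s = bitsValue k s' := by
  rw [bitsValue, bitsValue, List.map_congr_left fun t ht => h t (List.mem_range.1 ht)]

theorem bitsValue_testBit {k a : ℕ} (ha : a < 2 ^ k) : bitsValue k a.testBit = a := by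
  refine Nat.eq_of_testBit_eq fun t => ?_
  rw [testBit_bitsValue]
  split_ifs with h
  · rfl
  · exact (Nat.testBit_lt_two_pow (ha.trans_le (Nat.pow_le_pow_right (by norm_num)
      (by omega)))).symm

theorem bitsValue_eq_iff {k a : ℕ} (ha : a < 2 ^ k) (s : ℕ → Bool) :
    bitsValue k s = a ↔ ∀ t < k, s t = a.testBit t := by
  constructor
  · rintro rfl t ht
    rw [testBit_bitsValue, if_pos ht]
  · intro h
    rw [bitsValue_congr h, bitsValue_testBit ha]

/-- Type and arguments of a gate. -/
def BoolGate.triple : BoolGate → ℕ × ℕ × ℕ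
  | not i => (1, i, 0)
  | and i j => (2, i, j)
  | or i j => (3, i, j)

/-! ### What the equations of a block compute -/

namespace StackProg

open Function

/-- The data describe the Boolean circuit of an input. -/
structure Presents (D : StageData) (I : GraphInput) : Prop where
  fits : Fits D
  n : D.e .n = I.n
  pb : D.e .pb = I.posBits
  recs : D.recs = I.circuit.gates.map BoolGate.triple
  outs : D.outs = I.circuit.outputs
  bits : D.bits = Nat.bits (I.S - 1)

section

variable {D : StageData} {I : GraphInput} {s : Str}

/-- Wire numbers are addresses within the segment, so by induction on the gates the list of wire
values is an initial piece of the segment. -/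
theorem EvalEqs.wires (hP : Presents D I) (hw : I.circuit.WellFormed (I.n + I.posBits) I.n)
    (hs : EvalEqs D s) : I.circuit.wires ((List.range (I.n + I.posBits)).map s)
      = (List.range (I.n + I.posBits + I.circuit.gates.length)).map s := by
  have key : ∀ m ≤ I.circuit.gates.length, (I.circuit.gates.take m).foldl
      (fun u g => u ++ [g.eval u]) ((List.range (I.n + I.posBits)).map s)
      = (List.range (I.n + I.posBits + m)).map s := by
    intro m hm
    induction m with
    | zero => simp
    | succ m ih =>
      have hm' : m < I.circuit.gates.length := hm
      rw [List.take_succ_eq_append_getElem hm', List.foldl_append, ih (by omega), ← add_assoc,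
        List.range_succ, List.map_append]
      simp only [List.foldl_cons, List.foldl_nil, List.map_cons, List.map_nil]
      congr 2
      have h1 := hs m (by rw [hP.recs, List.length_map]; exact hm')
      have h2 := hw.gates_read m _ (List.getElem?_eq_getElem hm')
      rw [hP.recs, List.getD_eq_getElem _ _ (by simpa using hm'), List.getElem_map, hP.n,
        hP.pb] at h1
      rw [h1]
      generalize I.circuit.gates[m] = g at h2
      cases g with
      | not i =>
        simp only [BoolGate.ReadsBelow] at h2
        simp [BoolGate.eval, BoolGate.triple, selectType, getD_map_range, h2, -List.getD_eq_getElem?_getD]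
      | and i j =>
        simp only [BoolGate.ReadsBelow] at h2
        simp [BoolGate.eval, BoolGate.triple, selectType, getD_map_range, h2, -List.getD_eq_getElem?_getD]
      | or i j =>
        simp only [BoolGate.ReadsBelow] at h2
        simp [BoolGate.eval, BoolGate.triple, selectType, getD_map_range, h2, -List.getD_eq_getElem?_getD]
  simpa [BoolCircuit.wires] using key _ le_rfl

theorem EvalEqs.adj (hP : Presents D I) (hw : I.circuit.WellFormed (I.n + I.posBits) I.n)
    (hs : EvalEqs D s) {q : ℕ} (hq : q < I.n) : s (D.outs.getD q 0) =
      (I.adj (bitsValue I.n s) (bitsValue I.posBits fun t => s (I.n + t))).testBit q := by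
  have hq' : q < I.circuit.outputs.length := by rw [hw.outputs_length]; exact hq
  rw [GraphInput.adj, testBit_ofLowBits, lowBits_bitsValue, lowBits_bitsValue]
  have : (List.range I.n).map s ++ (List.range I.posBits).map (fun t => s (I.n + t))
      = (List.range (I.n + I.posBits)).map s := by
    rw [List.range_add, List.map_append, List.map_map]
    rfl
  have hr := hw.outputs_read _ (List.getElem_mem hq')
  rw [this, BoolCircuit.eval, hs.wires hP hw, hP.outs, List.getD_eq_getElem _ _ hq',
    List.getD_eq_getElem _ _ (by simpa using hq'), List.getElem_map, getD_map_range, if_pos hr]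

theorem adj_lt (hw : I.circuit.WellFormed (I.n + I.posBits) I.n) (i l : ℕ) :
    I.adj i l < 2 ^ I.n := by
  have := ofLowBits_lt (I.circuit.eval (lowBits I.n i ++ lowBits I.posBits l))
  rwa [BoolCircuit.eval, List.length_map, hw.outputs_length] at this

theorem Presents.length_bits (hP : Presents D I) : D.bits.length = I.posBits := by
  rw [hP.fits.bits, hP.pb]

/-- The position is compared with S - 1 from the lowest digit upwards. The bit q records whether the
numbers formed by the lowest q digits are in the right order, and a new digit overrides this verdict
unless the two digits agree. The digits of S - 1 suffice because a position has exactly as many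
bits. -/
theorem BlockEqs.le_iff (hP : Presents D I) (hs : BlockEqs D s) (hS : 1 ≤ I.S) :
    s (3 * D.e .M + D.e .pb) = decide (bitsValue I.posBits (fun t => s (I.n + t)) < I.S) := by
  set a := bitsValue I.posBits fun t => s (I.n + t) with ha
  have hb := hP.length_bits
  have key : ∀ q ≤ I.posBits, s (3 * D.e .M + q) = decide (a % 2 ^ q ≤ (I.S - 1) % 2 ^ q) := by
    intro q hq
    induction q with
    | zero => simp [hs.le_zero, Nat.mod_one]
    | succ q ih =>
      have h1 : s (I.n + q) = a.testBit q := by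
        rw [ha, testBit_bitsValue, if_pos (by omega)]
      have h2 : D.bits.getD q false = (I.S - 1).testBit q := by
        rw [hP.bits, PolyRuns.getD_bits, Nat.testBit_eq_decide_div_mod_eq]
      rw [hs.le_succ q (by omega), ih (by omega), hP.n, h1, h2, Nat.mod_pow_succ,
        Nat.mod_pow_succ, Nat.testBit_eq_decide_div_mod_eq, Nat.testBit_eq_decide_div_mod_eq]
      have l1 := Nat.mod_lt a (Nat.two_pow_pos q)
      have l2 := Nat.mod_lt (I.S - 1) (Nat.two_pow_pos q)
      generalize a % 2 ^ q = x at l1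
      generalize (I.S - 1) % 2 ^ q = y at l2
      rcases Nat.mod_two_eq_zero_or_one (a / 2 ^ q) with e1 | e1 <;>
        rcases Nat.mod_two_eq_zero_or_one ((I.S - 1) / 2 ^ q) with e2 | e2 <;>
        rw [e1, e2] <;> generalize 2 ^ q = z at l1 l2 <;> simp <;> omega
  have h1 : a < 2 ^ I.posBits := bitsValue_lt _ _
  have h2 : I.S - 1 < 2 ^ I.posBits := by
    have := Nat.lt_size_self (I.S - 1)
    rwa [← Nat.size_eq_bits_len, ← hP.bits, hb] at this
  rw [hP.pb, key _ le_rfl, Nat.mod_eq_of_lt h1, Nat.mod_eq_of_lt h2]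
  congr 1
  apply propext
  omega

/-- The bits of a block, apart from names of vertices and positions, are zero at the start. -/
structure ZeroConsts (D : StageData) (s : Str) : Prop where
  pos₁ : ∀ t < D.e .pb, s (1 * D.e .M + (D.e .n + t)) = false
  pos₂ : ∀ t < D.e .pb, 0 < t → s (2 * D.e .M + (D.e .n + t)) = false
  parity : s (5 * D.e .M) = false

theorem BlockEqs.seg₁ (hP : Presents D I) (hw : I.circuit.WellFormed (I.n + I.posBits) I.n)
    (hs : BlockEqs D s) (hz : ZeroConsts D s) {q : ℕ} (hq : q < I.n) :
    s (1 * D.e .M + D.outs.getD q 0) = (I.adj (bitsValue I.n s) 0).testBit q := by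
  rw [hs.eval₁.adj hP hw hq]
  congr 2
  · exact bitsValue_congr fun t ht => hs.copy₁ t (by rw [hP.n]; exact ht)
  · rw [bitsValue_eq_iff (Nat.two_pow_pos _)]
    intro t ht
    have := hz.pos₁ t (by rw [hP.pb]; exact ht)
    rw [hP.n] at this
    rw [this, Nat.zero_testBit]

theorem BlockEqs.seg₂ (hP : Presents D I) (hw : I.circuit.WellFormed (I.n + I.posBits) I.n)
    (hs : BlockEqs D s) (hz : ZeroConsts D s) (hp : 1 ≤ I.posBits) {q : ℕ} (hq : q < I.n) :
    s (2 * D.e .M + D.outs.getD q 0) = (I.adj (bitsValue I.n s) 1).testBit q := by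
  rw [hs.eval₂.adj hP hw hq]
  congr 2
  · exact bitsValue_congr fun t ht => hs.copy₂ t (by rw [hP.n]; exact ht)
  · rw [bitsValue_eq_iff (Nat.one_lt_two_pow (by omega))]
    intro t ht
    rcases Nat.eq_zero_or_pos t with rfl | h0
    · have := hs.one₂
      rw [hP.n] at this
      simpa using this
    · have := hz.pos₂ t (by rw [hP.pb]; exact ht) h0
      rw [hP.n] at this
      rw [this, Nat.testBit_lt_two_pow (Nat.one_lt_two_pow (by omega))]

theorem BlockEqs.null_iff (hP : Presents D I) (hw : I.circuit.WellFormed (I.n + I.posBits) I.n)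
    (hs : BlockEqs D s) (hz : ZeroConsts D s) :
    s (4 * D.e .M + D.e .n) = decide (I.adj (bitsValue I.n s) 0 = 0) := by
  have hl : D.outs.length = I.n := by rw [hP.outs, hw.outputs_length]
  have key : ∀ q ≤ I.n, s (4 * D.e .M + q)
      = decide (∀ t < q, (I.adj (bitsValue I.n s) 0).testBit t = false) := by
    intro q hq
    induction q with
    | zero => simp [hs.null_zero]
    | succ q ih =>
      rw [hs.null_succ q (by omega), ih (by omega), hs.seg₁ hP hw hz (by omega), Bool.eq_iff_iff]
      simp only [Bool.and_eq_true, decide_eq_true_eq, Bool.not_eq_true', Nat.lt_succ_iff_lt_or_eq]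
      constructor
      · rintro ⟨h1, h2⟩ t (ht | rfl)
        · exact h1 t ht
        · exact h2
      · exact fun h => ⟨fun t ht => h t (Or.inl ht), h q (Or.inr rfl)⟩
  rw [hP.n, key _ le_rfl, Bool.eq_iff_iff, decide_eq_true_eq, decide_eq_true_eq]
  constructor
  · intro h
    refine Nat.eq_of_testBit_eq fun t => ?_
    rw [Nat.zero_testBit]
    by_cases ht : t < I.n
    · exact h t ht
    · exact Nat.testBit_lt_two_pow ((adj_lt hw _ _).trans_le
        (Nat.pow_le_pow_right (by norm_num) (by omega)))
  · intro h t _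
    rw [h, Nat.zero_testBit]

/-- The entry at the position one is consulted only if the entry at the position zero vanishes, and
then it is 0 or 1. The parity of its digits tells these two values apart. -/
theorem BlockEqs.parity (hP : Presents D I) (hw : I.circuit.WellFormed (I.n + I.posBits) I.n)
    (hs : BlockEqs D s) (hz : ZeroConsts D s) (hp : 1 ≤ I.posBits) (hn : 1 ≤ I.n) :
    (I.adj (bitsValue I.n s) 1 = 0 → s (5 * D.e .M + D.e .n) = false) ∧
    (I.adj (bitsValue I.n s) 1 = 1 → s (5 * D.e .M + D.e .n) = true) := by
  have hl : D.outs.length = I.n := by rw [hP.outs, hw.outputs_length]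
  rw [hP.n]
  constructor
  · intro h
    have key : ∀ q ≤ I.n, s (5 * D.e .M + q) = false := by
      intro q hq
      induction q with
      | zero => simpa using hz.parity
      | succ q ih =>
        rw [hs.parity_succ q (by omega), ih (by omega), hs.seg₂ hP hw hz hp (by omega), h]
        simp
    exact key _ le_rfl
  · intro h
    have key : ∀ q, 1 ≤ q → q ≤ I.n → s (5 * D.e .M + q) = true := by
      intro q h1 hq
      induction q, h1 using Nat.le_induction with
      | base =>
        have h5 := hz.parity
        have := hs.parity_succ 0 (by omega)
        rw [hs.seg₂ hP hw hz hp (by omega), h, add_zero, h5] at this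
        simpa using this
      | succ q h1 ih =>
        rw [hs.parity_succ q (by omega), ih (by omega), hs.seg₂ hP hw hz hp (by omega), h,
          Nat.testBit_lt_two_pow (Nat.one_lt_two_pow (by omega))]
        rfl
    exact key _ hn le_rfl

end

end StackProg

/-! ### Marked sparse access -/

namespace IsMarkedSparseAccess

variable {n S : ℕ} {V : Finset ℕ} {G : SimpleGraph V} {adj : ℕ → ℕ → ℕ}

/-- Padding entries are 0, which is not the name of a vertex, so an entry that names a vertex comes
from the list of neighbours. -/
theorem adj_of_eq (h : IsMarkedSparseAccess n S V G adj) {i j : V} {l : ℕ} (hl : l < S)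
    (e : adj i l = j) : G.Adj i j := by
  classical
  by_cases hd : l < G.degree i
  · obtain ⟨f, hf⟩ := h.neighbors i
    have := hf ⟨l, by convert hd⟩
    simp only at this
    rw [e] at this
    have h2 := (f ⟨l, by convert hd⟩).2
    rwa [← Subtype.ext this] at h2
  · have := h.padding i l (by convert Nat.not_lt.1 hd) hl
    have h0 := (h.vertices j j.2).1
    omega

theorem exists_eq_of_adj (h : IsMarkedSparseAccess n S V G adj) {i j : V} (hij : G.Adj i j) :
    ∃ l < S, adj i l = j := by
  obtain ⟨f, hf⟩ := h.neighbors i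
  refine ⟨f.symm ⟨j, hij⟩, (f.symm ⟨j, hij⟩).2.trans_le (h.degree_le i), ?_⟩
  rw [hf]
  simp

/-- A vertex is recognised by the beginning of its adjacency list. -/
theorem mem_iff (h : IsMarkedSparseAccess n S V G adj) {i : ℕ} (hi : i < 2 ^ n) :
    (i ∈ V → adj i 0 = 0 → adj i 1 = 0) ∧ (i ∉ V → adj i 0 = 0 ∧ adj i 1 = 1) := by
  classical
  have h2 := h.two_le
  refine ⟨fun hV h0 => ?_, fun hV => ⟨h.marked i hi hV 0 (by omega), h.marked i hi hV 1 (by omega)⟩⟩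
  refine h.padding ⟨i, hV⟩ 1 ?_ (by omega)
  by_contra hd
  obtain ⟨f, hf⟩ := h.neighbors ⟨i, hV⟩
  have hlt : 0 < G.degree ⟨i, hV⟩ := by
    rw [not_le] at hd
    exact lt_of_le_of_lt (Nat.zero_le _) (lt_trans Nat.zero_lt_one (by convert hd))
  have := hf ⟨0, by convert hlt⟩
  simp only at this
  rw [h0] at this
  have h3 := (h.vertices _ (f ⟨0, by convert hlt⟩ : V).2).1
  omega

end IsMarkedSparseAccess

/-! ### Recognising vertices, and the bits that a round changes -/

namespace StackProg

open Function

/-- The data describe a graph. -/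
structure Represents (D : StageData) (I : GraphInput) (V : Finset ℕ) (G : SimpleGraph V) :
    Prop where
  presents : Presents D I
  describes : I.Describes V G

namespace Represents

variable {D : StageData} {I : GraphInput} {V : Finset ℕ} {G : SimpleGraph V}

theorem one_le_n (h : Represents D I V G) : 1 ≤ I.n := by
  obtain ⟨v, hv⟩ := h.describes.nonempty
  have := h.describes.access.vertices v hv
  by_contra h0
  rw [show I.n = 0 by omega] at this
  omega

theorem one_le_posBits (h : Represents D I V G) : 1 ≤ I.posBits :=
  Nat.clog_pos (by norm_num) h.describes.access.two_le

theorem outs_length (h : Represents D I V G) : D.outs.length = D.e .n := by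
  rw [h.presents.outs, h.describes.wellFormed.outputs_length, h.presents.n]

theorem recs_lt (h : Represents D I V G) {m : ℕ} (hm : m < D.recs.length) :
    (D.recs.getD m default).2.1 < D.e .n + D.e .pb + m ∧
      (D.recs.getD m default).2.2 < D.e .n + D.e .pb + m := by
  have h1 := h.one_le_n
  have hm' : m < I.circuit.gates.length := by rwa [h.presents.recs, List.length_map] at hm
  have h2 := h.describes.wellFormed.gates_read m _ (List.getElem?_eq_getElem hm')
  rw [h.presents.recs, List.getD_eq_getElem _ _ (by simpa using hm'), List.getElem_map,
    h.presents.n, h.presents.pb]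
  generalize I.circuit.gates[m] = g at h2
  cases g <;> simp only [BoolGate.triple, BoolGate.ReadsBelow] at h2 ⊢ <;> omega

theorem increasing (h : Represents D I V G) :
    Increasing (1 * D.e .M + D.e .n + D.e .pb) (17 * D.e .M + 5) (classicalList D) :=
  increasing_classicalList h.presents.fits (by rw [h.presents.pb]; exact h.one_le_posBits)
    h.outs_length fun _ hm => h.recs_lt hm

/-- Outside the graph the first two entries are 0 and 1. For a vertex whose first entry is 0 the
list of neighbours is empty, so the second entry is 0 too. Hence the conjunction of null and odd
holds exactly outside the graph. -/
theorem mark (h : Represents D I V G) {s : Str} (hs : BlockEqs D s) (hz : ZeroConsts D s) :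
    s (6 * D.e .M) = true ↔ bitsValue I.n s ∈ V := by
  obtain ⟨h1, h2⟩ := hs.parity h.presents h.describes.wellFormed hz h.one_le_posBits h.one_le_n
  have h3 := h.describes.access.mem_iff (bitsValue_lt I.n s)
  rw [hs.mark, hs.null_iff h.presents h.describes.wellFormed hz]
  by_cases hV : bitsValue I.n s ∈ V
  · simp only [hV, iff_true]
    by_cases h0 : I.adj (bitsValue I.n s) 0 = 0
    · rw [h1 (h3.1 hV h0)]; simp
    · simp [h0]
  · obtain ⟨h4, h5⟩ := h3.2 hV
    rw [h2 h5]
    simp [hV, h4]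

end Represents

/-! ### Targets -/

/-- The addresses, relative to a block, that the instructions of a block change. -/
def BlockTgt (D : StageData) (r : ℕ) : Prop := ∃ x ∈ blockList D 0, x.tgt = r

theorem Instr.tgt_map (x : Instr ℕ) (f : ℕ → ℕ) : (x.map f).tgt = f x.tgt := by
  cases x <;> rfl

theorem evalList_eq_map (D : StageData) (o o' : ℕ) :
    evalList D (o + o') = (evalList D o').map (Instr.map (o + ·)) := by
  rw [evalList, evalList, List.map_map]
  refine List.map_congr_left fun m _ => ?_
  simp only [selectType, comp_apply]
  split_ifs <;> simp [Instr.map, add_assoc]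

/-- Both blocks are translates of one list of instructions, so they change the same relative
addresses. The exchange of the blocks can therefore respect the distinction between changed and
unchanged bits. -/
theorem blockList_eq_map (D : StageData) (o : ℕ) :
    blockList D o = (blockList D 0).map (Instr.map (o + ·)) := by
  simp only [blockList, copyList, List.map_append, zero_add, ← evalList_eq_map, List.map_map]
  refine congrArg₂ _ rfl (congrArg₂ _ ?_ (congrArg₂ _ rfl (congrArg₂ _ ?_ (congrArg₂ _ ?_
    (congrArg₂ _ rfl (congrArg₂ _ ?_ (congrArg₂ _ ?_ (congrArg₂ _ ?_ (congrArg₂ _ ?_ (congrArg₂ _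
    ?_ ?_))))))))))
  case refine_5 =>
    refine List.map_congr_left fun m _ => ?_
    simp only [comp_apply]
    split_ifs <;> simp [Instr.map, add_assoc]
  all_goals simp [Instr.map, add_assoc, comp_def]

theorem exists_blockList_iff (D : StageData) (o r : ℕ) :
    (∃ x ∈ blockList D o, x.tgt = o + r) ↔ BlockTgt D r := by
  rw [blockList_eq_map]
  simp [BlockTgt, Instr.tgt_map]

/-- The addresses, relative to a window, that the instructions change. -/
def RoundTgt (D : StageData) (r : ℕ) : Prop := ∃ x ∈ classicalList D, x.tgt = r

namespace Represents

variable {D : StageData} {I : GraphInput} {V : Finset ℕ} {G : SimpleGraph V}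

theorem blockTgt_bound (h : Represents D I V G) {r : ℕ} (hr : BlockTgt D r) :
    D.e .n + D.e .pb ≤ r ∧ r < 7 * D.e .M := by
  obtain ⟨x, hx, e⟩ := (exists_blockList_iff D (D.e .M) r).2 hr
  have := (increasing_blockList h.presents.fits (by rw [h.presents.pb]; exact h.one_le_posBits)
    le_rfl fun _ hm => h.recs_lt hm).bound x hx
  omega

theorem roundTgt_iff (h : Represents D I V G) (r : ℕ) : RoundTgt D r ↔
    (∃ t, BlockTgt D t ∧ r = 1 * D.e .M + t) ∨ (∃ q < D.e .n, r = 8 * D.e .M + q) ∨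
      (∃ t, BlockTgt D t ∧ r = 8 * D.e .M + t) ∨ ∃ x ∈ compareList D, x.tgt = r := by
  have key : ∀ o, (∃ x ∈ blockList D o, x.tgt = r) ↔ ∃ t, BlockTgt D t ∧ r = o + t := by
    intro o
    constructor
    · rintro ⟨x, hx, rfl⟩
      have hx' := hx
      rw [blockList_eq_map, List.mem_map] at hx
      obtain ⟨y, hy, rfl⟩ := hx
      exact ⟨y.tgt, ⟨y, hy, rfl⟩, Instr.tgt_map _ _⟩
    · rintro ⟨t, ht, rfl⟩
      exact (exists_blockList_iff D o t).2 ht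
  rw [← key, ← key]
  have hl : (∃ x ∈ linkList D, x.tgt = r) ↔ ∃ q < D.e .n, r = 8 * D.e .M + q := by
    simp [linkList, h.outs_length, Instr.tgt, eq_comm]
  rw [← hl]
  simp only [RoundTgt, classicalList, List.mem_append, or_and_right, exists_or]

theorem compareList_bound (h : Represents D I V G) {x : Instr ℕ} (hx : x ∈ compareList D) :
    15 * D.e .M ≤ x.tgt ∧ x.tgt < 17 * D.e .M + 5 := by
  have h2 := h.presents.fits.e_le
  have h1 := h.outs_length
  revert x
  simp only [compareList, List.forall_mem_append, List.forall_mem_map, List.mem_range,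
    List.forall_mem_cons, List.mem_singleton, forall_eq, Instr.tgt, h1]
  refine ⟨fun q hq => ?_, ?_, fun q hq => ?_, ?_⟩ <;> omega

theorem roundTgt_fst (h : Represents D I V G) {t : ℕ} (ht : t < 7 * D.e .M) :
    RoundTgt D (1 * D.e .M + t) ↔ BlockTgt D t := by
  rw [h.roundTgt_iff]
  constructor
  · rintro (⟨t', h1, h2⟩ | ⟨q, h1, h2⟩ | ⟨t', h1, h2⟩ | ⟨x, h1, h2⟩)
    · rwa [show t = t' by omega]
    · omega
    · have := h.blockTgt_bound h1; omega
    · have := h.compareList_bound h1; omega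
  · exact fun h1 => Or.inl ⟨t, h1, rfl⟩

/-- The only asymmetry between the blocks: the second vertex name is computed from the first block,
whereas the first name is loaded from the witness. -/
theorem roundTgt_snd (h : Represents D I V G) {t : ℕ} (ht : t < 7 * D.e .M) :
    RoundTgt D (8 * D.e .M + t) ↔ t < D.e .n ∨ BlockTgt D t := by
  rw [h.roundTgt_iff]
  constructor
  · rintro (⟨t', h1, h2⟩ | ⟨q, h1, h2⟩ | ⟨t', h1, h2⟩ | ⟨x, h1, h2⟩)
    · have := h.blockTgt_bound h1; omega
    · left; omega
    · right; rwa [show t = t' by omega]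
    · have := h.compareList_bound h1; omega
  · rintro (h1 | h1)
    · exact Or.inr (Or.inl ⟨t, h1, rfl⟩)
    · exact Or.inr (Or.inr (Or.inl ⟨t, h1, rfl⟩))

theorem roundTgt_bound (h : Represents D I V G) {r : ℕ} (hr : RoundTgt D r) :
    1 * D.e .M + D.e .n + D.e .pb ≤ r ∧ r < 17 * D.e .M + 5 := by
  obtain ⟨x, hx, rfl⟩ := hr
  exact (h.increasing.bound x hx).2.2.2

end Represents

end StackProg

namespace StackProg

open Function

/-! ### Exchanges of bits -/

/-- Exchange two bits. -/
def swapBits (p : ℕ × ℕ) (γ : Str) : Str := update (update γ p.1 (γ p.2)) p.2 (γ p.1)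

/-- Exchange several pairs of bits. -/
def swapAll (l : List (ℕ × ℕ)) (γ : Str) : Str := l.foldl (fun γ p => swapBits p γ) γ

theorem swapAll_spec {l : List (ℕ × ℕ)} (h : l.Pairwise fun p q => p.1 ≠ q.1 ∧ p.1 ≠ q.2 ∧
    p.2 ≠ q.1 ∧ p.2 ≠ q.2) (h' : ∀ p ∈ l, p.1 ≠ p.2) (γ : Str) :
    (∀ p ∈ l, swapAll l γ p.1 = γ p.2 ∧ swapAll l γ p.2 = γ p.1) ∧
      ∀ a, (∀ p ∈ l, a ≠ p.1 ∧ a ≠ p.2) → swapAll l γ a = γ a := by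
  induction l generalizing γ with
  | nil => simp [swapAll]
  | cons p l ih =>
    obtain ⟨h1, h2⟩ := ih h.of_cons (fun q hq => h' q (by simp [hq])) (swapBits p γ)
    have hp := List.pairwise_cons.1 h
    have hpp := h' p (by simp)
    have e : swapAll (p :: l) γ = swapAll l (swapBits p γ) := rfl
    have s0 : ∀ a, a ≠ p.1 → a ≠ p.2 → swapBits p γ a = γ a := fun a ha hb => by
      simp [swapBits, ha, hb]
    rw [e]
    refine ⟨fun q hq => ?_, fun a ha => ?_⟩
    · rcases List.mem_cons.1 hq with rfl | hq
      · rw [h2 q.1 fun r hr => ⟨(hp.1 r hr).1, (hp.1 r hr).2.1⟩,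
          h2 q.2 fun r hr => ⟨(hp.1 r hr).2.2.1, (hp.1 r hr).2.2.2⟩]
        simp [swapBits, hpp]
      · obtain ⟨a1, a2, a3, a4⟩ := hp.1 q hq
        rw [(h1 q hq).1, (h1 q hq).2, s0 _ a2.symm a4.symm, s0 _ a1.symm a3.symm]
        exact ⟨rfl, rfl⟩
    · rw [h2 a fun q hq => ha q (by simp [hq]), s0 a (ha p (by simp)).1 (ha p (by simp)).2]

theorem run_swaps (B : ℕ) {l : List (ℕ × ℕ)} (h : ∀ p ∈ l, p.1 ≠ B + p.2) (γ : Str) :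
    run (gatesAt B (l.map fun p => .swap p.1 p.2)) γ
      = swapAll (l.map fun p => (p.1, B + p.2)) γ := by
  induction l generalizing γ with
  | nil => rfl
  | cons p l ih =>
    have hp := h p (by simp)
    rw [List.map_cons, gatesAt_cons, run_append, ih fun q hq => h q (by simp [hq])]
    change _ = swapAll _ (swapBits _ γ)
    congr 1
    funext a
    simp only [gatesAt, gatesOf, List.flatMap_cons, List.flatMap_nil, Instr.gates, List.append_nil,
      List.map_cons, List.map_nil, RGate.map, Addr.abs, run_cons, run_nil, RGate.act, swapBits]
    by_cases h1 : a = p.1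
    · subst h1; simp [hp, hp.symm, Bool.xor_comm (γ (B + p.2))]
    · by_cases h2 : a = B + p.2
      · subst h2; simp [hp, hp.symm]
      · simp [h1, h2]

theorem run_cswaps_of_false (B b : ℕ) {l : List (ℕ × ℕ)}
    (h : ∀ p ∈ l, p.1 ≠ p.2 ∧ b ≠ p.1 ∧ b ≠ p.2) (γ : Str) (hb : γ (B + b) = false) :
    run (gatesAt B (l.map fun p => .cswap b p.1 p.2)) γ = γ := by
  induction l generalizing γ with
  | nil => rfl
  | cons p l ih =>
    obtain ⟨hp, hb1, hb2⟩ := h p (by simp)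
    rw [List.map_cons, gatesAt_cons, run_append]
    have : run (gatesAt B [.cswap b p.1 p.2]) γ = γ := by
      simp [gatesAt, gatesOf, Instr.gates, RGate.map, Addr.abs, RGate.act, hb]
    rw [this, ih (fun q hq => h q (by simp [hq])) γ hb]

theorem run_cswaps_of_true (B b : ℕ) {l : List (ℕ × ℕ)}
    (h : ∀ p ∈ l, p.1 ≠ p.2 ∧ b ≠ p.1 ∧ b ≠ p.2) (γ : Str) (hb : γ (B + b) = true) :
    run (gatesAt B (l.map fun p => .cswap b p.1 p.2)) γ
      = swapAll (l.map fun p => (B + p.1, B + p.2)) γ := by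
  induction l generalizing γ with
  | nil => rfl
  | cons p l ih =>
    obtain ⟨hp, hb1, hb2⟩ := h p (by simp)
    rw [List.map_cons, gatesAt_cons, run_append]
    have : run (gatesAt B [.cswap b p.1 p.2]) γ = swapBits (B + p.1, B + p.2) γ := by
      funext a
      simp only [gatesAt, gatesOf, List.flatMap_cons, List.flatMap_nil, Instr.gates,
        List.append_nil, List.map_cons, List.map_nil, RGate.map, Addr.abs, run_cons, run_nil,
        RGate.act, swapBits]
      by_cases h1 : a = B + p.1
      · subst h1; simp [hp, hp.symm, hb1, hb2, hb, Bool.xor_comm (γ (B + p.2))]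
      · by_cases h2 : a = B + p.2
        · subst h2; simp [hp, hp.symm, hb1, hb2, hb]
        · simp [h1, h2]
    rw [this, ih (fun q hq => h q (by simp [hq]))]
    · rfl
    · simp [swapBits, hb1, hb2, hb]

section

variable {D : StageData}

/-- Exchange the beginning of the witness with the first vertex name of a window. -/
def loadAt (D : StageData) (B : ℕ) (γ : Str) : Str := fun a =>
  if a < D.e .n then γ (B + (1 * D.e .M + a))
  else if B + 1 * D.e .M ≤ a ∧ a < B + 1 * D.e .M + D.e .n then γ (a - (B + 1 * D.e .M))
  else γ a

theorem run_loadList (hD : Fits D) {B : ℕ} (hB : D.e .M ≤ B) (γ : Str) :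
    run (gatesAt B (loadList D)) γ = loadAt D B γ := by
  have h1 := hD.e_le
  have e : loadList D = ((List.range (D.e .n)).map fun q => (q, 1 * D.e .M + q)).map
      fun p => .swap p.1 p.2 := by simp [loadList]
  rw [e, run_swaps]
  · obtain ⟨k1, k2⟩ := swapAll_spec (l := ((List.range (D.e .n)).map fun q =>
      (q, 1 * D.e .M + q)).map fun p => (p.1, B + p.2)) (by
        rw [List.map_map, List.pairwise_map]
        refine List.pairwise_lt_range.imp_of_mem fun {a b} ha hb hab => ?_
        simp only [List.mem_range, comp_apply] at *
        omega) (by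
        simp only [List.map_map, List.forall_mem_map, List.mem_range, comp_apply]
        intro q hq
        omega) γ
    simp only [List.map_map, List.forall_mem_map, List.mem_range, comp_apply] at k1 k2
    funext a
    unfold loadAt
    split_ifs with c1 c2
    · simpa using (k1 a c1).1
    · have := (k1 (a - (B + 1 * D.e .M)) (by omega)).2
      rw [show B + (1 * D.e .M + (a - (B + 1 * D.e .M))) = a by omega] at this
      simpa using this
    · simpa using k2 a fun q hq => by omega
  · simp only [List.forall_mem_map, List.mem_range]
    intro q hq
    omega

/-- Exchange the two blocks of a window. -/
def swapAt (M B : ℕ) (t : Str) : Str := fun a =>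
  if B + 1 * M ≤ a ∧ a < B + 8 * M then t (a + 7 * M)
    else if B + 8 * M ≤ a ∧ a < B + 15 * M then t (a - 7 * M) else t a

theorem swapAt_swapAt (M B : ℕ) (t : Str) : swapAt M B (swapAt M B t) = t := by
  funext a
  unfold swapAt
  split_ifs <;> first | rfl | (congr 1; omega)

theorem swapAt_update (M B : ℕ) (t : Str) (v : Bool) (hM : 16 ≤ M) :
    swapAt M B (update t (B + 3) v) = update (swapAt M B t) (B + 3) v := by
  funext a
  by_cases ha : a = B + 3
  · subst ha
    rw [update_self, swapAt, if_neg (by omega), if_neg (by omega), update_self]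
  · rw [update_of_ne ha]
    unfold swapAt
    split_ifs
    · rw [update_of_ne (by omega)]
    · rw [update_of_ne (by omega)]
    · rw [update_of_ne ha]

theorem run_swapList (hD : Fits D) (B : ℕ) (γ : Str) :
    run (gatesAt B (swapList D)) γ = if γ (B + 3) then swapAt (D.e .M) B γ else γ := by
  have h1 := hD.e_le
  set l : List (ℕ × ℕ) := (List.range (D.e .M)).flatMap fun q => (List.range 7).map fun s =>
    ((1 + s) * D.e .M + q, (8 + s) * D.e .M + q) with hl
  have e : swapList D = l.map fun p => .cswap 3 p.1 p.2 := by
    simp [swapList, hl, List.map_flatMap, comp_def]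
  -- Segment number and offset are determined by the address, so the pairs that are exchanged are
  -- disjoint.
  have inj : ∀ {x y q r : ℕ}, q < D.e .M → r < D.e .M → x * D.e .M + q = y * D.e .M + r →
      x = y ∧ q = r := by
    intro x y q r hq hr h
    have h3 : x = y := by
      have := congrArg (· / D.e .M) h
      have hM : 0 < D.e .M := by omega
      simpa [Nat.add_comm _ q, Nat.add_comm _ r, Nat.add_mul_div_right _ _ hM,
        Nat.div_eq_of_lt, hq, hr] using this
    subst h3
    exact ⟨rfl, by omega⟩
  have hmem : ∀ p ∈ l, ∃ q < D.e .M, ∃ s < 7,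
      p = ((1 + s) * D.e .M + q, (8 + s) * D.e .M + q) := by
    intro p hp
    simp only [hl, List.mem_flatMap, List.mem_range, List.mem_map] at hp
    obtain ⟨q, hq, s, hs, rfl⟩ := hp
    exact ⟨q, hq, s, hs, rfl⟩
  have hb : ∀ p ∈ l, p.1 ≠ p.2 ∧ 3 ≠ p.1 ∧ 3 ≠ p.2 := by
    intro p hp
    obtain ⟨q, hq, s, hs, rfl⟩ := hmem p hp
    simp only [add_mul]
    have : 0 ≤ s * D.e .M := Nat.zero_le _
    omega
  rw [e]
  split_ifs with h3
  · rw [run_cswaps_of_true B 3 hb γ h3]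
    obtain ⟨k1, k2⟩ := swapAll_spec (l := l.map fun p => (B + p.1, B + p.2)) (by
      rw [List.pairwise_map, hl, List.pairwise_flatMap]
      constructor
      · intro q hq
        rw [List.mem_range] at hq
        rw [List.pairwise_map]
        refine List.pairwise_lt_range.imp_of_mem fun {a b} ha hb hab => ?_
        rw [List.mem_range] at ha hb
        refine ⟨fun h => ?_, fun h => ?_, fun h => ?_, fun h => ?_⟩ <;>
          have := inj hq hq (Nat.add_left_cancel h) <;> omega
      · refine List.pairwise_lt_range.imp_of_mem fun {q r} hq hr hqr => ?_
        rw [List.mem_range] at hq hr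
        simp only [List.forall_mem_map, List.mem_range]
        intro a ha b hb
        refine ⟨fun h => ?_, fun h => ?_, fun h => ?_, fun h => ?_⟩ <;>
          have := inj hq hr (Nat.add_left_cancel h) <;> omega) (by
      simp only [List.forall_mem_map]
      intro p hp
      have := (hb p hp).1
      omega) γ
    simp only [List.forall_mem_map] at k1 k2
    have hdiv : ∀ r < 7 * D.e .M, ∃ s < 7, ∃ q < D.e .M, r = s * D.e .M + q ∧
        ((1 + s) * D.e .M + q, (8 + s) * D.e .M + q) ∈ l := by
      intro r hr
      have hq : r % D.e .M < D.e .M := Nat.mod_lt _ (by omega)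
      have hs : r / D.e .M < 7 := Nat.div_lt_of_lt_mul (by omega)
      refine ⟨r / D.e .M, hs, r % D.e .M, hq, (Nat.div_add_mod' _ _).symm, ?_⟩
      simp only [hl, List.mem_flatMap, List.mem_range, List.mem_map]
      exact ⟨_, hq, _, hs, rfl⟩
    funext a
    unfold swapAt
    split_ifs with c1 c2
    · obtain ⟨s, hs, q, hq, e1, hm⟩ := hdiv (a - (B + 1 * D.e .M)) (by omega)
      have := (k1 _ hm).1
      simp only [add_mul] at this
      rw [show B + (1 * D.e .M + s * D.e .M + q) = a by omega,
        show B + (8 * D.e .M + s * D.e .M + q) = a + 7 * D.e .M by omega] at this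
      exact this
    · obtain ⟨s, hs, q, hq, e1, hm⟩ := hdiv (a - (B + 8 * D.e .M)) (by omega)
      have := (k1 _ hm).2
      simp only [add_mul] at this
      rw [show B + (8 * D.e .M + s * D.e .M + q) = a by omega,
        show B + (1 * D.e .M + s * D.e .M + q) = a - 7 * D.e .M by omega] at this
      exact this
    · refine k2 a fun p hp => ?_
      obtain ⟨q, hq, s, hs, rfl⟩ := hmem p hp
      have : s * D.e .M ≤ 6 * D.e .M := Nat.mul_le_mul_right _ (by omega)
      simp only [add_mul]
      omega
  · exact run_cswaps_of_false B 3 hb γ (by simpa using h3)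

end

end StackProg

namespace StackProg

open Function

/-! ### The strings between the two groups of Hadamard gates -/

/-- The inner bits of a window are zero. -/
def Clean (M B : ℕ) (ζ : Str) : Prop := ∀ a, B < a → a < B + 20 * M → ζ a = false

/-- Put a vertex name at the beginning of the witness. -/
def setName (n : ℕ) (ζ : Str) (j : ℕ) : Str := fun a => if a < n then j.testBit a else ζ a

/-- The string after the loading of a vertex name, where the coins show two positions and a bit. -/
def label (D : StageData) (B : ℕ) (ζ : Str) (k k' : ℕ) (b : Bool) : Str := fun a =>
  if a < D.e .n then false
  else if B + 1 * D.e .M ≤ a ∧ a < B + 1 * D.e .M + D.e .n then ζ (a - (B + 1 * D.e .M))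
  else if B + 1 * D.e .M + D.e .n ≤ a ∧ a < B + 1 * D.e .M + D.e .n + D.e .pb then
    k.testBit (a - (B + 1 * D.e .M + D.e .n))
  else if B + 8 * D.e .M + D.e .n ≤ a ∧ a < B + 8 * D.e .M + D.e .n + D.e .pb then
    k'.testBit (a - (B + 8 * D.e .M + D.e .n))
  else if a = B + 3 then b else ζ a

/-- The string after the classical computation. -/
def result (D : StageData) (B : ℕ) (ζ : Str) (k k' : ℕ) (b : Bool) : Str :=
  run (gatesAt B (classicalList D)) (label D B ζ k k' b)

section

variable {D : StageData} {B k k' : ℕ} {ζ : Str} {b : Bool}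

theorem label_name (hD : Fits D) {q : ℕ} (hq : q < D.e .n) :
    label D B ζ k k' b (B + (1 * D.e .M + q)) = ζ q := by
  have := hD.e_le
  rw [label, if_neg (by omega), if_pos (by omega)]
  congr 1; omega

theorem label_pos₁ (hD : Fits D) {q : ℕ} (hq : q < D.e .pb) :
    label D B ζ k k' b (B + (1 * D.e .M + (D.e .n + q))) = k.testBit q := by
  have := hD.e_le
  rw [label, if_neg (by omega), if_neg (by omega), if_pos (by omega)]
  congr 1; omega

theorem label_pos₂ (hD : Fits D) {q : ℕ} (hq : q < D.e .pb) :
    label D B ζ k k' b (B + (8 * D.e .M + (D.e .n + q))) = k'.testBit q := by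
  have := hD.e_le
  rw [label, if_neg (by omega), if_neg (by omega), if_neg (by omega), if_pos (by omega)]
  congr 1; omega

theorem label_ctrl (hD : Fits D) (hB : D.e .M ≤ B) : label D B ζ k k' b (B + 3) = b := by
  have := hD.e_le
  rw [label, if_neg (by omega), if_neg (by omega), if_neg (by omega), if_neg (by omega),
    if_pos rfl]

theorem label_zero (hD : Fits D) (hB : D.e .M ≤ B) (hζ : Clean (D.e .M) B ζ) {r : ℕ}
    (hr : 0 < r ∧ r < 20 * D.e .M) (h3 : r ≠ 3)
    (h1 : ¬ (1 * D.e .M ≤ r ∧ r < 1 * D.e .M + D.e .n + D.e .pb))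
    (h2 : ¬ (8 * D.e .M + D.e .n ≤ r ∧ r < 8 * D.e .M + D.e .n + D.e .pb)) :
    label D B ζ k k' b (B + r) = false := by
  have := hD.e_le
  rw [label, if_neg (by omega), if_neg (by omega), if_neg (by omega), if_neg (by omega),
    if_neg (by omega)]
  exact hζ _ (by omega) (by omega)

/-- The excluded addresses are the inputs that have to stay zero: the digits of the position zero,
the higher digits of the position one and the start of the parity computation. -/
theorem not_blockTgt (hD : Fits D) {r : ℕ}
    (hr : r = 5 * D.e .M ∨ (∃ t < D.e .pb, r = 1 * D.e .M + (D.e .n + t)) ∨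
      ∃ t < D.e .pb, 0 < t ∧ r = 2 * D.e .M + (D.e .n + t))
    (hl : D.outs.length = D.e .n) : ¬ BlockTgt D r := by
  have h1 := hD.e_le
  have h2 := hD.bits
  have he : ∀ o, ∀ x ∈ evalList D o, ∃ m < D.recs.length, x.tgt = o + D.e .n + D.e .pb + m := by
    intro o x hx
    simp only [evalList, List.mem_map, List.mem_range] at hx
    obtain ⟨m, hm, rfl⟩ := hx
    refine ⟨m, hm, ?_⟩
    unfold selectType
    split_ifs <;> rfl
  have key : ∀ x ∈ blockList D 0, x.tgt ≠ r := by
    simp only [blockList, copyList, List.forall_mem_append, List.forall_mem_map, List.mem_range,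
      List.mem_singleton, forall_eq, hl, h2]
    refine ⟨fun x hx => ?_, fun q hq => ?_, fun x hx => ?_, fun q hq => ?_, ?_, fun x hx => ?_, ?_,
      fun q hq => ?_, ?_, fun q hq => ?_, fun q hq => ?_, ?_⟩
    case refine_1 => obtain ⟨m, hm, e⟩ := he _ x hx; omega
    case refine_3 => obtain ⟨m, hm, e⟩ := he _ x hx; omega
    case refine_6 => obtain ⟨m, hm, e⟩ := he _ x hx; omega
    case refine_8 => split_ifs <;> simp only [Instr.tgt] <;> omega
    all_goals simp only [Instr.tgt]; omega
  rintro ⟨x, hx, e⟩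
  exact key x hx e

end

namespace Represents

variable {D : StageData} {I : GraphInput} {V : Finset ℕ} {G : SimpleGraph V} {B k k' : ℕ} {ζ : Str}
  {b : Bool}

theorem label_tgt (h : Represents D I V G) (hB : D.e .M ≤ B) (hζ : Clean (D.e .M) B ζ) {r : ℕ}
    (hr : RoundTgt D r) : label D B ζ k k' b (B + r) = false := by
  have h0 := h.presents.fits.e_le
  have h1 := h.roundTgt_bound hr
  refine label_zero h.presents.fits hB hζ (by omega) (by omega) (by omega) ?_
  rintro ⟨h2, h3⟩
  rw [show r = 8 * D.e .M + (r - 8 * D.e .M) by omega, h.roundTgt_snd (by omega)] at hr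
  rcases hr with hr | hr
  · omega
  · have := h.blockTgt_bound hr
    omega

variable (h : Represents D I V G) (hB : D.e .M ≤ B) (hζ : Clean (D.e .M) B ζ)

include h hB hζ

theorem scratch : label D B ζ k k' b (B + 1) = false ∧ label D B ζ k k' b (B + 2) = false := by
  have h0 := h.presents.fits.e_le
  exact ⟨label_zero h.presents.fits hB hζ (by omega) (by omega) (by omega) (by omega),
    label_zero h.presents.fits hB hζ (by omega) (by omega) (by omega) (by omega)⟩

theorem result_eqs : RoundEqs D fun a => result D B ζ k k' b (B + a) :=
  solves_classicalList.1 (h.increasing.solves_run (h.scratch hB hζ).1 (h.scratch hB hζ).2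
    fun x hx => h.label_tgt hB hζ ⟨x, hx, rfl⟩)

theorem result_of_not_tgt {a : ℕ} (ha : ∀ r, RoundTgt D r → a ≠ B + r) :
    result D B ζ k k' b a = label D B ζ k k' b a :=
  h.increasing.run_of_forall_ne (h.scratch hB hζ).1 (h.scratch hB hζ).2
    (fun x hx => h.label_tgt hB hζ ⟨x, hx, rfl⟩) fun x hx => ha _ ⟨x, hx, rfl⟩

/-- Uniqueness of the solution: a string can be identified as a result by checking the equations and
the bits that no instruction changes, without running the circuit. This is how the partner of a
matched string is found. -/
theorem result_eq_of {T : Str} (hT : RoundEqs D fun a => T (B + a))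
    (hag : ∀ a, (∀ r, RoundTgt D r → a ≠ B + r) → T a = label D B ζ k k' b a) :
    result D B ζ k k' b = T :=
  h.increasing.run_eq (h.scratch hB hζ).1 (h.scratch hB hζ).2
    (fun x hx => h.label_tgt hB hζ ⟨x, hx, rfl⟩) (solves_classicalList.2 hT) fun a ha =>
      hag a fun r ⟨x, hx, e⟩ => by rw [← e]; exact ha x hx

theorem result_fst {t : ℕ} (ht : t < 7 * D.e .M) (hn : ¬ BlockTgt D t) :
    result D B ζ k k' b (B + (1 * D.e .M + t)) = label D B ζ k k' b (B + (1 * D.e .M + t)) :=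
  h.result_of_not_tgt hB hζ fun r hr e => hn ((h.roundTgt_fst ht).1 (by
    rwa [Nat.add_left_cancel e]))

theorem result_snd {t : ℕ} (ht : t < 7 * D.e .M) (hn : ¬ BlockTgt D t) (hn' : D.e .n ≤ t) :
    result D B ζ k k' b (B + (8 * D.e .M + t)) = label D B ζ k k' b (B + (8 * D.e .M + t)) :=
  h.result_of_not_tgt hB hζ fun r hr e => by
    rw [← Nat.add_left_cancel e, h.roundTgt_snd ht] at hr
    rcases hr with hr | hr
    · omega
    · exact hn hr

theorem zeroConsts_fst : ZeroConsts D fun a => result D B ζ k k' b (B + (1 * D.e .M + a)) := by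
  have h0 := h.presents.fits.e_le
  constructor
  · intro t ht
    rw [h.result_fst hB hζ (by omega)
      (not_blockTgt h.presents.fits (Or.inr (Or.inl ⟨t, ht, rfl⟩)) h.outs_length)]
    exact label_zero h.presents.fits hB hζ (by omega) (by omega) (by omega) (by omega)
  · intro t ht ht0
    rw [h.result_fst hB hζ (by omega)
      (not_blockTgt h.presents.fits (Or.inr (Or.inr ⟨t, ht, ht0, rfl⟩)) h.outs_length)]
    exact label_zero h.presents.fits hB hζ (by omega) (by omega) (by omega) (by omega)
  · rw [h.result_fst hB hζ (by omega) (not_blockTgt h.presents.fits (Or.inl rfl) h.outs_length)]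
    exact label_zero h.presents.fits hB hζ (by omega) (by omega) (by omega) (by omega)

theorem zeroConsts_snd : ZeroConsts D fun a => result D B ζ k k' b (B + (8 * D.e .M + a)) := by
  have h0 := h.presents.fits.e_le
  constructor
  · intro t ht
    rw [h.result_snd hB hζ (by omega)
      (not_blockTgt h.presents.fits (Or.inr (Or.inl ⟨t, ht, rfl⟩)) h.outs_length) (by omega)]
    exact label_zero h.presents.fits hB hζ (by omega) (by omega) (by omega) (by omega)
  · intro t ht ht0
    rw [h.result_snd hB hζ (by omega)
      (not_blockTgt h.presents.fits (Or.inr (Or.inr ⟨t, ht, ht0, rfl⟩)) h.outs_length) (by omega)]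
    exact label_zero h.presents.fits hB hζ (by omega) (by omega) (by omega) (by omega)
  · rw [h.result_snd hB hζ (by omega) (not_blockTgt h.presents.fits (Or.inl rfl) h.outs_length)
      (by omega)]
    exact label_zero h.presents.fits hB hζ (by omega) (by omega) (by omega) (by omega)

theorem result_name {q : ℕ} (hq : q < D.e .n) :
    result D B ζ k k' b (B + (1 * D.e .M + q)) = ζ q := by
  have h0 := h.presents.fits.e_le
  rw [h.result_fst hB hζ (by omega) fun hb => by have := h.blockTgt_bound hb; omega]
  exact label_name h.presents.fits hq

theorem value_name₁ : bitsValue I.n (fun a => result D B ζ k k' b (B + (1 * D.e .M + a)))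
    = bitsValue I.n ζ :=
  bitsValue_congr fun q hq => h.result_name hB hζ (by rw [h.presents.n]; exact hq)

theorem value_pos₁ (hk : k < 2 ^ I.posBits) : bitsValue I.posBits
    (fun t => result D B ζ k k' b (B + (1 * D.e .M + (I.n + t)))) = k := by
  have h0 := h.presents.fits.e_le
  rw [bitsValue_eq_iff hk]
  intro t ht
  rw [← h.presents.pb] at ht
  rw [← h.presents.n, h.result_fst hB hζ (by omega) fun hb => by
    have := h.blockTgt_bound hb; omega]
  exact label_pos₁ h.presents.fits ht

theorem value_pos₂ (hk : k' < 2 ^ I.posBits) : bitsValue I.posBits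
    (fun t => result D B ζ k k' b (B + (8 * D.e .M + (I.n + t)))) = k' := by
  have h0 := h.presents.fits.e_le
  rw [bitsValue_eq_iff hk]
  intro t ht
  rw [← h.presents.pb] at ht
  rw [← h.presents.n, h.result_snd hB hζ (by omega) (fun hb => by
    have := h.blockTgt_bound hb; omega) (by omega)]
  exact label_pos₂ h.presents.fits ht

theorem result_adj₁ (hk : k < 2 ^ I.posBits) {q : ℕ} (hq : q < I.n) :
    result D B ζ k k' b (B + (1 * D.e .M + D.outs.getD q 0))
      = (I.adj (bitsValue I.n ζ) k).testBit q := by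
  have := (h.result_eqs hB hζ (k := k) (k' := k') (b := b)).fst.eval.adj h.presents
    h.describes.wellFormed hq
  rw [h.value_name₁ hB hζ, h.value_pos₁ hB hζ hk] at this
  exact this

theorem value_name₂ (hk : k < 2 ^ I.posBits) :
    bitsValue I.n (fun a => result D B ζ k k' b (B + (8 * D.e .M + a)))
      = I.adj (bitsValue I.n ζ) k := by
  rw [bitsValue_eq_iff (adj_lt h.describes.wellFormed _ _)]
  intro q hq
  rw [← h.result_adj₁ hB hζ (k' := k') (b := b) hk hq]
  exact (h.result_eqs hB hζ).link q (by rw [h.outs_length, h.presents.n]; exact hq)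

theorem result_adj₂ (hk : k < 2 ^ I.posBits) (hk' : k' < 2 ^ I.posBits) {q : ℕ} (hq : q < I.n) :
    result D B ζ k k' b (B + (8 * D.e .M + D.outs.getD q 0))
      = (I.adj (I.adj (bitsValue I.n ζ) k) k').testBit q := by
  have := (h.result_eqs hB hζ (k := k) (k' := k') (b := b)).snd.eval.adj h.presents
    h.describes.wellFormed hq
  rw [h.value_name₂ hB hζ hk, h.value_pos₂ hB hζ hk'] at this
  exact this

theorem mark₁_iff : result D B ζ k k' b (B + 7 * D.e .M) = true ↔ bitsValue I.n ζ ∈ V := by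
  have := h.mark (h.result_eqs hB hζ (k := k) (k' := k') (b := b)).fst (h.zeroConsts_fst hB hζ)
  rw [h.value_name₁ hB hζ] at this
  rw [← this, show 7 * D.e .M = 1 * D.e .M + 6 * D.e .M by ring]

theorem mark₂_iff (hk : k < 2 ^ I.posBits) :
    result D B ζ k k' b (B + 14 * D.e .M) = true ↔ I.adj (bitsValue I.n ζ) k ∈ V := by
  have := h.mark (h.result_eqs hB hζ (k := k) (k' := k') (b := b)).snd (h.zeroConsts_snd hB hζ)
  rw [h.value_name₂ hB hζ hk] at this
  rw [← this, show 14 * D.e .M = 8 * D.e .M + 6 * D.e .M by ring]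

theorem vertex_iff :
    result D B ζ k k' b (B + (17 * D.e .M + 4)) = true ↔ bitsValue I.n ζ ∈ V := by
  have := (h.result_eqs hB hζ (k := k) (k' := k') (b := b)).flag₄
  rw [this, h.mark₁_iff hB hζ]

/-- The string is matched when it describes an edge seen from both ends: k is the place of w in the
list of v, and k' the place of v in the list of w. -/
theorem matched_iff (hk : k < 2 ^ I.posBits) (hk' : k' < 2 ^ I.posBits) :
    result D B ζ k k' b (B + (17 * D.e .M + 3)) = true ↔
      bitsValue I.n ζ ∈ V ∧ I.adj (bitsValue I.n ζ) k ∈ V ∧ k < I.S ∧ k' < I.S ∧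
        I.adj (I.adj (bitsValue I.n ζ) k) k' = bitsValue I.n ζ := by
  have he := h.result_eqs hB hζ (k := k) (k' := k') (b := b)
  have hS := h.describes.access.two_le
  have l1 := he.fst.le_iff h.presents (by omega)
  have l2 := he.snd.le_iff h.presents (by omega)
  rw [h.value_pos₁ hB hζ hk, show 1 * D.e .M + (3 * D.e .M + D.e .pb) = 4 * D.e .M + D.e .pb
    by ring] at l1
  rw [h.value_pos₂ hB hζ hk', show 8 * D.e .M + (3 * D.e .M + D.e .pb) = 11 * D.e .M + D.e .pb
    by ring] at l2
  have heq : result D B ζ k k' b (B + (16 * D.e .M + D.e .n)) = true ↔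
      I.adj (I.adj (bitsValue I.n ζ) k) k' = bitsValue I.n ζ := by
    have key : ∀ q ≤ I.n, result D B ζ k k' b (B + (16 * D.e .M + q)) = true ↔
        ∀ t < q, ζ t = (I.adj (I.adj (bitsValue I.n ζ) k) k').testBit t := by
      intro q hq
      induction q with
      | zero => simpa using he.eq_zero
      | succ q ih =>
        have e1 := he.eq_succ q (by rw [h.presents.n]; omega)
        have e2 := he.diff q (by rw [h.outs_length, h.presents.n]; omega)
        rw [h.result_adj₂ hB hζ hk hk' (by omega),
          h.result_name hB hζ (by rw [h.presents.n]; omega)] at e2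
        rw [e1, e2, Bool.and_eq_true, ih (by omega)]
        simp only [Bool.not_eq_true', bne_eq_false_iff_eq, Nat.lt_succ_iff_lt_or_eq]
        constructor
        · rintro ⟨h1, h2⟩ t (ht | rfl)
          · exact h1 t ht
          · exact h2.symm
        · exact fun h1 => ⟨fun t ht => h1 t (Or.inl ht), (h1 q (Or.inr rfl)).symm⟩
    rw [h.presents.n, key _ le_rfl, eq_comm, bitsValue_eq_iff (adj_lt h.describes.wellFormed _ _)]
  have f0 := he.flag₀
  have f1 := he.flag₁
  have f2 := he.flag₂
  have f3 := he.flag₃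
  rw [f3, f2, f1, f0, l1, l2, Bool.and_eq_true, Bool.and_eq_true, Bool.and_eq_true,
    Bool.and_eq_true, heq, h.mark₁_iff hB hζ, h.mark₂_iff hB hζ hk, decide_eq_true_eq,
    decide_eq_true_eq]
  tauto

end Represents

end StackProg

/-! ### The pairing of matched strings under the exchange of the blocks -/

namespace StackProg

open Function

namespace Represents

variable {D : StageData} {I : GraphInput} {V : Finset ℕ} {G : SimpleGraph V} {B k k' : ℕ} {ζ : Str}
  {b : Bool}

theorem clean_setName {M n j : ℕ} (hB : n ≤ B) (hζ : Clean M B ζ) : Clean M B (setName n ζ j) :=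
  fun a h1 h2 => by rw [setName, if_neg (by omega)]; exact hζ a h1 h2

variable (h : Represents D I V G) (hB : D.e .M ≤ B) (hζ : Clean (D.e .M) B ζ)

include h hB hζ

/-- The partner of a matched string. -/
theorem result_partner (hk : k < 2 ^ I.posBits)
    (hm : result D B ζ k k' b (B + (17 * D.e .M + 3)) = true) :
    result D B (setName I.n ζ (I.adj (bitsValue I.n ζ) k)) k' k (!b)
      = update (swapAt (D.e .M) B (result D B ζ k k' b)) (B + 3) (!b) := by
  have h0 := h.presents.fits.e_le
  have hn := h.presents.n
  set T := result D B ζ k k' b with hT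
  have hc : T (B + 3) = b := by
    rw [hT, h.result_of_not_tgt hB hζ fun r hr e => by have := h.roundTgt_bound hr; omega]
    exact label_ctrl h.presents.fits hB
  -- Relative to the base, the exchange of the blocks with flipped control bit is the operation
  -- under which the equations were shown to be stable.
  have hx : (fun a => update (swapAt (D.e .M) B T) (B + 3) (!b) (B + a))
      = exchange (D.e .M) fun a => T (B + a) := by
    funext a
    unfold exchange
    by_cases h3 : a = 3
    · subst h3; simp [hc]
    · rw [if_neg h3, update_of_ne (by omega)]
      unfold swapAt
      split_ifs <;> first | rfl | (exfalso; omega) | (congr 1; omega)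
  refine h.result_eq_of hB (clean_setName (by omega) hζ) ?_ fun a ha => ?_
  · rw [hx]
    exact (h.result_eqs hB hζ).exchange h.presents.fits h.outs_length hm
  -- The second block starts with the name of the neighbour, which is the first name of the partner.
  -- The unchanged bits are now compared one region at a time: control bit, first block, second
  -- block, rest.
  · have hj : ∀ q < D.e .n, T (B + (8 * D.e .M + q))
        = setName I.n ζ (I.adj (bitsValue I.n ζ) k) q := by
      intro q hq
      have := h.value_name₂ hB hζ (k' := k') (b := b) hk
      rw [bitsValue_eq_iff (adj_lt h.describes.wellFormed _ _)] at this
      rw [setName, if_pos (by omega)]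
      exact this q (by omega)
    have hp : ∀ a, (∀ r, RoundTgt D r → a ≠ B + r) → T a = label D B ζ k k' b a :=
      fun a ha => h.result_of_not_tgt hB hζ ha
    by_cases c0 : a = B + 3
    · subst c0
      rw [update_self, label_ctrl h.presents.fits hB]
    rw [update_of_ne c0]
    by_cases c1 : B + 1 * D.e .M ≤ a ∧ a < B + 8 * D.e .M
    · obtain ⟨t, rfl⟩ : ∃ t, a = B + (1 * D.e .M + t) :=
        ⟨a - (B + 1 * D.e .M), by omega⟩
      have ht : t < 7 * D.e .M := by omega
      have hnt : ¬ BlockTgt D t := fun hb => ha _ ((h.roundTgt_fst ht).2 hb) rfl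
      rw [swapAt, if_pos c1, show B + (1 * D.e .M + t) + 7 * D.e .M = B + (8 * D.e .M + t) by ring]
      by_cases c2 : t < D.e .n
      · rw [hj t c2, label_name h.presents.fits c2]
      · rw [hT, h.result_snd hB hζ ht hnt (by omega)]
        by_cases c3 : t < D.e .n + D.e .pb
        · obtain ⟨q, rfl⟩ : ∃ q, t = D.e .n + q := ⟨t - D.e .n, by omega⟩
          rw [label_pos₂ h.presents.fits (by omega), label_pos₁ h.presents.fits (by omega)]
        · rw [label_zero h.presents.fits hB hζ (by omega) (by omega) (by omega) (by omega),
            label_zero h.presents.fits hB (clean_setName (by omega) hζ) (by omega) (by omega)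
              (by omega) (by omega)]
    by_cases c2 : B + 8 * D.e .M ≤ a ∧ a < B + 15 * D.e .M
    · obtain ⟨t, rfl⟩ : ∃ t, a = B + (8 * D.e .M + t) :=
        ⟨a - (B + 8 * D.e .M), by omega⟩
      have ht : t < 7 * D.e .M := by omega
      have hnt : ¬ (t < D.e .n ∨ BlockTgt D t) := fun hb => ha _ ((h.roundTgt_snd ht).2 hb) rfl
      rw [not_or] at hnt
      rw [swapAt, if_neg c1, if_pos c2,
        show B + (8 * D.e .M + t) - 7 * D.e .M = B + (1 * D.e .M + t) by omega, hT,
        h.result_fst hB hζ ht hnt.2]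
      by_cases c3 : t < D.e .n + D.e .pb
      · obtain ⟨q, rfl⟩ : ∃ q, t = D.e .n + q := ⟨t - D.e .n, by omega⟩
        rw [label_pos₂ h.presents.fits (by omega), label_pos₁ h.presents.fits (by omega)]
      · rw [label_zero h.presents.fits hB hζ (by omega) (by omega) (by omega) (by omega),
          label_zero h.presents.fits hB (clean_setName (by omega) hζ) (by omega) (by omega)
            (by omega) (by omega)]
    · rw [swapAt, if_neg c1, if_neg c2, hp a ha]
      -- Outside the window the two labels differ at most in the name bits of the witness, and these
      -- have been emptied by loading.
      unfold label setName
      split_ifs <;> first | rfl | (exfalso; omega)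

omit hB hζ in
/-- The string after the controlled swap. -/
theorem run_swap_result : run (gatesAt B (classicalList D ++ swapList D)) (label D B ζ k k' b)
    = if result D B ζ k k' b (B + 3) then swapAt (D.e .M) B (result D B ζ k k' b)
      else result D B ζ k k' b := by
  rw [gatesAt_append, run_append, run_swapList h.presents.fits]
  rfl

theorem result_ctrl : result D B ζ k k' b (B + 3) = b := by
  have h0 := h.presents.fits.e_le
  rw [h.result_of_not_tgt hB hζ fun r hr e => by have := h.roundTgt_bound hr; omega]
  exact label_ctrl h.presents.fits hB

theorem run_swap_label : run (gatesAt B (classicalList D ++ swapList D)) (label D B ζ k k' b)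
    = if b then swapAt (D.e .M) B (result D B ζ k k' b) else result D B ζ k k' b := by
  rw [h.run_swap_result, h.result_ctrl hB hζ]

theorem run_of_high {a : ℕ} (ha : a < B + 1 * D.e .M ∨ B + 15 * D.e .M ≤ a) :
    run (gatesAt B (classicalList D ++ swapList D)) (label D B ζ k k' b) a
      = result D B ζ k k' b a := by
  rw [h.run_swap_label hB hζ]
  split_ifs
  · rw [swapAt, if_neg (by omega), if_neg (by omega)]
  · rfl

theorem run_zero {r : ℕ} (hr : r = 1 ∨ r = 2 ∨ 17 * D.e .M + 5 ≤ r) (hr' : r < 20 * D.e .M) :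
    run (gatesAt B (classicalList D ++ swapList D)) (label D B ζ k k' b) (B + r) = false := by
  have h0 := h.presents.fits.e_le
  rw [h.run_of_high hB hζ (by omega),
    h.result_of_not_tgt hB hζ fun r hr e => by have := h.roundTgt_bound hr; omega]
  exact label_zero h.presents.fits hB hζ (by omega) (by omega) (by omega) (by omega)

theorem run_vertex_iff :
    run (gatesAt B (classicalList D ++ swapList D)) (label D B ζ k k' b) (B + (17 * D.e .M + 4))
      = true ↔ bitsValue I.n ζ ∈ V := by
  rw [h.run_of_high hB hζ (by omega), h.vertex_iff hB hζ]

theorem run_matched_iff (hk : k < 2 ^ I.posBits) (hk' : k' < 2 ^ I.posBits) :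
    run (gatesAt B (classicalList D ++ swapList D)) (label D B ζ k k' b) (B + (17 * D.e .M + 3))
      = true ↔ bitsValue I.n ζ ∈ V ∧ I.adj (bitsValue I.n ζ) k ∈ V ∧ k < I.S ∧ k' < I.S ∧
        I.adj (I.adj (bitsValue I.n ζ) k) k' = bitsValue I.n ζ := by
  rw [h.run_of_high hB hζ (by omega), h.matched_iff hB hζ hk hk']

theorem run_ctrl :
    run (gatesAt B (classicalList D ++ swapList D)) (label D B ζ k k' b) (B + 3) = b := by
  have h0 := h.presents.fits.e_le
  rw [h.run_of_high hB hζ (by omega), h.result_ctrl hB hζ]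

/-- Of a matched string and its partner exactly one has the control bit set. The controlled swap
exchanges the blocks of that one, after which the two strings differ only in the control bit, and so
can interfere. -/
theorem run_partner (hk : k < 2 ^ I.posBits)
    (hm : run (gatesAt B (classicalList D ++ swapList D)) (label D B ζ k k' b)
      (B + (17 * D.e .M + 3)) = true) :
    run (gatesAt B (classicalList D ++ swapList D))
      (label D B (setName I.n ζ (I.adj (bitsValue I.n ζ) k)) k' k (!b))
      = update (run (gatesAt B (classicalList D ++ swapList D)) (label D B ζ k k' b)) (B + 3)
        (!b) := by
  have h0 := h.presents.fits.e_le
  have hn := h.presents.n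
  rw [h.run_of_high hB hζ (by omega)] at hm
  rw [h.run_swap_label hB hζ, h.run_swap_label hB (clean_setName (by omega) hζ),
    h.result_partner hB hζ hk hm]
  cases b
  · simp only [Bool.not_false, if_true, Bool.false_eq_true, if_false]
    rw [swapAt_update _ _ _ _ (by omega), swapAt_swapAt]
  · simp

end Represents

end StackProg

namespace StackProg

open Function

/-! ### The state after the first Hadamard gates -/

theorem reversible_gatesAt (B : ℕ) {l : List (Instr ℕ)} (hl : ∀ x ∈ l, ∀ t, x ≠ .had t) :
    ∀ g ∈ gatesAt B l, g.Reversible := by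
  intro g hg
  simp only [gatesAt, gatesOf, List.mem_map, List.mem_flatMap] at hg
  obtain ⟨a, ⟨x, hx, ha⟩, rfl⟩ := hg
  have hx := hl x hx
  cases x with
  | bool c₀ c₁ c₂ c₃ i j t =>
    simp only [Instr.gates, List.mem_append, List.mem_cons, List.not_mem_nil, or_false,
      List.mem_ite_nil_right] at ha
    rcases ha with ((((((rfl | rfl) | ⟨-, rfl⟩) | ⟨-, rfl⟩) | ⟨-, rfl⟩) | ⟨-, rfl⟩) | rfl | rfl) <;>
      trivial
  | had t => exact absurd rfl (hx t)
  | swap i t =>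
    simp only [Instr.gates, List.mem_cons, List.not_mem_nil, or_false] at ha
    rcases ha with rfl | rfl | rfl <;> trivial
  | cswap b i t =>
    simp only [Instr.gates, List.mem_cons, List.not_mem_nil, or_false] at ha
    rcases ha with rfl | rfl | rfl <;> trivial

theorem gatesAt_had (B : ℕ) (l : List ℕ) :
    gatesAt B (l.map Instr.had) = (l.map (B + ·)).map RGate.had := by
  induction l with
  | nil => rfl
  | cons a l ih => rw [List.map_cons, gatesAt_cons, ih]; rfl

theorem loadList_ne_had (D : StageData) : ∀ x ∈ loadList D, ∀ t, x ≠ .had t := by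
  simp [loadList]

theorem swapList_ne_had (D : StageData) : ∀ x ∈ swapList D, ∀ t, x ≠ .had t := by
  simp only [swapList, List.mem_flatMap, List.mem_map]
  rintro x ⟨q, -, s, -, rfl⟩ t
  simp

theorem flagList_ne_had (D : StageData) : ∀ x ∈ flagList D, ∀ t, x ≠ .had t := by
  simp [flagList]

theorem loadAt_loadAt {D : StageData} {B : ℕ} (hB : D.e .n ≤ B) (γ : Str) :
    loadAt D B (loadAt D B γ) = γ := by
  funext a
  unfold loadAt
  split_ifs <;> first | rfl | (exfalso; omega) | (congr 1; omega)

theorem mem_coinList {D : StageData} {a : ℕ} : a ∈ coinList D ↔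
    (1 * D.e .M + D.e .n ≤ a ∧ a < 1 * D.e .M + D.e .n + D.e .pb) ∨
    (8 * D.e .M + D.e .n ≤ a ∧ a < 8 * D.e .M + D.e .n + D.e .pb) ∨ a = 3 := by
  simp only [coinList, List.mem_append, List.mem_flatMap, List.mem_range, List.mem_cons,
    List.not_mem_nil, or_false]
  constructor
  · rintro (⟨q, hq, rfl | rfl⟩ | rfl)
    · left; omega
    · right; left; omega
    · right; right; rfl
  · rintro (h | h | rfl)
    · exact Or.inl ⟨a - (1 * D.e .M + D.e .n), by omega, Or.inl (by omega)⟩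
    · exact Or.inl ⟨a - (8 * D.e .M + D.e .n), by omega, Or.inr (by omega)⟩
    · exact Or.inr rfl

theorem nodup_coinList {D : StageData} (hD : Fits D) : (coinList D).Nodup := by
  have h := hD.e_le
  rw [coinList, List.nodup_append]
  refine ⟨?_, by simp, ?_⟩
  · rw [List.nodup_flatMap]
    refine ⟨fun q hq => ?_, ?_⟩
    · rw [List.mem_range] at hq
      simp only [List.nodup_cons, List.mem_singleton, List.not_mem_nil, not_false_eq_true,
        List.nodup_nil, and_true]
      omega
    · refine List.pairwise_lt_range.imp_of_mem fun {q r} hq hr hqr => ?_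
      rw [List.mem_range] at hq hr
      simp only [onFun, List.disjoint_cons_left, List.mem_cons, List.not_mem_nil, or_false,
        List.disjoint_nil_left, and_true]
      omega
  · simp only [List.mem_flatMap, List.mem_range, List.mem_cons, List.not_mem_nil, or_false]
    rintro a ⟨q, hq, h1⟩ b rfl
    omega

theorem length_coinList (D : StageData) : (coinList D).length = 2 * D.e .pb + 1 := by
  simp [coinList, mul_comm]

/-- The state after the first Hadamard gates. -/
noncomputable def spread (D : StageData) (B : ℕ) (ψ : Str → ℂ) : Str → ℂ :=
  applyAll (gatesAt B (loadList D ++ (coinList D).map Instr.had)) ψ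

section

variable {D : StageData} {B : ℕ} {ψ : Str → ℂ}

theorem run_reverse_loadList (hD : Fits D) (hB : D.e .M ≤ B) (γ : Str) :
    run (gatesAt B (loadList D)).reverse γ = loadAt D B γ := by
  have h := hD.e_le
  have hd : ∀ g ∈ gatesAt B (loadList D), g.Distinct := fun g hg =>
    (inside_gatesAt (by omega) hB (fun x hx => ok_roundList hD x (by simp [roundList, hx])) g hg).1
  have := run_reverse_run hd (loadAt D B γ)
  rwa [run_loadList hD hB, loadAt_loadAt (by omega)] at this

/-- On a clean state the coins are zero, so the Hadamard gates spread each string uniformly. The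
amplitude is that of the string with the coins reset and the name moved back to the witness. -/
theorem spread_eq (hD : Fits D) (hB : D.e .M ≤ B) (hψ : ∀ ζ, ψ ζ ≠ 0 → Clean (D.e .M) B ζ)
    (γ : Str) : spread D B ψ γ
      = ψ (loadAt D B fun a => if a ∈ (coinList D).map (B + ·) then false else γ a)
        / (Real.sqrt 2 : ℂ) ^ (2 * D.e .pb + 1) := by
  have h := hD.e_le
  have e : ∀ γ, applyAll (gatesAt B (loadList D)) ψ γ = ψ (loadAt D B γ) := fun γ => by
    rw [applyAll_eq_run (reversible_gatesAt B (loadList_ne_had D)), run_reverse_loadList hD hB]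
  rw [spread, gatesAt_append, applyAll_append, gatesAt_had, applyAll_had, e, List.length_map,
    length_coinList]
  · exact (nodup_coinList hD).map fun a b h => Nat.add_left_cancel h
  · intro γ hγ q hq
    rw [e] at hγ
    obtain ⟨a, ha, rfl⟩ := List.mem_map.1 hq
    rw [mem_coinList] at ha
    have := hψ _ hγ (B + a) (by omega) (by omega)
    rwa [loadAt, if_neg (by omega), if_neg (by omega)] at this

theorem spread_label (hD : Fits D) (hB : D.e .M ≤ B) (hψ : ∀ ζ, ψ ζ ≠ 0 → Clean (D.e .M) B ζ)
    {ζ : Str} (hζ : Clean (D.e .M) B ζ) (k k' : ℕ) (b : Bool) :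
    spread D B ψ (label D B ζ k k' b) = ψ ζ / (Real.sqrt 2 : ℂ) ^ (2 * D.e .pb + 1) := by
  have h := hD.e_le
  rw [spread_eq hD hB hψ]
  congr 2
  funext a
  have hm : ∀ c, (c ∈ (coinList D).map (B + ·)) ↔
      (B + 1 * D.e .M + D.e .n ≤ c ∧ c < B + 1 * D.e .M + D.e .n + D.e .pb) ∨
      (B + 8 * D.e .M + D.e .n ≤ c ∧ c < B + 8 * D.e .M + D.e .n + D.e .pb) ∨ c = B + 3 := by
    intro c
    simp only [List.mem_map, mem_coinList]
    constructor
    · rintro ⟨a, ha, rfl⟩; omega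
    · intro hc; exact ⟨c - B, by omega, by omega⟩
  have hz : ∀ c, B < c → c < B + 20 * D.e .M → ζ c = false := hζ
  simp only [loadAt, hm]
  by_cases c1 : a < D.e .n
  · rw [if_pos c1, if_neg (by omega), label_name hD c1]
  rw [if_neg c1]
  by_cases c2 : B + 1 * D.e .M ≤ a ∧ a < B + 1 * D.e .M + D.e .n
  · rw [if_pos c2, if_neg (by omega), label, if_pos (by omega), hz a (by omega) (by omega)]
  rw [if_neg c2]
  split_ifs with c3
  · exact (hz a (by omega) (by omega)).symm
  · rw [label, if_neg c1, if_neg c2, if_neg (by omega), if_neg (by omega), if_neg (by omega)]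

/-- The data of the label are recovered by reading the positions and the control bit off the coins,
and the original string off the rest. It is clean because it has non-zero amplitude. -/
theorem exists_label_of_spread (hD : Fits D) (hB : D.e .M ≤ B)
    (hψ : ∀ ζ, ψ ζ ≠ 0 → Clean (D.e .M) B ζ) {γ : Str} (hγ : spread D B ψ γ ≠ 0) :
    ∃ ζ k k' b, Clean (D.e .M) B ζ ∧ k < 2 ^ D.e .pb ∧ k' < 2 ^ D.e .pb ∧
      γ = label D B ζ k k' b := by
  have h := hD.e_le
  rw [spread_eq hD hB hψ] at hγ
  set ζ := loadAt D B fun a => if a ∈ (coinList D).map (B + ·) then false else γ a with hζ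
  have hc : Clean (D.e .M) B ζ := hψ ζ fun h0 => hγ (by rw [h0, zero_div])
  have hm : ∀ c, (c ∈ (coinList D).map (B + ·)) ↔
      (B + 1 * D.e .M + D.e .n ≤ c ∧ c < B + 1 * D.e .M + D.e .n + D.e .pb) ∨
      (B + 8 * D.e .M + D.e .n ≤ c ∧ c < B + 8 * D.e .M + D.e .n + D.e .pb) ∨ c = B + 3 := by
    intro c
    simp only [List.mem_map, mem_coinList]
    constructor
    · rintro ⟨a, ha, rfl⟩; omega
    · intro hc; exact ⟨c - B, by omega, by omega⟩
  simp only [hm] at hζ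
  refine ⟨ζ, bitsValue (D.e .pb) fun t => γ (B + 1 * D.e .M + D.e .n + t),
    bitsValue (D.e .pb) fun t => γ (B + 8 * D.e .M + D.e .n + t), γ (B + 3), hc, bitsValue_lt _ _,
    bitsValue_lt _ _, ?_⟩
  funext a
  rw [label, testBit_bitsValue, testBit_bitsValue]
  by_cases c1 : a < D.e .n
  · have := hc (B + 1 * D.e .M + a) (by omega) (by omega)
    rw [hζ, loadAt, if_neg (by omega), if_pos (by omega), if_neg (by omega)] at this
    rw [if_pos c1, ← this]
    congr 1; omega
  rw [if_neg c1]
  by_cases c2 : B + 1 * D.e .M ≤ a ∧ a < B + 1 * D.e .M + D.e .n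
  · rw [if_pos c2, hζ, loadAt, if_pos (by omega), if_neg (by omega)]
    congr 1; omega
  rw [if_neg c2]
  by_cases c3 : B + 1 * D.e .M + D.e .n ≤ a ∧ a < B + 1 * D.e .M + D.e .n + D.e .pb
  · rw [if_pos c3, if_pos (by omega)]
    congr 1; omega
  rw [if_neg c3]
  by_cases c4 : B + 8 * D.e .M + D.e .n ≤ a ∧ a < B + 8 * D.e .M + D.e .n + D.e .pb
  · rw [if_pos c4, if_pos (by omega)]
    congr 1; omega
  rw [if_neg c4]
  by_cases c5 : a = B + 3
  · rw [if_pos c5, c5]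
  rw [if_neg c5, hζ, loadAt, if_neg c1, if_neg c2, if_neg (by omega)]

end

end StackProg

namespace StackProg

open Function

/-! ### The state before the flags are computed -/

/-- The gates between the two groups of Hadamard gates. -/
def coreAt (D : StageData) (B : ℕ) : List (RGate ℕ) :=
  gatesAt B (classicalList D ++ swapList D)

/-- The state after the second Hadamard gate. -/
noncomputable def interfere (D : StageData) (B : ℕ) (ψ : Str → ℂ) : Str → ℂ :=
  (RGate.had (B + 3)).apply (applyAll (coreAt D B) (spread D B ψ))

theorem applyAll_roundList (D : StageData) (B : ℕ) (ψ : Str → ℂ) :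
    applyAll (gatesAt B (roundList D)) ψ
      = applyAll (gatesAt B (flagList D)) (interfere D B ψ) := by
  simp only [roundList, interfere, spread, coreAt, gatesAt_append, applyAll_append]
  rfl

/-- The good bit is set if the name is a vertex and it is not the case that the string is matched
with control bit 0. In other words, a matched string has to pass the swap test with outcome 1. -/
theorem run_flagList {D : StageData} (hD : Fits D) {B : ℕ} {γ : Str} (h1 : γ (B + 1) = false)
    (h2 : γ (B + 2) = false) (h5 : γ (B + (17 * D.e .M + 5)) = false)
    (h6 : γ (B + (17 * D.e .M + 6)) = false) :
    run (gatesAt B (flagList D)) γ (B + (17 * D.e .M + 6))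
      = (γ (B + (17 * D.e .M + 4)) && !(γ (B + (17 * D.e .M + 3)) && !γ (B + 3))) := by
  have h := hD.e_le
  have hi : Increasing (17 * D.e .M + 5) (17 * D.e .M + 7) (flagList D) := by
    constructor
    · simp only [flagList, List.forall_mem_cons, Instr.IsBool, Instr.src₁, Instr.src₂, Instr.tgt,
        true_and]
      refine ⟨?_, ?_, by simp⟩ <;> omega
    · simp [flagList, Instr.tgt]
  have hz : ∀ x ∈ flagList D, γ (B + x.tgt) = false := by
    simp only [flagList, List.forall_mem_cons, Instr.tgt]
    exact ⟨h5, h6, by simp⟩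
  have hs := hi.solves_run h1 h2 hz
  have hk : ∀ a, a < 17 * D.e .M + 5 → run (gatesAt B (flagList D)) γ (B + a) = γ (B + a) := by
    intro a ha
    exact hi.run_of_forall_ne h1 h2 hz fun x hx => by have := hi.bound x hx; omega
  simp only [Solves, flagList, List.forall_mem_cons, Instr.tgt, Instr.result_andn] at hs
  have e1 := hs.1
  have e2 := hs.2.1
  rw [show [Instr.andn (17 * D.e .M + 3) 3 (17 * D.e .M + 5),
    Instr.andn (17 * D.e .M + 4) (17 * D.e .M + 5) (17 * D.e .M + 6)] = flagList D from rfl] at e1 e2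
  rw [e2, e1, hk _ (by omega), hk _ (by omega), hk _ (by omega)]

namespace Represents

variable {D : StageData} {I : GraphInput} {V : Finset ℕ} {G : SimpleGraph V}

theorem core_reversible (h : Represents D I V G) (B : ℕ) : ∀ g ∈ coreAt D B, g.Reversible := by
  refine reversible_gatesAt B fun x hx t => ?_
  rcases List.mem_append.1 hx with hx | hx
  · have := (h.increasing.bound x hx).1
    rintro rfl
    exact this
  · exact swapList_ne_had D x hx t

theorem core_inside (h : Represents D I V G) {B : ℕ} (hB : D.e .M ≤ B) :
    ∀ g ∈ coreAt D B, g.Inside (D.e .M) B := by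
  have h0 := h.presents.fits.e_le
  refine inside_gatesAt (by omega) hB fun x hx => ok_roundList h.presents.fits x ?_
  rcases List.mem_append.1 hx with hx | hx <;> simp [roundList, hx]

variable {B : ℕ} {ψ : Str → ℂ}

theorem core_apply_run (h : Represents D I V G) (hB : D.e .M ≤ B) (γ : Str) :
    applyAll (coreAt D B) ψ (run (coreAt D B) γ) = ψ γ := by
  rw [applyAll_eq_run (h.core_reversible B), run_reverse_run fun g hg => (h.core_inside hB g hg).1]

theorem exists_label_of_core (h : Represents D I V G) (hB : D.e .M ≤ B)
    (hψ : ∀ ζ, ψ ζ ≠ 0 → Clean (D.e .M) B ζ) {γ : Str}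
    (hγ : applyAll (coreAt D B) (spread D B ψ) γ ≠ 0) :
    ∃ ζ k k' b, Clean (D.e .M) B ζ ∧ k < 2 ^ I.posBits ∧ k' < 2 ^ I.posBits ∧ ψ ζ ≠ 0 ∧
      γ = run (coreAt D B) (label D B ζ k k' b) := by
  rw [applyAll_eq_run (h.core_reversible B)] at hγ
  obtain ⟨ζ, k, k', b, hζ, hk, hk', e⟩ := exists_label_of_spread h.presents.fits hB hψ hγ
  rw [h.presents.pb] at hk hk'
  refine ⟨ζ, k, k', b, hζ, hk, hk', ?_, ?_⟩
  · rw [e, spread_label h.presents.fits hB hψ hζ] at hγ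
    intro h0
    simp [h0] at hγ
  · rw [← e, run_run_reverse fun g hg => (h.core_inside hB g hg).1]

theorem exists_label_of_interfere (h : Represents D I V G) (hB : D.e .M ≤ B)
    (hψ : ∀ ζ, ψ ζ ≠ 0 → Clean (D.e .M) B ζ) {γ : Str} (hγ : interfere D B ψ γ ≠ 0) :
    ∃ ζ k k' b, Clean (D.e .M) B ζ ∧ k < 2 ^ I.posBits ∧ k' < 2 ^ I.posBits ∧ ψ ζ ≠ 0 ∧
      γ = update (run (coreAt D B) (label D B ζ k k' b)) (B + 3) (γ (B + 3)) := by
  -- The Hadamard gate mixes only the two values of the control bit, so one of them carried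
  -- amplitude before it.
  have : ∃ v, applyAll (coreAt D B) (spread D B ψ) (update γ (B + 3) v) ≠ 0 := by
    by_contra hc
    push Not at hc
    exact hγ (by simp [interfere, RGate.apply, hc])
  obtain ⟨v, hv⟩ := this
  obtain ⟨ζ, k, k', b, hζ, hk, hk', h0, e⟩ := h.exists_label_of_core hB hψ hv
  refine ⟨ζ, k, k', b, hζ, hk, hk', h0, ?_⟩
  rw [← e]
  simp

theorem interfere_zeros (h : Represents D I V G) (hB : D.e .M ≤ B)
    (hψ : ∀ ζ, ψ ζ ≠ 0 → Clean (D.e .M) B ζ) {γ : Str} (hγ : interfere D B ψ γ ≠ 0) :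
    run (gatesAt B (flagList D)) γ (B + (17 * D.e .M + 6))
      = (γ (B + (17 * D.e .M + 4)) && !(γ (B + (17 * D.e .M + 3)) && !γ (B + 3))) := by
  have h0 := h.presents.fits.e_le
  obtain ⟨ζ, k, k', b, hζ, hk, hk', -, e⟩ := h.exists_label_of_interfere hB hψ hγ
  have hz : ∀ r, (r = 1 ∨ r = 2 ∨ 17 * D.e .M + 5 ≤ r) → r < 20 * D.e .M → γ (B + r) = false := by
    intro r hr hr'
    rw [e, update_of_ne (by omega)]
    exact h.run_zero hB hζ hr hr'
  exact run_flagList h.presents.fits (hz _ (by omega) (by omega)) (hz _ (by omega) (by omega))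
    (hz _ (by omega) (by omega)) (hz _ (by omega) (by omega))

/-- The amplitude of a matched string. -/
theorem interfere_matched (h : Represents D I V G) (hB : D.e .M ≤ B)
    (hψ : ∀ ζ, ψ ζ ≠ 0 → Clean (D.e .M) B ζ) {ζ : Str} (hζ : Clean (D.e .M) B ζ) {k k' : ℕ}
    (b : Bool) (hk : k < 2 ^ I.posBits)
    (hm : run (coreAt D B) (label D B ζ k k' b) (B + (17 * D.e .M + 3)) = true) :
    interfere D B ψ (update (run (coreAt D B) (label D B ζ k k' b)) (B + 3) false)
      = (ψ ζ + ψ (setName I.n ζ (I.adj (bitsValue I.n ζ) k)))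
        / ((Real.sqrt 2 : ℂ) ^ (2 * D.e .pb + 1) * (Real.sqrt 2 : ℂ)) := by
  have h0 := h.presents.fits.e_le
  have hn := h.presents.n
  -- Before the Hadamard gate, the value b of the control bit carries the amplitude of the string
  -- itself, and the other value that of its partner.
  have e1 : applyAll (coreAt D B) (spread D B ψ)
      (update (run (coreAt D B) (label D B ζ k k' b)) (B + 3) b)
      = ψ ζ / (Real.sqrt 2 : ℂ) ^ (2 * D.e .pb + 1) := by
    have hc := h.run_ctrl hB hζ (k := k) (k' := k') (b := b)
    nth_rewrite 2 [← hc]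
    rw [← coreAt, update_eq_self, h.core_apply_run hB, spread_label h.presents.fits hB hψ hζ]
  have e2 : applyAll (coreAt D B) (spread D B ψ)
      (update (run (coreAt D B) (label D B ζ k k' b)) (B + 3) (!b))
      = ψ (setName I.n ζ (I.adj (bitsValue I.n ζ) k)) / (Real.sqrt 2 : ℂ) ^ (2 * D.e .pb + 1) := by
    have := h.run_partner hB hζ hk hm
    rw [← coreAt] at this
    rw [← this, h.core_apply_run hB, spread_label h.presents.fits hB hψ
      (clean_setName (by omega) hζ)]
  simp only [interfere, RGate.apply, update_idem, update_self]
  rw [← div_div]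
  cases b
  · rw [Bool.not_false] at e2
    rw [e1, e2]
    simp [add_div]
  · rw [Bool.not_true] at e2
    rw [e1, e2]
    simp [add_div, add_comm]

/-- On a state that changes the sign along edges, the good flag is always set. -/
theorem good_of_alternating (h : Represents D I V G) (hB : D.e .M ≤ B)
    (hψ : ∀ ζ, ψ ζ ≠ 0 → Clean (D.e .M) B ζ ∧ bitsValue I.n ζ ∈ V)
    (halt : ∀ ζ, ∀ i j : V, G.Adj i j → bitsValue I.n ζ = i → ψ (setName I.n ζ j) = -ψ ζ) {γ : Str}
    (hγ : applyAll (gatesAt B (roundList D)) ψ γ ≠ 0) : γ (B + (17 * D.e .M + 6)) = true := by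
  have h0 := h.presents.fits.e_le
  have hψ' : ∀ ζ, ψ ζ ≠ 0 → Clean (D.e .M) B ζ := fun ζ hζ => (hψ ζ hζ).1
  have hd : ∀ g ∈ gatesAt B (flagList D), g.Distinct := fun g hg =>
    (inside_gatesAt (by omega) hB (fun x hx => ok_roundList h.presents.fits x (by
      simp [roundList, hx])) g hg).1
  rw [applyAll_roundList, applyAll_eq_run (reversible_gatesAt B (flagList_ne_had D))] at hγ
  have e := h.interfere_zeros hB hψ' hγ
  rw [run_run_reverse hd] at e
  set γ₀ := run (gatesAt B (flagList D)).reverse γ with hγ₀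
  obtain ⟨ζ, k, k', b, hζ, hk, hk', hne, e0⟩ := h.exists_label_of_interfere hB hψ' hγ
  have hv : γ₀ (B + (17 * D.e .M + 4)) = true := by
    rw [e0, update_of_ne (by omega)]
    exact (h.run_vertex_iff hB hζ).2 (hψ ζ hne).2
  rw [e, hv, Bool.true_and, Bool.not_eq_true', Bool.and_eq_false_iff]
  -- Otherwise the string is matched with control bit 0, and its amplitude is a multiple of the sum
  -- over the two ends of an edge, which vanishes.
  by_contra hc
  push Not at hc
  obtain ⟨hu, hb⟩ := hc
  have hu : γ₀ (B + (17 * D.e .M + 3)) = true := by simpa using hu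
  have hb : γ₀ (B + 3) = false := by simpa using hb
  rw [hb] at e0
  rw [e0, update_of_ne (by omega)] at hu
  rw [e0, h.interfere_matched hB hψ' hζ b hk hu] at hγ
  obtain ⟨h1, h2, h3, -⟩ := (h.run_matched_iff hB hζ hk hk').1 hu
  rw [halt ζ ⟨_, h1⟩ ⟨_, h2⟩ (h.describes.access.adj_of_eq h3 rfl) rfl] at hγ
  simp at hγ

end Represents

end StackProg

namespace StackProg

open Function

/-! ### The probability that the good flag is not set -/

theorem run_mem_cube {N : ℕ} {l : List (RGate ℕ)} (hl : ∀ g ∈ l, g.target < N) {γ : Str}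
    (hγ : γ ∈ cube N) : run l γ ∈ cube N := by
  induction l generalizing γ with
  | nil => exact hγ
  | cons g l ih =>
    exact ih (fun x hx => hl x (by simp [hx])) (act_mem_cube (hl g (by simp)) hγ)

theorem setName_apply {n : ℕ} {ζ : Str} {j a : ℕ} (ha : a < n) : setName n ζ j a = j.testBit a :=
  if_pos ha

theorem bitsValue_setName {n : ℕ} {ζ : Str} {j : ℕ} (hj : j < 2 ^ n) :
    bitsValue n (setName n ζ j) = j :=
  (bitsValue_eq_iff hj _).2 fun _ ht => setName_apply ht

theorem setName_setName {n : ℕ} {ζ : Str} {i j : ℕ} :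
    setName n (setName n ζ i) j = setName n ζ j := by
  funext a
  unfold setName
  split_ifs <;> rfl

theorem label_mem_cube {D : StageData} (hD : Fits D) {B N : ℕ} (hN : B + 20 * D.e .M ≤ N)
    {ζ : Str} (hζ : ζ ∈ cube N) (k k' : ℕ) (b : Bool) : label D B ζ k k' b ∈ cube N := by
  have h := hD.e_le
  rw [mem_cube] at hζ ⊢
  intro a ha
  rw [label, if_neg (by omega), if_neg (by omega), if_neg (by omega), if_neg (by omega),
    if_neg (by omega)]
  exact hζ a ha

open Classical in
/-- The strings with clean inner bits and the vertex name zero. -/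
noncomputable def baseStrings (D : StageData) (B N : ℕ) : Finset Str :=
  (cube N).filter fun ρ => Clean (D.e .M) B ρ ∧ ∀ a < D.e .n, ρ a = false

theorem setName_injOn {n : ℕ} {ρ ρ' : Str} {i i' : ℕ} (hi : i < 2 ^ n) (hi' : i' < 2 ^ n)
    (hρ : ∀ a < n, ρ a = false) (hρ' : ∀ a < n, ρ' a = false)
    (e : setName n ρ i = setName n ρ' i') : ρ = ρ' ∧ i = i' := by
  refine ⟨?_, by rw [← bitsValue_setName (ζ := ρ) hi, e, bitsValue_setName hi']⟩
  funext a
  by_cases ha : a < n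
  · rw [hρ a ha, hρ' a ha]
  · have := congrFun e a
    rwa [setName, setName, if_neg ha, if_neg ha] at this

theorem mass_eq_sum_filter {N : ℕ} {P : Str → Prop} [DecidablePred P] {ψ : Str → ℂ} :
    mass N P ψ = ∑ γ ∈ (cube N).filter P, ‖ψ γ‖ ^ 2 := by
  rw [Finset.sum_filter]
  exact Finset.sum_congr rfl fun γ _ => by split_ifs <;> rfl

namespace Represents

variable {D : StageData} {I : GraphInput} {V : Finset ℕ} {G : SimpleGraph V} {B N : ℕ}
  {ψ : Str → ℂ}

theorem setName_mem_cube (h : Represents D I V G) (hN : D.e .M ≤ N) {ρ : Str}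
    (hρ : ρ ∈ cube N) (j : ℕ) : setName I.n ρ j ∈ cube N := by
  have h0 := h.presents.fits.e_le
  have hn := h.presents.n
  rw [mem_cube] at hρ ⊢
  intro a ha
  rw [setName, if_neg (by omega)]
  exact hρ a ha

/-- A string is a vertex name together with the remaining bits ρ. A witness that is entangled with
padding bits or with earlier windows is thus a family of vectors on V, one for each ρ, and the
inequality for the graph applies to each of them. -/
theorem mass_vertex (h : Represents D I V G) (hB : D.e .M ≤ B) (hN : D.e .M ≤ N)
    (hψ : ∀ ζ, ψ ζ ≠ 0 → Clean (D.e .M) B ζ) :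
    mass N (fun ζ => bitsValue I.n ζ ∈ V) ψ
      = ∑ ρ ∈ baseStrings D B N, ∑ i : V, ‖ψ (setName I.n ρ i)‖ ^ 2 := by
  classical
  have h0 := h.presents.fits.e_le
  have hn := h.presents.n
  have hv := fun i : V => (h.describes.access.vertices i i.2).2
  have hinj : Set.InjOn (fun x : Str × V => setName I.n x.1 x.2)
      (baseStrings D B N ×ˢ (Finset.univ : Finset V) : Finset (Str × V)) := by
    rintro ⟨ρ, i⟩ hx ⟨ρ', i'⟩ hx' e
    simp only [baseStrings, Finset.coe_product, Set.mem_prod, Finset.mem_coe,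
      Finset.mem_filter] at hx hx'
    obtain ⟨rfl, e2⟩ := setName_injOn (hv i) (hv i') (hn ▸ hx.1.2.2) (hn ▸ hx'.1.2.2) e
    rw [Subtype.ext e2]
  rw [← Finset.sum_product' (f := fun ρ (i : V) => ‖ψ (setName I.n ρ i)‖ ^ 2),
    ← Finset.sum_image (f := fun γ => ‖ψ γ‖ ^ 2) hinj]
  rw [mass_eq_sum_filter]
  symm
  refine Finset.sum_subset ?_ ?_
  · intro γ hγ
    simp only [Finset.mem_image, Finset.mem_product, baseStrings, Finset.mem_filter] at hγ ⊢
    obtain ⟨⟨ρ, i⟩, ⟨⟨h1, h2⟩, -⟩, rfl⟩ := hγ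
    refine ⟨h.setName_mem_cube hN h1 _, ?_⟩
    rw [bitsValue_setName (hv i)]
    exact i.2
  · intro γ hγ hγ'
    rw [Finset.mem_filter] at hγ
    -- A string of non-zero amplitude is clean, so it arises from the base string obtained by
    -- setting its name to zero.
    by_contra hne
    refine hγ' (Finset.mem_image.2 ⟨(setName I.n γ 0, ⟨_, hγ.2⟩), ?_, ?_⟩)
    · simp only [Finset.mem_product, baseStrings, Finset.mem_filter, Finset.mem_univ, and_true]
      refine ⟨h.setName_mem_cube hN hγ.1 _, clean_setName (by omega) (hψ γ fun h1 => hne ?_), ?_⟩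
      · simp [h1]
      · intro a ha
        rw [setName_apply (by omega), Nat.zero_testBit]
    · simp only [setName_setName]
      funext a
      unfold setName
      split_ifs with ha
      · rw [testBit_bitsValue, if_pos ha]
      · rfl

/-- Whether the name is a vertex depends on the loaded name alone. Neither the Hadamard gates on the
coins nor the one on the control bit touches the name or the vertex flag. -/
theorem mass_not_vertex (h : Represents D I V G) (hB : D.e .M ≤ B) (hN : B + 20 * D.e .M ≤ N)
    (hψ : ∀ ζ, ψ ζ ≠ 0 → Clean (D.e .M) B ζ) :
    mass N (fun γ => γ (B + (17 * D.e .M + 4)) = false) (interfere D B ψ)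
      = mass N (fun ζ => bitsValue I.n ζ ∉ V) ψ := by
  have h0 := h.presents.fits.e_le
  have hn := h.presents.n
  have hin : ∀ l : List (Instr ℕ), (∀ x ∈ l, x ∈ roundList D) → ∀ g ∈ gatesAt B l,
      g.Inside (D.e .M) B := fun l hl =>
    inside_gatesAt (by omega) hB fun x hx => ok_roundList h.presents.fits x (hl x hx)
  have hval : ∀ {M B N : ℕ} {g : RGate ℕ}, g.Inside M B → B + 20 * M ≤ N → g.target < N :=
    fun hg h2 => (hg.valid h2).target_lt
  rw [interfere, mass_had (by omega) fun γ b => by rw [update_of_ne (by omega)],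
    mass_applyAll_reversible (h.core_reversible B) (fun g hg => (h.core_inside hB g hg).1)
      fun g hg => hval (h.core_inside hB g hg) hN]
  rw [mass_congr (P' := fun γ => bitsValue I.n (fun q => γ (B + (1 * D.e .M + q))) ∉ V)]
  · rw [spread, gatesAt_append, applyAll_append, gatesAt_had, mass_applyAll,
      mass_applyAll_reversible (reversible_gatesAt B (loadList_ne_had D))
        (fun g hg => (hin _ (by simp [roundList]; tauto) g hg).1)
        fun g hg => hval (hin _ (by simp [roundList]; tauto) g hg) hN]
    · refine mass_congr fun γ _ _ => ?_
      rw [run_loadList h.presents.fits hB, bitsValue_congr (s' := γ)]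
      intro t ht
      rw [loadAt, if_neg (by omega), if_pos (by omega)]
      congr 1; omega
    · simp only [List.forall_mem_map]
      intro q _
      simp [RGate.Distinct, RGate.args]
    · simp only [List.forall_mem_map, RGate.target, mem_coinList]
      intro q hq
      omega
    · simp only [List.forall_mem_map, RGate.target, mem_coinList]
      intro q hq γ b
      rw [bitsValue_congr (s' := fun q => γ (B + (1 * D.e .M + q)))]
      intro t ht
      rw [update_of_ne (by omega)]
  · intro γ _ hγ
    obtain ⟨ζ, k, k', b, hζ, -, -, rfl⟩ := exists_label_of_spread h.presents.fits hB hψ hγ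
    have e : bitsValue I.n (fun q => label D B ζ k k' b (B + (1 * D.e .M + q))) = bitsValue I.n ζ :=
      bitsValue_congr fun q hq => label_name h.presents.fits (by omega)
    rw [e, ← h.run_vertex_iff hB hζ (k := k) (k' := k') (b := b), Bool.not_eq_true]
    rfl

/-- An ordered edge (i, j) and a base string ρ select one string: the name i, the place of j in the
list of i, the place of i in the list of j, control bit 0. These strings are distinct, all of them
are bad, and their amplitudes are known. Both orders of an edge contribute. -/
theorem mass_matched (h : Represents D I V G) (hB : D.e .M ≤ B) (hN : B + 20 * D.e .M ≤ N)
    (hψ : ∀ ζ, ψ ζ ≠ 0 → Clean (D.e .M) B ζ) :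
    open Classical in
    (∑ ρ ∈ baseStrings D B N, ∑ i : V, ∑ j : V, if G.Adj i j then
      ‖ψ (setName I.n ρ i) + ψ (setName I.n ρ j)‖ ^ 2 else 0) / (4 * 4 ^ I.posBits)
      ≤ mass N (fun γ => γ (B + (17 * D.e .M + 4)) = true ∧ γ (B + (17 * D.e .M + 3)) = true ∧
        γ (B + 3) = false) (interfere D B ψ) := by
  classical
  have h0 := h.presents.fits.e_le
  have hn := h.presents.n
  have hv := fun i : V => (h.describes.access.vertices i i.2).2
  choose! pos hpos hadj using fun (i j : V) (hij : G.Adj i j) =>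
    h.describes.access.exists_eq_of_adj hij
  have hS : I.S ≤ 2 ^ I.posBits := Nat.le_pow_clog (by norm_num) _
  set f : Str × V × V → Str := fun x => run (coreAt D B)
    (label D B (setName I.n x.1 x.2.1) (pos x.2.1 x.2.2) (pos x.2.2 x.2.1) false) with hf
  set s : Finset (Str × V × V) := (baseStrings D B N ×ˢ (Finset.univ : Finset (V × V))).filter
    fun x => G.Adj x.2.1 x.2.2 with hs
  have hmem : ∀ x ∈ s, (x.1 ∈ cube N ∧ Clean (D.e .M) B x.1 ∧ ∀ a < I.n, x.1 a = false) ∧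
      G.Adj x.2.1 x.2.2 := by
    intro x hx
    simp only [hs, Finset.mem_filter, Finset.mem_product, Finset.mem_univ, and_true, baseStrings]
      at hx
    exact ⟨⟨hx.1.1, hx.1.2.1, hn ▸ hx.1.2.2⟩, hx.2⟩
  have hcl : ∀ x ∈ s, Clean (D.e .M) B (setName I.n x.1 x.2.1) := fun x hx =>
    clean_setName (by omega) (hmem x hx).1.2.1
  have hk : ∀ x ∈ s, pos x.2.1 x.2.2 < 2 ^ I.posBits ∧ pos x.2.2 x.2.1 < 2 ^ I.posBits :=
    fun x hx => ⟨(hpos _ _ (hmem x hx).2).trans_le hS, (hpos _ _ (hmem x hx).2.symm).trans_le hS⟩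
  have hX : ∀ x : Str × V × V, bitsValue I.n (setName I.n x.1 x.2.1) = x.2.1 := fun x =>
    bitsValue_setName (hv _)
  have hctrl : ∀ x ∈ s, f x (B + 3) = false := fun x hx => h.run_ctrl hB (hcl x hx)
  have hm : ∀ x ∈ s, f x (B + (17 * D.e .M + 3)) = true := by
    intro x hx
    refine (h.run_matched_iff hB (hcl x hx) (hk x hx).1 (hk x hx).2).2 ?_
    rw [hX, hadj _ _ (hmem x hx).2, hadj _ _ (hmem x hx).2.symm]
    exact ⟨x.2.1.2, x.2.2.2, hpos _ _ (hmem x hx).2, hpos _ _ (hmem x hx).2.symm, rfl⟩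
  have hval : ∀ x ∈ s, ‖interfere D B ψ (f x)‖ ^ 2
      = ‖ψ (setName I.n x.1 x.2.1) + ψ (setName I.n x.1 x.2.2)‖ ^ 2 / (4 * 4 ^ I.posBits) := by
    intro x hx
    have := h.interfere_matched hB hψ (hcl x hx) false (hk x hx).1 (hm x hx)
    rw [hX, hadj _ _ (hmem x hx).2, setName_setName] at this
    have e : update (f x) (B + 3) false = f x := by rw [← hctrl x hx, update_eq_self]
    rw [e] at this
    rw [this, norm_div, div_pow, ← pow_succ, norm_pow, ← pow_mul, mul_comm _ 2, pow_mul,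
      Complex.norm_real, Real.norm_eq_abs, sq_abs, Real.sq_sqrt (by norm_num), h.presents.pb]
    congr 1
    -- There are 2·pb + 2 factors √2: the coins of two positions, and the control bit twice. Their
    -- product squares to 4·4^pb.
    rw [show 2 * I.posBits + 1 + 1 = 2 * (I.posBits + 1) by ring, pow_mul, pow_succ]
    norm_num
    ring
  -- The circuit is undone. The label shows the name, the first position and the remaining bits; the
  -- neighbour is then determined by the name and the position.
  have hinj : Set.InjOn f s := by
    intro x hx y hy e
    have hd : ∀ g ∈ coreAt D B, g.Distinct := fun g hg => (h.core_inside hB g hg).1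
    have e' := congrArg (run (coreAt D B).reverse) e
    simp only [hf] at e'
    rw [run_reverse_run hd, run_reverse_run hd] at e'
    have e1 : (x.2.1 : ℕ) = y.2.1 := by
      rw [← hX x, ← hX y]
      refine bitsValue_congr fun t ht => ?_
      have := congrFun e' (B + (1 * D.e .M + t))
      rwa [label_name h.presents.fits (by omega), label_name h.presents.fits (by omega)]
        at this
    have e2 : pos x.2.1 x.2.2 = pos y.2.1 y.2.2 := by
      rw [← bitsValue_testBit (hk x hx).1, ← bitsValue_testBit (hk y hy).1]
      refine bitsValue_congr fun t ht => ?_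
      have := congrFun e' (B + (1 * D.e .M + (D.e .n + t)))
      rwa [label_pos₁ h.presents.fits (by rw [h.presents.pb]; exact ht),
        label_pos₁ h.presents.fits (by rw [h.presents.pb]; exact ht)] at this
    have e3 : (x.2.2 : ℕ) = y.2.2 := by
      rw [← hadj _ _ (hmem x hx).2, ← hadj _ _ (hmem y hy).2, e1, e2]
    have e4 : x.1 = y.1 := by
      funext a
      by_cases c1 : a < I.n
      · rw [(hmem x hx).1.2.2 a c1, (hmem y hy).1.2.2 a c1]
      by_cases c2 : B < a ∧ a < B + 20 * D.e .M
      · rw [(hmem x hx).1.2.1 a c2.1 c2.2, (hmem y hy).1.2.1 a c2.1 c2.2]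
      have := congrFun e' a
      rw [label, if_neg (by omega), if_neg (by omega), if_neg (by omega), if_neg (by omega),
        if_neg (by omega), label, if_neg (by omega), if_neg (by omega), if_neg (by omega),
        if_neg (by omega), if_neg (by omega)] at this
      rwa [setName, setName, if_neg c1, if_neg c1] at this
    exact Prod.ext e4 (Prod.ext (Subtype.ext e1) (Subtype.ext e3))
  have hsum : (∑ ρ ∈ baseStrings D B N, ∑ i : V, ∑ j : V, if G.Adj i j then
      ‖ψ (setName I.n ρ i) + ψ (setName I.n ρ j)‖ ^ 2 else 0) / (4 * 4 ^ I.posBits)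
      = ∑ x ∈ s, ‖interfere D B ψ (f x)‖ ^ 2 := by
    rw [Finset.sum_congr rfl hval, ← Finset.sum_div, hs, Finset.sum_filter, Finset.sum_product]
    congr 1
    refine Finset.sum_congr rfl fun ρ _ => ?_
    rw [← Finset.univ_product_univ, Finset.sum_product]
  rw [hsum, ← Finset.sum_image (f := fun γ => ‖interfere D B ψ γ‖ ^ 2) hinj,
    mass_eq_sum_filter]
  refine Finset.sum_le_sum_of_subset_of_nonneg (fun γ hγ => ?_) fun _ _ _ => by positivity
  obtain ⟨x, hx, rfl⟩ := Finset.mem_image.1 hγ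
  rw [Finset.mem_filter]
  refine ⟨run_mem_cube (fun g hg => ((h.core_inside hB g hg).valid hN).target_lt)
    (label_mem_cube h.presents.fits hN (h.setName_mem_cube (by omega) (hmem x hx).1.1 _) _ _ _),
    (h.run_vertex_iff hB (hcl x hx)).2 ?_, hm x hx, hctrl x hx⟩
  rw [hX]
  exact x.2.1.2

/-- A lower bound for the probability that the good flag is not set. -/
theorem le_mass_bad (h : Represents D I V G) (hB : D.e .M ≤ B) (hN : B + 20 * D.e .M ≤ N)
    (hψ : ∀ ζ, ψ ζ ≠ 0 → Clean (D.e .M) B ζ) {δ ε : ℝ} (hε : ε ≤ 1)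
    (hδ : ε * (4 * 4 ^ I.posBits) ≤ δ)
    (hG : open Classical in ∀ w : V → ℂ, δ * ∑ i, ‖w i‖ ^ 2 ≤
      ∑ i, ∑ j, if G.Adj i j then ‖w i + w j‖ ^ 2 else 0) :
    ε * mass N (fun _ => True) ψ
      ≤ mass N (fun γ => γ (B + (17 * D.e .M + 6)) = false)
        (applyAll (gatesAt B (roundList D)) ψ) := by
  classical
  have h0 := h.presents.fits.e_le
  have hin : ∀ g ∈ gatesAt B (flagList D), g.Inside (D.e .M) B :=
    inside_gatesAt (by omega) hB fun x hx => ok_roundList h.presents.fits x (by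
      simp [roundList, hx])
  have h1 := h.mass_not_vertex hB hN hψ
  have h2 := h.mass_matched hB hN hψ
  have h3 := h.mass_vertex hB (N := N) (by omega) hψ
  have h4 : mass N (fun ζ => bitsValue I.n ζ ∈ V) ψ + mass N (fun ζ => bitsValue I.n ζ ∉ V) ψ
      = mass N (fun _ => True) ψ := by
    simpa using mass_and_add (N := N) (ψ := ψ) (fun _ => True) fun ζ => bitsValue I.n ζ ∈ V
  -- The inequality for the graph, summed over the base strings.
  have h5 : ε * mass N (fun ζ => bitsValue I.n ζ ∈ V) ψ ≤
      (∑ ρ ∈ baseStrings D B N, ∑ i : V, ∑ j : V, if G.Adj i j then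
        ‖ψ (setName I.n ρ i) + ψ (setName I.n ρ j)‖ ^ 2 else 0) / (4 * 4 ^ I.posBits) := by
    rw [le_div_iff₀ (by positivity), h3, mul_right_comm, Finset.mul_sum]
    refine Finset.sum_le_sum fun ρ _ => le_trans ?_ (hG fun i => ψ (setName I.n ρ i))
    exact mul_le_mul_of_nonneg_right hδ (Finset.sum_nonneg fun _ _ => by positivity)
  have h6 : ε * mass N (fun ζ => bitsValue I.n ζ ∉ V) ψ
      ≤ mass N (fun ζ => bitsValue I.n ζ ∉ V) ψ := mul_le_of_le_one_left mass_nonneg hε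
  have hb : mass N (fun γ => γ (B + (17 * D.e .M + 6)) = false)
      (applyAll (gatesAt B (roundList D)) ψ)
      = mass N (fun γ => ¬ (γ (B + (17 * D.e .M + 4)) &&
        !(γ (B + (17 * D.e .M + 3)) && !γ (B + 3))) = true) (interfere D B ψ) := by
    rw [applyAll_roundList, mass_applyAll_reversible (reversible_gatesAt B (flagList_ne_had D))
      (fun g hg => (hin g hg).1) fun g hg => ((hin g hg).valid hN).target_lt]
    exact mass_congr fun γ _ hγ => by rw [h.interfere_zeros hB hψ hγ, Bool.not_eq_true]
  rw [hb, ← mass_and_add (ψ := interfere D B ψ) _ fun γ => γ (B + (17 * D.e .M + 4)) = false]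
  have h7 := mass_mono (N := N) (ψ := interfere D B ψ)
    (P := fun γ => γ (B + (17 * D.e .M + 4)) = false)
    (P' := fun γ => (¬ (γ (B + (17 * D.e .M + 4)) && !(γ (B + (17 * D.e .M + 3)) && !γ (B + 3)))
      = true) ∧ γ (B + (17 * D.e .M + 4)) = false) fun γ hγ => by simp [hγ]
  have h8 := mass_mono (N := N) (ψ := interfere D B ψ)
    (P := fun γ => γ (B + (17 * D.e .M + 4)) = true ∧ γ (B + (17 * D.e .M + 3)) = true ∧
        γ (B + 3) = false)
    (P' := fun γ => (¬ (γ (B + (17 * D.e .M + 4)) && !(γ (B + (17 * D.e .M + 3)) && !γ (B + 3)))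
      = true) ∧ ¬ γ (B + (17 * D.e .M + 4)) = false) fun γ hγ => by simp [hγ]
  rw [← h4, mul_add]
  linarith

end Represents

end StackProg

namespace StackProg

open Function

/-! ### Rounds -/

theorem RGate.apply_not_comm {g : RGate ℕ} {q : ℕ} (hq : q ∉ g.args) (ψ : Str → ℂ) :
    g.apply ((RGate.not q).apply ψ) = (RGate.not q).apply (g.apply ψ) := by
  funext γ
  cases g with
  | had t =>
    have ht : t ≠ q := by simpa [args, eq_comm] using hq
    simp [apply, act, ht, ht.symm, update_comm ht.symm]
  | not t =>
    have ht : t ≠ q := by simpa [args, eq_comm] using hq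
    simp [apply, act, ht, ht.symm, update_comm ht.symm]
  | cnot c t =>
    have ht : q ≠ c ∧ q ≠ t := by simpa [args] using hq
    simp [apply, act, ht, ht.1.symm, ht.2.symm, update_comm ht.2]
  | tof c d t =>
    have ht : q ≠ c ∧ q ≠ d ∧ q ≠ t := by simpa [args] using hq
    simp [apply, act, ht, ht.1.symm, ht.2.1.symm, ht.2.2.symm, update_comm ht.2.2]

theorem applyAll_not_comm {l : List (RGate ℕ)} {q : ℕ} (hq : ∀ g ∈ l, q ∉ g.args) (ψ : Str → ℂ) :
    applyAll l ((RGate.not q).apply ψ) = (RGate.not q).apply (applyAll l ψ) := by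
  induction l generalizing ψ with
  | nil => rfl
  | cons g l ih =>
    rw [applyAll_cons, RGate.apply_not_comm (hq g (by simp)), ih fun x hx => hq x (by simp [hx])]
    rfl

/-- The bits after `B` are zero. -/
def Fresh (B : ℕ) (ψ : Str → ℂ) : Prop := ∀ γ, ψ γ ≠ 0 → ∀ a, B < a → γ a = false

namespace Represents

variable {D : StageData} {I : GraphInput} {V : Finset ℕ} {G : SimpleGraph V} {B N : ℕ}
  {ψ : Str → ℂ}

theorem round_inside (h : Represents D I V G) (hB : D.e .M ≤ B) :
    ∀ g ∈ gatesAt B (roundList D), g.Inside (D.e .M) B := by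
  have h0 := h.presents.fits.e_le
  exact inside_gatesAt (by omega) hB (ok_roundList h.presents.fits)

theorem not_mem_args (h : Represents D I V G) (hB : D.e .M ≤ B) {a : ℕ}
    (ha : a = B ∨ B + 20 * D.e .M ≤ a) : ∀ g ∈ gatesAt B (roundList D), a ∉ g.args := by
  have h0 := h.presents.fits.e_le
  intro g hg hm
  have := (h.round_inside hB g hg).2 a hm
  omega

theorem ne_target (h : Represents D I V G) (hB : D.e .M ≤ B) {a : ℕ}
    (ha : a = B ∨ B + 20 * D.e .M ≤ a) : ∀ g ∈ gatesAt B (roundList D), a ≠ g.target := by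
  rintro g hg rfl
  exact h.not_mem_args hB ha g hg g.target_mem_args

/-- When a test fails, running the round backwards does not restore the window. Each round has a
window of its own for this reason, and only the bits beyond the next flag are required to be zero.
-/
theorem fresh_round (h : Represents D I V G) (hB : D.e .M ≤ B) (hψ : Fresh B ψ) :
    Fresh (B + 20 * D.e .M) (applyAll (roundAt D B) ψ) := by
  have h0 := h.presents.fits.e_le
  refine applyAll_support (P := fun γ => ∀ a, B + 20 * D.e .M < a → γ a = false) (fun g hg γ b => ?_)
    fun γ hγ a ha => hψ γ hγ a (by omega)
  refine forall₂_congr fun a ha => ?_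
  rw [update_of_ne]
  simp only [roundAt, List.mem_append, List.mem_singleton, List.mem_reverse] at hg
  rcases hg with (hg | rfl) | hg
  · exact h.ne_target hB (by omega) g hg
  · simp only [flagGateAt, RGate.target]; omega
  · exact h.ne_target hB (by omega) g hg

/-- The flag at the base is not changed by the round, so one may condition on it. A bad round then
removes at least the fraction ε, and running the round backwards leaves the new flag alone. The
bound holds for every fresh state, so damage done by earlier rounds does not matter. -/
theorem mass_round_le (h : Represents D I V G) (hB : D.e .M ≤ B) (hN : B + 20 * D.e .M < N)
    (hψ : Fresh B ψ) {δ ε : ℝ} (hε : ε ≤ 1) (hδ : ε * (4 * 4 ^ I.posBits) ≤ δ)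
    (hG : open Classical in ∀ w : V → ℂ, δ * ∑ i, ‖w i‖ ^ 2 ≤
      ∑ i, ∑ j, if G.Adj i j then ‖w i + w j‖ ^ 2 else 0) :
    mass N (fun γ => γ (B + 20 * D.e .M) = true) (applyAll (roundAt D B) ψ)
      ≤ (1 - ε) * mass N (fun γ => γ B = true) ψ := by
  classical
  have h0 := h.presents.fits.e_le
  have hin := h.round_inside hB
  have hv : ∀ g ∈ gatesAt B (roundList D), g.target < N := fun g hg =>
    ((hin g hg).valid hN.le).target_lt
  set W := gatesAt B (roundList D) with hW
  set χ := applyAll W ψ with hχ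
  have hind : ∀ a, (a = B ∨ B + 20 * D.e .M ≤ a) → ∀ g ∈ W, ∀ (γ : Str) (b : Bool),
      (update γ g.target b a = true ↔ γ a = true) := fun a ha g hg γ b => by
    rw [update_of_ne (h.ne_target hB ha g hg)]
  have e1 : applyAll (roundAt D B) ψ = applyAll W.reverse ((flagGateAt D B).apply χ) := by
    rw [roundAt, applyAll_append, applyAll_append]
    rfl
  -- The next flag is zero before the Toffoli gate, so afterwards it is the conjunction of the old
  -- flag and the good bit.
  have hz : ∀ γ, χ γ ≠ 0 → γ (B + 20 * D.e .M) = false := by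
    refine applyAll_support (fun g hg γ b => ?_) fun γ hγ => hψ γ hγ _ (by omega)
    rw [update_of_ne (h.ne_target hB (by omega) g hg)]
  have hd : (flagGateAt D B).Distinct := by
    simp [flagGateAt, RGate.Distinct, RGate.args]; omega
  have e2 : mass N (fun γ => γ (B + 20 * D.e .M) = true) (applyAll (roundAt D B) ψ)
      = mass N (fun γ => γ B = true ∧ γ (B + (17 * D.e .M + 6)) = true) χ := by
    rw [e1, mass_applyAll (fun g hg => (hin g (List.mem_reverse.1 hg)).1)
      (fun g hg => hv g (List.mem_reverse.1 hg))
      (fun g hg => hind _ (by omega) g (List.mem_reverse.1 hg)), mass_act (show (flagGateAt D B).Reversible from trivial) hd hN]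
    refine mass_congr fun γ _ hγ => ?_
    simp [flagGateAt, RGate.act, hz γ hγ, and_comm]
  have e3 := mass_and_add (N := N) (ψ := χ) (fun γ => γ B = true)
    fun γ => γ (B + (17 * D.e .M + 6)) = true
  have e4 : mass N (fun γ => γ B = true) χ = mass N (fun γ => γ B = true) ψ :=
    mass_applyAll (fun g hg => (hin g hg).1) hv (hind B (by omega))
  -- The bound for bad rounds is applied to the unnormalised part of the state on which the flag is
  -- set.
  have e5 := h.le_mass_bad hB hN.le (ψ := restrict (fun γ => γ B = true) ψ) (fun γ hγ => by
    intro a h1 h2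
    refine hψ γ (fun h0 => hγ ?_) a h1
    simp [restrict, h0]) hε hδ hG
  rw [applyAll_restrict (hind B (by omega)), mass_restrict, mass_restrict] at e5
  simp only [and_true] at e5
  simp only [Bool.not_eq_true] at e3
  rw [e2]
  linarith

/-- The state is accepted by all rounds. -/
structure Alternating (I : GraphInput) (V : Finset ℕ) (G : SimpleGraph V) (B : ℕ) (ψ : Str → ℂ) :
    Prop where
  fresh : Fresh B ψ
  acc : ∀ γ, ψ γ ≠ 0 → γ B = true
  vertex : ∀ γ, ψ γ ≠ 0 → bitsValue I.n γ ∈ V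
  alternate : ∀ γ, ∀ i j : V, G.Adj i j → bitsValue I.n γ = i → ψ (setName I.n γ j) = -ψ γ

/-- The good bit and the old flag are set wherever the state is supported, so the Toffoli gate is a
plain NOT on the next flag. This NOT commutes with the gates of the round, which then cancel against
their inverses. -/
theorem applyAll_roundAt_eq (h : Represents D I V G) (hB : D.e .M ≤ B)
    (hψ : Alternating I V G B ψ) :
    applyAll (roundAt D B) ψ = (RGate.not (B + 20 * D.e .M)).apply ψ := by
  have h0 := h.presents.fits.e_le
  set W := gatesAt B (roundList D) with hW
  set χ := applyAll W ψ with hχ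
  have hgood : ∀ γ, χ γ ≠ 0 → γ (B + (17 * D.e .M + 6)) = true := fun γ hγ =>
    h.good_of_alternating hB (fun ζ hζ => ⟨fun a h1 _ => hψ.fresh ζ hζ a h1, hψ.vertex ζ hζ⟩)
      hψ.alternate hγ
  have hacc : ∀ γ, χ γ ≠ 0 → γ B = true :=
    applyAll_support (fun g hg γ b => by rw [update_of_ne (h.ne_target hB (by omega) g hg)]) hψ.acc
  have hflag : (flagGateAt D B).apply χ = (RGate.not (B + 20 * D.e .M)).apply χ := by
    funext γ
    simp only [flagGateAt, RGate.apply, RGate.act]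
    by_cases hg : γ (B + (17 * D.e .M + 6)) = true ∧ γ B = true
    · simp [hg]
    · have key : ∀ v, χ (update γ (B + 20 * D.e .M) v) = 0 := by
        intro v
        by_contra hne
        have h1 := hgood _ hne
        have h2 := hacc _ hne
        rw [update_of_ne (by omega)] at h1 h2
        exact hg ⟨h1, h2⟩
      rw [key, key]
  rw [roundAt, applyAll_append, applyAll_append, applyAll_cons, applyAll_nil, ← hW, ← hχ, hflag,
    applyAll_not_comm fun g hg => h.not_mem_args hB (by omega) g (List.mem_reverse.1 hg), hχ,
    applyAll_reverse_applyAll fun g hg => (h.round_inside hB g hg).1]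

/-- The flag lies outside the name bits, so setting it keeps the sign pattern. This supplies both
the first flag and the passage from one round to the next. -/
theorem alternating_not (h : Represents D I V G) {B' : ℕ} (hB : D.e .M ≤ B')
    (hf : ∀ γ, ψ γ ≠ 0 → ∀ a, B' ≤ a → γ a = false)
    (hvert : ∀ γ, ψ γ ≠ 0 → bitsValue I.n γ ∈ V)
    (halt : ∀ γ, ∀ i j : V, G.Adj i j → bitsValue I.n γ = i → ψ (setName I.n γ j) = -ψ γ) :
    Alternating I V G B' ((RGate.not B').apply ψ) := by
  have h0 := h.presents.fits.e_le
  have hn := h.presents.n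
  have e : ∀ γ : Str, bitsValue I.n (update γ B' !γ B') = bitsValue I.n γ := fun γ =>
    bitsValue_congr fun t ht => by rw [update_of_ne (by omega)]
  constructor
  · intro γ hγ a ha
    have := hf _ hγ a (by omega)
    rwa [RGate.act, update_of_ne (by omega)] at this
  · intro γ hγ
    have := hf _ hγ B' le_rfl
    simpa [RGate.act] using this
  · intro γ hγ
    have := hvert _ hγ
    rwa [RGate.act, e] at this
  · intro γ i j hij hi
    have := halt (update γ B' !γ B') i j hij (by rw [e, hi])
    simp only [RGate.apply, RGate.act]
    rw [← this]
    congr 1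
    funext a
    by_cases ha : a = B'
    · subst ha
      rw [update_self, setName, setName, if_neg (by omega), if_neg (by omega), update_self]
    · rw [update_of_ne ha, setName, setName, update_of_ne ha]

theorem alternating_round (h : Represents D I V G) (hB : D.e .M ≤ B)
    (hψ : Alternating I V G B ψ) :
    Alternating I V G (B + 20 * D.e .M) (applyAll (roundAt D B) ψ) := by
  have h0 := h.presents.fits.e_le
  rw [h.applyAll_roundAt_eq hB hψ]
  exact h.alternating_not (by omega) (fun γ hγ a ha => hψ.fresh γ hγ a (by omega)) hψ.vertex
    hψ.alternate

/-- The rounds without the initial gate. -/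
theorem mass_rounds_le (h : Represents D I V G) {R : ℕ} (hψ : Fresh (D.e .M) ψ) {δ ε : ℝ}
    (hε : ε ≤ 1) (hδ : ε * (4 * 4 ^ I.posBits) ≤ δ)
    (hG : open Classical in ∀ w : V → ℂ, δ * ∑ i, ‖w i‖ ^ 2 ≤
      ∑ i, ∑ j, if G.Adj i j then ‖w i + w j‖ ^ 2 else 0) :
    mass (numQubits (D.e .M) R) (fun γ => γ (D.e .M + R * (20 * D.e .M)) = true)
      (applyAll ((List.range R).flatMap fun k => roundAt D (D.e .M + k * (20 * D.e .M))) ψ)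
      ≤ (1 - ε) ^ R * mass (numQubits (D.e .M) R) (fun γ => γ (D.e .M) = true) ψ := by
  have key : ∀ r ≤ R, Fresh (D.e .M + r * (20 * D.e .M)) (applyAll ((List.range r).flatMap fun k =>
        roundAt D (D.e .M + k * (20 * D.e .M))) ψ) ∧
      mass (numQubits (D.e .M) R) (fun γ => γ (D.e .M + r * (20 * D.e .M)) = true)
      (applyAll ((List.range r).flatMap fun k => roundAt D (D.e .M + k * (20 * D.e .M))) ψ)
      ≤ (1 - ε) ^ r * mass (numQubits (D.e .M) R) (fun γ => γ (D.e .M) = true) ψ := by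
    intro r hr
    induction r with
    | zero => simpa using hψ
    | succ r ih =>
      obtain ⟨h1, h2⟩ := ih (by omega)
      have e : D.e .M + (r + 1) * (20 * D.e .M) = D.e .M + r * (20 * D.e .M) + 20 * D.e .M := by
        ring
      rw [List.range_succ, List.flatMap_append, applyAll_append, List.flatMap_singleton, e]
      refine ⟨h.fresh_round (by omega) h1, (h.mass_round_le (by omega) (window_le hr) h1 hε hδ
        hG).trans ?_⟩
      rw [pow_succ', mul_assoc]
      exact mul_le_mul_of_nonneg_left h2 (by linarith)
  exact (key R le_rfl).2

theorem alternating_rounds (h : Represents D I V G) (hψ : Alternating I V G (D.e .M) ψ) (R : ℕ) :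
    Alternating I V G (D.e .M + R * (20 * D.e .M))
      (applyAll ((List.range R).flatMap fun k => roundAt D (D.e .M + k * (20 * D.e .M))) ψ) := by
  induction R with
  | zero => simpa using hψ
  | succ r ih =>
    have e : D.e .M + (r + 1) * (20 * D.e .M) = D.e .M + r * (20 * D.e .M) + 20 * D.e .M := by
      ring
    rw [List.range_succ, List.flatMap_append, applyAll_append, List.flatMap_singleton, e]
    exact h.alternating_round (by omega) ih

end Represents

end StackProg

namespace StackProg

open Function

/-! ### The acceptance probability -/

open Classical in
/-- The amplitudes of a witness. -/
noncomputable def witnessState (M : ℕ) (w : EuclideanSpace ℂ (Fin M → Bool)) : Str → ℂ := fun γ =>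
  if ∀ a, M ≤ a → γ a = false then w fun i => γ i else 0

theorem witnessState_eq_zero {M : ℕ} {w : EuclideanSpace ℂ (Fin M → Bool)} {γ : Str}
    (h : ¬ ∀ a, M ≤ a → γ a = false) : witnessState M w γ = 0 := if_neg h

theorem sum_cube {N : ℕ} (f : Str → ℝ) : ∑ γ ∈ cube N, f γ = ∑ b : Fin N → Bool, f (extend N b) := by
  simp [cube]

theorem mass_witnessState {M N : ℕ} (hN : M ≤ N) (w : EuclideanSpace ℂ (Fin M → Bool)) :
    mass N (fun _ => True) (witnessState M w) = ‖w‖ ^ 2 := by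
  classical
  have hs : cube M ⊆ cube N := fun γ hγ => by
    rw [mem_cube] at hγ ⊢
    exact fun a ha => hγ a (by omega)
  simp only [mass, if_true]
  rw [← Finset.sum_subset hs fun γ _ hγ => ?_, sum_cube, EuclideanSpace.norm_sq_eq]
  · refine Finset.sum_congr rfl fun b _ => ?_
    rw [witnessState, if_pos fun a ha => by simp [extend, Nat.not_lt.2 ha]]
    rw [show (fun i : Fin M => extend M b i) = b from funext fun i => extend_apply i.2 b]
  · rw [mem_cube] at hγ
    rw [witnessState, if_neg hγ]
    simp

/-- The analysis on infinite strings and the given semantics on finitely many qubits agree, because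
strings of N bits correspond to the members of `cube N`. -/
theorem acceptProb_verifier {D : StageData} (hD : Fits D) (R : ℕ)
    (w : EuclideanSpace ℂ (Fin (verifier D hD R).witness → Bool)) :
    (verifier D hD R).acceptProb w = mass (numQubits (D.e .M) R)
      (fun γ => γ (D.e .M + R * (20 * D.e .M)) = true)
      (applyAll (roundsAt D R) (witnessState (D.e .M) w)) := by
  classical
  have hi : (verifier D hD R).initial w
      = fun b => witnessState (D.e .M) w (extend (numQubits (D.e .M) R) b) := by
    funext b
    unfold QVerifier.initial witnessState
    have hiff : (∀ j : Fin (verifier D hD R).ancilla, b (Fin.natAdd _ j) = false) ↔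
        ∀ a, D.e .M ≤ a → extend (numQubits (D.e .M) R) b a = false := by
      constructor
      · intro hb a ha
        unfold extend
        split_ifs with h
        · have := hb ⟨a - D.e .M, by simp only [verifier]; unfold numQubits at h; omega⟩
          rw [← this]
          congr 1
          ext
          simp only [verifier, Fin.val_natAdd]
          omega
        · rfl
      · intro hb j
        have hj := j.2
        have := hb (D.e .M + j) (by omega)
        have hlt : D.e .M + j < numQubits (D.e .M) R := by
          simp only [verifier] at hj; unfold numQubits; omega
        exact (extend_apply hlt b).symm.trans this
    simp only [hiff]
    split_ifs
    · refine congrArg w.ofLp (funext fun i => Eq.symm ?_)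
      exact extend_apply (i.2.trans_le (Nat.le_add_right _ _)) b
    · rfl
  have hf : (verifier D hD R).final w = fun b => applyAll (roundsAt D R)
      (witnessState (D.e .M) w) (extend (numQubits (D.e .M) R) b) := by
    rw [QVerifier.final, hi]
    exact toQList_apply _ _ _
  rw [QVerifier.acceptProb, mass, sum_cube]
  refine Finset.sum_congr rfl fun b _ => ?_
  have e : extend (numQubits (D.e .M) R) b (D.e .M + R * (20 * D.e .M))
      = b (verifier D hD R).output := extend_apply _ _
  rw [hf, e]
  split_ifs <;> rfl

namespace Represents

variable {D : StageData} {I : GraphInput} {V : Finset ℕ} {G : SimpleGraph V}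

theorem mass_roundsAt_le (h : Represents D I V G) (R : ℕ) {δ ε : ℝ}
    (hε : ε ≤ 1) (hδ : ε * (4 * 4 ^ I.posBits) ≤ δ)
    (hG : open Classical in ∀ w : V → ℂ, δ * ∑ i, ‖w i‖ ^ 2 ≤
      ∑ i, ∑ j, if G.Adj i j then ‖w i + w j‖ ^ 2 else 0)
    (w : EuclideanSpace ℂ (Fin (D.e .M) → Bool)) (hw : ‖w‖ = 1) :
    mass (numQubits (D.e .M) R) (fun γ => γ (D.e .M + R * (20 * D.e .M)) = true)
      (applyAll (roundsAt D R) (witnessState (D.e .M) w)) ≤ (1 - ε) ^ R := by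
  have hv : (RGate.not (D.e .M)).target < numQubits (D.e .M) R := by
    simp [RGate.target, numQubits]
  rw [roundsAt, applyAll_cons]
  refine (h.mass_rounds_le (fun γ hγ a ha => ?_) hε hδ hG).trans ?_
  · by_contra hc
    refine hγ (witnessState_eq_zero fun hall => hc ?_)
    have := hall a ha.le
    rwa [RGate.act, update_of_ne (by omega)] at this
  · refine mul_le_of_le_one_right (pow_nonneg (by linarith) _) ?_
    refine (mass_mono (P' := fun _ => True) fun _ _ => trivial).trans ?_
    rw [mass_act (show (RGate.not (D.e .M)).Reversible from trivial)
      (by simp [RGate.Distinct, RGate.args]) hv, mass_witnessState (by unfold numQubits; omega), hw,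
      one_pow]

theorem acceptProb_le (h : Represents D I V G) (R : ℕ) {δ ε : ℝ}
    (hε : ε ≤ 1) (hδ : ε * (4 * 4 ^ I.posBits) ≤ δ)
    (hG : open Classical in ∀ w : V → ℂ, δ * ∑ i, ‖w i‖ ^ 2 ≤
      ∑ i, ∑ j, if G.Adj i j then ‖w i + w j‖ ^ 2 else 0)
    (w : EuclideanSpace ℂ (Fin (verifier D h.presents.fits R).witness → Bool)) (hw : ‖w‖ = 1) :
    (verifier D h.presents.fits R).acceptProb w ≤ (1 - ε) ^ R :=
  (acceptProb_verifier h.presents.fits R w).trans_le (h.mass_roundsAt_le R hε hδ hG w hw)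

/-- A sign pattern that alternates along the edges yields a witness that is always accepted. -/
theorem exists_witness (h : Represents D I V G) (R : ℕ) (F : ℕ → ℂ) (h0 : ∃ i ∈ V, F i ≠ 0)
    (hV : ∀ i, F i ≠ 0 → i ∈ V) (halt : ∀ i j : V, G.Adj i j → F j = -F i) :
    ∃ w : EuclideanSpace ℂ (Fin (verifier D h.presents.fits R).witness → Bool),
      ‖w‖ = 1 ∧ (verifier D h.presents.fits R).acceptProb w = 1 := by
  classical
  have hle := h.presents.fits.e_le
  have hn := h.presents.n
  set M := D.e .M with hM
  -- The amplitude depends on the n name bits only; the other witness qubits are left in a uniform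
  -- superposition.
  set w₀ : EuclideanSpace ℂ (Fin M → Bool) := WithLp.toLp 2 fun b =>
    F (bitsValue I.n (extend M b)) with hw₀
  have hne : w₀ ≠ 0 := by
    obtain ⟨i, hi, hF⟩ := h0
    intro hz
    have : F (bitsValue I.n (extend M fun q => i.testBit q)) = 0 :=
      congrFun (congrArg WithLp.ofLp hz) fun q => i.testBit q
    refine hF ?_
    rw [← this]
    congr 1
    symm
    rw [bitsValue_eq_iff (h.describes.access.vertices i hi).2]
    intro t ht
    rw [extend_apply (by omega)]
  have hnorm : ‖w₀‖ ≠ 0 := norm_ne_zero_iff.2 hne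
  set w : EuclideanSpace ℂ (Fin M → Bool) := ((‖w₀‖⁻¹ : ℝ) : ℂ) • w₀ with hw
  have hw1 : ‖w‖ = 1 := by
    rw [hw, norm_smul, Complex.norm_real, norm_inv, norm_norm, inv_mul_cancel₀ hnorm]
  have hval : ∀ γ, (∀ a, M ≤ a → γ a = false) → witnessState M w γ
      = ((‖w₀‖⁻¹ : ℝ) : ℂ) * F (bitsValue I.n γ) := by
    intro γ hγ
    rw [witnessState, if_pos hγ, hw]
    simp only [PiLp.smul_apply, hw₀, smul_eq_mul]
    congr 2
    exact bitsValue_congr fun t ht => extend_apply (by omega) _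
  have hfresh : ∀ γ, witnessState M w γ ≠ 0 → ∀ a, M ≤ a → γ a = false := fun γ hγ => by
    by_contra hc
    exact hγ (witnessState_eq_zero hc)
  have halt' : Alternating I V G M ((RGate.not M).apply (witnessState M w)) := by
    refine h.alternating_not le_rfl hfresh (fun γ hγ => ?_) fun γ i j hij hi => ?_
    · rw [hval γ (hfresh γ hγ)] at hγ
      exact hV _ (right_ne_zero_of_mul hγ)
    · by_cases hγ : ∀ a, M ≤ a → γ a = false
      · have hγ' : ∀ a, M ≤ a → setName I.n γ j a = false := fun a ha => by
          rw [setName, if_neg (by omega)]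
          exact hγ a ha
        rw [hval _ hγ, hval _ hγ', bitsValue_setName (h.describes.access.vertices j j.2).2, hi,
          halt i j hij, mul_neg]
      · rw [witnessState_eq_zero hγ, witnessState_eq_zero, neg_zero]
        intro hc
        refine hγ fun a ha => ?_
        have := hc a ha
        rwa [setName, if_neg (by omega)] at this
  refine ⟨w, hw1, ?_⟩
  have hval := valid_roundsAt h.presents.fits R
  have e : applyAll (roundsAt D R) (witnessState M w) = applyAll ((List.range R).flatMap fun k =>
      roundAt D (D.e .M + k * (20 * D.e .M))) ((RGate.not M).apply (witnessState M w)) := rfl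
  have hR := h.alternating_rounds halt' R
  rw [← e] at hR
  have hmass := mass_witnessState (show M ≤ numQubits M R by unfold numQubits; omega) w
  rw [hw1, one_pow] at hmass
  refine (acceptProb_verifier h.presents.fits R w).trans (Eq.trans ?_ hmass)
  -- The last flag is set wherever the final state is supported, so the acceptance probability is
  -- the total mass, which the circuit conserves.
  refine Eq.trans ?_ (mass_applyAll (P := fun _ => True) (fun g hg => (hval g hg).1)
    (fun g hg => (hval g hg).target_lt) fun _ _ _ _ => Iff.rfl)
  exact mass_congr fun γ _ hγ => by simpa using hR.acc γ hγ

end Represents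

end StackProg

/-! ### The signless Laplacian -/

section

variable {V : Type*} [Fintype V] (G : SimpleGraph V)

open Classical Matrix

theorem signlessLaplacian_mulVec (x : V → ℝ) (i : V) :
    (signlessLaplacian G *ᵥ x) i = ∑ j, if G.Adj i j then x i + x j else 0 := by
  have h : ∀ j, signlessLaplacian G i j * x j
      = (if i = j then (G.degree i : ℝ) * x i else 0) + if G.Adj i j then x j else 0 := by
    intro j
    simp only [signlessLaplacian, Matrix.of_apply]
    by_cases hij : i = j
    · subst hij; simp
    · simp [hij]
  have hd : (G.degree i : ℝ) * x i = ∑ j, if G.Adj i j then x i else 0 := by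
    rw [← Finset.sum_filter, Finset.sum_const, nsmul_eq_mul, ← G.card_neighborFinset_eq_degree,
      G.neighborFinset_eq_filter]
  rw [Matrix.mulVec, dotProduct, Finset.sum_congr rfl fun j _ => h j, Finset.sum_add_distrib,
    Finset.sum_ite_eq, if_pos (Finset.mem_univ _), hd, ← Finset.sum_add_distrib]
  exact Finset.sum_congr rfl fun j _ => by split_ifs <;> simp

/-- Expanding the form in two ways, with the outer factor at either end of an edge, and adding the
results completes the square. -/
theorem two_mul_dotProduct_signlessLaplacian (x : V → ℝ) :
    2 * (x ⬝ᵥ (signlessLaplacian G *ᵥ x)) = ∑ i, ∑ j, if G.Adj i j then (x i + x j) ^ 2 else 0 := by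
  have h1 : x ⬝ᵥ (signlessLaplacian G *ᵥ x)
      = ∑ i, ∑ j, if G.Adj i j then x i * (x i + x j) else 0 := by
    rw [dotProduct]
    refine Finset.sum_congr rfl fun i _ => ?_
    rw [signlessLaplacian_mulVec, Finset.mul_sum]
    exact Finset.sum_congr rfl fun j _ => by split_ifs <;> simp
  have h2 : x ⬝ᵥ (signlessLaplacian G *ᵥ x)
      = ∑ i, ∑ j, if G.Adj i j then x j * (x i + x j) else 0 := by
    rw [h1, Finset.sum_comm]
    refine Finset.sum_congr rfl fun i _ => Finset.sum_congr rfl fun j _ => ?_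
    simp only [G.adj_comm j i, add_comm (x j)]
  rw [two_mul]
  nth_rewrite 1 [h1]
  rw [h2, ← Finset.sum_add_distrib]
  refine Finset.sum_congr rfl fun i _ => ?_
  rw [← Finset.sum_add_distrib]
  refine Finset.sum_congr rfl fun j _ => ?_
  split_ifs <;> ring

theorem isHermitian_signlessLaplacian : (signlessLaplacian G).IsHermitian := by
  ext i j
  simp only [signlessLaplacian, Matrix.conjTranspose_apply, Matrix.of_apply, star_trivial,
    G.adj_comm j i]
  by_cases h : i = j
  · subst h; simp
  · simp [h, Ne.symm h]

variable {G}

/-- The Rayleigh quotients are at least the smallest eigenvalue. -/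
theorem IsSmallestEigenvalue.mul_le {μ : ℝ} (h : IsSmallestEigenvalue (signlessLaplacian G) μ)
    (x : V → ℝ) : 2 * μ * ∑ i, x i ^ 2 ≤ ∑ i, ∑ j, if G.Adj i j then (x i + x j) ^ 2 else 0 := by
  -- After the shift by μ all eigenvalues are non-negative, since adding μ to one of them gives an
  -- eigenvalue of the signless Laplacian. Hence the shifted matrix is positive semidefinite.
  set A : Matrix V V ℝ := signlessLaplacian G - μ • 1 with hA
  have hH : A.IsHermitian := by
    refine (isHermitian_signlessLaplacian G).sub ?_
    ext i j
    simp [Matrix.one_apply, eq_comm]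
  have hmul : ∀ y, A *ᵥ y = signlessLaplacian G *ᵥ y - μ • y := fun y => by
    rw [hA, Matrix.sub_mulVec, Matrix.smul_mulVec, Matrix.one_mulVec]
  have hpos : A.PosSemidef := by
    rw [hH.posSemidef_iff_eigenvalues_nonneg]
    intro k
    have hk := hH.mulVec_eigenvectorBasis k
    have hne : (⇑(hH.eigenvectorBasis k) : V → ℝ) ≠ 0 := by
      intro h0
      apply hH.eigenvectorBasis.orthonormal.ne_zero k
      ext i
      exact congrFun h0 i
    have hev : Module.End.HasEigenvalue (Matrix.toLin' (signlessLaplacian G))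
        (hH.eigenvalues k + μ) := by
      refine Module.End.hasEigenvalue_of_hasEigenvector
        (x := (⇑(hH.eigenvectorBasis k) : V → ℝ)) ⟨?_, hne⟩
      rw [Module.End.mem_eigenspace_iff, Matrix.toLin'_apply, add_smul, ← hk, hmul,
        sub_add_cancel]
    have := h.2 hev
    simp only [Pi.zero_apply]
    linarith
  have hq := hpos.dotProduct_mulVec_nonneg x
  rw [star_trivial, hmul, dotProduct_sub, dotProduct_smul, smul_eq_mul] at hq
  have hs : x ⬝ᵥ x = ∑ i, x i ^ 2 := Finset.sum_congr rfl fun i _ => by ring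
  rw [← two_mul_dotProduct_signlessLaplacian, ← hs]
  linarith

/-- The matrix is real, so the real and imaginary parts can be treated separately. Amplitudes need
the complex version. -/
theorem IsSmallestEigenvalue.mul_norm_le {μ : ℝ}
    (h : IsSmallestEigenvalue (signlessLaplacian G) μ) (w : V → ℂ) :
    2 * μ * ∑ i, ‖w i‖ ^ 2 ≤ ∑ i, ∑ j, if G.Adj i j then ‖w i + w j‖ ^ 2 else 0 := by
  have hn : ∀ z : ℂ, ‖z‖ ^ 2 = z.re ^ 2 + z.im ^ 2 := fun z => by
    rw [← Complex.normSq_eq_norm_sq, Complex.normSq_apply]; ring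
  have h1 := h.mul_le fun i => (w i).re
  have h2 := h.mul_le fun i => (w i).im
  have e1 : ∑ i, ‖w i‖ ^ 2 = ∑ i, (w i).re ^ 2 + ∑ i, (w i).im ^ 2 := by
    rw [← Finset.sum_add_distrib]
    exact Finset.sum_congr rfl fun i _ => hn _
  have e2 : (∑ i, ∑ j, if G.Adj i j then ‖w i + w j‖ ^ 2 else 0)
      = (∑ i, ∑ j, if G.Adj i j then ((w i).re + (w j).re) ^ 2 else 0)
        + ∑ i, ∑ j, if G.Adj i j then ((w i).im + (w j).im) ^ 2 else 0 := by
    rw [← Finset.sum_add_distrib]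
    refine Finset.sum_congr rfl fun i _ => ?_
    rw [← Finset.sum_add_distrib]
    refine Finset.sum_congr rfl fun j _ => ?_
    split_ifs
    · rw [hn, Complex.add_re, Complex.add_im]
    · simp
  rw [e1, e2, mul_add]
  linarith

/-- The kernel of the signless Laplacian comes from bipartite components. -/
theorem hasBipartiteComponent_of_eigenvalue_zero
    (h : Module.End.HasEigenvalue (Matrix.toLin' (signlessLaplacian G)) 0) :
    HasBipartiteComponent G := by
  obtain ⟨x, hx, hne⟩ := h.exists_hasEigenvector
  rw [Module.End.mem_eigenspace_iff, Matrix.toLin'_apply, zero_smul] at hx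
  have hsum := two_mul_dotProduct_signlessLaplacian G x
  rw [hx, dotProduct_zero, mul_zero] at hsum
  -- The form vanishes at x, and it is a sum of squares over the edges.
  have hadj : ∀ i j, G.Adj i j → x j = -x i := by
    intro i j hij
    have h1 := (Finset.sum_eq_zero_iff_of_nonneg fun i _ => Finset.sum_nonneg fun j _ => by
      split_ifs <;> positivity).1 hsum.symm i (Finset.mem_univ _)
    have h2 := (Finset.sum_eq_zero_iff_of_nonneg fun j _ => by
      split_ifs <;> positivity).1 h1 j (Finset.mem_univ _)
    rw [if_pos hij] at h2
    have := pow_eq_zero_iff (two_ne_zero) |>.1 h2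
    linarith
  obtain ⟨i₀, hi₀⟩ := Function.ne_iff.1 hne
  have hne' : ∀ u v, G.Reachable u v → x u ≠ 0 → x v ≠ 0 := by
    rintro u v ⟨p⟩ hu
    induction p with
    | nil => exact hu
    | cons huv _ ih =>
      refine ih ?_
      rw [hadj _ _ huv]
      exact neg_ne_zero.2 hu
  refine ⟨G.connectedComponentMk i₀, ?_⟩
  -- The colour of a vertex is the sign of x there, which is non-zero on the whole component of i₀.
  have hc : (G.connectedComponentMk i₀).toSimpleGraph.Coloring Bool :=
    SimpleGraph.Coloring.mk (fun v => decide (0 < x v)) fun {u v} huv => by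
      have hr : G.Reachable i₀ u := (SimpleGraph.ConnectedComponent.exact u.2).symm
      have hu := hne' _ _ hr hi₀
      have huv' : G.Adj u v := huv
      rw [hadj _ _ huv']
      rcases lt_or_gt_of_ne hu with h1 | h1
      · simp [h1, h1.le]
      · simp [h1, h1.le]
  exact hc.colorable

/-- A sign pattern on a bipartite component. -/
theorem HasBipartiteComponent.exists_signs (h : HasBipartiteComponent G) :
    ∃ f : V → ℂ, (∃ v, f v ≠ 0) ∧ ∀ i j, G.Adj i j → f j = -f i := by
  obtain ⟨C, ⟨c⟩⟩ := h
  obtain ⟨v, hv⟩ := C.nonempty_supp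
  refine ⟨fun i => if hi : i ∈ C.supp then (if c ⟨i, hi⟩ = 0 then 1 else -1) else 0,
    ⟨v, ?_⟩, fun i j hij => ?_⟩
  · simp only [hv, dite_true]
    split_ifs <;> norm_num
  · have hiff : i ∈ C.supp ↔ j ∈ C.supp := by
      rw [SimpleGraph.ConnectedComponent.mem_supp_iff, SimpleGraph.ConnectedComponent.mem_supp_iff,
        SimpleGraph.ConnectedComponent.connectedComponentMk_eq_of_adj hij]
    by_cases hi : i ∈ C.supp
    · have hj := hiff.1 hi
      have hne := c.valid (show C.toSimpleGraph.Adj ⟨i, hi⟩ ⟨j, hj⟩ from hij)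
      simp only [hi, hj, dite_true]
      generalize c ⟨i, hi⟩ = a at hne
      generalize c ⟨j, hj⟩ = b at hne
      fin_cases a <;> fin_cases b <;> simp at hne ⊢
    · have hj : j ∉ C.supp := fun hj => hi (hiff.2 hj)
      simp [hi, hj]

end

namespace StackProg

open Function

/-! ### Reading a graph -/

theorem unaryEncode_cons (k : ℕ) (l : List ℕ) :
    unaryEncode (k :: l) = ones k ++ false :: unaryEncode l := by
  simp [unaryEncode]

theorem splitNum_unaryEncode (k : ℕ) (l : List ℕ) :
    splitNum (unaryEncode (k :: l)) = (k, unaryEncode l) := by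
  rw [unaryEncode_cons, splitNum_ones]

theorem skipNum_unaryEncode (k : ℕ) (l : List ℕ) :
    skipNum (unaryEncode (k :: l)) = unaryEncode l := by
  rw [skipNum, splitNum_unaryEncode]

theorem unaryEncode_cons_ne_nil (k : ℕ) (l : List ℕ) : unaryEncode (k :: l) ≠ [] := by
  simp [unaryEncode]

theorem iterate_skipNum_unaryEncode (l : List ℕ) (m : ℕ) :
    skipNum^[m] (unaryEncode l) = unaryEncode (l.drop m) := by
  induction m generalizing l with
  | zero => rfl
  | succ m ih =>
    rw [iterate_succ_apply]
    cases l with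
    | nil => exact (ih []).trans (by simp)
    | cons k l => rw [skipNum_unaryEncode, ih, List.drop_succ_cons]

theorem numOuts_unaryEncode (l : List ℕ) : numOuts (unaryEncode l) = l.length := by
  have h : ∀ m, skipNum^[m] (unaryEncode l) = [] ↔ l.length ≤ m := fun m => by
    rw [iterate_skipNum_unaryEncode, ← List.drop_eq_nil_iff]
    cases l.drop m with
    | nil => simp [unaryEncode]
    | cons k r => simp [unaryEncode_cons_ne_nil]
  refine le_antisymm (not_lt.1 fun hlt => numOuts_min hlt ((h _).2 le_rfl)) ?_
  exact (h _).1 (numOuts_spec _)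

theorem readNums_unaryEncode (l : List ℕ) : readNums (unaryEncode l) = l := by
  rw [readNums, numOuts_unaryEncode]
  refine List.ext_getElem (by simp) fun m h1 h2 => ?_
  rw [List.getElem_map, List.getElem_range, iterate_skipNum_unaryEncode,
    List.drop_eq_getElem_cons h2, splitNum_unaryEncode]

theorem gateRec_unaryEncode (g : BoolGate) (l : List ℕ) :
    gateRec (unaryEncode (g.tokens ++ l)) = g.triple := by
  cases g <;>
    simp [gateRec, BoolGate.tokens, BoolGate.triple, splitNum_unaryEncode, skipNum_unaryEncode]

theorem gateRest_unaryEncode (g : BoolGate) (l : List ℕ) :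
    gateRest (unaryEncode (g.tokens ++ l)) = unaryEncode l := by
  cases g <;> simp [gateRest, BoolGate.tokens, splitNum_unaryEncode, skipNum_unaryEncode]

theorem iterate_gateRest_unaryEncode (gs : List BoolGate) (l : List ℕ) (m : ℕ)
    (hm : m ≤ gs.length) : gateRest^[m] (unaryEncode (gs.flatMap BoolGate.tokens ++ l)) =
      unaryEncode ((gs.drop m).flatMap BoolGate.tokens ++ l) := by
  induction m generalizing gs with
  | zero => rfl
  | succ m ih =>
    cases gs with
    | nil => simp at hm
    | cons g gs =>
      rw [iterate_succ_apply, List.flatMap_cons, List.append_assoc, gateRest_unaryEncode,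
        ih gs (by simpa using hm), List.drop_succ_cons]

theorem numGates_unaryEncode (gs : List BoolGate) (l : List ℕ) :
    numGates (unaryEncode (gs.flatMap BoolGate.tokens ++ 0 :: l)) = gs.length := by
  refine le_antisymm (not_lt.1 fun hlt => numGates_min hlt ?_) (not_lt.1 fun hlt => ?_)
  · rw [iterate_gateRest_unaryEncode _ _ _ le_rfl]
    simp [splitNum_unaryEncode]
  · have h := numGates_spec (unaryEncode (gs.flatMap BoolGate.tokens ++ 0 :: l))
    rw [iterate_gateRest_unaryEncode _ _ _ hlt.le, List.drop_eq_getElem_cons hlt,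
      List.flatMap_cons] at h
    cases hg : gs[numGates (unaryEncode (gs.flatMap BoolGate.tokens ++ 0 :: l))] <;>
      simp [hg, BoolGate.tokens, splitNum_unaryEncode] at h

theorem readRecs_unaryEncode (gs : List BoolGate) (l : List ℕ) :
    readRecs (unaryEncode (gs.flatMap BoolGate.tokens ++ 0 :: l)) = gs.map BoolGate.triple := by
  rw [readRecs, numGates_unaryEncode]
  refine List.ext_getElem (by simp) fun m h1 h2 => ?_
  have hm : m < gs.length := by simpa using h2
  rw [List.getElem_map, List.getElem_range, iterate_gateRest_unaryEncode _ _ _ hm.le,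
    List.drop_eq_getElem_cons hm, List.flatMap_cons, List.append_assoc, gateRec_unaryEncode,
    List.getElem_map]

theorem afterGates_unaryEncode (gs : List BoolGate) (l : List ℕ) :
    afterGates (unaryEncode (gs.flatMap BoolGate.tokens ++ 0 :: l)) = unaryEncode l := by
  rw [afterGates, numGates_unaryEncode, iterate_gateRest_unaryEncode _ _ _ le_rfl]
  simp [skipNum_unaryEncode]

/-- Both sides are the least k with S ≤ 2^k. The machine counts the digits of S - 1, while the
problem is phrased with the logarithm rounded up. -/
theorem length_bits_pred {S : ℕ} (hS : 1 ≤ S) : (Nat.bits (S - 1)).length = Nat.clog 2 S := by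
  rw [Nat.size_eq_bits_len]
  refine eq_of_forall_ge_iff fun k => ?_
  rw [Nat.size_le, Nat.clog_le_iff_le_pow (by norm_num)]
  omega

theorem encode_eq (I : GraphInput) : I.encode = unaryEncode (I.n :: I.S ::
    (I.circuit.gates.flatMap BoolGate.tokens ++ 0 :: I.circuit.outputs)) := by
  simp [GraphInput.encode]

theorem presents_encode {I : GraphInput} (hS : 1 ≤ I.S) : Presents (inputData I.encode) I := by
  have h1 : (splitNum I.encode).1 = I.n := by rw [encode_eq, splitNum_unaryEncode]
  have h2 : (splitNum (skipNum I.encode)).1 = I.S := by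
    rw [encode_eq, skipNum_unaryEncode, splitNum_unaryEncode]
  have h3 : skipNum (skipNum I.encode) = unaryEncode
      (I.circuit.gates.flatMap BoolGate.tokens ++ 0 :: I.circuit.outputs) := by
    rw [encode_eq, skipNum_unaryEncode, skipNum_unaryEncode]
  refine ⟨fits_inputData _, h1, ?_, ?_, ?_, ?_⟩
  · change (Nat.bits ((splitNum (skipNum I.encode)).1 - 1)).length = _
    rw [h2, length_bits_pred hS, GraphInput.posBits]
  · change readRecs (skipNum (skipNum I.encode)) = _
    rw [h3, readRecs_unaryEncode]
  · change readNums (afterGates (skipNum (skipNum I.encode))) = _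
    rw [h3, afterGates_unaryEncode, readNums_unaryEncode]
  · change Nat.bits ((splitNum (skipNum I.encode)).1 - 1) = _
    rw [h2]

theorem le_length_encode (I : GraphInput) : I.n + I.S ≤ I.encode.length := by
  rw [encode_eq, unaryEncode_cons, unaryEncode_cons]
  simp only [List.length_append, List.length_replicate, List.length_cons]
  omega

end StackProg

namespace StackProg

/-! ### Error bounds -/

/-- The power is at most exp(-εR), and exp(εR) ≥ 1 + εR ≥ 3. -/
theorem one_sub_pow_le_third {ε : ℝ} (h1 : ε ≤ 1) {R : ℕ} (hR : 2 ≤ ε * R) :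
    (1 - ε) ^ R ≤ 1 / 3 := by
  have h := pow_le_pow_left₀ (by linarith : 0 ≤ 1 - ε) (Real.one_sub_le_exp_neg ε) R
  rw [← Real.exp_nat_mul] at h
  refine h.trans ?_
  rw [show (R : ℝ) * -ε = -(ε * R) by ring, Real.exp_neg, ← one_div]
  exact one_div_le_one_div_of_le (by norm_num) (by linarith [Real.add_one_le_exp (ε * R)])

/-- Rounding up to a power of two at most doubles S. -/
theorem four_pow_clog_le {S : ℕ} (hS : 2 ≤ S) : 4 ^ Nat.clog 2 S ≤ 4 * S ^ 2 := by
  have h := Nat.pow_pred_clog_lt_self (b := 2) (by norm_num) (show 1 < S by omega)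
  have h0 := Nat.clog_pos (b := 2) (by norm_num) hS
  have h2 : 2 ^ Nat.clog 2 S ≤ 2 * S := by
    rw [← Nat.succ_pred_eq_of_pos h0, pow_succ']
    exact Nat.mul_le_mul_left 2 h.le
  calc 4 ^ Nat.clog 2 S = (2 ^ Nat.clog 2 S) ^ 2 := by
        rw [← pow_mul, mul_comm, pow_mul]; norm_num
    _ ≤ (2 * S) ^ 2 := Nat.pow_le_pow_left h2 2
    _ = 4 * S ^ 2 := by ring

/-- The number of rounds `C * M ^ (k + 2)` suffices when the gap is at least `c / n ^ k`. -/
theorem error_mul_le {c c' : ℝ} (hc : c' ≤ c / 16) (h0 : 0 < c') {n S M k : ℕ} (hn : 1 ≤ n)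
    (hS : 2 ≤ S) (hnM : n ≤ M) (hSM : S ≤ M) :
    c' / (M : ℝ) ^ (k + 2) * (4 * 4 ^ Nat.clog 2 S) ≤ c / (n : ℝ) ^ k := by
  have hM : (0 : ℝ) < M := by exact_mod_cast (by omega : 0 < M)
  have hn' : (0 : ℝ) < n := by exact_mod_cast hn
  have h4 : (4 : ℝ) ^ Nat.clog 2 S ≤ 4 * (M : ℝ) ^ 2 := by
    have h := (four_pow_clog_le hS).trans
      (Nat.mul_le_mul_left 4 (Nat.pow_le_pow_left hSM 2))
    exact_mod_cast h
  have hk : (n : ℝ) ^ k ≤ (M : ℝ) ^ k := pow_le_pow_left₀ hn'.le (by exact_mod_cast hnM) k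
  -- The factor 16 is one 4 from the normalisation of the amplitudes and one 4 from rounding S up.
  -- The two extra powers of M absorb S².
  calc c' / (M : ℝ) ^ (k + 2) * (4 * 4 ^ Nat.clog 2 S)
      ≤ c' / (M : ℝ) ^ (k + 2) * (4 * (4 * (M : ℝ) ^ 2)) := by gcongr
    _ = 16 * c' / (M : ℝ) ^ k := by rw [pow_add]; field_simp; ring
    _ ≤ c / (M : ℝ) ^ k := by gcongr; linarith
    _ ≤ c / (n : ℝ) ^ k := div_le_div_of_nonneg_left (by linarith) (by positivity) hk

/-! ### Completeness and soundness -/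

section

variable {I : GraphInput} {V : Finset ℕ} {G : SimpleGraph V}

theorem represents_encode (h : I.Describes V G) : Represents (inputData I.encode) I V G :=
  ⟨presents_encode (one_le_two.trans h.access.two_le), h⟩

theorem exists_witness_encode (h : I.Describes V G) (hB : HasBipartiteComponent G) (R : ℕ) :
    ∃ w, ‖w‖ = 1 ∧ (verifier (inputData I.encode) (fits_inputData _) R).acceptProb w = 1 := by
  obtain ⟨f, ⟨v, hv⟩, halt⟩ := hB.exists_signs
  refine (represents_encode h).exists_witness R
    (fun i => if hi : i ∈ V then f ⟨i, hi⟩ else 0) ⟨v, v.2, by simpa using hv⟩ ?_ ?_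
  · intro i hi
    by_contra hV
    simp [hV] at hi
  · intro i j hij
    simpa using halt i j hij

/-- Without a bipartite component 0 is not an eigenvalue, so the promise leaves only the gap. The
error per round is taken as a' / M^(k+2). -/
theorem acceptProb_encode_le {s c : ℕ → ℕ} {δ : ℕ → ℝ} (h : IsPromiseInstance s c δ I V G)
    (hB : ¬ HasBipartiteComponent G) {a a' : ℝ} (ha' : 0 < a') (ha1 : a' ≤ 1) (haa : a' ≤ a / 16)
    {k C : ℕ} (hδ : ∀ n : ℕ, 1 ≤ n → a / (n : ℝ) ^ k ≤ δ n) (hC : 2 ≤ a' * C)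
    {M : ℕ} (hM : M = I.encode.length + 16) (w) (hw : ‖w‖ = 1) :
    (verifier (inputData I.encode) (fits_inputData _)
      (C * M ^ (k + 2))).acceptProb w ≤ 1 / 3 := by
  obtain ⟨μ, hμ, hgap⟩ := h.gap
  have hμ : IsSmallestEigenvalue (signlessLaplacian G) μ := hμ
  have hle : δ I.n ≤ μ := hgap.resolve_left fun h0 =>
    hB (hasBipartiteComponent_of_eigenvalue_zero (h0 ▸ hμ.1))
  have hlen := le_length_encode I
  obtain ⟨v, hv⟩ := h.describes.nonempty
  have hn : 1 ≤ I.n := by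
    rw [Nat.one_le_iff_ne_zero]
    intro h0
    have := h.describes.access.vertices v hv
    rw [h0] at this
    omega
  have hS := h.describes.access.two_le
  have hM1 : (1 : ℝ) ≤ M := by exact_mod_cast (by omega : 1 ≤ M)
  have hpow : (1 : ℝ) ≤ (M : ℝ) ^ (k + 2) := one_le_pow₀ hM1
  have herr := error_mul_le haa ha' (k := k) hn hS (M := M) (by omega) (by omega)
  have h0 : 0 ≤ μ := le_trans (by have : 0 ≤ a := by linarith
                                  positivity) ((hδ _ hn).trans hle)
  have hε1 : a' / (M : ℝ) ^ (k + 2) ≤ 1 := (div_le_self ha'.le hpow).trans ha1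
  -- The constant is 2μ because the quadratic form is summed over ordered pairs. This is more than
  -- enough, as the gap only has to bound the error from above.
  refine ((represents_encode h.describes).acceptProb_le _ (δ := 2 * μ) hε1 ?_
    (fun w => by convert hμ.mul_norm_le w) w hw).trans (one_sub_pow_le_third hε1 ?_)
  · exact (herr.trans ((hδ _ hn).trans hle)).trans (by linarith)
  · push_cast
    rw [show a' / (M : ℝ) ^ (k + 2) * (C * (M : ℝ) ^ (k + 2)) = a' * C by field_simp]
    exact hC

end

end StackProg

theorem mainTheorem5 (s c : ℕ → ℕ) (δ : ℕ → ℝ)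
    (hs : PolyBounded s) (hc : PolyBounded c) (hδ : InversePolyBounded δ) :
    (promiseSparseBipartitedness s c δ).InQMA := by
  obtain ⟨a, ha, k, hδ⟩ := hδ
  -- The minimum with 1 keeps the error per round at most 1, and C is chosen so that the product of
  -- the error per round and the number of rounds is at least 2.
  obtain ⟨C, hC⟩ := exists_nat_ge (2 / min 1 (a / 16))
  have ha' : 0 < min 1 (a / 16) := lt_min one_pos (by positivity)
  -- The witness length equals the segment size M, the input length plus 16; all but the first n
  -- witness qubits are padding.
  refine ⟨Polynomial.X + 16, fun x => StackProg.verifier (StackProg.inputData x)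
    (StackProg.fits_inputData x) (C * (x.length + 16) ^ (k + 2)), ?_, fun x => ?_, ?_, ?_⟩
  · exact StackProg.nonempty_computable C (k + 2) _ _ fun x => StackProg.encode_verifier _ _ _
  · simp [StackProg.verifier, StackProg.inputData]
  · rintro x ⟨I, V, G, rfl, h, hB⟩
    obtain ⟨w, hw, hw1⟩ := StackProg.exists_witness_encode h.describes hB
      (C * (I.encode.length + 16) ^ (k + 2))
    exact ⟨w, hw, by rw [hw1]; norm_num⟩
  · rintro x ⟨I, V, G, rfl, h, hB⟩ w hw
    refine StackProg.acceptProb_encode_le h hB ha' (min_le_left _ _) (min_le_right _ _) hδ ?_ rfl w hw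
    rwa [div_le_iff₀' ha'] at hC
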